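/- **Lemma (Rankin–Selberg unfolding).** Let $K\subset\mathbb C$ be an imaginary quadratic field of class number one, with ring of integers $\mathcal O$, discriminant $d_K$ and Dedekind zeta function $\zeta_K$, and let $\sqrt{d_K}=i\sqrt{|d_K|}$. Let $\Gamma=\mathrm{PSL}_2(\mathcal O)$ act on $\mathbb H^3=\{P=z+rj: z=x+iy\in\mathbb C,\ r>0\}$, with volume $dv=dx\,dy\,dr/r^3$ and Laplacian $\Delta=r^2(\partial_x^2+\partial_y^2+\partial_r^2)-r\partial_r$. *Eisenstein series.* Let $E(P,s)=\sum_{\gamma\in\Gamma'_\infty\backslash\Gamma}r(\gamma P)^{1+s}$ for $\Re s>2$, continued meromorphically in $s$, where $\Gamma'_\infty$ is the group of translations $z\mapsto z+b$, $b\in\mathcal O$. For $t\in\mathbb R$ put $E_t=E(\cdot,it)$. *Cusp forms.* A Hecke–Maaß cusp form $f$ with spectral parameter $t_f$ and Hecke eigenvalues $\lambda_f(n)$ $(0\ne n\in\mathcal O)$ is a non-zero $\Gamma$-invariant $C^2$ function of polynomial growth at the cusp $\infty$ whose mean over $z\in\mathbb C/\mathcal O$ vanishes for every $r$, with $-\Delta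 f=(1+t_f^2)f$ and $T_nf=\lambda_f(n)f$ for all $n\neq0$. Here $(T_nf)(P)=|n|^{-1}\sum_{\gamma}f(\gamma P)$, the sum being over the integral matrices of determinant $n$ modulo left multiplication by $\mathrm{SL}_2(\mathcal O)$. Note that $\lambda_f(-1)=\pm1$, with $\lambda_f(-1)=1$ exactly if $f(-z+rj)=f(z+rj)$. *Coefficients.* The coefficients $\rho_f(\mu)$ are given by the Fourier expansion $f(z+rj)=\sum_{0\ne\mu\in\mathcal O}\rho_f(\mu)\,rK_{it_f}(2\pi|\tilde\mu|r)\,e^{2\pi i\,\Re(\overline{\tilde\mu}z)}$, where $\tilde\mu=\frac{2}{\sqrt{d_K}}\bar\mu$. Likewise $\rho_t(\mu)$ are the coefficients of $E_t$ (with Bessel function $K_{it}$), apart from its constant term. *L-functions.* For $\Re s>2$ let $$L(s,f)=\frac1{|\mathcal O^\times|}\sum_{\mu\ne0}\frac{\lambda_f(\mu)}{|\mu|^{2s}},\qquad L(s,f\times h)=\frac{\zeta_K(2s)}{|\mathcal O^\times|}\sum_{\mu\neq0}\frac{\lambda_f(\mu)\lambda_h(\mu)}{|\mu|^{2s}},$$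 and let the following functions be continued meromorphically to $\mathbb C$, where $c=2\pi/\sqrt{|d_K|}$: $$\Lambda(s)=c^{-s}\,\Gamma(s)\zeta_K(s),\qquad \Lambda(s,f)=c^{-2s}\prod_{\pm}\Gamma\Bigl(s\pm\tfrac{it_f}2\Bigr)L(s,f),\qquad \Lambda(s,f\times h)=c^{-4s}\prod_{\pm,\pm}\Gamma\Bigl(s\pm\tfrac{it_f}2\pm\tfrac{it_h}2\Bigr)L(s,f\times h).$$ Then all these continuations exist, and $\Lambda(1+it)\ne0$ for real $t\neq0$. For all Hecke–Maaß cusp forms $u_k,g$ (with spectral parameters $t_k,t_g$ and coefficients $\rho_k,\rho_g$) and all $s,t\in\mathbb R$, the integrals below converge absolutely. If $t\ne0$, then $$\int_{\Gamma\backslash\mathbb H^3}u_k\,g\,E_t\,dv=\frac{|\mathcal O^\times|\sqrt{|d_K|}}{16}\,\lambda_g(-1)\,\frac{\rho_k(1)\rho_g(1)\,\Lambda(\frac{1+it}2,g\times u_k)}{\Lambda(1+it)}.$$ If $s\neq0$, then $$\int_{\Gamma\backslash\mathbb H^3}E_t\,g\,E_s\,dv=\frac{|\mathcal O^\times|\sqrt{|d_K|}}{16}\,\frac{\rho_t(1)\rho_g(1)\,\Lambda(\frac{1+is+it}2,g)\,\Lambda(\frac{1+is-it}2,g)}{\Lambda(1+is)}.$$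 The Hermitian inner products $\langle u_kg,E_t\rangle=\int_{\Gamma\backslash\mathbb H^3} u_kg\,\overline{E_t}\,dv$ and $\langle E_tg,E_s\rangle=\int_{\Gamma\backslash\mathbb H^3} E_tg\,\overline{E_s}\,dv$ are given by the same right-hand sides with the denominators replaced by $\Lambda(1-it)$ and $\Lambda(1-is)$, respectively. Finally $\langle u_kg,E_0\rangle=0$ and $\langle E_tg,E_0\rangle=0$, in accordance with the pole of $\Lambda$ at $1$. -/

import Mathlib

open Complex MeasureTheory NumberField
open scoped MatrixGroups ComplexConjugate

namespace Bianchi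

noncomputable section

/-! ### Hyperbolic three-space -/

/-- Hyperbolic 3-space: the point `z + r j` is the pair `(z, r)`, with `z` complex and `r > 0`. -/
abbrev H3 : Type := {p : ℂ × ℝ // 0 < p.2}

/-- The point `z + r j`. -/
def mk (z : ℂ) (r : ℝ) (hr : 0 < r) : H3 := ⟨(z, r), hr⟩

/-- The horizontal coordinate of a point. -/
def H3.z (P : H3) : ℂ := P.1.1

/-- The height of a point. -/
def H3.r (P : H3) : ℝ := P.1.2

lemma H3.r_pos (P : H3) : 0 < P.r := P.2

/-- The hyperbolic volume `dx dy dr / r ^ 3`. -/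
def hypVol : Measure H3 :=
  (Measure.comap Subtype.val (volume : Measure (ℂ × ℝ))).withDensity
    (fun P : H3 => ENNReal.ofReal ((P.r ^ 3)⁻¹))

/-- `|c z + d|² + |c|² r²`, the norm of the quaternion `c P + d`. -/
def den (M : Matrix (Fin 2) (Fin 2) ℂ) (P : H3) : ℝ :=
  normSq (M 1 0 * P.z + M 1 1) + normSq (M 1 0) * P.r ^ 2

lemma den_pos (M : GL (Fin 2) ℂ) (P : H3) : 0 < den M.1 P := by
  have hdet : M.1.det ≠ 0 := M.det.ne_zero
  have h1 := normSq_nonneg (M.1 1 0 * P.z + M.1 1 1)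
  have h2 := normSq_nonneg (M.1 1 0)
  unfold den
  by_cases hc : M.1 1 0 = 0
  · have hd : M.1 1 1 ≠ 0 := by
      intro hd
      apply hdet
      rw [Matrix.det_fin_two, hc, hd]
      ring
    have := normSq_pos.2 hd
    simpa [hc] using this
  · have h3 := normSq_pos.2 hc
    have := mul_pos h3 (pow_pos P.r_pos 2)
    linarith

/-- The action of an invertible complex matrix on `z + r j`. In coordinates the quaternion
`q⁻¹ (a P + b) (c P + d)⁻¹ q`, where `q ^ 2` is the determinant, is `z' + r' j` with
`z' = ((a z + b) conj (c z + d) + a conj c r²) / (|c z + d|² + |c|² r²)` and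
`r' = |a d - b c| r / (|c z + d|² + |c|² r²)`. -/
def act (M : GL (Fin 2) ℂ) (P : H3) : H3 :=
  mk (((M.1 0 0 * P.z + M.1 0 1) * conj (M.1 1 0 * P.z + M.1 1 1)
      + M.1 0 0 * conj (M.1 1 0) * (P.r : ℂ) ^ 2) / (den M.1 P : ℂ))
    (‖M.1.det‖ * P.r / den M.1 P)
    (div_pos (mul_pos (norm_pos_iff.2 M.det.ne_zero) P.r_pos) (den_pos M P))

lemma H3.ext' {P Q : H3} (h1 : P.z = Q.z) (h2 : P.r = Q.r) : P = Q :=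
  Subtype.ext (Prod.ext h1 h2)

lemma den_cast (M : Matrix (Fin 2) (Fin 2) ℂ) (P : H3) :
    (den M P : ℂ) = (M 1 0 * P.z + M 1 1) * conj (M 1 0 * P.z + M 1 1)
      + M 1 0 * conj (M 1 0) * (P.r : ℂ) ^ 2 := by
  simp only [den, ofReal_add, ofReal_mul, ofReal_pow, mul_conj]

lemma act_r_sq (M : GL (Fin 2) ℂ) (P : H3) :
    ((act M P).r : ℂ) ^ 2
      = M.1.det * conj M.1.det * (P.r : ℂ) ^ 2 / (den M.1 P : ℂ) ^ 2 := by
  have : (act M P).r = ‖M.1.det‖ * P.r / den M.1 P := rfl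
  rw [this, mul_conj, ← Complex.sq_norm]
  push_cast
  ring

lemma den_mul (M N : GL (Fin 2) ℂ) (P : H3) :
    den (M * N).1 P = den M.1 (act N P) * den N.1 P := by
  have hN : (den N.1 P : ℂ) ≠ 0 := by exact_mod_cast (den_pos N P).ne'
  have key : (den (M * N).1 P : ℂ) = den M.1 (act N P) * den N.1 P := by
    have hz : (act N P).z = ((N.1 0 0 * P.z + N.1 0 1) * conj (N.1 1 0 * P.z + N.1 1 1)
      + N.1 0 0 * conj (N.1 1 0) * (P.r : ℂ) ^ 2) / (den N.1 P : ℂ) := rfl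
    have hD := den_cast N.1 P
    rw [den_cast (M * N).1, den_cast M.1, act_r_sq, hz]
    generalize (den N.1 P : ℂ) = D at *
    have hDc : conj D = D := by
      rw [hD]; simp only [map_add, map_mul, map_pow, conj_conj, conj_ofReal]; ring
    simp only [Units.val_mul, Matrix.mul_apply, Fin.sum_univ_two, Matrix.det_fin_two, map_add,
      map_mul, map_sub, map_div₀, conj_conj, map_pow, conj_ofReal, hDc]
    simp only [map_add, map_mul] at hD
    field_simp
    rw [hD]
    ring
  exact_mod_cast key

instance : MulAction (GL (Fin 2) ℂ) H3 where
  smul := act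
  one_smul P := by
    have hd : den (1 : GL (Fin 2) ℂ).1 P = 1 := by simp [den]
    apply H3.ext'
    · change ((_ : ℂ) / _) = _
      rw [hd]; simp
    · change (_ : ℝ) / _ = _
      rw [hd]; simp
  mul_smul M N P := by
    change act (M * N) P = act M (act N P)
    have hN : (den N.1 P : ℂ) ≠ 0 := by exact_mod_cast (den_pos N P).ne'
    have hM : (den M.1 (act N P) : ℂ) ≠ 0 := by exact_mod_cast (den_pos M (act N P)).ne'
    have hm := den_mul M N P
    have hN' := (den_pos N P).ne'
    have hM' := (den_pos M (act N P)).ne'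
    apply H3.ext'
    · change ((_ : ℂ) / (den (M * N).1 P : ℂ)) = _ / (den M.1 (act N P) : ℂ)
      rw [hm, act_r_sq]
      have hz : (act N P).z = ((N.1 0 0 * P.z + N.1 0 1) * conj (N.1 1 0 * P.z + N.1 1 1)
        + N.1 0 0 * conj (N.1 1 0) * (P.r : ℂ) ^ 2) / (den N.1 P : ℂ) := rfl
      have hD := den_cast N.1 P
      rw [hz, ofReal_mul]
      generalize (den M.1 (act N P) : ℂ) = E at *
      generalize (den N.1 P : ℂ) = D at *
      have hDc : conj D = D := by
        rw [hD]; simp only [map_add, map_mul, map_pow, conj_conj, conj_ofReal]; ring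
      simp only [Units.val_mul, Matrix.mul_apply, Fin.sum_univ_two, Matrix.det_fin_two, map_add,
        map_mul, map_sub, map_div₀, conj_conj, map_pow, conj_ofReal, hDc]
      simp only [map_add, map_mul] at hD
      field_simp
      rw [hD]
      ring
    · change (_ : ℝ) / den (M * N).1 P = ‖M.1.det‖ * (‖N.1.det‖ * P.r / den N.1 P) / _
      rw [hm, Units.val_mul, Matrix.det_mul, norm_mul]
      field_simp

/-! ### The Bianchi group -/

variable {K : Type*} [Field K] [NumberField K]

/-- The embedding of the ring of integers into the complex numbers. -/
def emb (σ : K →+* ℂ) : 𝓞 K →+* ℂ := σ.comp (algebraMap (𝓞 K) K)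

/-- The inclusion of `SL₂(𝓞 K)` into `GL₂(ℂ)`. -/
def incl (σ : K →+* ℂ) : SL(2, 𝓞 K) →* GL (Fin 2) ℂ :=
  Matrix.SpecialLinearGroup.toGL.comp (Matrix.SpecialLinearGroup.map (emb σ))

/-- `Γ = PSL₂(𝓞 K)`, as the group of transformations of `H3` induced by `SL₂(𝓞 K)`
(the kernel of the action is `{1, -1}`). -/
def Gam (σ : K →+* ℂ) : Subgroup (Equiv.Perm H3) :=
  ((MulAction.toPermHom (GL (Fin 2) ℂ) H3).comp (incl σ)).range

/-- The full preimage in `SL₂(𝓞 K)` of the group `Γ'_∞` of parabolic elements of `Γ` fixing `∞`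
(and the identity): the matrices with lower row `(0, ±1)`. -/
def ParInf (K : Type*) [Field K] [NumberField K] : Subgroup SL(2, 𝓞 K) where
  carrier := {M | M 1 0 = 0 ∧ (M 1 1 = 1 ∨ M 1 1 = -1)}
  one_mem' := by simp
  mul_mem' := by
    rintro M N ⟨h1, h2⟩ ⟨h3, h4⟩
    simp only [Set.mem_ofPred_eq, Matrix.SpecialLinearGroup.coe_mul, Matrix.mul_apply,
      Fin.sum_univ_two, h1, h3]
    rcases h2 with h2 | h2 <;> rcases h4 with h4 | h4 <;> simp [h2, h4]
  inv_mem' := by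
    rintro M ⟨h1, h2⟩
    have hdet := M.det_coe
    rw [Matrix.det_fin_two, h1] at hdet
    rw [Set.mem_ofPred_eq, Matrix.SpecialLinearGroup.SL2_inv_expl]
    refine ⟨by simp [h1], ?_⟩
    change M.1 0 0 = 1 ∨ M.1 0 0 = -1
    rcases h2 with h2 | h2 <;> rw [h2] at hdet
    · left; simpa using hdet
    · right; simpa [neg_eq_iff_eq_neg] using hdet

/-! ### Meromorphic continuation -/

/-- `F` is meromorphic on the whole plane, normalised so that it is continuous off its poles
(and `0` at its poles), and agrees with `f` for `Re s > σ₀`. -/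
def IsMeroCont (f : ℂ → ℂ) (σ₀ : ℝ) (F : ℂ → ℂ) : Prop :=
  MeromorphicNFOn F Set.univ ∧ ∀ s : ℂ, σ₀ < s.re → F s = f s

/-- `f`, given for `Re s > σ₀`, has a meromorphic continuation to `ℂ`. -/
def HasMeroCont (f : ℂ → ℂ) (σ₀ : ℝ) : Prop := ∃ F, IsMeroCont f σ₀ F

open Classical in
/-- The meromorphic continuation to `ℂ` of the function `f`, given for `Re s > σ₀`
(unique by the identity theorem if it exists, and `0` by convention if it does not). -/
def meroCont (f : ℂ → ℂ) (σ₀ : ℝ) : ℂ → ℂ :=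
  if h : HasMeroCont f σ₀ then h.choose else 0

/-! ### Eisenstein series -/

/-- The series `∑ r(γ P) ^ (1 + s)` over `γ ∈ Γ'_∞ \ Γ`, convergent for `Re s > 2`. The height
`r(γ P)` does not depend on the representative of the class of `γ`. -/
def eisSeries (σ : K →+* ℂ) (P : H3) (s : ℂ) : ℂ :=
  ∑' c : Quotient (QuotientGroup.rightRel (ParInf K)),
    ((incl σ c.out • P).r : ℂ) ^ (1 + s)

/-- The Eisenstein series `E(P, s)`, continued meromorphically in `s`. -/
def eisenstein (σ : K →+* ℂ) (P : H3) (s : ℂ) : ℂ := meroCont (eisSeries σ P) 2 s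

/-- `E_t = E(·, i t)`. -/
def Eis (σ : K →+* ℂ) (t : ℝ) (P : H3) : ℂ := eisenstein σ P (I * t)

/-! ### Fourier coefficients -/

/-- The Bessel function `K_ν(x)`, `x > 0`. -/
def besselK (ν : ℂ) (x : ℝ) : ℂ :=
  ∫ u in Set.Ioi (0 : ℝ), (Real.exp (-x * Real.cosh u) : ℂ) * Complex.cosh (ν * u)

/-- `sqrt |d_K|`. -/
def sqrtDisc (K : Type*) [Field K] [NumberField K] : ℝ := Real.sqrt |(discr K : ℝ)|

/-- The dual frequency `(2 / sqrt d_K) conj μ`, where `sqrt d_K = i sqrt |d_K|`. -/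
def dualFreq (σ : K →+* ℂ) (μ : 𝓞 K) : ℂ := 2 / (I * sqrtDisc K) * conj (emb σ μ)

/-- The character `e(⟨w, z⟩)`, where `⟨w, z⟩ = Re (conj w z)` and `e(x) = exp(2 π i x)`. -/
def chr (w z : ℂ) : ℂ := Complex.exp (2 * Real.pi * I * ((conj w * z).re : ℝ))

/-- The `μ`-th Fourier coefficient of `z ↦ f(z + r j)`: the mean of `f(z + r j) e(-⟨μ̃, z⟩)`
over a period parallelogram of the lattice `𝓞 K`. -/
def fourierCoeff (σ : K →+* ℂ) (f : H3 → ℂ) (μ : 𝓞 K) (r : ℝ) (hr : 0 < r) : ℂ :=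
  ∫ x in Set.Icc (0 : Module.Free.ChooseBasisIndex ℤ (𝓞 K) → ℝ) 1,
    f (mk (∑ i, (x i : ℂ) * emb σ (RingOfIntegers.basis K i)) r hr)
      * chr (dualFreq σ μ) (-∑ i, (x i : ℂ) * emb σ (RingOfIntegers.basis K i))

open Classical in
/-- The coefficient `ρ_f(μ)`, `μ ≠ 0`, in the Fourier expansion
`f(z + r j) = (constant term) + ∑ ρ_f(μ) r K_{it}(2 π |μ̃| r) e(⟨μ̃, z⟩)`
of a function with spectral parameter `t`: the number such that the `μ`-th Fourier coefficient
is `ρ_f(μ) r K_{it}(2 π |μ̃| r)` for all `r > 0`. -/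
def rho (σ : K →+* ℂ) (f : H3 → ℂ) (t : ℂ) (μ : 𝓞 K) : ℂ :=
  if h : ∃ a : ℂ, ∀ (r : ℝ) (hr : 0 < r),
      fourierCoeff σ f μ r hr = a * (r * besselK (I * t) (2 * Real.pi * ‖dualFreq σ μ‖ * r))
  then h.choose else 0

/-! ### Hecke-Maass cusp forms -/

open Classical in
/-- `f` in the coordinates of `z + r j`, extended by `0` to `r ≤ 0`. -/
def coord (f : H3 → ℂ) (p : ℂ × ℝ) : ℂ := if h : 0 < p.2 then f ⟨p, h⟩ else 0

/-- The Laplace-Beltrami operator `r² (∂²/∂x² + ∂²/∂y² + ∂²/∂r²) - r ∂/∂r`. -/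
def lap (f : H3 → ℂ) (P : H3) : ℂ :=
  (P.r : ℂ) ^ 2 *
      (iteratedDeriv 2 (fun x : ℝ => coord f (⟨x, P.z.im⟩, P.r)) P.z.re
        + iteratedDeriv 2 (fun y : ℝ => coord f (⟨P.z.re, y⟩, P.r)) P.z.im
        + iteratedDeriv 2 (fun r : ℝ => coord f (P.z, r)) P.r)
    - P.r * deriv (fun r : ℝ => coord f (P.z, r)) P.r

/-- The integral matrices of determinant `n`. -/
def MatDet (n : 𝓞 K) : Type _ := {M : Matrix (Fin 2) (Fin 2) (𝓞 K) // M.det = n}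

/-- Two matrices of determinant `n` are equivalent if they differ by left multiplication by an
element of `SL₂(𝓞 K)`. -/
def matSetoid (n : 𝓞 K) : Setoid (MatDet n) where
  r M M' := ∃ γ : SL(2, 𝓞 K), M'.1 = γ.1 * M.1
  iseqv :=
    { refl := fun M => ⟨1, by simp⟩
      symm := by
        rintro M M' ⟨γ, h⟩
        refine ⟨γ⁻¹, ?_⟩
        rw [h, ← Matrix.mul_assoc, ← Matrix.SpecialLinearGroup.coe_mul, inv_mul_cancel]
        simp
      trans := by
        rintro M M' M'' ⟨γ, h⟩ ⟨δ, h'⟩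
        exact ⟨δ * γ, by rw [h', h, Matrix.SpecialLinearGroup.coe_mul, Matrix.mul_assoc]⟩ }

open Classical in
/-- A matrix of non-zero determinant over `𝓞 K`, as an element of `GL₂(ℂ)`. -/
def toGL (σ : K →+* ℂ) (M : Matrix (Fin 2) (Fin 2) (𝓞 K)) : GL (Fin 2) ℂ :=
  if h : (M.map (emb σ)).det ≠ 0 then Matrix.GeneralLinearGroup.mkOfDetNeZero _ h else 1

/-- The Hecke operator `(T_n f)(P) = N(n)^(-1/2) ∑ f(γ P)`, the sum over `Γ \ M_n`, for `n ≠ 0`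
and a `Γ`-invariant `f` (then `f(γ P)` does not depend on the representative `γ`; the sum is
finite). Here `N(n)^(1/2) = |n|`. -/
def hecke (σ : K →+* ℂ) (n : 𝓞 K) (f : H3 → ℂ) (P : H3) : ℂ :=
  (‖emb σ n‖ : ℂ)⁻¹ * ∑ᶠ c : Quotient (matSetoid n), f (toGL σ c.out.1 • P)

/-- `f` is a Hecke-Maass cusp form for `Γ` with spectral parameter `t` (the Laplace eigenvalue is
`1 - s²` with `s = it`) and Hecke eigenvalues `lam n`, `n ≠ 0`: a non-zero `Γ`-invariant
eigenfunction of `-Δ` and of all Hecke operators, of polynomial growth at the cusp, with vanishing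
constant term at the cusp. -/
structure IsHeckeMaassCuspForm (σ : K →+* ℂ) (f : H3 → ℂ) (t : ℂ) (lam : 𝓞 K → ℂ) : Prop where
  ne_zero : f ≠ 0
  contDiffOn : ContDiffOn ℝ 2 (coord f) {p : ℂ × ℝ | 0 < p.2}
  invariant : ∀ γ ∈ Gam σ, ∀ P, f (γ P) = f P
  eigen : ∀ P, -lap f P = (1 - (I * t) ^ 2) * f P
  growth : ∃ (C : ℝ) (N : ℕ), ∀ P : H3, 1 ≤ P.r → ‖f P‖ ≤ C * P.r ^ N
  cuspidal : ∀ (r : ℝ) (hr : 0 < r), fourierCoeff σ f 0 r hr = 0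
  hecke_eigen : ∀ n : 𝓞 K, n ≠ 0 → ∀ P, hecke σ n f P = lam n * f P

/-! ### L-functions -/

/-- `2 π / sqrt |d_K|`. -/
def cond (K : Type*) [Field K] [NumberField K] : ℂ := ((2 * Real.pi / sqrtDisc K : ℝ) : ℂ)

/-- The number of units of `𝓞 K`. -/
def unitCard (K : Type*) [Field K] [NumberField K] : ℂ := (Nat.card (𝓞 K)ˣ : ℂ)

/-- The Dirichlet series `|𝓞ˣ|⁻¹ ∑ a(μ) N(μ)^(-s)` over the non-zero `μ` in `𝓞 K`. If `a` is
unit-invariant and `K` has class number one, it is the sum of `a(μ) N(μ)^(-s)` over the non-zero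
ideals `(μ)`. -/
def dirichletSeries (σ : K →+* ℂ) (a : 𝓞 K → ℂ) (s : ℂ) : ℂ :=
  (unitCard K)⁻¹ * ∑' μ : {μ : 𝓞 K // μ ≠ 0}, a μ * ((‖emb σ μ‖ ^ 2 : ℝ) : ℂ) ^ (-s)

/-- `(2π/sqrt|d_K|)^(-s) Γ(s) ζ_K(s)`, for `Re s > 1`. -/
def zetaSeries (K : Type*) [Field K] [NumberField K] (s : ℂ) : ℂ :=
  cond K ^ (-s) * Gamma s * dedekindZeta K s

/-- The completed Dedekind zeta function `Λ(s)`, on `ℂ`. -/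
def LamK (K : Type*) [Field K] [NumberField K] : ℂ → ℂ := meroCont (zetaSeries K) 1

/-- `(2π/sqrt|d_K|)^(-2s) Γ(s + i t/2) Γ(s - i t/2) L(s, g)` for `Re s > 2`, where
`L(s, g) = ∑ λ_g(μ) N(μ)^(-s)`. -/
def stdSeries (σ : K →+* ℂ) (t : ℂ) (lam : 𝓞 K → ℂ) (s : ℂ) : ℂ :=
  cond K ^ (-2 * s) * (Gamma (s + I * t / 2) * Gamma (s - I * t / 2))
    * dirichletSeries σ lam s

/-- The completed standard L-function `Λ(s, g)`, on `ℂ`. -/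
def LamStd (σ : K →+* ℂ) (t : ℂ) (lam : 𝓞 K → ℂ) : ℂ → ℂ := meroCont (stdSeries σ t lam) 2

/-- `(2π/sqrt|d_K|)^(-4s) ∏ Γ(s ± i t₁/2 ± i t₂/2) L(s, f₁ × f₂)` for `Re s > 2`, where
`L(s, f₁ × f₂) = ζ_K(2s) ∑ λ₁(μ) λ₂(μ) N(μ)^(-s)`. -/
def rsSeries (σ : K →+* ℂ) (t₁ t₂ : ℂ) (lam₁ lam₂ : 𝓞 K → ℂ) (s : ℂ) : ℂ :=
  cond K ^ (-4 * s)
    * (Gamma (s + I * t₁ / 2 + I * t₂ / 2) * Gamma (s + I * t₁ / 2 - I * t₂ / 2)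
      * Gamma (s - I * t₁ / 2 + I * t₂ / 2) * Gamma (s - I * t₁ / 2 - I * t₂ / 2))
    * (dedekindZeta K (2 * s) * dirichletSeries σ (fun μ => lam₁ μ * lam₂ μ) s)

/-- The completed Rankin-Selberg L-function `Λ(s, f₁ × f₂)`, on `ℂ`. -/
def LamRS (σ : K →+* ℂ) (t₁ t₂ : ℂ) (lam₁ lam₂ : 𝓞 K → ℂ) : ℂ → ℂ :=
  meroCont (rsSeries σ t₁ t₂ lam₁ lam₂) 2

/-- The constant `|𝓞ˣ| sqrt|d_K| / 16`. -/
def cK (K : Type*) [Field K] [NumberField K] : ℂ := unitCard K * sqrtDisc K / 16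

/-! ### Pairings on the quotient -/

/-- `F G` is integrable over the fundamental domain `D`, and `∫ F G dv = v`. -/
def HasPairing (D : Set H3) (F G : H3 → ℂ) (v : ℂ) : Prop :=
  IntegrableOn (fun P => F P * G P) D hypVol ∧ ∫ P in D, F P * G P ∂hypVol = v

/-- `⟨F, G⟩ = v` for the inner product `⟨F, G⟩ = ∫ F conj(G) dv` over the fundamental domain `D`
(and the integral converges absolutely). -/
def HasInner (D : Set H3) (F G : H3 → ℂ) (v : ℂ) : Prop :=
  HasPairing D F (fun P => conj (G P)) v

end

end Bianchi

/-!
# Rankin-Selberg unfolding on the quotient of hyperbolic space by a Bianchi group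

Let `Λ` be the completed zeta function of `K` and `q_{c,d}(P) = |c z + d|² + |c|² r²`. The function
`Λ(1 + s) E(P, s)` is, up to a constant, the Mellin transform of the theta series of the quadratic
form `(c, d) ↦ q_{c,d}(P) / r` (`Est`, `eisenstein_eq`): a non-zero pair of integers is the greatest
common divisor times a coprime pair, and the coprime pairs are the bottom rows of the matrices in
`SL₂(𝓞 K)`. Poisson summation (`poisson`) inverts the theta series, and Riemann's splitting of the
Mellin integral continues `Est` to the plane, with poles at `±1` only and invariant under `s ↦ -s`.
Poisson summation over `d` alone gives the constant term, a combination of `r^(1+s) Λ(1+s)` and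
`r^(1-s) Λ(1-s)` (`planeCoeff_Est_zero`), and the other coefficients, which are divisor sums
`τ_s(μ)` times `r K_s` (`planeCoeff_Est`). The same argument in one variable continues `Λ` (`LamF`),
which has poles at `0` and `1`.

If `F` is `Γ`-invariant and decreases rapidly at the cusp (`RapidInv`), its integral against
`E(P, s)` unfolds, for large `Re s`, to the Mellin transform of the constant term of `F`
(`RapidInv.integral_mul_Est`). As the integral of `F` against `Est` is holomorphic off `±1`, it
continues that Mellin transform.

* Cusp forms: separation of variables turns the Laplace equation into the Bessel equation for each
  coefficient, and polynomial growth leaves the solution `r K`. With the Siegel domain this gives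
  rapid decay (`Cuspidal.rapidInv`). An explicit set of representatives of the Hecke operators
  yields the Hecke relations (`IsHeckeMaassCuspForm.hecke_rho`), in particular `ρ(μ) = ρ(1) λ(μ)`
  with `ρ(1) ≠ 0`.
* `L(s, f × h)` is continued by the integral of `f h` against `Est` (`lamRS`); the Gamma factors
  come from the Mellin transform of a product of two Bessel functions. `L(s, f)` is continued by the
  Mellin transform in `r` of `f(rj)`, which is invariant under `r ↦ 1/r`
  (`IsHeckeMaassCuspForm.lamStd`). For `E_t g` against `E_s` the Dirichlet series
  `∑ τ_t(μ) λ_g(μ) N(μ)^(-w)` factors into two standard ones, by the Hecke relations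
  (`IsHeckeMaassCuspForm.tsum_mul_tsum`).
* Non-vanishing of `Λ(1 + it)` (`LamF_ne_zero`): at a zero the constant term of `Est` at `it`
  vanishes, so `Est` is cuspidal and may be integrated against Eisenstein series. By unfolding all
  these integrals are zero, among them the square norm of `Est`, which is real-valued at `it`. Hence
  `Est` vanishes there, but its first coefficient does not.

The identity theorem carries the formulas from a half plane to the line `Re s = 0`, where
`E_t = Est(·, it) / Λ(1 + it)`; the Hermitian versions follow as `Est(·, it)` is real. At `t = 0`
the pole of `Λ` at `1` makes `E_0` vanish identically.
-/

set_option linter.unusedSectionVars false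

namespace Bianchi

noncomputable section

/-! ### Arithmetic of an imaginary quadratic field -/

section Field

variable {K : Type*} [Field K] [NumberField K]
variable (σ : K →+* ℂ)

lemma emb_injective : Function.Injective (emb σ) :=
  σ.injective.comp (FaithfulSMul.algebraMap_injective (𝓞 K) K)

lemma emb_ne_zero {μ : 𝓞 K} (h : μ ≠ 0) : emb σ μ ≠ 0 := by
  simpa using (emb_injective σ).ne h

lemma norm_emb_pos {μ : 𝓞 K} (h : μ ≠ 0) : 0 < ‖emb σ μ‖ := norm_pos_iff.2 (emb_ne_zero σ h)

variable [IsTotallyComplex K] [hdeg : Fact (Module.finrank ℚ K = 2)]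

lemma trace_eq_re (x : K) : ((Algebra.trace ℚ K x : ℚ) : ℂ) = 2 * ((σ x).re : ℂ) := by
  classical
  have h1 := trace_eq_sum_embeddings ℂ (K := ℚ) (L := K) (x := x)
  have hne : σ.toRatAlgHom ≠ (ComplexEmbedding.conjugate σ).toRatAlgHom := by
    intro h
    apply IsTotallyComplex.complexEmbedding_not_isReal σ
    ext y
    exact (DFunLike.congr_fun h y).symm
  have hu : (Finset.univ : Finset (K →ₐ[ℚ] ℂ))
      = {σ.toRatAlgHom, (ComplexEmbedding.conjugate σ).toRatAlgHom} := by
    symm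
    apply Finset.eq_univ_of_card
    rw [Finset.card_pair hne, AlgHom.card, hdeg.out]
  rw [hu, Finset.sum_pair hne] at h1
  have h2 : (algebraMap ℚ ℂ) (Algebra.trace ℚ K x) = ((Algebra.trace ℚ K x : ℚ) : ℂ) := rfl
  rw [← h2, h1]
  change σ x + conj (σ x) = _
  rw [add_conj]
  push_cast; ring

instance uniqueInfinitePlace : Subsingleton (InfinitePlace K) := by
  rw [← Fintype.card_le_one_iff_subsingleton]
  have h := IsTotallyComplex.finrank K
  rw [hdeg.out] at h
  have h2 := InfinitePlace.card_eq_nrRealPlaces_add_nrComplexPlaces K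
  rw [IsTotallyComplex.nrRealPlaces_eq_zero] at h2
  omega

/-- The square of the complex absolute value is the norm. -/
lemma norm_emb_sq (μ : 𝓞 K) : ‖emb σ μ‖ ^ 2 = (Ideal.absNorm (Ideal.span {μ}) : ℝ) := by
  have h := InfinitePlace.prod_eq_abs_norm (K := K) (μ : K)
  have hu : (Finset.univ : Finset (InfinitePlace K)) = {InfinitePlace.mk σ} := by
    ext w; simp [Subsingleton.elim w (InfinitePlace.mk σ)]
  rw [hu, Finset.prod_singleton, IsTotallyComplex.mult_eq, InfinitePlace.apply] at h
  have h3 : ‖emb σ μ‖ ^ 2 = |((Algebra.norm ℚ (μ : K) : ℚ) : ℝ)| := by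
    rw [← Rat.cast_abs]; exact h
  rw [h3, Ideal.absNorm_span_singleton, Nat.cast_natAbs, ← Algebra.coe_norm_int]
  push_cast; rfl

lemma one_le_norm_emb {μ : 𝓞 K} (h : μ ≠ 0) : 1 ≤ ‖emb σ μ‖ := by
  have h1 : 1 ≤ ‖emb σ μ‖ ^ 2 := by
    rw [norm_emb_sq]
    have : Ideal.absNorm (Ideal.span {μ}) ≠ 0 := by
      rw [Ne, Ideal.absNorm_eq_zero_iff]; simpa using h
    exact_mod_cast Nat.one_le_iff_ne_zero.2 this
  nlinarith [norm_nonneg (emb σ μ)]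

lemma norm_emb_unit (u : (𝓞 K)ˣ) : ‖emb σ u‖ = 1 := by
  have h := norm_emb_sq σ (u : 𝓞 K)
  rw [Ideal.span_singleton_eq_top.2 u.isUnit, Ideal.absNorm_top, Nat.cast_one] at h
  exact (pow_eq_one_iff_of_nonneg (norm_nonneg _) two_ne_zero).1 h

instance finite_units : Finite (𝓞 K)ˣ := by
  have h := Embeddings.finite_of_norm_le K ℂ 1
  have := h.to_subtype
  apply Finite.of_injective (β := {x : K | IsIntegral ℤ x ∧ ∀ φ : K →+* ℂ, ‖φ x‖ ≤ 1})
    (fun u : (𝓞 K)ˣ => ⟨((u : 𝓞 K) : K), RingOfIntegers.isIntegral_coe _,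
      fun φ => (norm_emb_unit φ u).le⟩)
  intro u v huv
  apply Units.ext
  exact RingOfIntegers.ext (by simpa using huv)

lemma unitCard_ne_zero : unitCard K ≠ 0 := by
  unfold unitCard
  exact_mod_cast Nat.card_pos.ne'

/-! ### The lattice of integers and its dual -/

variable (K) in
/-- The index set of the chosen `ℤ`-basis of `𝓞 K`. -/
abbrev Idx : Type _ := Module.Free.ChooseBasisIndex ℤ (𝓞 K)

/-- The generators of the lattice of integers. -/
def lat (i : Idx K) : ℂ :=
  emb σ (RingOfIntegers.basis K i)

variable (K) in
lemma card_index : Fintype.card (Idx K) = 2 := by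
  rw [← Module.finrank_eq_card_chooseBasisIndex, RingOfIntegers.rank, hdeg.out]

variable (K) in
/-- A numbering of the index set of the integral basis. -/
def idx : Fin 2 ≃ Idx K :=
  (Fintype.equivFinOfCardEq (card_index K)).symm

lemma sum_idx {M : Type*} [AddCommMonoid M] (f : Idx K → M) :
    ∑ i, f i = f (idx K 0) + f (idx K 1) := by
  rw [← (idx K).sum_comp, Fin.sum_univ_two]

lemma emb_eq_sum (μ : 𝓞 K) : emb σ μ = ∑ i, ((RingOfIntegers.basis K).repr μ i : ℂ) * lat σ i := by
  conv_lhs => rw [← (RingOfIntegers.basis K).sum_repr μ]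
  simp [lat, zsmul_eq_mul]

/-- The oriented covolume of the lattice of integers. -/
def area : ℝ := (lat σ (idx K 0) * conj (lat σ (idx K 1))).im

lemma discr_eq_area : ((discr K : ℤ) : ℝ) = -4 * area σ ^ 2 := by
  have h := coe_discr K
  rw [Algebra.discr_def, ← Matrix.det_reindex_self (idx K).symm, Matrix.det_fin_two] at h
  simp only [Matrix.reindex_apply, Matrix.submatrix_apply, Algebra.traceMatrix_apply,
    Algebra.traceForm_apply, Equiv.symm_symm, integralBasis_apply] at h
  have h' : ((discr K : ℤ) : ℂ) = _ := congrArg (fun q : ℚ => (q : ℂ)) h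
  push_cast at h'
  simp only [trace_eq_re σ, map_mul] at h'
  have e : ∀ i, σ (algebraMap (𝓞 K) K (RingOfIntegers.basis K i)) = lat σ i := fun i => rfl
  have hr : 2 * (lat σ (idx K 0) * lat σ (idx K 0)).re * (2 * (lat σ (idx K 1) * lat σ (idx K 1)).re)
      - 2 * (lat σ (idx K 0) * lat σ (idx K 1)).re * (2 * (lat σ (idx K 1) * lat σ (idx K 0)).re)
      = -4 * area σ ^ 2 := by
    simp only [area, mul_re, mul_im, conj_re, conj_im]
    ring
  rw [← hr]
  exact_mod_cast h'

lemma area_ne_zero : area σ ≠ 0 := by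
  intro h
  have := discr_eq_area σ
  rw [h] at this
  have h2 : discr K = 0 := by exact_mod_cast (by simpa using this : ((discr K : ℤ) : ℝ) = 0)
  exact discr_ne_zero K h2

/-- The covolume of the lattice of integers is half of `sqrt |d_K|`. -/
lemma sqrtDisc_eq : sqrtDisc K = 2 * |area σ| := by
  unfold sqrtDisc
  rw [discr_eq_area σ, abs_mul, abs_pow, sq_abs]
  rw [show |(-4 : ℝ)| * area σ ^ 2 = (2 * |area σ|) ^ 2 by
    rw [mul_pow, sq_abs]; norm_num]
  exact Real.sqrt_sq (by positivity)

variable (K) in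
lemma sqrtDisc_pos : 0 < sqrtDisc K := by
  obtain ⟨σ⟩ : Nonempty (K →+* ℂ) := inferInstance
  rw [sqrtDisc_eq σ]
  have := abs_pos.2 (area_ne_zero σ)
  positivity

lemma lat_linearIndependent : LinearIndependent ℝ (lat σ) := by
  rw [← linearIndependent_equiv (idx K)]
  have h : lat σ ∘ idx K = ![lat σ (idx K 0), lat σ (idx K 1)] := by
    ext i; fin_cases i <;> rfl
  rw [h, LinearIndependent.pair_iff]
  intro a b hab
  have h1 := congrArg re hab
  have h2 := congrArg im hab
  have ha := area_ne_zero σ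
  simp only [add_re, real_smul, mul_re, ofReal_re, ofReal_im, zero_re, add_im, mul_im,
    zero_im] at h1 h2
  simp only [area, mul_im, conj_im, conj_re] at ha
  constructor
  · apply (mul_eq_zero.1 (?_ : a * _ = 0)).resolve_right ha
    linear_combination (-(lat σ (idx K 1)).im) * h1 + (lat σ (idx K 1)).re * h2
  · apply (mul_eq_zero.1 (?_ : b * _ = 0)).resolve_right ha
    linear_combination ((lat σ (idx K 0)).im) * h1 - (lat σ (idx K 0)).re * h2

/-- The integral basis as a real basis of the complex plane. -/
def latB : Module.Basis (Idx K) ℝ ℂ :=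
  basisOfLinearIndependentOfCardEqFinrank' (lat σ) (lat_linearIndependent σ)
    (by rw [card_index, Complex.finrank_real_complex])

@[simp] lemma latB_apply (i) : latB σ i = lat σ i := by
  simp [latB]

lemma conj_dualFreq (μ : 𝓞 K) : conj (dualFreq σ μ) = 2 * I / sqrtDisc K * emb σ μ := by
  have := (sqrtDisc_pos K).ne'
  simp only [dualFreq, map_mul, map_div₀, conj_ofReal, conj_I, conj_conj, map_ofNat]
  have h : (sqrtDisc K : ℂ) ≠ 0 := by exact_mod_cast this
  field_simp
  linear_combination (-emb σ μ) * I_sq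

lemma norm_dualFreq (μ : 𝓞 K) : ‖dualFreq σ μ‖ = 2 / sqrtDisc K * ‖emb σ μ‖ := by
  rw [← RCLike.norm_conj, conj_dualFreq]
  simp [abs_of_pos (sqrtDisc_pos K)]

lemma dualFreq_add (μ ν : 𝓞 K) : dualFreq σ (μ + ν) = dualFreq σ μ + dualFreq σ ν := by
  simp [dualFreq, mul_add]

lemma dualFreq_neg (μ : 𝓞 K) : dualFreq σ (-μ) = -dualFreq σ μ := by
  simp [dualFreq]

lemma dualFreq_zero : dualFreq σ (0 : 𝓞 K) = 0 := by
  simp [dualFreq]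

lemma re_conj_dualFreq_mul (μ : 𝓞 K) (z : ℂ) : (conj (dualFreq σ μ) * z).re = -(2 / sqrtDisc K) *
    (emb σ μ * z).im := by
  rw [conj_dualFreq, show 2 * I / (sqrtDisc K : ℂ) * emb σ μ * z
    = ((2 / sqrtDisc K : ℝ) : ℂ) * (I * (emb σ μ * z)) by push_cast; ring, re_ofReal_mul,
    I_mul_re]
  ring

lemma exists_int_im (α : 𝓞 K) : ∃ n : ℤ, 2 * (emb σ α).im = n * sqrtDisc K := by
  have h1 := emb_eq_sum σ α
  have h2 := emb_eq_sum σ (1 : 𝓞 K)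
  rw [sum_idx] at h1 h2
  rw [map_one] at h2
  generalize (RingOfIntegers.basis K).repr α (idx K 0) = m0 at *
  generalize (RingOfIntegers.basis K).repr α (idx K 1) = m1 at *
  generalize (RingOfIntegers.basis K).repr 1 (idx K 0) = p0 at *
  generalize (RingOfIntegers.basis K).repr 1 (idx K 1) = p1 at *
  have h3 : (emb σ α).im = (m0 * p1 - m1 * p0) * area σ := by
    have e1 : emb σ α = emb σ α * conj (1 : ℂ) := by simp
    rw [e1, h2, h1]
    simp only [area, mul_im, add_im, add_re, mul_re, conj_im, conj_re, intCast_re, intCast_im]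
    ring
  rw [sqrtDisc_eq σ, h3]
  rcases abs_choice (area σ) with h | h <;> rw [h]
  · exact ⟨m0 * p1 - m1 * p0, by push_cast; ring⟩
  · exact ⟨-(m0 * p1 - m1 * p0), by push_cast; ring⟩

lemma exists_int_pairing (μ ν : 𝓞 K) : ∃ n : ℤ, (conj (dualFreq σ μ) * emb σ ν).re = n := by
  obtain ⟨n, hn⟩ := exists_int_im σ (μ * ν)
  refine ⟨-n, ?_⟩
  rw [re_conj_dualFreq_mul, ← map_mul]
  have := (sqrtDisc_pos K).ne'
  field_simp
  push_cast
  linarith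

/-- The pairings of a frequency with the generators of the lattice. -/
def dualInt (μ : 𝓞 K) (i : Idx K) : ℤ :=
  (exists_int_pairing σ μ (RingOfIntegers.basis K i)).choose

lemma dualInt_spec (μ : 𝓞 K) (i) : (dualInt σ μ i : ℝ) = -(2 / sqrtDisc K) * (emb σ μ * lat σ i).im
    := by
  rw [← re_conj_dualFreq_mul]
  exact (exists_int_pairing σ μ (RingOfIntegers.basis K i)).choose_spec.symm

/-- The frequencies `μ̃` are exactly the dual lattice: the pairing matrix is unimodular. -/
lemma dualInt_bijective : Function.Bijective (dualInt σ) := by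
  have hs := (sqrtDisc_pos K).ne'
  constructor
  · intro μ ν h
    have h0 : ∀ i, (emb σ (μ - ν) * lat σ i).im = 0 := by
      intro i
      have h1 := dualInt_spec σ μ i
      rw [h, dualInt_spec σ ν i] at h1
      have h2 : (2 / sqrtDisc K) * (emb σ (μ - ν) * lat σ i).im = 0 := by
        rw [map_sub, sub_mul, sub_im]; linarith
      exact (mul_eq_zero.1 h2).resolve_left (by positivity)
    by_contra hne
    have hδ := emb_ne_zero σ (sub_ne_zero.2 hne)
    have h1 : area σ * normSq (emb σ (μ - ν)) = 0 := by
      have e : area σ * normSq (emb σ (μ - ν))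
          = ((emb σ (μ - ν) * lat σ (idx K 0)) * conj (emb σ (μ - ν) * lat σ (idx K 1))).im := by
        simp only [area, normSq_apply, mul_im, mul_re, conj_im, conj_re]
        ring
      rw [e, mul_im, conj_im, h0, h0]
      simp
    exact mul_ne_zero (area_ne_zero σ) (by simpa using hδ) h1
  · intro n
    set A : Fin 2 → Fin 2 → ℤ := fun i j => dualInt σ (RingOfIntegers.basis K (idx K i)) (idx K j)
    have hA : ∀ i j, (A i j : ℝ) = -(2 / sqrtDisc K) * (lat σ (idx K i) * lat σ (idx K j)).im :=
      fun i j => dualInt_spec σ _ _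
    have hsym : A 1 0 = A 0 1 := by
      have : (A 1 0 : ℝ) = A 0 1 := by rw [hA, hA, mul_comm (lat σ (idx K 1))]
      exact_mod_cast this
    have hdet : A 0 0 * A 1 1 - A 0 1 * A 0 1 = -1 := by
      have : (A 0 0 * A 1 1 - A 0 1 * A 0 1 : ℝ) = -1 := by
        simp only [hA]
        have e := sqrtDisc_eq σ
        have e2 : sqrtDisc K ^ 2 = 4 * area σ ^ 2 := by rw [e, mul_pow, sq_abs]; norm_num
        have e3 : area σ ^ 2 = ((lat σ (idx K 0)).im * (lat σ (idx K 1)).re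
          - (lat σ (idx K 0)).re * (lat σ (idx K 1)).im) ^ 2 := by
          simp only [area, mul_im, conj_re, conj_im]; ring
        rw [e3] at e2
        simp only [mul_im]
        field_simp
        linear_combination (1 : ℝ) * e2
      exact_mod_cast this
    set m0 : ℤ := -(A 1 1 * n (idx K 0) - A 0 1 * n (idx K 1))
    set m1 : ℤ := -(A 0 0 * n (idx K 1) - A 0 1 * n (idx K 0))
    refine ⟨m0 • RingOfIntegers.basis K (idx K 0) + m1 • RingOfIntegers.basis K (idx K 1), ?_⟩
    have key : ∀ j, dualInt σ (m0 • RingOfIntegers.basis K (idx K 0)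
        + m1 • RingOfIntegers.basis K (idx K 1)) (idx K j) = m0 * A 0 j + m1 * A 1 j := by
      intro j
      have : (dualInt σ (m0 • RingOfIntegers.basis K (idx K 0)
        + m1 • RingOfIntegers.basis K (idx K 1)) (idx K j) : ℝ) = m0 * A 0 j + m1 * A 1 j := by
        rw [dualInt_spec, hA, hA]
        have e1 : emb σ (m0 • RingOfIntegers.basis K (idx K 0)
            + m1 • RingOfIntegers.basis K (idx K 1)) * lat σ (idx K j)
            = ((m0 : ℝ) : ℂ) * (lat σ (idx K 0) * lat σ (idx K j))
              + ((m1 : ℝ) : ℂ) * (lat σ (idx K 1) * lat σ (idx K j)) := by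
          simp only [map_add, zsmul_eq_mul, map_mul, map_intCast, lat, ofReal_intCast]
          ring
        rw [e1, add_im, im_ofReal_mul, im_ofReal_mul]
        ring
      exact_mod_cast this
    funext i
    obtain ⟨j, rfl⟩ := (idx K).surjective i
    rw [key]
    fin_cases j
    · change m0 * A 0 0 + m1 * A 1 0 = n (idx K 0)
      rw [hsym]
      linear_combination (-n (idx K 0)) * hdet
    · change m0 * A 0 1 + m1 * A 1 1 = n (idx K 1)
      linear_combination (-n (idx K 1)) * hdet

lemma summable_norm_rpow {A : ℝ} (hA : 2 < A) : Summable fun μ : 𝓞 K => ‖emb σ μ‖ ^ (-A) := by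
  have h := ZLattice.summable_norm_rpow (Submodule.span ℤ (Set.range (latB σ))) (-A) (by
    rw [ZLattice.rank ℝ, Complex.finrank_real_complex]
    push_cast; linarith)
  have hmem : ∀ μ : 𝓞 K, emb σ μ ∈ Submodule.span ℤ (Set.range (latB σ)) := by
    intro μ
    rw [emb_eq_sum]
    refine Submodule.sum_mem _ fun i _ => ?_
    rw [← zsmul_eq_mul]
    exact Submodule.smul_mem _ _ (Submodule.subset_span ⟨i, latB_apply σ i⟩)
  exact h.comp_injective (i := fun μ : 𝓞 K => (⟨emb σ μ, hmem μ⟩ : Submodule.span ℤ _))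
    (fun a b hab => emb_injective σ (congrArg Subtype.val hab))

lemma summable_one_add_rpow {B : ℝ} (hB : 1 < B) : Summable fun μ : 𝓞 K => (1 + ‖emb σ μ‖ ^ 2) ^
    (-B) := by
  classical
  have h1 := (summable_norm_rpow σ (A := 2 * B) (by linarith)).add
    (hasSum_ite_eq (0 : 𝓞 K) (1 : ℝ)).summable
  refine Summable.of_nonneg_of_le (fun μ => by positivity) (fun μ => ?_) h1
  by_cases hμ : μ = 0
  · subst hμ
    have : (0 : ℝ) ≤ 0 ^ (-(2 * B)) := Real.rpow_nonneg le_rfl _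
    simp
    linarith
  · simp only [hμ, if_false, add_zero]
    have h2 := one_le_norm_emb σ hμ
    rw [show -(2 * B) = 2 * -B by ring, Real.rpow_mul (norm_nonneg _), Real.rpow_two]
    exact Real.rpow_le_rpow_of_nonpos (by positivity) (by linarith) (by linarith)

end Field

/-! ### Characters and Fourier coefficients in the plane -/

lemma chr_add (w z z' : ℂ) : chr w (z + z') = chr w z * chr w z' := by
  simp only [chr, mul_add, add_re, ofReal_add, Complex.exp_add]

lemma chr_add_left (w w' z : ℂ) : chr (w + w') z = chr w z * chr w' z := by
  simp only [chr, map_add, add_mul, mul_add, add_re, ofReal_add, Complex.exp_add]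

@[simp] lemma chr_zero (w : ℂ) : chr w 0 = 1 := by simp [chr]

@[simp] lemma chr_zero_left (z : ℂ) : chr 0 z = 1 := by simp [chr]

lemma chr_eq_exp (w z : ℂ) :
    chr w z = Complex.exp (((2 * Real.pi * (conj w * z).re : ℝ) : ℂ) * I) := by
  unfold chr; congr 1; push_cast; ring

@[simp] lemma norm_chr (w z : ℂ) : ‖chr w z‖ = 1 := by
  rw [chr_eq_exp, norm_exp_ofReal_mul_I]

lemma chr_neg (w z : ℂ) : chr w (-z) = conj (chr w z) := by
  rw [chr_eq_exp, chr_eq_exp, ← exp_conj, map_mul, conj_ofReal, conj_I, mul_neg, neg_re]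
  congr 1
  push_cast
  ring

lemma chr_neg_left (w z : ℂ) : chr (-w) z = conj (chr w z) := by
  rw [← chr_neg]; simp [chr]

lemma chr_mul_chr_neg (w z : ℂ) : chr w z * chr w (-z) = 1 := by
  rw [← chr_add, add_neg_cancel, chr_zero]

lemma continuous_chr (w : ℂ) : Continuous (chr w) := by
  unfold chr; fun_prop

section Field

variable {K : Type*} [Field K] [NumberField K] [IsTotallyComplex K]
variable (σ : K →+* ℂ)
  [hdeg : Fact (Module.finrank ℚ K = 2)]

instance countable_integers : Countable (𝓞 K) :=
  (RingOfIntegers.basis K).equivFun.injective.countable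

lemma chr_dualFreq_emb (μ ν : 𝓞 K) : chr (dualFreq σ μ) (emb σ ν) = 1 := by
  obtain ⟨n, hn⟩ := exists_int_pairing σ μ ν
  rw [chr, hn]
  rw [show 2 * (Real.pi : ℂ) * I * ((n : ℝ) : ℂ) = n * (2 * Real.pi * I) by push_cast; ring]
  exact exp_int_mul_two_pi_mul_I n

lemma chr_dualFreq_add_emb (μ ν : 𝓞 K) (z : ℂ) :
    chr (dualFreq σ μ) (z + emb σ ν) = chr (dualFreq σ μ) z := by
  rw [chr_add, chr_dualFreq_emb, mul_one]

lemma chr_dualFreq_mul (μ ν : 𝓞 K) (z : ℂ) :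
    chr (dualFreq σ (μ * ν)) z = chr (dualFreq σ μ) (emb σ ν * z) := by
  unfold chr
  rw [conj_dualFreq, conj_dualFreq, map_mul]
  congr 4; ring

/-- Real coordinates with respect to the integral basis. -/
def par : (Idx K → ℝ) ≃L[ℝ] ℂ :=
  (latB σ).equivFunL.symm

lemma par_apply (x) : par σ x = ∑ i, (x i : ℂ) * emb σ (RingOfIntegers.basis K i) := by
  change (latB σ).equivFun.symm x = _
  simp [Module.Basis.equivFun_symm_apply, lat]

lemma par_intCast (n : Idx K → ℤ) :
    par σ (fun i => (n i : ℝ)) = emb σ (∑ i, n i • RingOfIntegers.basis K i) := by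
  rw [par_apply]
  simp [zsmul_eq_mul]

/-- The `μ`-th Fourier coefficient of a function on the plane which is periodic for the lattice
of integers. -/
def planeCoeff (F : ℂ → ℂ) (μ : 𝓞 K) : ℂ :=
  ∫ x in Set.Icc (0 : Idx K → ℝ) 1,
    F (par σ x) * chr (dualFreq σ μ) (-par σ x)

lemma fourierCoeff_eq (f : H3 → ℂ) (μ : 𝓞 K) (r : ℝ) (hr : 0 < r) : fourierCoeff σ f μ r hr =
    planeCoeff σ (fun z => f (mk z r hr)) μ := by
  simp only [fourierCoeff, planeCoeff, par_apply]

/-- Invariance under the lattice of integers. -/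
def Periodic (F : ℂ → ℂ) : Prop := ∀ (z : ℂ) (b : 𝓞 K), F (z + emb σ b) = F z

/-- The function on the torus induced by a function on the plane. -/
def torusLift (F : ℂ → ℂ) (t : UnitAddTorus (Idx K)) : ℂ :=
  F (par σ (fun i => (AddCircle.equivIoc 1 0 (t i)).1))

lemma torusLift_coe {σ : K →+* ℂ} {F : ℂ → ℂ} (hF : Periodic σ F)
    (x : Idx K → ℝ) :
    torusLift σ F (fun i => (x i : UnitAddCircle)) = F (par σ x) := by
  have h : ∀ i, ∃ n : ℤ, (AddCircle.equivIoc 1 0 (x i : UnitAddCircle)).1 = x i + n := by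
    intro i
    have h1 : (((AddCircle.equivIoc 1 0 (x i : UnitAddCircle)).1 : ℝ) : UnitAddCircle) = x i :=
      (AddCircle.equivIoc 1 0).symm_apply_apply (x i : UnitAddCircle)
    rw [eq_comm, ← sub_eq_zero, ← AddCircle.coe_sub, AddCircle.coe_eq_zero_iff] at h1
    obtain ⟨n, hn⟩ := h1
    refine ⟨-n, ?_⟩
    simp only [zsmul_eq_mul, mul_one] at hn
    push_cast; linarith
  choose n hn using h
  unfold torusLift
  have e : (fun i => (AddCircle.equivIoc 1 0 (x i : UnitAddCircle)).1)
      = x + fun i => (n i : ℝ) := by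
    funext i; rw [hn]; rfl
  rw [e, map_add, par_intCast, hF]

lemma continuous_torusLift {σ : K →+* ℂ} {F : ℂ → ℂ} (hF : Periodic σ F) (hc : Continuous F) :
    Continuous (torusLift σ F) := by
  have hq : IsOpenQuotientMap (Pi.map
      (fun (_ : Idx K) (x : ℝ) => (x : UnitAddCircle))) :=
    IsOpenQuotientMap.piMap fun _ => QuotientAddGroup.isOpenQuotientMap_mk
  rw [hq.isQuotientMap.continuous_iff]
  have : torusLift σ F ∘ (Pi.map
      (fun (_ : Idx K) (x : ℝ) => (x : UnitAddCircle)))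
      = fun x => F (par σ x) := by
    funext x; exact torusLift_coe hF x
  rw [this]
  exact hc.comp (par σ).continuous

lemma Icc_ae_eq {ι : Type*} [Fintype ι] :
    (Set.Icc (0 : ι → ℝ) 1) =ᵐ[volume] {x : ι → ℝ | ∀ i, x i ∈ Set.Ioc (0 : ℝ) (0 + 1)} := by
  have h := (Measure.univ_pi_Ioc_ae_eq_Icc (μ := fun _ : ι => (volume : Measure ℝ))
    (f := fun _ => (0 : ℝ)) (g := fun _ => 1)).symm
  have e : {x : ι → ℝ | ∀ i, x i ∈ Set.Ioc (0 : ℝ) (0 + 1)}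
      = Set.univ.pi fun _ => Set.Ioc (0 : ℝ) 1 := by
    ext x; simp
  rw [e]
  exact h

lemma mFourier_neg_dualInt (μ : 𝓞 K) (x) :
    UnitAddTorus.mFourier (-dualInt σ μ) (fun i => (x i : UnitAddCircle))
    = chr (dualFreq σ μ) (-par σ x) := by
  rw [UnitAddTorus.mFourier_neg, chr_neg]
  congr 1
  simp only [UnitAddTorus.mFourier, ContinuousMap.coe_mk, fourier_coe_apply, chr,
    ← Complex.exp_sum, par_apply, Finset.mul_sum, re_sum, ofReal_sum]
  refine congrArg _ (Finset.sum_congr rfl fun i _ => ?_)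
  have h := dualInt_spec σ μ i
  rw [← re_conj_dualFreq_mul] at h
  rw [show (conj (dualFreq σ μ) * ((x i : ℂ) * emb σ (RingOfIntegers.basis K i))).re
    = x i * (conj (dualFreq σ μ) * lat σ i).re by
      rw [← re_ofReal_mul, lat]; congr 1; ring, ← h]
  push_cast; ring

lemma planeCoeff_eq_mFourierCoeff {σ : K →+* ℂ} {F : ℂ → ℂ} (hF : Periodic σ F) (μ : 𝓞 K) :
    planeCoeff σ F μ = UnitAddTorus.mFourierCoeff (torusLift σ F) (dualInt σ μ) := by
  rw [UnitAddTorus.mFourierCoeff_eq_integral _ _ 0, planeCoeff]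
  rw [setIntegral_congr_set Icc_ae_eq]
  refine integral_congr_ae (.of_forall fun x => ?_)
  simp only [smul_eq_mul]
  rw [torusLift_coe hF, mFourier_neg_dualInt, mul_comm]

/-- The mean of a periodic function does not change under translations. -/
lemma integral_box_translate {σ : K →+* ℂ} {F : ℂ → ℂ} (hF : Periodic σ F) (w : ℂ) :
    ∫ x in Set.Icc (0 : Idx K → ℝ) 1, F (par σ x + w)
      = ∫ x in Set.Icc (0 : Idx K → ℝ) 1, F (par σ x) := by
  set a := (par σ).symm w
  have h := (UnitAddTorus.integral_preimage (torusLift σ F) a).symm.trans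
    (UnitAddTorus.integral_preimage (torusLift σ F) 0)
  simp only [torusLift_coe hF] at h
  rw [setIntegral_congr_set Icc_ae_eq, setIntegral_congr_set (f := fun x => F (par σ x)) Icc_ae_eq]
  simp only [Pi.zero_apply] at h
  rw [← h]
  have hmp : MeasurePreserving (fun x : Idx K → ℝ => x + a) :=
    measurePreserving_add_right volume a
  have hemb : MeasurableEmbedding
      (fun x : Idx K → ℝ => x + a) := measurableEmbedding_addRight a
  rw [← hmp.setIntegral_preimage_emb hemb (fun x => F (par σ x))]
  have e : par σ a = w := (par σ).apply_symm_apply w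
  simp only [map_add, e]
  congr 2
  ext x
  simp only [Set.mem_ofPred_eq, Set.mem_preimage, Set.mem_Ioc, Pi.add_apply]
  refine forall_congr' fun i => ?_
  constructor <;> rintro ⟨h1, h2⟩ <;> constructor <;> linarith

lemma periodic_chr (μ : 𝓞 K) : Periodic σ (chr (dualFreq σ μ)) :=
  fun z b => chr_dualFreq_add_emb σ μ b z

lemma volume_box {ι : Type*} [Fintype ι] : volume.real (Set.Icc (0 : ι → ℝ) 1) = 1 := by
  simp [Measure.real, Real.volume_Icc_pi]

lemma integral_box_chr (μ : 𝓞 K) [Decidable (μ = 0)] : ∫ x in Set.Icc (0 : Idx K → ℝ) 1, chr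
    (dualFreq σ μ) (par σ x) = if μ = 0 then 1 else 0 := by
  split_ifs with h
  · subst h
    simp [dualFreq_zero, volume_box]
  · have hd : conj (dualFreq σ μ) ≠ 0 := by
      rw [conj_dualFreq]
      have h1 := (sqrtDisc_pos K).ne'
      have h2 := emb_ne_zero σ h
      simp [h1, h2]
    have h1 := integral_box_translate (periodic_chr σ μ) (1 / 2 / conj (dualFreq σ μ))
    have h2 : chr (dualFreq σ μ) (1 / 2 / conj (dualFreq σ μ)) = -1 := by
      rw [chr, mul_div_cancel₀ _ hd]
      rw [show 2 * (Real.pi : ℂ) * I * (((1 / 2 : ℂ).re : ℝ) : ℂ) = Real.pi * I by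
        norm_num; ring]
      exact exp_pi_mul_I
    simp only [chr_add, h2, mul_neg, mul_one] at h1
    rw [integral_neg] at h1
    exact self_eq_neg.1 h1.symm

/-- Fourier coefficients of an absolutely convergent Fourier series. -/
lemma planeCoeff_tsum {σ : K →+* ℂ} {a : 𝓞 K → ℂ} (ha : Summable a) {F : ℂ → ℂ}
    (hF : ∀ z, F z = ∑' ν, a ν * chr (dualFreq σ ν) z) (μ : 𝓞 K) : planeCoeff σ F μ = a μ := by
  classical
  unfold planeCoeff
  have h1 : ∀ x, F (par σ x) * chr (dualFreq σ μ) (-par σ x)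
      = ∑' ν, a ν * chr (dualFreq σ (ν - μ)) (par σ x) := by
    intro x
    rw [hF, ← tsum_mul_right]
    refine tsum_congr fun ν => ?_
    rw [sub_eq_add_neg, dualFreq_add, dualFreq_neg, chr_add_left, chr_neg_left, chr_neg]
    ring
  simp only [h1]
  have hfin : volume (Set.Icc (0 : Idx K → ℝ) 1) ≠ ⊤ := by
    simp [Real.volume_Icc_pi]
  have hnorm : ∀ ν x, ‖a ν * chr (dualFreq σ (ν - μ)) (par σ x)‖ = ‖a ν‖ := by
    intro ν x; rw [norm_mul, norm_chr, mul_one]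
  rw [← integral_tsum_of_summable_integral_norm]
  · simp only [integral_const_mul, integral_box_chr, sub_eq_zero]
    simp
  · intro ν
    refine Integrable.mono' (g := fun _ => ‖a ν‖) (integrableOn_const hfin) ?_ ?_
    · exact ((continuous_const.mul ((continuous_chr _).comp (par σ).continuous))).aestronglyMeasurable
    · exact .of_forall fun x => (hnorm ν x).le
  · simp only [hnorm, integral_const, Measure.real, Measure.restrict_apply_univ]
    simpa [Real.volume_Icc_pi] using ha.norm

/-- Pointwise Fourier inversion. -/
lemma hasSum_planeCoeff {σ : K →+* ℂ} {F : ℂ → ℂ} (hF : Periodic σ F) (hc : Continuous F)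
    (hs : Summable (planeCoeff σ F)) (z : ℂ) :
    HasSum (fun μ => planeCoeff σ F μ * chr (dualFreq σ μ) z) (F z) := by
  set e := Equiv.ofBijective _ (dualInt_bijective σ)
  set f : C(UnitAddTorus (Idx K), ℂ) :=
    ⟨torusLift σ F, continuous_torusLift hF hc⟩
  have h0 : ∀ μ, UnitAddTorus.mFourierCoeff f (e μ) = planeCoeff σ F μ := fun μ =>
    (planeCoeff_eq_mFourierCoeff hF μ).symm
  have h1 : Summable (UnitAddTorus.mFourierCoeff f) := by
    rw [← e.summable_iff]
    exact hs.congr fun μ => (h0 μ).symm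
  set x := (par σ).symm z
  have hx : par σ x = z := (par σ).apply_symm_apply z
  have h2 := UnitAddTorus.hasSum_mFourier_series_apply_of_summable h1
    (fun i => (x i : UnitAddCircle))
  rw [← e.hasSum_iff] at h2
  have h3 : f (fun i => (x i : UnitAddCircle)) = F z := by
    rw [← hx]; exact torusLift_coe hF x
  rw [h3] at h2
  convert h2 using 2 with μ
  simp only [Function.comp_apply, smul_eq_mul]
  rw [h0]
  congr 1
  have h4 := mFourier_neg_dualInt σ μ x
  rw [UnitAddTorus.mFourier_neg, chr_neg, hx] at h4
  exact ((starRingEnd ℂ).injective h4).symm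

/-! ### Lattice sums and integrals over the plane -/

/-- A period parallelogram. -/
def cell : Set ℂ := ZSpan.fundamentalDomain (latB σ)

lemma measurableSet_cell : MeasurableSet (cell σ) :=
  ZSpan.fundamentalDomain_measurableSet _

lemma mem_cell_iff (z : ℂ) : z ∈ cell σ ↔ ∀ i, (par σ).symm z i ∈ Set.Ico (0 : ℝ) 1 := Iff.rfl

lemma exists_norm_le_of_mem_cell : ∃ R : ℝ, 0 < R ∧ ∀ z ∈ cell σ, ‖z‖ ≤ R := by
  obtain ⟨R, hR⟩ := (ZSpan.fundamentalDomain_isBounded (latB σ)).exists_norm_le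
  exact ⟨max R 1, by positivity, fun z hz => (hR z hz).trans (le_max_left _ _)⟩

lemma emb_mem_span (μ : 𝓞 K) : emb σ μ ∈ Submodule.span ℤ (Set.range (latB σ)) := by
  rw [emb_eq_sum]
  refine Submodule.sum_mem _ fun i _ => ?_
  rw [← zsmul_eq_mul]
  exact Submodule.smul_mem _ _ (Submodule.subset_span ⟨i, latB_apply σ i⟩)

lemma exists_emb_of_mem_span {z : ℂ} (hz : z ∈ Submodule.span ℤ (Set.range (latB σ))) : ∃ b : 𝓞 K,
    emb σ b = z := by
  induction hz using Submodule.span_induction with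
  | mem x hx => obtain ⟨i, rfl⟩ := hx; exact ⟨RingOfIntegers.basis K i, (latB_apply σ i).symm⟩
  | zero => exact ⟨0, map_zero _⟩
  | add x y _ _ hx hy =>
    obtain ⟨a, rfl⟩ := hx; obtain ⟨b, rfl⟩ := hy
    exact ⟨a + b, map_add _ _ _⟩
  | smul n x _ hx => obtain ⟨a, rfl⟩ := hx; exact ⟨n • a, map_zsmul _ _ _⟩

/-- The ring of integers as a lattice in the plane. -/
def latEquiv : 𝓞 K ≃ Submodule.span ℤ (Set.range (latB σ)) :=
  Equiv.ofBijective (fun μ => ⟨emb σ μ, emb_mem_span σ μ⟩)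
    ⟨fun _ _ h => emb_injective σ (congrArg Subtype.val h), fun z => by
      obtain ⟨b, hb⟩ := exists_emb_of_mem_span σ z.2
      exact ⟨b, Subtype.ext hb⟩⟩

lemma existsUnique_add_mem_cell (z : ℂ) : ∃! b : 𝓞 K, z + emb σ b ∈ cell σ := by
  obtain ⟨v, hv, huniq⟩ := ZSpan.exist_unique_vadd_mem_fundamentalDomain (latB σ) z
  refine ⟨(latEquiv σ).symm v, ?_, ?_⟩
  · have h : emb σ ((latEquiv σ).symm v) = v :=
      congrArg Subtype.val ((latEquiv σ).apply_symm_apply v)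
    beta_reduce
    rw [h, add_comm]
    exact hv
  · intro b hb
    rw [Equiv.eq_symm_apply]
    apply huniq
    change emb σ b + z ∈ _
    rw [add_comm]
    exact hb

lemma volume_cell : volume (cell σ) = ENNReal.ofReal (sqrtDisc K / 2) := by
  have h := ZSpan.measure_fundamentalDomain (latB σ) volume
    ((Complex.orthonormalBasisOneI.reindex (idx K)).toBasis)
  have h1 : volume (ZSpan.fundamentalDomain
      ((Complex.orthonormalBasisOneI.reindex (idx K)).toBasis)) = 1 := by
    rw [measure_congr (ZSpan.fundamentalDomain_ae_parallelepiped _ volume)]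
    exact (Complex.orthonormalBasisOneI.reindex (idx K)).volume_parallelepiped
  rw [h1, mul_one] at h
  rw [cell, h, sqrtDisc_eq σ, mul_div_cancel_left₀ _ two_ne_zero]
  congr 1
  rw [Module.Basis.det_apply, ← Matrix.det_reindex_self (idx K).symm, Matrix.det_fin_two]
  simp only [Matrix.reindex_apply, Matrix.submatrix_apply, Module.Basis.toMatrix_apply,
    Equiv.symm_symm, latB_apply, area]
  simp [mul_im]
  rw [← abs_neg]
  congr 1
  ring

lemma preimage_par_cell : par σ ⁻¹' cell σ = Set.univ.pi fun _ => Set.Ico (0 : ℝ) 1 := by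
  ext x
  rw [Set.mem_preimage, mem_cell_iff, (par σ).symm_apply_apply]
  simp

lemma volume_eq_map_par :
    (volume : Measure ℂ) = ENNReal.ofReal (sqrtDisc K / 2) • Measure.map (par σ) volume := by
  have h := Measure.isAddLeftInvariant_eq_smul (volume : Measure ℂ) (Measure.map (par σ) volume)
  have h1 : Measure.map (par σ) volume (cell σ) = 1 := by
    rw [Measure.map_apply (par σ).continuous.measurable (measurableSet_cell σ),
      preimage_par_cell, Real.volume_pi_Ico]
    simp
  have h2 := congrArg (fun m => m (cell σ)) h
  simp only [Measure.smul_apply, h1, volume_cell] at h2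
  rw [h2]
  conv_lhs => rw [h]
  rw [show ∀ c : NNReal, c • (1 : ENNReal) = c from fun c => by
    rw [ENNReal.smul_def, smul_eq_mul, mul_one]]
  rfl

lemma integral_cell (F : ℂ → ℂ) : ∫ z in cell σ, F z = ((sqrtDisc K / 2 : ℝ) : ℂ) * ∫ x in Set.Icc
    (0 : Idx K → ℝ) 1, F (par σ x) := by
  have hs := sqrtDisc_pos K
  rw [volume_eq_map_par σ, Measure.restrict_smul, integral_smul_measure,
    ENNReal.toReal_ofReal (by positivity), real_smul]
  congr 1
  have hemb : MeasurableEmbedding (par σ) := (par σ).toHomeomorph.measurableEmbedding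
  rw [hemb.setIntegral_map]
  rw [preimage_par_cell]
  exact setIntegral_congr_set (Measure.univ_pi_Ico_ae_eq_Icc (μ := fun _ => (volume : Measure ℝ)))

/-- Unfolding a sum over the lattice. -/
lemma integral_cell_tsum {σ : K →+* ℂ} {h : ℂ → ℂ} (hh : Integrable h) :
    ∫ z in cell σ, ∑' d : 𝓞 K, h (z + emb σ d) = ∫ z, h z := by
  have hfd := ZSpan.isAddFundamentalDomain (latB σ) volume
  have : VAddInvariantMeasure (Submodule.span ℤ (Set.range (latB σ))) ℂ volume :=
    ⟨fun c s _ => measure_preimage_add volume (c : ℂ) s⟩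
  have hint : ∀ d : 𝓞 K, Integrable (fun z => h (z + emb σ d)) (volume.restrict (cell σ)) :=
    fun d => (hh.comp_add_right _).restrict
  have hl : ∑' d : 𝓞 K, ∫⁻ z in cell σ, ‖h (z + emb σ d)‖ₑ = ∫⁻ z, ‖h z‖ₑ := by
    rw [hfd.lintegral_eq_tsum'', ← (latEquiv σ).tsum_eq]
    refine tsum_congr fun d => lintegral_congr fun z => ?_
    rw [add_comm]; rfl
  have hfin : ∑' d : 𝓞 K, ∫⁻ z in cell σ, ‖h (z + emb σ d)‖ₑ ≠ ⊤ := by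
    rw [hl]; exact hh.2.ne
  have hsum : Summable fun d : 𝓞 K => ∫ z in cell σ, ‖h (z + emb σ d)‖ := by
    have := ENNReal.summable_toReal hfin
    refine this.congr fun d => ?_
    rw [integral_norm_eq_lintegral_enorm (hint d).1]
  rw [← integral_tsum_of_summable_integral_norm hint hsum, hfd.integral_eq_tsum'' h hh,
    ← (latEquiv σ).tsum_eq]
  refine tsum_congr fun d => integral_congr_ae (.of_forall fun z => ?_)
  change h (z + emb σ d) = h (emb σ d + z)
  rw [add_comm]

variable (K) in
/-- The real number `2 π / sqrt |d_K|`. -/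
def condR : ℝ := 2 * Real.pi / sqrtDisc K

variable (K) in
lemma condR_pos : 0 < condR K := by
  have := sqrtDisc_pos K
  unfold condR; positivity

lemma exp_neg_le_rpow {t : ℝ} (ht : 0 ≤ t) : Real.exp (-t) ≤ 4 * (1 + t) ^ (-2 : ℝ) := by
  rw [Real.exp_neg, Real.rpow_neg (by linarith), ← div_eq_mul_inv, inv_le_comm₀ (Real.exp_pos _)
    (by positivity), inv_div, Real.rpow_two]
  have h := Real.add_one_le_exp (t / 2)
  have h2 : Real.exp t = Real.exp (t / 2) ^ 2 := by rw [← Real.exp_nat_mul]; congr 1; push_cast; ring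
  nlinarith

/-- A locally uniform bound for the terms of a shifted theta series. -/
lemma exists_gaussian_bound {a R : ℝ} (ha : 0 < a) : ∃ C : ℝ, ∀ (w : ℂ) (d : 𝓞 K), ‖w‖ ≤ R →
    Real.exp (-a * ‖w + emb σ d‖ ^ 2) ≤ C * (1 + ‖emb σ d‖ ^ 2) ^ (-2 : ℝ) := by
  set m := min (a / 2) 1
  have hm : 0 < m := by positivity
  refine ⟨Real.exp (a * R ^ 2) * (4 * m ^ (-2 : ℝ)), fun w d hw => ?_⟩
  have h1 : ‖emb σ d‖ ^ 2 ≤ 2 * ‖w + emb σ d‖ ^ 2 + 2 * R ^ 2 := by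
    have h2 : ‖emb σ d‖ ≤ ‖w + emb σ d‖ + ‖w‖ := by
      have := norm_sub_le (w + emb σ d) w
      rwa [add_sub_cancel_left] at this
    nlinarith [norm_nonneg (emb σ d), norm_nonneg w, norm_nonneg (w + emb σ d),
      sq_nonneg (‖w + emb σ d‖ - ‖w‖)]
  have hx : (0 : ℝ) ≤ ‖emb σ d‖ ^ 2 := by positivity
  set x := ‖emb σ d‖ ^ 2
  calc Real.exp (-a * ‖w + emb σ d‖ ^ 2) ≤ Real.exp (a * R ^ 2 + -(a / 2 * x)) := by
        apply Real.exp_le_exp.2; nlinarith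
    _ = Real.exp (a * R ^ 2) * Real.exp (-(a / 2 * x)) := Real.exp_add _ _
    _ ≤ Real.exp (a * R ^ 2) * (4 * (1 + a / 2 * x) ^ (-2 : ℝ)) := by
        gcongr; exact exp_neg_le_rpow (by positivity)
    _ ≤ Real.exp (a * R ^ 2) * (4 * (m * (1 + x)) ^ (-2 : ℝ)) := by
        have h5 : m ≤ a / 2 := min_le_left _ _
        have h6 : m ≤ 1 := min_le_right _ _
        have h7 : (1 + a / 2 * x) ^ (-2 : ℝ) ≤ (m * (1 + x)) ^ (-2 : ℝ) :=
          Real.rpow_le_rpow_of_nonpos (by positivity) (by nlinarith) (by norm_num)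
        gcongr
    _ = _ := by rw [Real.mul_rpow hm.le (by positivity)]; ring

lemma summable_exp_norm {a : ℝ} (ha : 0 < a) (w : ℂ) :
    Summable fun d : 𝓞 K => Real.exp (-a * ‖w + emb σ d‖ ^ 2) := by
  obtain ⟨C, hC⟩ := exists_gaussian_bound σ (R := ‖w‖) ha
  exact Summable.of_nonneg_of_le (fun _ => (Real.exp_pos _).le) (fun d => hC w d le_rfl)
    ((summable_one_add_rpow σ (by norm_num)).mul_left C)

/-- **Poisson summation** for Gaussians on the lattice of integers. -/
theorem poisson {y : ℝ} (hy : 0 < y) (w : ℂ) :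
    ∑' d : 𝓞 K, (Real.exp (-(condR K * y) * ‖w + emb σ d‖ ^ 2) : ℂ) = (y : ℂ)⁻¹ * ∑' ν : 𝓞 K,
    (Real.exp (-(condR K / y) * ‖emb σ ν‖ ^ 2) : ℂ) * chr (dualFreq σ ν) w := by
  have hs := sqrtDisc_pos K
  have hc := condR_pos K
  have hcy : 0 < condR K * y := by positivity
  set F : ℂ → ℂ := fun w => ∑' d : 𝓞 K, (Real.exp (-(condR K * y) * ‖w + emb σ d‖ ^ 2) : ℂ) with hF
  have hper : Periodic σ F := by
    intro z b
    simp only [hF]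
    rw [← (Equiv.addLeft b).tsum_eq (fun d => (Real.exp (-(condR K * y) * ‖z + emb σ d‖ ^ 2) : ℂ))]
    refine tsum_congr fun d => ?_
    simp [add_assoc]
  have hcont : Continuous F := by
    rw [continuous_iff_continuousAt]
    intro w₀
    obtain ⟨C, hC⟩ := exists_gaussian_bound σ (R := ‖w₀‖ + 1) hcy
    have h1 : ContinuousOn F (Metric.ball 0 (‖w₀‖ + 1)) := by
      apply continuousOn_tsum (u := fun d : 𝓞 K => C * (1 + ‖emb σ d‖ ^ 2) ^ (-2 : ℝ))
      · fun_prop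
      · exact (summable_one_add_rpow σ (by norm_num)).mul_left C
      · intro d x hx
        rw [norm_real, Real.norm_of_nonneg (Real.exp_pos _).le]
        exact hC x d (mem_ball_zero_iff.1 hx).le
    exact h1.continuousAt (Metric.isOpen_ball.mem_nhds (by simp))
  have hcoef : ∀ μ, planeCoeff σ F μ
      = (y : ℂ)⁻¹ * (Real.exp (-(condR K / y) * ‖emb σ μ‖ ^ 2) : ℂ) := by
    intro μ
    set h : ℂ → ℂ := fun z =>
      Complex.exp (-((condR K * y : ℝ) : ℂ) * ‖z‖ ^ 2 + (-2 * Real.pi * I) * (inner ℝ (dualFreq σ μ) z : ℝ))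
    have hre : 0 < (((condR K * y : ℝ) : ℂ)).re := by simpa using hcy
    have hint : Integrable h := GaussianFourier.integrable_cexp_neg_mul_sq_norm_add hre _ _
    have hval := GaussianFourier.integral_cexp_neg_mul_sq_norm_add hre (-2 * Real.pi * I)
      (dualFreq σ μ)
    have hh : ∀ z, h z = (Real.exp (-(condR K * y) * ‖z‖ ^ 2) : ℂ) * chr (dualFreq σ μ) (-z) := by
      intro z
      simp only [h, chr, ofReal_exp, ← Complex.exp_add]
      congr 1
      rw [Complex.inner, mul_neg, neg_re]
      push_cast; ring_nf
    have h1 := integral_cell_tsum (σ := σ) hint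
    have h2 : ∀ z, ∑' d : 𝓞 K, h (z + emb σ d) = F z * chr (dualFreq σ μ) (-z) := by
      intro z
      rw [← tsum_mul_right]
      refine tsum_congr fun d => ?_
      rw [hh, chr_neg, chr_dualFreq_add_emb, chr_neg]
    simp only [h2] at h1
    rw [integral_cell σ (fun z => F z * chr (dualFreq σ μ) (-z)), hval] at h1
    have hs' : ((sqrtDisc K / 2 : ℝ) : ℂ) ≠ 0 := by
      exact_mod_cast (by positivity : sqrtDisc K / 2 ≠ 0)
    unfold planeCoeff
    apply mul_left_cancel₀ hs'
    rw [h1, Complex.finrank_real_complex, norm_dualFreq]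
    rw [show ((2 : ℕ) / 2 : ℂ) = 1 by norm_num, cpow_one, ofReal_exp, ← mul_assoc]
    congr 1
    · simp only [condR]; push_cast; field_simp
    · congr 1
      simp only [condR]; push_cast; field_simp
      rw [I_sq]; ring_nf
  have hsummable : Summable (planeCoeff σ F) := by
    have h1 := summable_exp_norm σ (a := condR K / y) (by positivity) 0
    simp only [zero_add] at h1
    have h2 := (Complex.ofRealCLM.summable h1).mul_left (y : ℂ)⁻¹
    exact h2.congr fun μ => (hcoef μ).symm
  have h3 := (hasSum_planeCoeff hper hcont hsummable w).tsum_eq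
  simp only [hcoef, mul_assoc] at h3
  rw [tsum_mul_left] at h3
  exact h3.symm

end Field

/-! ### The Bessel function -/

open Filter Topology Set

lemma quarter_sq_le_cosh (u : ℝ) : u ^ 2 / 4 ≤ Real.cosh u := by
  have h : ∀ v : ℝ, 0 ≤ v → v ^ 2 / 4 ≤ Real.cosh v := by
    intro v hv
    have h1 := Real.quadratic_le_exp_of_nonneg hv
    have h2 := Real.add_one_le_exp (-v)
    rw [Real.cosh_eq]; linarith
  rw [← sq_abs, ← Real.cosh_abs]
  exact h _ (abs_nonneg u)

lemma cosh_le_exp_abs (u : ℝ) : Real.cosh u ≤ Real.exp |u| := by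
  rw [Real.cosh_eq]
  have h1 := Real.exp_le_exp.2 (le_abs_self u)
  have h2 := Real.exp_le_exp.2 (neg_le_abs u)
  linarith

lemma norm_cosh_le (ν : ℂ) (u : ℝ) :
    ‖Complex.cosh (ν * u)‖ ≤ Real.exp (|ν.re| * |u|) := by
  have h : ∀ z : ℂ, ‖Complex.cosh z‖ ≤ Real.exp |z.re| := by
    intro z
    rw [Complex.cosh]
    have h1 : ‖Complex.exp z‖ ≤ Real.exp |z.re| := by
      rw [norm_exp]; exact Real.exp_le_exp.2 (le_abs_self _)
    have h2 : ‖Complex.exp (-z)‖ ≤ Real.exp |z.re| := by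
      rw [norm_exp]; exact Real.exp_le_exp.2 (neg_le_abs _)
    rw [norm_div]
    have := norm_add_le (Complex.exp z) (Complex.exp (-z))
    simp only [Complex.norm_ofNat]
    linarith
  refine (h _).trans (le_of_eq ?_)
  rw [re_mul_ofReal, abs_mul]

lemma norm_sinh_le (ν : ℂ) (u : ℝ) :
    ‖Complex.sinh (ν * u)‖ ≤ Real.exp (|ν.re| * |u|) := by
  have h : ∀ z : ℂ, ‖Complex.sinh z‖ ≤ Real.exp |z.re| := by
    intro z
    rw [Complex.sinh]
    have h1 : ‖Complex.exp z‖ ≤ Real.exp |z.re| := by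
      rw [norm_exp]; exact Real.exp_le_exp.2 (le_abs_self _)
    have h2 : ‖Complex.exp (-z)‖ ≤ Real.exp |z.re| := by
      rw [norm_exp]; exact Real.exp_le_exp.2 (neg_le_abs _)
    rw [norm_div]
    have := norm_sub_le (Complex.exp z) (Complex.exp (-z))
    simp only [Complex.norm_ofNat]
    linarith
  refine (h _).trans (le_of_eq ?_)
  rw [re_mul_ofReal, abs_mul]

lemma exp_cosh_le {x : ℝ} (hx : 0 < x) (A u : ℝ) :
    Real.exp (-x * Real.cosh u + A * |u|)
      ≤ Real.exp (2 * A ^ 2 / x) * Real.exp (-(x / 8) * u ^ 2) := by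
  rw [← Real.exp_add]
  apply Real.exp_le_exp.2
  have h1 := quarter_sq_le_cosh u
  have h2 : A * |u| ≤ 2 * A ^ 2 / x + x / 8 * u ^ 2 := by
    rw [div_add' _ _ _ hx.ne', le_div_iff₀ hx, ← sq_abs u]
    nlinarith [sq_nonneg (4 * A - x * |u|)]
  nlinarith

lemma integrable_exp_cosh {x : ℝ} (hx : 0 < x) (A : ℝ) :
    Integrable fun u : ℝ => Real.exp (-x * Real.cosh u + A * |u|) := by
  refine Integrable.mono' ((integrable_exp_neg_mul_sq (b := x / 8) (by positivity)).const_mul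
    (Real.exp (2 * A ^ 2 / x))) ?_ ?_
  · fun_prop
  · refine .of_forall fun u => ?_
    rw [Real.norm_of_nonneg (Real.exp_pos _).le]
    exact exp_cosh_le hx A u

/-- A majorant of the Bessel functions whose order has real part at most `A`. -/
def besselBound (A x : ℝ) : ℝ := ∫ u in Ioi (0 : ℝ), Real.exp (-x * Real.cosh u + A * |u|)

lemma besselBound_nonneg (A x : ℝ) : 0 ≤ besselBound A x :=
  integral_nonneg fun _ => (Real.exp_pos _).le

lemma besselBound_le {A x₀ x : ℝ} (h0 : 0 < x₀) (h : x₀ ≤ x) :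
    besselBound A x ≤ Real.exp (-(x - x₀)) * besselBound A x₀ := by
  unfold besselBound
  rw [← integral_const_mul]
  refine integral_mono (integrable_exp_cosh (h0.trans_le h) A).restrict
    ((integrable_exp_cosh h0 A).restrict.const_mul _) fun u => ?_
  rw [← Real.exp_add]
  apply Real.exp_le_exp.2
  nlinarith [Real.one_le_cosh u]

/-- The integrals `∫ cosh(u)^k e^{-x cosh u} cosh(ν u) du`, that is, the `k`-th derivative of the
Bessel function up to sign. -/
def besselDer (k : ℕ) (ν : ℂ) (x : ℝ) : ℂ :=
  ∫ u in Ioi (0 : ℝ), ((Real.cosh u ^ k * Real.exp (-x * Real.cosh u) : ℝ) : ℂ)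
    * Complex.cosh (ν * u)

lemma besselK_eq_besselDer (ν : ℂ) (x : ℝ) : besselK ν x = besselDer 0 ν x := by
  simp [besselK, besselDer]

lemma norm_besselDer_integrand_le (k : ℕ) (ν : ℂ) (x u : ℝ) :
    ‖((Real.cosh u ^ k * Real.exp (-x * Real.cosh u) : ℝ) : ℂ) * Complex.cosh (ν * u)‖
      ≤ Real.exp (-x * Real.cosh u + (k + |ν.re|) * |u|) := by
  rw [norm_mul, norm_real, Real.norm_of_nonneg (by positivity)]
  have h1 : Real.cosh u ^ k ≤ Real.exp (k * |u|) := by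
    rw [Real.exp_nat_mul]
    exact pow_le_pow_left₀ (Real.cosh_pos u).le (cosh_le_exp_abs u) k
  calc _ ≤ Real.exp (k * |u|) * Real.exp (-x * Real.cosh u) * Real.exp (|ν.re| * |u|) := by
        gcongr
        exact norm_cosh_le ν u
    _ = _ := by rw [← Real.exp_add, ← Real.exp_add]; congr 1; ring

lemma integrable_besselDer (k : ℕ) (ν : ℂ) {x : ℝ} (hx : 0 < x) :
    Integrable fun u : ℝ => ((Real.cosh u ^ k * Real.exp (-x * Real.cosh u) : ℝ) : ℂ)
      * Complex.cosh (ν * u) := by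
  refine Integrable.mono' (integrable_exp_cosh hx (k + |ν.re|)) ?_ ?_
  · fun_prop
  · exact .of_forall fun u => norm_besselDer_integrand_le k ν x u

lemma norm_besselDer_le (k : ℕ) (ν : ℂ) {x : ℝ} (hx : 0 < x) :
    ‖besselDer k ν x‖ ≤ besselBound (k + |ν.re|) x :=
  norm_integral_le_of_norm_le (integrable_exp_cosh hx _).restrict
    (.of_forall fun u => norm_besselDer_integrand_le k ν x u)

lemma norm_besselK_le (ν : ℂ) {x : ℝ} (hx : 0 < x) : ‖besselK ν x‖ ≤ besselBound |ν.re| x := by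
  rw [besselK_eq_besselDer]
  simpa using norm_besselDer_le 0 ν hx

lemma hasDerivAt_besselDer (k : ℕ) (ν : ℂ) {x : ℝ} (hx : 0 < x) :
    HasDerivAt (besselDer k ν) (-besselDer (k + 1) ν x) x := by
  have h := hasDerivAt_integral_of_dominated_loc_of_deriv_le (μ := volume.restrict (Ioi (0 : ℝ)))
    (F := fun x u => ((Real.cosh u ^ k * Real.exp (-x * Real.cosh u) : ℝ) : ℂ)
      * Complex.cosh (ν * u))
    (F' := fun x u => -(((Real.cosh u ^ (k + 1) * Real.exp (-x * Real.cosh u) : ℝ) : ℂ)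
      * Complex.cosh (ν * u))) (x₀ := x) (s := Ioi (x / 2))
    (bound := fun u => Real.exp (-(x / 2) * Real.cosh u + ((k + 1 : ℕ) + |ν.re|) * |u|))
    (Ioi_mem_nhds (by linarith)) ?_ (integrable_besselDer k ν hx).restrict ?_ ?_ ?_ ?_
  · have h2 := h.2
    rw [integral_neg] at h2
    exact h2
  · exact .of_forall fun y => Continuous.aestronglyMeasurable (by fun_prop)
  · exact Continuous.aestronglyMeasurable (by fun_prop)
  · refine .of_forall fun u y hy => ?_
    rw [norm_neg]
    refine (norm_besselDer_integrand_le (k + 1) ν y u).trans (Real.exp_le_exp.2 ?_)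
    have := Real.one_le_cosh u
    have hy' : x / 2 < y := hy
    nlinarith
  · exact (integrable_exp_cosh (by positivity) _).restrict
  · refine .of_forall fun u y _ => ?_
    have h1 : HasDerivAt (fun y : ℝ => Real.cosh u ^ k * Real.exp (-y * Real.cosh u))
        (-(Real.cosh u ^ (k + 1) * Real.exp (-y * Real.cosh u))) y := by
      have h3 : HasDerivAt (fun y : ℝ => -y * Real.cosh u) (-1 * Real.cosh u) y :=
        (hasDerivAt_id y).neg.mul_const _
      have h4 := (h3.exp).const_mul (Real.cosh u ^ k)
      exact h4.congr_deriv (by ring)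
    have h2 := (h1.ofReal_comp).mul_const (Complex.cosh (ν * u))
    exact h2.congr_deriv (by push_cast; ring)

lemma tendsto_exp_cosh {x : ℝ} (hx : 0 < x) (A : ℝ) :
    Tendsto (fun u : ℝ => Real.exp (-x * Real.cosh u + A * |u|)) atTop (𝓝 0) := by
  have h1 : Tendsto (fun u : ℝ => Real.exp (-(x / 8) * u ^ 2)) atTop (𝓝 0) := by
    apply Real.tendsto_exp_atBot.comp
    apply Tendsto.const_mul_atTop_of_neg (by linarith)
    exact tendsto_pow_atTop two_ne_zero
  have h2 := h1.const_mul (Real.exp (2 * A ^ 2 / x))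
  rw [mul_zero] at h2
  exact squeeze_zero (fun u => (Real.exp_pos _).le) (fun u => exp_cosh_le hx A u) h2

/-- The modified Bessel equation. -/
lemma bessel_equation (ν : ℂ) {x : ℝ} (hx : 0 < x) :
    (x : ℂ) ^ 2 * besselDer 2 ν x - x * besselDer 1 ν x
      - ((x : ℂ) ^ 2 + ν ^ 2) * besselDer 0 ν x = 0 := by
  set E : ℝ → ℂ := fun u => ((Real.exp (-x * Real.cosh u) : ℝ) : ℂ)
  set G : ℝ → ℂ := fun u => -x * (Real.sinh u : ℂ) * E u * Complex.cosh (ν * u)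
    - ν * E u * Complex.sinh (ν * u)
  have hE : ∀ u, HasDerivAt E (-x * (Real.sinh u : ℂ) * E u) u := by
    intro u
    have h3 : HasDerivAt (fun u : ℝ => -x * Real.cosh u) (-x * Real.sinh u) u :=
      (Real.hasDerivAt_cosh u).const_mul _
    have h4 := h3.exp.ofReal_comp
    exact h4.congr_deriv (by simp only [E]; push_cast; ring)
  have hnu : ∀ u : ℝ, HasDerivAt (fun u : ℝ => ν * (u : ℂ)) ν u := by
    intro u
    simpa using (Complex.ofRealCLM.hasDerivAt (x := u)).const_mul ν
  have hcosh : ∀ u : ℝ, HasDerivAt (fun u : ℝ => Complex.cosh (ν * u))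
      (Complex.sinh (ν * u) * ν) u := fun u =>
    (Complex.hasDerivAt_cosh _).comp u (hnu u)
  have hsinh : ∀ u : ℝ, HasDerivAt (fun u : ℝ => Complex.sinh (ν * u))
      (Complex.cosh (ν * u) * ν) u := fun u =>
    (Complex.hasDerivAt_sinh _).comp u (hnu u)
  have hs : ∀ u : ℝ, HasDerivAt (fun u : ℝ => (Real.sinh u : ℂ)) (Real.cosh u : ℂ) u :=
    fun u => (Real.hasDerivAt_sinh u).ofReal_comp
  set D : ℝ → ℂ := fun u =>
    (x : ℂ) ^ 2 * (((Real.cosh u ^ 2 * Real.exp (-x * Real.cosh u) : ℝ) : ℂ) * Complex.cosh (ν * u))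
    - x * (((Real.cosh u ^ 1 * Real.exp (-x * Real.cosh u) : ℝ) : ℂ) * Complex.cosh (ν * u))
    - ((x : ℂ) ^ 2 + ν ^ 2)
      * (((Real.cosh u ^ 0 * Real.exp (-x * Real.cosh u) : ℝ) : ℂ) * Complex.cosh (ν * u))
  have hG : ∀ u, HasDerivAt G (D u) u := by
    intro u
    have h1 := ((((hs u).const_mul (-x : ℂ)).mul (hE u)).mul (hcosh u)).sub
      (((hE u).const_mul ν).mul (hsinh u))
    refine h1.congr_deriv ?_
    have h2 : (Real.cosh u : ℂ) ^ 2 = (Real.sinh u : ℂ) ^ 2 + 1 := by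
      exact_mod_cast Real.cosh_sq u
    simp only [D, E, Pi.mul_apply]
    push_cast at h2 ⊢
    linear_combination -((x : ℂ) ^ 2 * Complex.exp (-x * Complex.cosh u) * Complex.cosh (ν * u)) * h2
  have hint : IntegrableOn D (Ioi 0) :=
    ((((integrable_besselDer 2 ν hx).const_mul _).sub
      ((integrable_besselDer 1 ν hx).const_mul _)).sub
      ((integrable_besselDer 0 ν hx).const_mul _)).integrableOn
  have hlim : Tendsto G atTop (𝓝 0) := by
    have hb : ∀ u, ‖G u‖ ≤ (x + ‖ν‖) * Real.exp (-x * Real.cosh u + (1 + |ν.re|) * |u|) := by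
      intro u
      have e1 : ‖E u‖ = Real.exp (-x * Real.cosh u) := by
        simp only [E, norm_real]; exact Real.norm_of_nonneg (Real.exp_pos _).le
      have e2 : |Real.sinh u| ≤ Real.exp |u| := by
        have h1 := Real.exp_le_exp.2 (le_abs_self u)
        have h2 := Real.exp_le_exp.2 (neg_le_abs u)
        have h3 := Real.exp_pos u
        have h4 := Real.exp_pos (-u)
        rw [Real.sinh_eq, abs_le]
        constructor <;> linarith
      have e3 : Real.exp (-x * Real.cosh u + (1 + |ν.re|) * |u|)
          = Real.exp |u| * Real.exp (-x * Real.cosh u) * Real.exp (|ν.re| * |u|) := by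
        rw [← Real.exp_add, ← Real.exp_add]; congr 1; ring
      have e4 : 1 ≤ Real.exp |u| := Real.one_le_exp (abs_nonneg u)
      have e5 := norm_cosh_le ν u
      have e6 := norm_sinh_le ν u
      calc ‖G u‖ ≤ ‖-x * (Real.sinh u : ℂ) * E u * Complex.cosh (ν * u)‖
            + ‖ν * E u * Complex.sinh (ν * u)‖ := norm_sub_le _ _
        _ = x * |Real.sinh u| * Real.exp (-x * Real.cosh u) * ‖Complex.cosh (ν * u)‖
            + ‖ν‖ * 1 * Real.exp (-x * Real.cosh u) * ‖Complex.sinh (ν * u)‖ := by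
          rw [norm_mul, norm_mul, norm_mul, norm_mul, norm_mul, e1, norm_neg, norm_real, norm_real,
            Real.norm_of_nonneg hx.le, Real.norm_eq_abs, mul_one]
        _ ≤ x * Real.exp |u| * Real.exp (-x * Real.cosh u) * Real.exp (|ν.re| * |u|)
            + ‖ν‖ * Real.exp |u| * Real.exp (-x * Real.cosh u) * Real.exp (|ν.re| * |u|) := by
          gcongr
        _ = _ := by rw [e3]; ring
    have h1 := (tendsto_exp_cosh hx (1 + |ν.re|)).const_mul (x + ‖ν‖)
    rw [mul_zero] at h1
    exact squeeze_zero_norm hb h1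
  have h := integral_Ioi_of_hasDerivAt_of_tendsto' (fun u _ => hG u) hint hlim
  have hG0 : G 0 = 0 := by simp [G]
  rw [hG0, sub_zero] at h
  rw [← h]
  unfold besselDer
  rw [← integral_const_mul, ← integral_const_mul, ← integral_const_mul, ← integral_sub,
    ← integral_sub]
  · exact (((integrable_besselDer 2 ν hx).const_mul _).sub
      ((integrable_besselDer 1 ν hx).const_mul _)).restrict
  · exact ((integrable_besselDer 0 ν hx).const_mul _).restrict
  · exact ((integrable_besselDer 2 ν hx).const_mul _).restrict
  · exact ((integrable_besselDer 1 ν hx).const_mul _).restrict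

lemma hasDerivAt_besselK (ν : ℂ) {x : ℝ} (hx : 0 < x) :
    HasDerivAt (besselK ν) (-besselDer 1 ν x) x := by
  have : besselK ν = besselDer 0 ν := funext fun x => besselK_eq_besselDer ν x
  rw [this]
  exact hasDerivAt_besselDer 0 ν hx

/-! ### Mellin transforms -/

lemma integrable_mul_exp_and_swap {Y : Type*} [MeasurableSpace Y] {μ : Measure Y} [SFinite μ]
    {c : Y → ℝ} (hc : Measurable c) (hpos : ∀ y, 0 < c y) {g : Y → ℂ}
    (hg : AEStronglyMeasurable g μ) {s : ℂ} (hs : 0 < s.re)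
    (hint : Integrable (fun y => c y ^ (-s.re) * ‖g y‖) μ) :
    Integrable (fun p : ℝ × Y => (p.1 : ℂ) ^ (s - 1) * ((Real.exp (-p.1 * c p.2) : ℂ) * g p.2))
      ((volume.restrict (Ioi 0)).prod μ) := by
  rw [integrable_prod_iff']
  · constructor
    · refine .of_forall fun y => ?_
      have h := integrableOn_rpow_mul_exp_neg_mul_rpow (p := 1) (s := s.re - 1) (b := c y)
        (by linarith) one_pos (hpos y)
      refine (h.mul_const ‖g y‖).mono' ?_ ?_
      · dsimp only
        exact ((Measurable.aestronglyMeasurable (by fun_prop)).mul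
          ((Measurable.aestronglyMeasurable (by fun_prop)).mul aestronglyMeasurable_const))
      · refine ae_restrict_of_forall_mem measurableSet_Ioi fun x hx => ?_
        rw [norm_mul, norm_mul, norm_cpow_eq_rpow_re_of_pos hx, norm_real,
          Real.norm_of_nonneg (Real.exp_pos _).le, sub_re, one_re, mul_assoc, Real.rpow_one]
        apply le_of_eq
        congr 3; ring_nf
    · refine hint.const_mul (Real.Gamma s.re) |>.congr (.of_forall fun y => ?_)
      have h := Real.integral_rpow_mul_exp_neg_mul_Ioi hs (hpos y)
      have h2 : ∫ x in Ioi (0 : ℝ), ‖(x : ℂ) ^ (s - 1) * ((Real.exp (-x * c y) : ℂ) * g y)‖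
          = ∫ x in Ioi (0 : ℝ), x ^ (s.re - 1) * Real.exp (-(c y * x)) * ‖g y‖ := by
        refine setIntegral_congr_fun measurableSet_Ioi fun x hx => ?_
        rw [norm_mul, norm_mul, norm_cpow_eq_rpow_re_of_pos hx, norm_real,
          Real.norm_of_nonneg (Real.exp_pos _).le, sub_re, one_re, mul_assoc]
        congr 3; ring_nf
      beta_reduce
      rw [h2, integral_mul_const, h, one_div, Real.inv_rpow (hpos y).le, Real.rpow_neg (hpos y).le]
      ring
  · apply AEStronglyMeasurable.mul
    · apply Measurable.aestronglyMeasurable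
      fun_prop
    · apply AEStronglyMeasurable.mul
      · fun_prop
      · exact hg.comp_snd

/-- Differentiability in the exponent of an integral of complex powers. -/
lemma differentiable_integral_cpow {X : Type*} [MeasurableSpace X] {μ : Measure X} {φ : X → ℝ}
    (hφ : Measurable φ) (h1 : ∀ᵐ x ∂μ, 1 ≤ φ x) {h : X → ℂ} (hh : AEStronglyMeasurable h μ)
    (hint : ∀ A : ℝ, Integrable (fun x => ‖h x‖ * φ x ^ A) μ) :
    Differentiable ℂ fun s : ℂ => ∫ x, h x * (φ x : ℂ) ^ s ∂μ := by
  intro s₀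
  have hmeas : ∀ s : ℂ, AEStronglyMeasurable (fun x => h x * (φ x : ℂ) ^ s) μ := fun s =>
    hh.mul (Measurable.aestronglyMeasurable (by fun_prop))
  have hnorm : ∀ s : ℂ, ∀ x, 1 ≤ φ x → ‖h x * (φ x : ℂ) ^ s‖ = ‖h x‖ * φ x ^ s.re := by
    intro s x hx
    rw [norm_mul, norm_cpow_eq_rpow_re_of_pos (by linarith)]
  have key := hasDerivAt_integral_of_dominated_loc_of_deriv_le (μ := μ)
    (F := fun s x => h x * (φ x : ℂ) ^ s)
    (F' := fun s x => h x * ((φ x : ℂ) ^ s * Complex.log (φ x))) (x₀ := s₀)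
    (s := Metric.ball s₀ 1) (bound := fun x => ‖h x‖ * φ x ^ (s₀.re + 2))
    (Metric.ball_mem_nhds _ one_pos) (.of_forall hmeas) ?_ ?_ ?_ (hint _) ?_
  · exact key.2.differentiableAt
  · refine (hint s₀.re).mono' (hmeas s₀) ?_
    filter_upwards [h1] with x hx
    rw [hnorm s₀ x hx]
  · exact hh.mul (Measurable.aestronglyMeasurable (by fun_prop))
  · filter_upwards [h1] with x hx s hs
    have hx0 : 0 < φ x := by linarith
    have hre : s.re ≤ s₀.re + 1 := by
      have := (abs_re_le_norm (s - s₀)).trans (mem_ball_iff_norm.1 hs).le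
      rw [sub_re, abs_le] at this; linarith [this.2]
    rw [norm_mul, norm_mul, norm_cpow_eq_rpow_re_of_pos hx0, ← ofReal_log hx0.le, norm_real,
      Real.norm_of_nonneg (Real.log_nonneg hx)]
    have h3 : Real.log (φ x) ≤ φ x := by linarith [Real.log_le_sub_one_of_pos hx0]
    have h5 : φ x ^ (s₀.re + 2) = φ x ^ (s₀.re + 1) * φ x := by
      rw [← Real.rpow_add_one hx0.ne']; congr 1; ring
    rw [h5]
    have := Real.log_nonneg hx
    gcongr
  · filter_upwards [h1] with x hx s _
    have hx0 : (φ x : ℂ) ≠ 0 := by exact_mod_cast (by linarith : φ x ≠ 0)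
    have h2 := (hasDerivAt_id s).const_cpow (c := (φ x : ℂ)) (Or.inl hx0)
    simpa using h2.const_mul (h x)

/-! ### Meromorphic continuation -/

/-- A meromorphic function that agrees with the analytic function `f` on a half-plane (off a
discrete set) represents the continuation of `f` wherever it is analytic. -/
lemma hasMeroCont_and_eq' {f : ℂ → ℂ} {σ₀ : ℝ} {G : ℂ → ℂ} (hG : MeromorphicOn G univ)
    (hf : ∀ s : ℂ, σ₀ < s.re → AnalyticAt ℂ f s ∧ G =ᶠ[𝓝[≠] s] f) :
    HasMeroCont f σ₀ ∧ ∀ s, AnalyticAt ℂ G s → meroCont f σ₀ s = G s := by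
  set F := toMeromorphicNFOn G univ with hFdef
  have hF : MeromorphicNFOn F univ := meromorphicNFOn_toMeromorphicNFOn G univ
  have hFG : ∀ s, AnalyticAt ℂ G s → F s = G s := by
    intro s hs
    rw [hFdef, toMeromorphicNFOn_eq_toMeromorphicNFAt hG (mem_univ s),
      toMeromorphicNFAt_eq_self.2 hs.meromorphicNFAt]
  have hFf : ∀ s : ℂ, σ₀ < s.re → F s = f s := fun s hs =>
    (((hF (mem_univ s)).eventuallyEq_nhdsNE_iff_eventuallyEq_nhds (hf s hs).1.meromorphicNFAt).1
      ((hG.toMeromorphicNFOn_eq_self_on_nhdsNE (mem_univ s)).trans (hf s hs).2)).eq_of_nhds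
  have hcont : HasMeroCont f σ₀ := ⟨F, hF, hFf⟩
  refine ⟨hcont, fun s hs => ?_⟩
  have hm : meroCont f σ₀ = hcont.choose := by rw [meroCont, dif_pos hcont]
  obtain ⟨h1, h2⟩ := hcont.choose_spec
  rw [← hm] at h1 h2
  set H := meroCont f σ₀
  rw [← hFG s hs]
  have hD : MeromorphicOn (H - F) univ := h1.meromorphicOn.sub hF.meromorphicOn
  have htop : meromorphicOrderAt (H - F) s = ⊤ := by
    by_contra hne
    have hall := (hD.exists_meromorphicOrderAt_ne_top_iff_forall isConnected_univ).1
      ⟨⟨s, mem_univ s⟩, hne⟩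
    have h3 := hall ⟨((σ₀ + 1 : ℝ) : ℂ), mem_univ _⟩
    apply h3
    rw [meromorphicOrderAt_eq_top_iff]
    apply eventually_nhdsWithin_of_eventually_nhds
    have hopen : IsOpen {z : ℂ | σ₀ < z.re} := isOpen_lt continuous_const continuous_re
    filter_upwards [hopen.mem_nhds (by simp : ((σ₀ + 1 : ℝ) : ℂ) ∈ {z : ℂ | σ₀ < z.re})] with z hz
    rw [Pi.sub_apply, h2 z hz, hFf z hz, sub_self]
  rw [meromorphicOrderAt_eq_top_iff] at htop
  have h4 : H =ᶠ[𝓝[≠] s] F := by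
    filter_upwards [htop] with z hz
    exact sub_eq_zero.1 hz
  exact (((h1 (mem_univ s)).eventuallyEq_nhdsNE_iff_eventuallyEq_nhds (hF (mem_univ s))).1
    h4).eq_of_nhds

lemma hasMeroCont_and_eq {f : ℂ → ℂ} {σ₀ : ℝ} {G : ℂ → ℂ} (hG : MeromorphicOn G univ)
    (hA : ∀ s : ℂ, σ₀ < s.re → AnalyticAt ℂ G s) (hf : ∀ s : ℂ, σ₀ < s.re → G s = f s) :
    HasMeroCont f σ₀ ∧ ∀ s, AnalyticAt ℂ G s → meroCont f σ₀ s = G s := by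
  refine hasMeroCont_and_eq' hG fun s hs => ?_
  have h : G =ᶠ[𝓝 s] f :=
    Filter.eventually_of_mem ((isOpen_lt continuous_const continuous_re).mem_nhds hs) hf
  exact ⟨(hA s hs).congr h, h.filter_mono nhdsWithin_le_nhds⟩

/-! ### Integral formulas for the Bessel function -/

lemma integrable_exp_cosh_mul_exp {x : ℝ} (hx : 0 < x) (ν : ℂ) :
    Integrable fun u : ℝ => (Real.exp (-x * Real.cosh u) : ℂ) * Complex.exp (ν * u) := by
  refine Integrable.mono' (integrable_exp_cosh hx |ν.re|) ?_ ?_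
  · exact Continuous.aestronglyMeasurable (by fun_prop)
  · refine .of_forall fun u => ?_
    rw [norm_mul, norm_real, Real.norm_of_nonneg (Real.exp_pos _).le, norm_exp, ← Real.exp_add,
      re_mul_ofReal]
    apply Real.exp_le_exp.2
    have := le_abs_self (ν.re * u)
    rw [abs_mul] at this
    linarith

lemma besselK_eq_integral (ν : ℂ) {x : ℝ} (hx : 0 < x) :
    besselK ν x = 1 / 2 * ∫ u : ℝ, (Real.exp (-x * Real.cosh u) : ℂ) * Complex.exp (ν * u) := by
  have h1 := integrable_exp_cosh_mul_exp hx ν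
  have h2 := intervalIntegral.integral_Iic_add_Ioi (b := (0 : ℝ)) h1.integrableOn h1.integrableOn
  have h3 : ∫ u in Iic (0 : ℝ), (Real.exp (-x * Real.cosh u) : ℂ) * Complex.exp (ν * u)
      = ∫ u in Ioi (0 : ℝ), (Real.exp (-x * Real.cosh (-u)) : ℂ)
        * Complex.exp (ν * ((-u : ℝ) : ℂ)) := by
    have := integral_comp_neg_Ioi (0 : ℝ)
      (fun u : ℝ => (Real.exp (-x * Real.cosh u) : ℂ) * Complex.exp (ν * u))
    rw [this, neg_zero]
  rw [← h2, h3, ← integral_add, ← integral_const_mul]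
  · unfold besselK
    refine setIntegral_congr_fun measurableSet_Ioi fun u _ => ?_
    simp only [Real.cosh_neg, Complex.cosh]
    push_cast
    ring_nf
  · exact (h1.comp_neg).integrableOn
  · exact h1.integrableOn

/-- The integral representation of the Bessel function on the positive half-line. -/
lemma integral_rpow_mul_exp_eq_besselK (s : ℂ) {y p q : ℝ} (hy : 0 < y) (hp : 0 < p) (hq : 0 < q) :
    IntegrableOn (fun x : ℝ => (x : ℂ) ^ (s - 1) * (Real.exp (-y * (p ^ 2 * x + q ^ 2 / x)) : ℂ))
      (Ioi 0) ∧
    ∫ x in Ioi (0 : ℝ), (x : ℂ) ^ (s - 1) * (Real.exp (-y * (p ^ 2 * x + q ^ 2 / x)) : ℂ)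
      = 2 * ((q / p : ℝ) : ℂ) ^ s * besselK s (2 * y * p * q) := by
  have himg : (fun u : ℝ => q / p * Real.exp u) '' univ = Ioi 0 := by
    ext x
    simp only [image_univ, mem_range, mem_Ioi]
    constructor
    · rintro ⟨u, rfl⟩; positivity
    · intro hx
      refine ⟨Real.log (x / (q / p)), ?_⟩
      rw [Real.exp_log (by positivity)]
      field_simp
  have hinj : InjOn (fun u : ℝ => q / p * Real.exp u) univ := by
    intro a _ b _ hab
    exact Real.exp_injective (mul_left_cancel₀ (by positivity : q / p ≠ 0) hab)
  have hder : ∀ u ∈ (univ : Set ℝ), HasDerivWithinAt (fun u : ℝ => q / p * Real.exp u)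
      (q / p * Real.exp u) univ u :=
    fun u _ => ((Real.hasDerivAt_exp u).const_mul (q / p)).hasDerivWithinAt
  have hfun : ∀ u : ℝ, |q / p * Real.exp u| • (((q / p * Real.exp u : ℝ) : ℂ) ^ (s - 1)
      * (Real.exp (-y * (p ^ 2 * (q / p * Real.exp u) + q ^ 2 / (q / p * Real.exp u))) : ℂ))
      = ((q / p : ℝ) : ℂ) ^ s
        * ((Real.exp (-(2 * y * p * q) * Real.cosh u) : ℂ) * Complex.exp (s * u)) := by
    intro u
    have hqp : 0 < q / p := by positivity
    have hpos : 0 < q / p * Real.exp u := by positivity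
    have hne : ((q / p * Real.exp u : ℝ) : ℂ) ≠ 0 := by exact_mod_cast hpos.ne'
    rw [abs_of_pos hpos, real_smul, ← mul_assoc, cpow_sub _ _ hne, cpow_one, mul_div_cancel₀ _ hne,
      ofReal_mul, mul_cpow_ofReal_nonneg hqp.le (Real.exp_pos u).le, mul_assoc]
    congr 1
    have h1 : ((Real.exp u : ℝ) : ℂ) ^ s = Complex.exp (s * u) := by
      rw [cpow_def_of_ne_zero (by exact_mod_cast (Real.exp_pos u).ne'), ← ofReal_log
        (Real.exp_pos u).le, Real.log_exp, mul_comm]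
    rw [h1, mul_comm]
    congr 3
    rw [Real.cosh_eq, Real.exp_neg]
    field_simp
  have hx : 0 < 2 * y * p * q := by positivity
  constructor
  · rw [← himg, integrableOn_image_iff_integrableOn_abs_deriv_smul MeasurableSet.univ hder hinj,
      integrableOn_univ]
    simp only [hfun]
    exact (integrable_exp_cosh_mul_exp hx s).const_mul _
  · rw [← himg, integral_image_eq_integral_abs_deriv_smul MeasurableSet.univ hder hinj,
      setIntegral_univ]
    simp only [hfun]
    rw [integral_const_mul, besselK_eq_integral s hx]
    ring

/-- The Mellin transform of a superposition of exponentials. -/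
lemma mellin_superposition {Y : Type*} [MeasurableSpace Y] {μ : Measure Y} [SFinite μ]
    {c : Y → ℝ} (hc : Measurable c) (hpos : ∀ y, 0 < c y) {g : Y → ℂ}
    (hg : AEStronglyMeasurable g μ) {s : ℂ} (hs : 0 < s.re)
    (hint : Integrable (fun y => c y ^ (-s.re) * ‖g y‖) μ) :
    IntegrableOn (fun x : ℝ => (x : ℂ) ^ (s - 1) * ∫ y, (Real.exp (-x * c y) : ℂ) * g y ∂μ)
      (Ioi 0) ∧
    ∫ x in Ioi (0 : ℝ), (x : ℂ) ^ (s - 1) * ∫ y, (Real.exp (-x * c y) : ℂ) * g y ∂μ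
      = Gamma s * ∫ y, (c y : ℂ) ^ (-s) * g y ∂μ := by
  have h := integrable_mul_exp_and_swap hc hpos hg hs hint
  have hl := h.integral_prod_left
  simp only [integral_const_mul] at hl
  refine ⟨hl, ?_⟩
  have hsw := integral_integral_swap
    (f := fun (x : ℝ) (y : Y) => (x : ℂ) ^ (s - 1) * ((Real.exp (-x * c y) : ℂ) * g y)) h
  simp only [integral_const_mul] at hsw
  rw [hsw, ← integral_const_mul]
  refine integral_congr_ae (.of_forall fun y => ?_)
  beta_reduce
  have hΓ := Complex.integral_cpow_mul_exp_neg_mul_Ioi hs (hpos y)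
  calc ∫ x in Ioi (0 : ℝ), (x : ℂ) ^ (s - 1) * ((Real.exp (-x * c y) : ℂ) * g y)
      = (∫ x in Ioi (0 : ℝ), (x : ℂ) ^ (s - 1) * Complex.exp (-(c y * x))) * g y := by
        rw [← integral_mul_const]
        refine setIntegral_congr_fun measurableSet_Ioi fun x _ => ?_
        rw [← mul_assoc]
        push_cast
        congr 3; ring
    _ = _ := by
        rw [hΓ, one_div, inv_cpow _ _ (by
          rw [arg_ofReal_of_nonneg (hpos y).le]; exact Real.pi_pos.ne), cpow_neg]
        ring

/-- `∫ (2 cosh u)^(-s) e^(α u) du` is a Beta integral, by the substitution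
`x = e^u / (2 cosh u)`. -/
lemma integral_cosh_cpow {s α : ℂ} (hs : |α.re| < s.re) :
    Integrable (fun u : ℝ => ((2 * Real.cosh u : ℝ) : ℂ) ^ (-s) * Complex.exp (α * u)) ∧
    ∫ u : ℝ, ((2 * Real.cosh u : ℝ) : ℂ) ^ (-s) * Complex.exp (α * u)
      = 1 / 2 * (Gamma ((s + α) / 2) * Gamma ((s - α) / 2) / Gamma s) := by
  rw [abs_lt] at hs
  set a := (s + α) / 2 with ha
  set b := (s - α) / 2 with hb
  have hare : 0 < a.re := by
    rw [ha, div_ofNat_re, add_re]; linarith [hs.1]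
  have hbre : 0 < b.re := by
    rw [hb, div_ofNat_re, sub_re]; linarith [hs.2]
  have hab : a + b = s := by rw [ha, hb]; ring
  have hβ := Complex.Gamma_mul_Gamma_eq_betaIntegral hare hbre
  have hconv := Complex.betaIntegral_convergent hare hbre
  rw [hab] at hβ
  have hΓ : Gamma s ≠ 0 := Gamma_ne_zero_of_re_pos (by linarith [hs.1, hs.2])
  set φ : ℝ → ℝ := fun u => Real.exp u / (2 * Real.cosh u) with hφ
  have hc : ∀ u : ℝ, 0 < 2 * Real.cosh u := fun u => by linarith [Real.cosh_pos u]
  have h1φ : ∀ u, 1 - φ u = Real.exp (-u) / (2 * Real.cosh u) := by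
    intro u
    have := (hc u).ne'
    rw [eq_div_iff this, sub_mul, div_mul_cancel₀ _ this, Real.cosh_eq]; ring
  have hderiv : ∀ u, HasDerivAt φ (2 * (φ u * (1 - φ u))) u := by
    intro u
    have h := (Real.hasDerivAt_exp u).div ((Real.hasDerivAt_cosh u).const_mul 2) (hc u).ne'
    refine h.congr_deriv ?_
    rw [h1φ]
    have h0 := (Real.cosh_pos u).ne'
    rw [hφ]
    have h2 : Real.exp u * Real.exp (-u) = 1 := by rw [← Real.exp_add]; simp
    have h3 : Real.exp (-u) = Real.cosh u - Real.sinh u := by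
      rw [Real.cosh_sub_sinh]
    rw [h3]
    field_simp
  have hφpos : ∀ u, 0 < φ u := fun u => div_pos (Real.exp_pos _) (hc u)
  have h1φpos : ∀ u, 0 < 1 - φ u := fun u => by rw [h1φ]; exact div_pos (Real.exp_pos _) (hc u)
  have himg : φ '' univ = Ioo 0 1 := by
    ext x
    simp only [image_univ, mem_range, mem_Ioo]
    constructor
    · rintro ⟨u, rfl⟩; exact ⟨hφpos u, by linarith [h1φpos u]⟩
    · rintro ⟨h0, h1⟩
      refine ⟨Real.log (x / (1 - x)) / 2, ?_⟩
      set u := Real.log (x / (1 - x)) / 2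
      have h2 : Real.exp u * Real.exp u = x / (1 - x) := by
        rw [← Real.exp_add, add_halves, Real.exp_log (div_pos h0 (by linarith))]
      have h4 : (1 - x) ≠ 0 := by linarith
      rw [eq_div_iff h4] at h2
      rw [div_eq_iff (hc u).ne', Real.cosh_eq, Real.exp_neg]
      field_simp
      linear_combination h2
  have hinj : InjOn φ univ := by
    have : StrictMono φ := strictMono_of_deriv_pos fun u => by
      rw [(hderiv u).deriv]
      exact mul_pos two_pos (mul_pos (hφpos u) (h1φpos u))
    exact this.injective.injOn
  have hcongr : ∀ u : ℝ, |2 * (φ u * (1 - φ u))| •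
      ((φ u : ℂ) ^ (a - 1) * (1 - (φ u : ℂ)) ^ (b - 1))
      = 2 * (((2 * Real.cosh u : ℝ) : ℂ) ^ (-s) * Complex.exp (α * u)) := by
    intro u
    have hp := hφpos u
    have hq := h1φpos u
    rw [abs_of_pos (by positivity), real_smul]
    have e1 : (φ u : ℂ) ^ (a - 1) = (φ u : ℂ) ^ a / φ u := by
      rw [cpow_sub _ _ (by exact_mod_cast hp.ne'), cpow_one]
    have e2 : (1 - (φ u : ℂ)) ^ (b - 1) = ((1 - φ u : ℝ) : ℂ) ^ b / ((1 - φ u : ℝ) : ℂ) := by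
      rw [show (1 : ℂ) - (φ u : ℂ) = ((1 - φ u : ℝ) : ℂ) by push_cast; ring,
        cpow_sub _ _ (by exact_mod_cast hq.ne'), cpow_one]
    have hpc : (φ u : ℂ) ≠ 0 := by exact_mod_cast hp.ne'
    have hqc : ((1 - φ u : ℝ) : ℂ) ≠ 0 := by exact_mod_cast hq.ne'
    rw [e1, e2, ofReal_mul, ofReal_mul]
    have e3 : ∀ (v : ℝ) (w : ℂ), ((Real.exp v / (2 * Real.cosh u) : ℝ) : ℂ) ^ w
        = Complex.exp (v * w) * ((2 * Real.cosh u : ℝ) : ℂ) ^ (-w) := by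
      intro v w
      rw [div_eq_mul_inv, ofReal_mul, mul_cpow_ofReal_nonneg (Real.exp_pos _).le
        (inv_pos.2 (hc u)).le, ofReal_inv, inv_cpow _ _ (by
          rw [arg_ofReal_of_nonneg (hc u).le]; exact Real.pi_pos.ne), cpow_neg]
      congr 1
      rw [cpow_def_of_ne_zero (by exact_mod_cast (Real.exp_pos v).ne'), ← ofReal_log
        (Real.exp_pos v).le, Real.log_exp]
    have e4 : (φ u : ℂ) ^ a * ((1 - φ u : ℝ) : ℂ) ^ b
        = ((2 * Real.cosh u : ℝ) : ℂ) ^ (-s) * Complex.exp (α * u) := by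
      rw [h1φ u, e3, e3, ← hab, neg_add, cpow_add _ _ (by exact_mod_cast (hc u).ne')]
      have : Complex.exp (α * u) = Complex.exp (u * a) * Complex.exp (((-u : ℝ) : ℂ) * b) := by
        rw [← Complex.exp_add, ha, hb]; congr 1; push_cast; ring
      rw [this]; ring
    rw [← e4]
    push_cast at hqc ⊢
    field_simp
  have hF : IntegrableOn (fun x : ℝ => (x : ℂ) ^ (a - 1) * (1 - (x : ℂ)) ^ (b - 1)) (Ioo 0 1) := by
    rw [← integrableOn_Ioc_iff_integrableOn_Ioo]
    exact (intervalIntegrable_iff_integrableOn_Ioc_of_le zero_le_one).1 hconv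
  rw [← himg] at hF
  have hF2 := (integrableOn_image_iff_integrableOn_abs_deriv_smul MeasurableSet.univ
    (fun u _ => (hderiv u).hasDerivWithinAt) hinj _).1 hF
  simp only [hcongr, integrableOn_univ] at hF2
  have hI := integral_image_eq_integral_abs_deriv_smul MeasurableSet.univ
    (fun u _ => (hderiv u).hasDerivWithinAt) hinj
    (fun x : ℝ => (x : ℂ) ^ (a - 1) * (1 - (x : ℂ)) ^ (b - 1))
  simp only [hcongr, setIntegral_univ, integral_const_mul, himg] at hI
  have hβ2 : betaIntegral a b
      = ∫ x in Ioo (0 : ℝ) 1, (x : ℂ) ^ (a - 1) * (1 - (x : ℂ)) ^ (b - 1) := by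
    rw [betaIntegral, intervalIntegral.integral_of_le zero_le_one,
      integral_Ioc_eq_integral_Ioo]
  constructor
  · have := hF2.const_mul (1 / 2)
    refine this.congr (.of_forall fun u => ?_)
    beta_reduce
    ring
  · rw [hβ, hβ2, hI]
    field_simp

lemma integrable_cosh_rpow {σ A : ℝ} (h : |A| < σ) :
    Integrable fun u : ℝ => Real.cosh u ^ (-σ) * Real.exp (A * u) := by
  have h1 := (integral_cosh_cpow (s := σ) (α := A) (by simpa using h)).1.norm
  refine (h1.const_mul ((2 : ℝ) ^ σ)).congr (.of_forall fun u => ?_)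
  have hc := Real.cosh_pos u
  beta_reduce
  rw [norm_mul, norm_cpow_eq_rpow_re_of_pos (by positivity), norm_exp, neg_re, ofReal_re,
    re_mul_ofReal, ofReal_re, Real.mul_rpow two_pos.le hc.le, ← mul_assoc, ← mul_assoc,
    ← Real.rpow_add two_pos]
  simp

lemma ofReal_cpow_two_mul {x : ℝ} (hx : 0 < x) (s : ℂ) :
    ((x : ℝ) : ℂ) ^ (-s) = 2 ^ s * ((2 * x : ℝ) : ℂ) ^ (-s) := by
  rw [ofReal_mul, mul_cpow_ofReal_nonneg two_pos.le hx.le, ← mul_assoc, ofReal_ofNat,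
    ← cpow_add _ _ two_ne_zero]
  simp

/-- The Mellin transform of the Bessel function. -/
lemma mellin_besselK {ν s : ℂ} (hs : |ν.re| < s.re) :
    IntegrableOn (fun x : ℝ => (x : ℂ) ^ (s - 1) * besselK ν x) (Ioi 0) ∧
    ∫ x in Ioi (0 : ℝ), (x : ℂ) ^ (s - 1) * besselK ν x
      = 2 ^ (s - 2) * (Gamma ((s + ν) / 2) * Gamma ((s - ν) / 2)) := by
  have hs0 : 0 < s.re := (abs_nonneg _).trans_lt hs
  have hg : Integrable fun u : ℝ => Real.cosh u ^ (-s.re) * ‖Complex.exp (ν * u)‖ := by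
    refine (integrable_cosh_rpow hs).congr (.of_forall fun u => ?_)
    beta_reduce
    rw [norm_exp, re_mul_ofReal]
  have h := mellin_superposition (μ := volume) (c := Real.cosh)
    (g := fun u : ℝ => Complex.exp (ν * u)) Real.continuous_cosh.measurable Real.cosh_pos
    (Continuous.aestronglyMeasurable (by fun_prop)) hs0 hg
  have hK : ∀ x ∈ Ioi (0 : ℝ), (x : ℂ) ^ (s - 1) * besselK ν x = 1 / 2 * ((x : ℂ) ^ (s - 1) *
      ∫ u : ℝ, (Real.exp (-x * Real.cosh u) : ℂ) * Complex.exp (ν * u)) := by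
    intro x hx
    rw [besselK_eq_integral ν hx]; ring
  refine ⟨IntegrableOn.congr_fun (h.1.const_mul (1 / 2)) (fun x hx => (hK x hx).symm)
    measurableSet_Ioi, ?_⟩
  rw [setIntegral_congr_fun measurableSet_Ioi hK, integral_const_mul, h.2]
  have hJ := (integral_cosh_cpow hs).2
  have h3 : ∫ u : ℝ, (Real.cosh u : ℂ) ^ (-s) * Complex.exp (ν * u)
      = 2 ^ s * ∫ u : ℝ, ((2 * Real.cosh u : ℝ) : ℂ) ^ (-s) * Complex.exp (ν * u) := by
    rw [← integral_const_mul]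
    refine integral_congr_ae (.of_forall fun u => ?_)
    beta_reduce
    rw [ofReal_cpow_two_mul (Real.cosh_pos u)]; ring
  have hΓ : Gamma s ≠ 0 := Gamma_ne_zero_of_re_pos hs0
  rw [h3, hJ, cpow_sub _ _ two_ne_zero]
  have : (2 : ℂ) ^ (2 : ℂ) = 4 := by norm_num [← Nat.cast_ofNat (R := ℂ) (n := 2), cpow_natCast]
  field_simp
  norm_num
  ring

/-- The product of two Bessel functions, from `cosh (p + q) + cosh (p - q) = 2 cosh p cosh q`. -/
lemma besselK_mul_besselK (a b : ℂ) {x : ℝ} (hx : 0 < x) :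
    besselK a x * besselK b x = 1 / 2 * ∫ y : ℝ × ℝ,
      (Real.exp (-x * (2 * Real.cosh y.1 * Real.cosh y.2)) : ℂ)
        * (Complex.exp ((a + b) * y.1) * Complex.exp ((a - b) * y.2)) := by
  set F : ℝ → ℝ → ℂ := fun u v => ((Real.exp (-x * Real.cosh u) : ℂ) * Complex.exp (a * u))
    * ((Real.exp (-x * Real.cosh v) : ℂ) * Complex.exp (b * v)) with hF
  set G : ℝ × ℝ → ℂ := fun y => (Real.exp (-x * (2 * Real.cosh y.1 * Real.cosh y.2)) : ℂ)
        * (Complex.exp ((a + b) * y.1) * Complex.exp ((a - b) * y.2)) with hG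
  have hFG : ∀ v q : ℝ, G (v + q, q) = F (v + 2 * q) v := by
    intro v q
    rw [hG, hF]
    beta_reduce
    rw [mul_mul_mul_comm, ← ofReal_mul, ← Real.exp_add, ← Complex.exp_add, ← Complex.exp_add]
    congr 2
    · congr 1
      have e1 : v + 2 * q = (v + q) + q := by ring
      have e2 : Real.cosh v = Real.cosh ((v + q) - q) := by congr 1; ring
      rw [e1, e2, Real.cosh_add (v + q), Real.cosh_sub (v + q)]; ring
    · push_cast; ring
  have hGi : Integrable G := by
    have hd := (integrable_exp_cosh hx |(a + b).re|).mul_prod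
      (integrable_exp_cosh hx |(a - b).re|)
    refine Integrable.mono' hd (Continuous.aestronglyMeasurable (by rw [hG]; fun_prop)) ?_
    refine .of_forall fun y => ?_
    rw [norm_mul, norm_mul, norm_real, Real.norm_of_nonneg (Real.exp_pos _).le, norm_exp, norm_exp,
      ← Real.exp_add, ← Real.exp_add, ← Real.exp_add, re_mul_ofReal, re_mul_ofReal]
    apply Real.exp_le_exp.2
    have h1 := le_abs_self ((a + b).re * y.1)
    have h2 := le_abs_self ((a - b).re * y.2)
    rw [abs_mul] at h1 h2
    have h3 := Real.one_le_cosh y.1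
    have h4 := Real.one_le_cosh y.2
    have h5 : Real.cosh y.1 + Real.cosh y.2 ≤ 2 * Real.cosh y.1 * Real.cosh y.2 := by
      nlinarith
    nlinarith
  have hmp := measurePreserving_add_prod (volume : Measure ℝ) (volume : Measure ℝ)
  have hHi : Integrable (fun y : ℝ × ℝ => F (y.1 + 2 * y.2) y.1) := by
    have := hmp.integrable_comp_of_integrable hGi
    refine this.congr (.of_forall fun y => ?_)
    simp only [Function.comp_apply, hFG]
  have hGH : ∫ y, G y = ∫ y : ℝ × ℝ, F (y.1 + 2 * y.2) y.1 := by
    have h0 := integral_map hmp.aemeasurable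
      (hmp.map_eq.symm ▸ hGi.aestronglyMeasurable : AEStronglyMeasurable G _)
    rw [hmp.map_eq] at h0
    rw [Measure.volume_eq_prod, h0]
    simp only [hFG]
  rw [hGH, Measure.volume_eq_prod, integral_prod _ hHi]
  have h1 : ∀ v : ℝ, ∫ q : ℝ, F (v + 2 * q) v = 1 / 2 * ∫ u : ℝ, F u v := by
    intro v
    have e := Measure.integral_comp_mul_left (fun q => F (v + q) v) 2
    rw [e, integral_add_left_eq_self (fun q => F q v)]
    norm_num [real_smul]
  simp only [h1, integral_const_mul]
  rw [besselK_eq_integral a hx, besselK_eq_integral b hx]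
  simp only [hF, integral_mul_const]
  rw [integral_const_mul]
  ring

/-- The Mellin transform of a product of two Bessel functions. -/
lemma mellin_besselK_mul {a b s : ℂ} (h1 : |(a + b).re| < s.re) (h2 : |(a - b).re| < s.re) :
    IntegrableOn (fun x : ℝ => (x : ℂ) ^ (s - 1) * (besselK a x * besselK b x)) (Ioi 0)
    ∧ ∫ x in Ioi (0 : ℝ), (x : ℂ) ^ (s - 1) * (besselK a x * besselK b x)
    = 2 ^ (s - 3)
    * (Gamma ((s + (a + b)) / 2) * Gamma ((s - (a + b)) / 2)
    * (Gamma ((s + (a - b)) / 2) * Gamma ((s - (a - b)) / 2))) / Gamma s := by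
  have hs0 : 0 < s.re := (abs_nonneg _).trans_lt h1
  have hg : Integrable fun y : ℝ × ℝ => (2 * Real.cosh y.1 * Real.cosh y.2) ^ (-s.re)
      * ‖Complex.exp ((a + b) * y.1) * Complex.exp ((a - b) * y.2)‖ := by
    refine (((integrable_cosh_rpow h1).mul_prod (integrable_cosh_rpow h2)).const_mul
      ((2 : ℝ) ^ (-s.re))).congr (.of_forall fun y => ?_)
    have hc1 := Real.cosh_pos y.1
    have hc2 := Real.cosh_pos y.2
    beta_reduce
    rw [norm_mul, norm_exp, norm_exp, re_mul_ofReal, re_mul_ofReal,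
      Real.mul_rpow (by positivity) hc2.le, Real.mul_rpow two_pos.le hc1.le]
    ring
  have h := mellin_superposition (μ := (volume : Measure (ℝ × ℝ)))
    (c := fun y => 2 * Real.cosh y.1 * Real.cosh y.2)
    (g := fun y : ℝ × ℝ => Complex.exp ((a + b) * y.1) * Complex.exp ((a - b) * y.2))
    (Continuous.measurable (by fun_prop))
    (fun y => mul_pos (mul_pos two_pos (Real.cosh_pos _)) (Real.cosh_pos _))
    (Continuous.aestronglyMeasurable (by fun_prop)) hs0 hg
  have hK : ∀ x ∈ Ioi (0 : ℝ), (x : ℂ) ^ (s - 1) * (besselK a x * besselK b x)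
      = 1 / 2 * ((x : ℂ) ^ (s - 1) * ∫ y : ℝ × ℝ,
      (Real.exp (-x * (2 * Real.cosh y.1 * Real.cosh y.2)) : ℂ)
        * (Complex.exp ((a + b) * y.1) * Complex.exp ((a - b) * y.2))) := by
    intro x hx
    rw [besselK_mul_besselK a b hx]; ring
  refine ⟨IntegrableOn.congr_fun (h.1.const_mul (1 / 2)) (fun x hx => (hK x hx).symm)
    measurableSet_Ioi, ?_⟩
  rw [setIntegral_congr_fun measurableSet_Ioi hK, integral_const_mul, h.2]
  have h3 : ∫ y : ℝ × ℝ, ((2 * Real.cosh y.1 * Real.cosh y.2 : ℝ) : ℂ) ^ (-s)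
        * (Complex.exp ((a + b) * y.1) * Complex.exp ((a - b) * y.2))
      = 2 ^ s * ((∫ u : ℝ, ((2 * Real.cosh u : ℝ) : ℂ) ^ (-s) * Complex.exp ((a + b) * u))
        * ∫ u : ℝ, ((2 * Real.cosh u : ℝ) : ℂ) ^ (-s) * Complex.exp ((a - b) * u)) := by
    rw [← integral_prod_mul, ← integral_const_mul, ← Measure.volume_eq_prod]
    refine integral_congr_ae (.of_forall fun y => ?_)
    have hc2 := Real.cosh_pos y.2
    beta_reduce
    rw [ofReal_mul, mul_cpow_ofReal_nonneg (by positivity) hc2.le, ofReal_cpow_two_mul hc2]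
    ring
  rw [h3, (integral_cosh_cpow h1).2, (integral_cosh_cpow h2).2, cpow_sub _ _ two_ne_zero]
  have : (2 : ℂ) ^ (3 : ℂ) = 8 := by
    norm_num [← Nat.cast_ofNat (R := ℂ) (n := 3), cpow_natCast]
  field_simp
  norm_num
  ring

/-- By its Mellin transform, the Bessel function does not vanish identically. -/
lemma exists_besselK_ne_zero (ν : ℂ) : ∃ X : ℝ, 0 < X ∧ besselK ν X ≠ 0 := by
  by_contra! h
  have h1 := (mellin_besselK (ν := ν) (s := ((|ν.re| + 1 : ℝ) : ℂ)) (by simp)).2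
  rw [setIntegral_congr_fun (g := fun _ => (0 : ℂ)) measurableSet_Ioi
    (fun x hx => by rw [h x hx, mul_zero]), integral_zero] at h1
  have h2 := neg_abs_le ν.re
  have h3 := le_abs_self ν.re
  refine mul_ne_zero (by rw [Ne, cpow_eq_zero_iff]; simp) (mul_ne_zero (Gamma_ne_zero_of_re_pos ?_)
    (Gamma_ne_zero_of_re_pos ?_)) h1.symm <;> norm_num <;> linarith

lemma besselK_neg (ν : ℂ) (x : ℝ) : besselK (-ν) x = besselK ν x := by
  simp only [besselK, neg_mul, Complex.cosh_neg]

/-- If `K_ν(x) = O(1 / x)` on the whole half-line then `|Re ν| ≤ 1`: otherwise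
`2 x ^ ν K_ν(2 x)` would tend to `0` with `x`, while its limit is `Γ(ν)`. -/
lemma abs_re_le_one_of_besselK {ν : ℂ} {C : ℝ} (h : ∀ x : ℝ, 0 < x → ‖besselK ν x‖ ≤ C / x) :
    |ν.re| ≤ 1 := by
  wlog hν : 0 ≤ ν.re generalizing ν
  · rw [← abs_neg, ← neg_re]
    exact this (fun x hx => by rw [besselK_neg]; exact h x hx) (by rw [neg_re]; linarith)
  rw [abs_of_nonneg hν]
  by_contra! h1
  have hν0 : 0 < ν.re := by linarith
  have hF := fun x (hx : 0 < x) => integral_rpow_mul_exp_eq_besselK ν one_pos one_pos hx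
  simp only [one_pow, one_mul, mul_one, div_one] at hF
  have hG := GammaIntegral_convergent hν0
  have hlim : Tendsto (fun x : ℝ => ∫ u in Ioi (0 : ℝ), (u : ℂ) ^ (ν - 1)
      * (Real.exp (-1 * (u + x ^ 2 / u)) : ℂ)) (𝓝[>] 0) (𝓝 (Gamma ν)) := by
    rw [Gamma_eq_integral hν0, GammaIntegral]
    refine tendsto_integral_filter_of_dominated_convergence _ ?_ ?_ hG.norm ?_
    · filter_upwards [self_mem_nhdsWithin] with x hx using (hF x hx).1.aestronglyMeasurable
    · refine .of_forall fun x => ae_restrict_of_forall_mem measurableSet_Ioi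
        fun u (hu : 0 < u) => ?_
      rw [norm_mul, norm_mul, mul_comm, norm_real, norm_real]
      gcongr
      rw [Real.norm_of_nonneg (Real.exp_pos _).le, Real.norm_of_nonneg (Real.exp_pos _).le]
      have : 0 ≤ x ^ 2 / u := by positivity
      exact Real.exp_le_exp.2 (by linarith)
    · refine ae_restrict_of_forall_mem measurableSet_Ioi fun u _ => ?_
      have hc : Continuous fun x : ℝ => (u : ℂ) ^ (ν - 1)
          * (Real.exp (-1 * (u + x ^ 2 / u)) : ℂ) := by fun_prop
      convert (hc.tendsto 0).mono_left nhdsWithin_le_nhds using 2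
      simp [mul_comm]
  have h0 : Tendsto (fun x : ℝ => C * x ^ (ν.re - 1)) (𝓝[>] 0) (𝓝 0) := by
    have := (Real.continuousAt_rpow_const 0 (ν.re - 1) (.inr (by linarith))).tendsto.const_mul C
    rw [Real.zero_rpow (by linarith), mul_zero] at this
    exact this.mono_left nhdsWithin_le_nhds
  refine Gamma_ne_zero_of_re_pos hν0 (norm_le_zero_iff.1 (le_of_tendsto_of_tendsto hlim.norm h0 ?_))
  filter_upwards [self_mem_nhdsWithin] with x (hx : 0 < x)
  have h2 := h (2 * x) (by positivity)
  rw [(hF x hx).2, norm_mul, norm_mul, norm_cpow_eq_rpow_re_of_pos hx, Real.rpow_sub_one hx.ne',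
    Complex.norm_ofNat]
  calc _ ≤ 2 * x ^ ν.re * (C / (2 * x)) := by gcongr
    _ = C * (x ^ ν.re / x) := by field_simp

/-! ### The action on hyperbolic space and its invariant measure -/

open scoped Pointwise

section

variable {K : Type*} [Field K] [NumberField K]
variable (σ : K →+* ℂ)

/-- `|c z + d|² + |c|² r²` for integers `c`, `d`. -/
def qf (c d : 𝓞 K) (P : H3) : ℝ :=
  normSq (emb σ c * P.z + emb σ d) + normSq (emb σ c) * P.r ^ 2

lemma incl_apply (γ : SL(2, 𝓞 K)) (i j : Fin 2) : (incl σ γ).1 i j = emb σ (γ i j) := rfl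

lemma incl_det (γ : SL(2, 𝓞 K)) : (incl σ γ).1.det = 1 := by
  have h := γ.2
  rw [Matrix.det_fin_two] at h ⊢
  simp only [incl_apply, ← map_mul, ← map_sub]
  rw [h, map_one]

lemma den_incl (γ : SL(2, 𝓞 K)) (P : H3) : den (incl σ γ).1 P = qf σ (γ 1 0) (γ 1 1) P := rfl

lemma r_smul (M : GL (Fin 2) ℂ) (P : H3) : (M • P).r = ‖M.1.det‖ * P.r / den M.1 P := rfl

lemma z_smul (M : GL (Fin 2) ℂ) (P : H3) :
    (M • P).z = ((M.1 0 0 * P.z + M.1 0 1) * conj (M.1 1 0 * P.z + M.1 1 1)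
      + M.1 0 0 * conj (M.1 1 0) * (P.r : ℂ) ^ 2) / (den M.1 P : ℂ) := rfl

lemma r_incl_smul (γ : SL(2, 𝓞 K)) (P : H3) : (incl σ γ • P).r = P.r / qf σ (γ 1 0) (γ 1 1) P := by
  rw [r_smul, incl_det, norm_one, one_mul, den_incl]

lemma qf_nonneg (c d : 𝓞 K) (P : H3) : 0 ≤ qf σ c d P :=
  add_nonneg (normSq_nonneg _) (mul_nonneg (normSq_nonneg _) (sq_nonneg _))

@[simp] lemma mk_z (z : ℂ) (r : ℝ) (hr : 0 < r) : (mk z r hr).z = z := rfl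

@[simp] lemma mk_r (z : ℂ) (r : ℝ) (hr : 0 < r) : (mk z r hr).r = r := rfl

/-- The coordinates of the action, as a function on `ℂ × ℝ`. -/
def actFun (M : Matrix (Fin 2) (Fin 2) ℂ) (p : ℂ × ℝ) : ℂ × ℝ :=
  (((M 0 0 * p.1 + M 0 1) * conj (M 1 0 * p.1 + M 1 1)
      + M 0 0 * conj (M 1 0) * (p.2 : ℂ) ^ 2) /
      ((normSq (M 1 0 * p.1 + M 1 1) + normSq (M 1 0) * p.2 ^ 2 : ℝ) : ℂ),
    ‖M.det‖ * p.2 / (normSq (M 1 0 * p.1 + M 1 1) + normSq (M 1 0) * p.2 ^ 2))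

/-- The Euclidean square norm on `ℂ × ℝ`. -/
def sqN (p : ℂ × ℝ) : ℝ := normSq p.1 + p.2 ^ 2

lemma actFun_eq (M : GL (Fin 2) ℂ) (P : H3) : actFun M.1 P.1 = (M • P).1 := rfl

/-- Moebius transformations distort the Euclidean distance by the factor
`|det| / sqrt (den P den Q)`. -/
lemma sqN_act_sub (M : GL (Fin 2) ℂ) (P Q : H3) :
    sqN ((M • P).1 - (M • Q).1) * (den M.1 P * den M.1 Q) = ‖M.1.det‖ ^ 2 * sqN (P.1 - Q.1) := by
  have hP : (den M.1 P : ℂ) ≠ 0 := by exact_mod_cast (den_pos M P).ne'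
  have hQ : (den M.1 Q : ℂ) ≠ 0 := by exact_mod_cast (den_pos M Q).ne'
  have e : ∀ p : ℂ × ℝ, (sqN p : ℂ) = p.1 * conj p.1 + (p.2 : ℂ) ^ 2 := by
    intro p; rw [sqN, mul_conj]; push_cast; ring
  have h1 : ∀ P : H3, ((M • P).1.1 : ℂ) = (M • P).z := fun _ => rfl
  have h2 : ∀ P : H3, ((M • P).1.2 : ℝ) = (M • P).r := fun _ => rfl
  have key : (sqN ((M • P).1 - (M • Q).1) : ℂ) * (den M.1 P * den M.1 Q)
      = (‖M.1.det‖ : ℂ) ^ 2 * (sqN (P.1 - Q.1) : ℂ) := by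
    rw [e, e, Prod.fst_sub, Prod.snd_sub, h1, h1, h2, h2, z_smul, z_smul, r_smul, r_smul]
    have hDP := den_cast M.1 P
    have hDQ := den_cast M.1 Q
    have hn : (‖M.1.det‖ : ℂ) ^ 2 = M.1.det * conj M.1.det := by
      rw [mul_conj, ← ofReal_pow, Complex.sq_norm]
    push_cast
    generalize (‖M.1.det‖ : ℂ) = n at *
    have hcP : conj (den M.1 P : ℂ) = den M.1 P := conj_ofReal _
    have hcQ : conj (den M.1 Q : ℂ) = den M.1 Q := conj_ofReal _
    generalize (den M.1 P : ℂ) = D at *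
    generalize (den M.1 Q : ℂ) = E at *
    rw [Matrix.det_fin_two] at hn
    have hz : (P.1 - Q.1).1 = P.z - Q.z := rfl
    have hr : (P.1 - Q.1).2 = P.r - Q.r := rfl
    rw [hz, hr]
    simp only [map_add, map_mul, map_sub, map_div₀, conj_conj, map_pow, conj_ofReal, hcP, hcQ,
      ofReal_sub] at *
    generalize M.1 0 0 = a at *
    generalize M.1 0 1 = b at *
    generalize M.1 1 0 = c at *
    generalize M.1 1 1 = d at *
    generalize (P.r : ℂ) = r at *
    generalize (Q.r : ℂ) = r' at *
    generalize (P.z : ℂ) = z at *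
    generalize (Q.z : ℂ) = z' at *
    generalize conj a = a' at *
    generalize conj b = b' at *
    generalize conj c = c' at *
    generalize conj d = d' at *
    generalize conj z = w at *
    generalize conj z' = w' at *
    -- `|N|² + |det|² r² = D (|a z + b|² + |a|² r²)`
    have n1 : ((a * z + b) * (c' * w + d') + a * c' * r ^ 2)
        * ((a' * w + b') * (c * z + d) + a' * c * r ^ 2) + n ^ 2 * r ^ 2
        = D * ((a * z + b) * (a' * w + b') + a * a' * r ^ 2) := by
      rw [hn, hDP]; ring
    have n2 : ((a * z' + b) * (c' * w' + d') + a * c' * r' ^ 2)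
        * ((a' * w' + b') * (c * z' + d) + a' * c * r' ^ 2) + n ^ 2 * r' ^ 2
        = E * ((a * z' + b) * (a' * w' + b') + a * a' * r' ^ 2) := by
      rw [hn, hDQ]; ring
    have n3 : ((a * z + b) * (a' * w + b') + a * a' * r ^ 2) * E
        + ((a * z' + b) * (a' * w' + b') + a * a' * r' ^ 2) * D
        - ((a * z + b) * (c' * w + d') + a * c' * r ^ 2)
          * ((a' * w' + b') * (c * z' + d) + a' * c * r' ^ 2)
        - ((a * z' + b) * (c' * w' + d') + a * c' * r' ^ 2)
          * ((a' * w + b') * (c * z + d) + a' * c * r ^ 2)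
        = n ^ 2 * ((z - z') * (w - w') + r ^ 2 + r' ^ 2) := by
      rw [hn, hDP, hDQ]; ring
    field_simp
    linear_combination E ^ 2 * n1 + D ^ 2 * n2 + D * E * n3
  exact_mod_cast key

lemma sqN_smul (t : ℝ) (p : ℂ × ℝ) : sqN (t • p) = t ^ 2 * sqN p := by
  simp only [sqN, Prod.smul_fst, Prod.smul_snd, real_smul, normSq_mul, normSq_ofReal, smul_eq_mul]
  ring

lemma continuous_sqN : Continuous sqN := by
  unfold sqN
  exact (continuous_normSq.comp continuous_fst).add (continuous_snd.pow 2)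

lemma sqN_eq_zero {p : ℂ × ℝ} : sqN p = 0 ↔ p = 0 := by
  constructor
  · intro h
    have h1 := normSq_nonneg p.1
    have h2 := sq_nonneg p.2
    unfold sqN at h
    have h3 : normSq p.1 = 0 := by linarith
    have h4 : p.2 ^ 2 = 0 := by linarith
    exact Prod.ext (normSq_eq_zero.1 h3) (by simpa using h4)
  · rintro rfl; simp [sqN]

instance : (volume : Measure (ℂ × ℝ)).IsAddHaarMeasure := by
  rw [Measure.volume_eq_prod]; infer_instance

/-- A linear map multiplying the Euclidean length by `l` has determinant `± l ^ 3`. -/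
lemma abs_det_of_conformal (L : ℂ × ℝ →L[ℝ] ℂ × ℝ) {l : ℝ} (hl : 0 < l)
    (h : ∀ v, sqN (L v) = l ^ 2 * sqN v) : |L.det| = l ^ 3 := by
  set S : Set (ℂ × ℝ) := {p | sqN p ≤ 1} with hS
  have hinj : Function.Injective L := by
    rw [injective_iff_map_eq_zero]
    intro v hv
    have := h v
    rw [hv, sqN_eq_zero.2 rfl] at this
    rcases mul_eq_zero.1 this.symm with h1 | h1
    · exact absurd h1 (by positivity)
    · exact sqN_eq_zero.1 h1
  have hsurj : Function.Surjective L :=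
    (LinearMap.injective_iff_surjective (f := (L : ℂ × ℝ →ₗ[ℝ] ℂ × ℝ))).1 hinj
  have himg : L '' S = l • S := by
    ext w
    constructor
    · rintro ⟨v, hv, rfl⟩
      refine ⟨l⁻¹ • L v, ?_, smul_inv_smul₀ hl.ne' _⟩
      rw [hS, mem_ofPred_eq, sqN_smul, h, ← mul_assoc, ← mul_pow, inv_mul_cancel₀ hl.ne', one_pow,
        one_mul]
      exact hv
    · rintro ⟨v, hv, rfl⟩
      obtain ⟨u, hu⟩ := hsurj (l • v)
      refine ⟨u, ?_, hu⟩
      have := h u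
      rw [hu, sqN_smul] at this
      rw [hS, mem_ofPred_eq, ← mul_left_cancel₀ (by positivity) this]
      exact hv
  have hopen : IsOpen {p : ℂ × ℝ | sqN p < 1} := isOpen_lt continuous_sqN continuous_const
  have hpos : volume S ≠ 0 := by
    have : 0 < volume {p : ℂ × ℝ | sqN p < 1} :=
      hopen.measure_pos _ ⟨0, by simp [sqN]⟩
    exact (this.trans_le (measure_mono fun p (hp : sqN p < 1) => (hp.le : sqN p ≤ 1))).ne'
  have hfin : volume S ≠ ⊤ := by
    refine (Bornology.IsBounded.measure_lt_top ?_).ne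
    refine Metric.isBounded_iff_subset_closedBall (0 : ℂ × ℝ) |>.2 ⟨1, fun p hp => ?_⟩
    rw [mem_closedBall_zero_iff, Prod.norm_def]
    have hp : normSq p.1 + p.2 ^ 2 ≤ 1 := hp
    have h1 := normSq_nonneg p.1
    have h2 := sq_nonneg p.2
    rw [max_le_iff, Real.norm_eq_abs]
    constructor
    · rw [← sq_le_one_iff₀ (norm_nonneg _), Complex.sq_norm]; linarith
    · rw [← sq_le_one_iff_abs_le_one]; linarith
  have hdet := Measure.addHaar_image_continuousLinearMap (volume : Measure (ℂ × ℝ)) L S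
  rw [himg, Measure.addHaar_smul] at hdet
  have hfr : Module.finrank ℝ (ℂ × ℝ) = 3 := by
    rw [Module.finrank_prod, Complex.finrank_real_complex, Module.finrank_self]
  rw [hfr] at hdet
  have h3 := (ENNReal.mul_left_inj hpos hfin).1 hdet
  rw [ENNReal.ofReal_eq_ofReal_iff (abs_nonneg _) (abs_nonneg _)] at h3
  rw [← h3, abs_of_pos (by positivity)]

lemma differentiableAt_actFun (M : GL (Fin 2) ℂ) (P : H3) :
    DifferentiableAt ℝ (actFun M.1) P.1 := by
  have hd := (den_pos M P).ne'
  have hN : ∀ w : ℂ × ℝ → ℂ, DifferentiableAt ℝ w P.1 →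
      DifferentiableAt ℝ (fun p => normSq (w p)) P.1 := by
    intro w hw
    have h1 := Complex.reCLM.differentiableAt.comp P.1 hw
    have h2 := Complex.imCLM.differentiableAt.comp P.1 hw
    exact (h1.mul h1).add (h2.mul h2)
  have hC : ∀ w : ℂ × ℝ → ℂ, DifferentiableAt ℝ w P.1 →
      DifferentiableAt ℝ (fun p => conj (w p)) P.1 := fun w hw =>
    Complex.conjCLE.differentiableAt.comp P.1 hw
  have hR : ∀ w : ℂ × ℝ → ℝ, DifferentiableAt ℝ w P.1 →
      DifferentiableAt ℝ (fun p => (w p : ℂ)) P.1 := fun w hw =>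
    Complex.ofRealCLM.differentiableAt.comp P.1 hw
  have h1 : DifferentiableAt ℝ (fun p : ℂ × ℝ => p.1) P.1 := differentiableAt_fst
  have h2 : DifferentiableAt ℝ (fun p : ℂ × ℝ => p.2) P.1 := differentiableAt_snd
  have hden : DifferentiableAt ℝ (fun p : ℂ × ℝ =>
      normSq (M.1 1 0 * p.1 + M.1 1 1) + normSq (M.1 1 0) * p.2 ^ 2) P.1 :=
    (hN _ ((h1.const_mul _).add_const _)).add ((h2.pow 2).const_mul _)
  unfold actFun
  refine DifferentiableAt.prodMk ?_ ?_
  · simp only [div_eq_mul_inv]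
    refine DifferentiableAt.mul ?_ ((hR _ hden).inv (by exact_mod_cast hd))
    exact (((h1.const_mul _).add_const _).mul (hC _ ((h1.const_mul _).add_const _))).add
      (((hR _ h2).pow 2).const_mul _)
  · simp only [div_eq_mul_inv]
    exact (h2.const_mul _).mul (hden.inv hd)

lemma continuous_smul_H3 (M : GL (Fin 2) ℂ) : Continuous fun P : H3 => M • P := by
  refine Continuous.subtype_mk (f := fun P : H3 => actFun M.1 P.1) ?_ _
  rw [continuous_iff_continuousAt]
  intro P
  exact (differentiableAt_actFun M P).continuousAt.comp continuous_subtype_val.continuousAt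

/-- The Jacobian of a Moebius transformation. -/
lemma abs_det_fderiv_actFun (M : GL (Fin 2) ℂ) (P : H3) :
    |(fderiv ℝ (actFun M.1) P.1).det| = (‖M.1.det‖ / den M.1 P) ^ 3 := by
  have hpos : 0 < ‖M.1.det‖ / den M.1 P :=
    div_pos (norm_pos_iff.2 M.det.ne_zero) (den_pos M P)
  refine abs_det_of_conformal _ hpos fun v => ?_
  have hF := (differentiableAt_actFun M P).hasFDerivAt
  -- the curve `t ↦ P + t v`
  have hc : HasDerivAt (fun t : ℝ => P.1 + t • v) v 0 := by
    simpa using ((hasDerivAt_id (0 : ℝ)).smul_const v).const_add P.1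
  have hF0 : HasFDerivAt (actFun M.1) (fderiv ℝ (actFun M.1) P.1) (P.1 + (0 : ℝ) • v) := by
    simpa using hF
  have hcomp := hF0.comp_hasDerivAt (0 : ℝ) hc
  have hs := hasDerivAt_iff_tendsto_slope_zero.1 hcomp
  have hs2 := (continuous_sqN.tendsto _).comp hs
  have hopen : IsOpen {t : ℝ | 0 < (P.1 + t • v).2} :=
    isOpen_lt continuous_const (by fun_prop)
  have hmem : (0 : ℝ) ∈ {t : ℝ | 0 < (P.1 + t • v).2} := by
    simpa using P.2
  have hdc : Tendsto (fun t : ℝ => normSq (M.1 1 0 * (P.1 + t • v).1 + M.1 1 1)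
      + normSq (M.1 1 0) * (P.1 + t • v).2 ^ 2) (𝓝 0) (𝓝 (den M.1 P)) := by
    have hcc : Continuous fun t : ℝ => normSq (M.1 1 0 * (P.1 + t • v).1 + M.1 1 1)
      + normSq (M.1 1 0) * (P.1 + t • v).2 ^ 2 :=
      (continuous_normSq.comp (by fun_prop)).add (by fun_prop)
    have h0 := hcc.tendsto 0
    simpa [den, H3.z, H3.r] using h0
  have hlim : Tendsto (fun t : ℝ => ‖M.1.det‖ ^ 2 * sqN v / (den M.1 P *
      (normSq (M.1 1 0 * (P.1 + t • v).1 + M.1 1 1)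
      + normSq (M.1 1 0) * (P.1 + t • v).2 ^ 2))) (𝓝[≠] 0)
      (𝓝 (‖M.1.det‖ ^ 2 * sqN v / (den M.1 P * den M.1 P))) :=
    (tendsto_const_nhds.div (tendsto_const_nhds.mul hdc)
      (mul_pos (den_pos M P) (den_pos M P)).ne').mono_left nhdsWithin_le_nhds
  refine (tendsto_nhds_unique (hs2.congr' ?_) hlim).trans (by rw [div_pow]; ring)
  filter_upwards [nhdsWithin_le_nhds (hopen.mem_nhds hmem), self_mem_nhdsWithin] with t ht ht0
  have ht0 : t ≠ 0 := ht0
  set Q : H3 := ⟨P.1 + t • v, ht⟩ with hQ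
  have hkey := sqN_act_sub M Q P
  have hd1 := den_pos M P
  have hd2 := den_pos M Q
  have hdQ : normSq (M.1 1 0 * (P.1 + t • v).1 + M.1 1 1)
      + normSq (M.1 1 0) * (P.1 + t • v).2 ^ 2 = den M.1 Q := rfl
  rw [hdQ]
  simp only [Function.comp_apply, zero_add, zero_smul, add_zero]
  have e1 : actFun M.1 (P.1 + t • v) = (M • Q).1 := rfl
  rw [e1, actFun_eq, sqN_smul]
  have e2 : Q.1 - P.1 = t • v := by rw [hQ]; simp
  rw [e2, sqN_smul] at hkey
  field_simp
  linear_combination hkey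

lemma lintegral_hypVol (f : H3 → ENNReal) :
    ∫⁻ P, f P ∂hypVol = ∫⁻ P : H3, ENNReal.ofReal ((P.r ^ 3)⁻¹) * f P
      ∂(Measure.comap Subtype.val (volume : Measure (ℂ × ℝ))) := by
  unfold hypVol
  rw [lintegral_withDensity_eq_lintegral_mul_non_measurable]
  · rfl
  · exact Measurable.ennreal_ofReal (((measurable_snd.comp measurable_subtype_coe).pow_const 3).inv)
  · exact .of_forall fun P => ENNReal.ofReal_lt_top

lemma measurableSet_upper : MeasurableSet {p : ℂ × ℝ | 0 < p.2} :=
  measurableSet_lt measurable_const measurable_snd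

/-- Moebius transformations preserve the hyperbolic volume. -/
lemma measurePreserving_smul (M : GL (Fin 2) ℂ) :
    MeasurePreserving (fun P : H3 => M • P) hypVol hypVol := by
  have hm := (continuous_smul_H3 M).measurable
  refine ⟨hm, Measure.ext fun S hS => ?_⟩
  rw [Measure.map_apply hm hS, ← lintegral_indicator_one (hm hS), ← lintegral_indicator_one hS,
    lintegral_hypVol, lintegral_hypVol]
  set G : ℂ × ℝ → ENNReal := fun p => ENNReal.ofReal ((p.2 ^ 3)⁻¹) *
    (Subtype.val '' S).indicator 1 p with hG
  have hind : ∀ P : H3, S.indicator (1 : H3 → ENNReal) P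
      = (Subtype.val '' S).indicator (1 : ℂ × ℝ → ENNReal) P.1 := by
    intro P
    by_cases h : P ∈ S
    · rw [indicator_of_mem h, indicator_of_mem (mem_image_of_mem _ h)]; rfl
    · rw [indicator_of_notMem h, indicator_of_notMem]
      rintro ⟨Q, hQ, hQP⟩
      exact h (Subtype.ext hQP ▸ hQ)
  have hsub : ∀ g : ℂ × ℝ → ENNReal, ∫⁻ P : H3, g P.1
      ∂(Measure.comap Subtype.val (volume : Measure (ℂ × ℝ))) = ∫⁻ p in {p | 0 < p.2}, g p := by
    intro g
    exact lintegral_subtype_comap measurableSet_upper g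
  have himg : actFun M.1 '' {p | 0 < p.2} = {p | 0 < p.2} := by
    ext p
    constructor
    · rintro ⟨q, hq, rfl⟩
      exact (M • (⟨q, hq⟩ : H3)).2
    · intro hp
      refine ⟨(M⁻¹ • (⟨p, hp⟩ : H3)).1, (M⁻¹ • (⟨p, hp⟩ : H3)).2, ?_⟩
      rw [actFun_eq, smul_inv_smul]
  have hinj : InjOn (actFun M.1) {p | 0 < p.2} := by
    intro p hp q hq hpq
    have : M • (⟨p, hp⟩ : H3) = M • (⟨q, hq⟩ : H3) := Subtype.ext hpq
    exact congrArg Subtype.val (smul_left_cancel M this)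
  have h1 : ∫⁻ P : H3, ENNReal.ofReal ((P.r ^ 3)⁻¹) * S.indicator 1 P
      ∂(Measure.comap Subtype.val (volume : Measure (ℂ × ℝ))) = ∫⁻ p in {p | 0 < p.2}, G p := by
    rw [← hsub]
    refine lintegral_congr fun P => ?_
    rw [hind]; rfl
  rw [h1, ← himg, lintegral_image_eq_lintegral_abs_det_fderiv_mul volume measurableSet_upper
    (f' := fderiv ℝ (actFun M.1))
    (fun p hp => ((differentiableAt_actFun M ⟨p, hp⟩).hasFDerivAt).hasFDerivWithinAt) hinj,
    ← hsub]
  refine lintegral_congr fun P => ?_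
  rw [abs_det_fderiv_actFun, hG]
  rw [← mul_assoc, ← ENNReal.ofReal_mul (by
    have := (den_pos M P).le
    positivity)]
  have e1 : (actFun M.1 P.1).2 = H3.r (M • P) := rfl
  have e2 : ((fun P => M • P) ⁻¹' S).indicator (1 : H3 → ENNReal) P = S.indicator 1 (M • P) := rfl
  rw [e1, e2, hind, actFun_eq, r_smul]
  congr 2
  have h2 := (den_pos M P).ne'
  have h4 : ‖M.1.det‖ ≠ 0 := norm_ne_zero_iff.2 M.det.ne_zero
  field_simp

/-! ### The action of the Bianchi group -/

lemma gam_smul (γ : Gam σ) (P : H3) : γ • P = γ.1 P := rfl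

/-- The transformation of `H3` given by an element of `SL₂(𝓞 K)`. -/
def toGam : SL(2, 𝓞 K) →* Gam σ :=
  ((MulAction.toPermHom (GL (Fin 2) ℂ) H3).comp (incl σ)).rangeRestrict

lemma toGam_surjective : Function.Surjective (toGam σ) :=
  MonoidHom.rangeRestrict_surjective _

@[simp] lemma toGam_smul (γ : SL(2, 𝓞 K)) (P : H3) : toGam σ γ • P = incl σ γ • P := rfl

instance countable_SL2 : Countable SL(2, 𝓞 K) := by
  have : Countable (Matrix (Fin 2) (Fin 2) (𝓞 K)) :=
    inferInstanceAs (Countable (Fin 2 → Fin 2 → 𝓞 K))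
  exact Subtype.countable

instance countable_Gam (σ : K →+* ℂ) : Countable (Gam σ) :=
  (toGam_surjective σ).countable

instance measurableConstSMul_Gam (σ : K →+* ℂ) : MeasurableConstSMul (Gam σ) H3 where
  measurable_const_smul γ := by
    obtain ⟨M, rfl⟩ := toGam_surjective σ γ
    exact (continuous_smul_H3 (incl σ M)).measurable

instance smulInvariant_Gam (σ : K →+* ℂ) : SMulInvariantMeasure (Gam σ) H3 hypVol where
  measure_preimage_smul γ S hS := by
    obtain ⟨M, rfl⟩ := toGam_surjective σ γ
    exact (measurePreserving_smul (incl σ M)).measure_preimage hS.nullMeasurableSet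

/-- The translation by an integer. -/
def trl (b : 𝓞 K) : SL(2, 𝓞 K) := ⟨!![1, b; 0, 1], by simp⟩

@[simp] lemma trl_10 (b : 𝓞 K) : trl b 1 0 = 0 := rfl
@[simp] lemma trl_11 (b : 𝓞 K) : trl b 1 1 = 1 := rfl
@[simp] lemma trl_00 (b : 𝓞 K) : trl b 0 0 = 1 := rfl
@[simp] lemma trl_01 (b : 𝓞 K) : trl b 0 1 = b := rfl

@[simp] lemma qf_zero_one (P : H3) : qf σ 0 1 P = 1 := by simp [qf]

lemma z_incl_smul (γ : SL(2, 𝓞 K)) (P : H3) : (incl σ γ • P).z = ((emb σ (γ 0 0) * P.z + emb σ (γ 0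
    1)) * conj (emb σ (γ 1 0) * P.z + emb σ (γ 1 1)) + emb σ (γ 0 0) * conj (emb σ (γ 1 0)) * (P.r :
    ℂ) ^ 2) / (qf σ (γ 1 0) (γ 1 1) P : ℂ) := rfl

lemma trl_smul (b : 𝓞 K) (P : H3) : incl σ (trl b) • P = mk (P.z + emb σ b) P.r P.r_pos := by
  apply H3.ext'
  · rw [z_incl_smul]; simp
  · rw [r_incl_smul]; simp

lemma trl_add (b c : 𝓞 K) : trl (b + c) = trl b * trl c := by
  ext i j
  fin_cases i <;> fin_cases j <;> simp [Matrix.mul_apply, add_comm]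

lemma trl_mem_ParInf (b : 𝓞 K) : trl b ∈ ParInf K := ⟨rfl, Or.inl rfl⟩

/-- Elements of `ParInf` act as translations. -/
lemma parInf_smul {N : SL(2, 𝓞 K)} (hN : N ∈ ParInf K) : ∃ b : 𝓞 K, toGam σ N = toGam σ (trl b) :=
    by
  obtain ⟨h0, h1⟩ := hN
  have hdet := N.2
  rw [Matrix.det_fin_two] at hdet
  rcases h1 with h1 | h1
  · refine ⟨N 0 1, ?_⟩
    congr 1
    ext i j
    rw [h0, h1] at hdet
    fin_cases i <;> fin_cases j <;> simp [h0, h1]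
    simpa using hdet
  · refine ⟨-N 0 1, ?_⟩
    rw [h0, h1] at hdet
    have h00 : N 0 0 = -1 := by
      have : -N 0 0 = 1 := by simpa using hdet
      exact neg_eq_iff_eq_neg.1 this
    apply Subtype.ext
    ext1 P
    change incl σ N • P = incl σ (trl _) • P
    rw [trl_smul]
    apply H3.ext'
    · rw [z_incl_smul, h00, h0, h1]; simp [qf, add_comm]
    · rw [r_incl_smul, h0, h1]; simp [qf]

/-- Only `1` and `-1` act trivially. -/
lemma mem_ker_toGam {N : SL(2, 𝓞 K)} (hN : toGam σ N = 1) : N ∈ ParInf K := by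
  have hP : ∀ P : H3, incl σ N • P = P := fun P => by
    have : toGam σ N • P = P := by rw [hN, one_smul]
    exact this
  have hq : ∀ P : H3, qf σ (N 1 0) (N 1 1) P = 1 := by
    intro P
    have h := congrArg H3.r (hP P)
    rw [r_incl_smul] at h
    have h1 := P.r_pos
    have h2 : qf σ (N 1 0) (N 1 1) P ≠ 0 := by
      intro h0; rw [h0, div_zero] at h; exact h1.ne h
    rw [div_eq_iff h2] at h
    nlinarith [mul_left_cancel₀ h1.ne' (h.symm.trans (mul_one _).symm)]
  have ha := hq (mk 0 1 one_pos)
  have hb := hq (mk 0 2 two_pos)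
  simp only [qf, mk_z, mk_r, mul_zero, zero_add] at ha hb
  have hc : normSq (emb σ (N 1 0)) = 0 := by linarith
  have hc0 : N 1 0 = 0 := by
    by_contra h; exact emb_ne_zero σ h (normSq_eq_zero.1 hc)
  have hdet := N.2
  rw [Matrix.det_fin_two, hc0, mul_zero, sub_zero] at hdet
  have hz := congrArg H3.z (hP (mk 1 1 one_pos))
  have hz0 := congrArg H3.z (hP (mk 0 1 one_pos))
  rw [z_incl_smul, hq] at hz hz0
  simp only [mk_z, mk_r, hc0, map_zero, mul_zero, zero_mul, zero_add, mul_one, ofReal_one,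
    div_one, add_zero] at hz hz0
  rw [add_mul, hz0, add_zero] at hz
  have hdet' : emb σ (N 0 0) * emb σ (N 1 1) = 1 := by rw [← map_mul, hdet, map_one]
  have hreal : conj (emb σ (N 1 1)) = emb σ (N 1 1) := by
    have h0 : emb σ (N 0 0) ≠ 0 := left_ne_zero_of_mul_eq_one hz
    exact mul_left_cancel₀ h0 (hz.trans hdet'.symm)
  have hone : emb σ (N 1 1) * emb σ (N 1 1) = 1 := by
    have : (normSq (emb σ (N 1 1)) : ℂ) = 1 := by
      have : normSq (emb σ (N 1 1)) = 1 := by linarith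
      rw [this, ofReal_one]
    rw [← this, ← mul_conj, hreal]
  refine ⟨hc0, ?_⟩
  rcases mul_self_eq_one_iff.1 hone with h | h
  · exact Or.inl (emb_injective σ (by rw [h, map_one]))
  · exact Or.inr (emb_injective σ (by rw [h, map_neg, map_one]))

/-! ### Cosets, rows and unfolding -/

section Cosets

/-- The cosets `Γ'_∞ \ Γ`, which index the Eisenstein series. -/
abbrev Cosets (K : Type*) [Field K] [NumberField K] : Type _ :=
  Quotient (QuotientGroup.rightRel (ParInf K))

variable [IsTotallyComplex K] [hdeg : Fact (Module.finrank ℚ K = 2)]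

/-- The part of `φ` over the fundamental cell of the lattice of translations. -/
def onCell (φ : H3 → ℂ) : H3 → ℂ := {P : H3 | P.z ∈ cell σ}.indicator φ

/-- For each coset the element of `Γ` that moves `P` over the fundamental cell. -/
def cellRep (P : H3) (c : Cosets K) : Gam σ :=
  toGam σ (trl (existsUnique_add_mem_cell σ (incl σ c.out • P).z).choose * c.out)

lemma mk_eq_of_toGam {M N : SL(2, 𝓞 K)} {b : 𝓞 K} (h : toGam σ M = toGam σ (trl b * N)) :
    (Quotient.mk'' M : Cosets K) = Quotient.mk'' N := by
  rw [Quotient.eq'', QuotientGroup.rightRel_apply]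
  have h1 : toGam σ (M⁻¹ * (trl b * N)) = 1 := by rw [map_mul, ← h, map_inv, inv_mul_cancel]
  have h2 : toGam σ (N * M⁻¹ * trl b) = 1 := by
    have := congrArg (fun g => toGam σ N * g * (toGam σ N)⁻¹) h1
    simp only [mul_one, mul_inv_cancel] at this
    rw [← this, ← map_inv, ← map_mul, ← map_mul]
    congr 1; group
  have h3 := (ParInf K).mul_mem (mem_ker_toGam σ h2) ((ParInf K).inv_mem (trl_mem_ParInf b))
  rwa [mul_assoc, mul_inv_cancel, mul_one] at h3

lemma cellRep_injective (P : H3) : Function.Injective (cellRep σ P) := by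
  intro c c' h
  unfold cellRep at h
  set b := (existsUnique_add_mem_cell σ (incl σ c.out • P).z).choose
  set b' := (existsUnique_add_mem_cell σ (incl σ c'.out • P).z).choose
  have h1 : toGam σ c.out = toGam σ (trl (b' - b) * c'.out) := by
    have h2 := congrArg (fun g => (toGam σ (trl b))⁻¹ * g) h
    simp only [map_mul, inv_mul_cancel_left] at h2
    rw [h2, map_mul, ← mul_assoc]
    congr 1
    rw [← map_inv, ← map_mul]
    congr 1
    rw [inv_mul_eq_iff_eq_mul, ← trl_add, add_sub_cancel]
  have h2 := mk_eq_of_toGam σ h1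
  simpa [Quotient.mk''_eq_mk] using h2

lemma cellRep_smul_z (P : H3) (c : Cosets K) : (cellRep σ P c • P).z ∈ cell σ := by
  have h := (existsUnique_add_mem_cell σ (incl σ c.out • P).z).choose_spec.1
  unfold cellRep
  rw [toGam_smul, map_mul, mul_smul, trl_smul]
  exact h

/-- If `γ P` lies over the fundamental cell then `γ` is one of the chosen representatives. -/
lemma mem_range_cellRep (P : H3) (γ : Gam σ) (h : (γ • P).z ∈ cell σ) : γ ∈ Set.range (cellRep σ P)
    := by
  obtain ⟨M, rfl⟩ := toGam_surjective σ γ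
  set c : Cosets K := Quotient.mk'' M with hc
  refine ⟨c, ?_⟩
  have h1 : (Quotient.mk'' c.out : Cosets K) = Quotient.mk'' M := by
    rw [Quotient.mk''_eq_mk, Quotient.out_eq]
  rw [Quotient.eq'', QuotientGroup.rightRel_apply] at h1
  obtain ⟨b, hb⟩ := parInf_smul σ h1
  have h2 : toGam σ M = toGam σ (trl b * c.out) := by
    rw [map_mul, ← hb, ← map_mul, inv_mul_cancel_right]
  rw [h2, toGam_smul, map_mul, mul_smul, trl_smul, mk_z] at h
  rw [h2]
  unfold cellRep
  congr 3
  exact (existsUnique_add_mem_cell σ (incl σ c.out • P).z).unique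
    (existsUnique_add_mem_cell σ (incl σ c.out • P).z).choose_spec.1 h

/-- The sum over `Γ'_∞ \ Γ` as a sum over `Γ`. -/
lemma sum_cosets_eq {φ : H3 → ℂ} (hφ : ∀ b P, φ (incl σ (trl b) • P) = φ P) (P : H3) : ∑' c : Cosets
    K, φ (incl σ c.out • P) = ∑' γ : Gam σ, onCell σ φ (γ • P) := by
  have hsupp : Function.support (fun γ : Gam σ => onCell σ φ (γ • P)) ⊆
      Set.range (cellRep σ P) := by
    intro γ hγ
    apply mem_range_cellRep
    by_contra h
    exact hγ (indicator_of_notMem (s := {P : H3 | P.z ∈ cell σ}) h φ)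
  rw [← (cellRep_injective σ P).tsum_eq hsupp]
  refine tsum_congr fun c => ?_
  have h1 : onCell σ φ (cellRep σ P c • P) = φ (cellRep σ P c • P) :=
    indicator_of_mem (s := {P : H3 | P.z ∈ cell σ}) (cellRep_smul_z σ P c) φ
  rw [h1]
  unfold cellRep
  rw [toGam_smul, map_mul, mul_smul, hφ]

/-- Unfolding of the sum over `Γ'_∞ \ Γ`. -/
theorem unfolding {D : Set H3} (hD : IsFundamentalDomain (Gam σ) D hypVol) {F φ : H3 → ℂ}
    (hF : ∀ γ ∈ Gam σ, ∀ P, F (γ P) = F P) (hφ : ∀ b P, φ (incl σ (trl b) • P) = φ P)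
    (hint : Integrable (onCell σ (F * φ)) hypVol) :
    ∫ P in D, F P * ∑' c : Cosets K, φ (incl σ c.out • P) ∂hypVol
    = ∫ P, onCell σ (F * φ) P ∂hypVol := by
  have hmp : ∀ γ : Gam σ, MeasurePreserving (fun P : H3 => γ • P) hypVol hypVol := fun γ =>
    MeasureTheory.measurePreserving_smul γ hypVol
  have hi : ∀ γ : Gam σ, Integrable (fun P => onCell σ (F * φ) (γ • P)) (hypVol.restrict D) :=
    fun γ => ((hmp γ).integrable_comp_of_integrable hint).integrableOn
  have hs : Summable fun γ : Gam σ => ∫ P in D, ‖onCell σ (F * φ) (γ • P)‖ ∂hypVol := by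
    have h1 := hD.lintegral_eq_tsum'' fun P => ‖onCell σ (F * φ) P‖ₑ
    have h2 : ∑' γ : Gam σ, ∫⁻ P in D, ‖onCell σ (F * φ) (γ • P)‖ₑ ∂hypVol ≠ ⊤ := by
      rw [← h1]; exact hint.2.ne
    refine (ENNReal.summable_toReal h2).congr fun γ => ?_
    rw [integral_norm_eq_lintegral_enorm (hi γ).1]
  have h := (hasSum_integral_of_summable_integral_norm hi hs).tsum_eq
  rw [hD.integral_eq_tsum'' _ hint, h]
  refine integral_congr_ae (.of_forall fun P => ?_)
  beta_reduce
  rw [sum_cosets_eq σ hφ, ← tsum_mul_left]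
  refine tsum_congr fun γ => ?_
  unfold onCell
  by_cases hz : γ • P ∈ {P : H3 | P.z ∈ cell σ}
  · rw [indicator_of_mem hz, indicator_of_mem hz, Pi.mul_apply, gam_smul, hF γ.1 γ.2]
  · rw [indicator_of_notMem hz, indicator_of_notMem hz, mul_zero]

end Cosets

/-! ### Sums over pairs of integers and the zeta function -/

/-- The non-zero integers. -/
abbrev NZ (K : Type*) [Field K] [NumberField K] : Type _ := {μ : 𝓞 K // μ ≠ 0}

/-- The non-zero pairs of integers. -/
abbrev Pairs (K : Type*) [Field K] [NumberField K] : Type _ := {p : 𝓞 K × 𝓞 K // p ≠ 0}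

/-- The coprime pairs of integers. -/
abbrev Cop (K : Type*) [Field K] [NumberField K] : Type _ :=
  {p : 𝓞 K × 𝓞 K // IsCoprime p.1 p.2}

lemma isCoprime_row (γ : SL(2, 𝓞 K)) : IsCoprime (γ 1 0) (γ 1 1) := by
  have h := γ.2
  rw [Matrix.det_fin_two] at h
  exact ⟨-γ 0 1, γ 0 0, by linear_combination h⟩

/-- Lower rows of coset representatives, up to sign. -/
def rowMap (p : Cosets K × ℤˣ) : Cop K :=
  ⟨((p.2 : ℤ) • p.1.out 1 0, (p.2 : ℤ) • p.1.out 1 1), by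
    rcases Int.units_eq_one_or p.2 with h | h
    · simpa [h] using isCoprime_row p.1.out
    · simpa [h] using (isCoprime_row p.1.out).neg_neg⟩

lemma mem_ParInf_of_row {M N : SL(2, 𝓞 K)} {ε : 𝓞 K} (hε : ε = 1 ∨ ε = -1)
    (h0 : N 1 0 = ε * M 1 0) (h1 : N 1 1 = ε * M 1 1) : N * M⁻¹ ∈ ParInf K := by
  have hM := M.2
  rw [Matrix.det_fin_two] at hM
  have e : ∀ j, (N * M⁻¹) 1 j = N 1 0 * M⁻¹ 0 j + N 1 1 * M⁻¹ 1 j := by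
    intro j
    rw [Matrix.SpecialLinearGroup.coe_mul, Matrix.mul_apply, Fin.sum_univ_two]
  have i00 : M⁻¹ 0 0 = M 1 1 := by rw [Matrix.SpecialLinearGroup.SL2_inv_expl]; rfl
  have i01 : M⁻¹ 0 1 = -M 0 1 := by rw [Matrix.SpecialLinearGroup.SL2_inv_expl]; rfl
  have i10 : M⁻¹ 1 0 = -M 1 0 := by rw [Matrix.SpecialLinearGroup.SL2_inv_expl]; rfl
  have i11 : M⁻¹ 1 1 = M 0 0 := by rw [Matrix.SpecialLinearGroup.SL2_inv_expl]; rfl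
  have r0 : (N * M⁻¹) 1 0 = 0 := by rw [e, h0, h1, i00, i10]; ring
  have r1 : (N * M⁻¹) 1 1 = ε := by
    rw [e, h0, h1, i01, i11]; linear_combination ε * hM
  exact ⟨r0, by rw [r1]; exact hε⟩

lemma rowMap_bijective : Function.Bijective (rowMap (K := K)) := by
  have hcast : ∀ ε : ℤˣ, ((ε : ℤ) : 𝓞 K) = 1 ∨ ((ε : ℤ) : 𝓞 K) = -1 := by
    intro ε
    rcases Int.units_eq_one_or ε with h | h <;> simp [h]
  have hsq : ∀ ε : ℤˣ, ((ε : ℤ) : 𝓞 K) * ((ε : ℤ) : 𝓞 K) = 1 := by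
    intro ε
    rcases Int.units_eq_one_or ε with h | h <;> simp [h]
  constructor
  · rintro ⟨c, ε⟩ ⟨c', ε'⟩ h
    simp only [rowMap, Subtype.mk.injEq, Prod.mk.injEq, zsmul_eq_mul] at h
    obtain ⟨h0, h1⟩ := h
    have hm : c'.out * (c.out)⁻¹ ∈ ParInf K := by
      refine mem_ParInf_of_row (ε := ((ε' : ℤ) : 𝓞 K) * ((ε : ℤ) : 𝓞 K)) ?_ ?_ ?_
      · rcases hcast ε with a | a <;> rcases hcast ε' with b | b <;> simp [a, b]
      · rw [mul_assoc, h0, ← mul_assoc, hsq, one_mul]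
      · rw [mul_assoc, h1, ← mul_assoc, hsq, one_mul]
    have hcc : c = c' := by
      rw [← Quotient.out_eq c, ← Quotient.out_eq c']
      exact Quotient.sound (by
        change QuotientGroup.rightRel (ParInf K) _ _
        rwa [QuotientGroup.rightRel_apply])
    subst hcc
    congr 1
    have hcop := isCoprime_row c.out
    have hne : c.out 1 0 ≠ 0 ∨ c.out 1 1 ≠ 0 := by
      by_contra hcon
      push Not at hcon
      rw [hcon.1, hcon.2] at hcop
      exact not_isCoprime_zero_zero hcop
    have : ((ε : ℤ) : 𝓞 K) = ((ε' : ℤ) : 𝓞 K) := by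
      rcases hne with hne | hne
      · exact mul_right_cancel₀ hne h0
      · exact mul_right_cancel₀ hne h1
    exact Units.ext (Int.cast_injective this)
  · rintro ⟨⟨x, y⟩, hxy⟩
    obtain ⟨N, h0, h1⟩ := hxy.exists_SL2_row 1
    set c : Cosets K := Quotient.mk'' N with hc
    have h : (Quotient.mk'' c.out : Cosets K) = Quotient.mk'' N := by
      rw [Quotient.mk''_eq_mk, Quotient.out_eq]
    rw [Quotient.eq'', QuotientGroup.rightRel_apply] at h
    have hN : N = N * (c.out)⁻¹ * c.out := by rw [inv_mul_cancel_right]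
    obtain ⟨p0, p1⟩ := h
    set T := N * (c.out)⁻¹ with hT
    have e : ∀ j, N 1 j = T 1 1 * c.out 1 j := by
      intro j
      rw [hN, Matrix.SpecialLinearGroup.coe_mul, Matrix.mul_apply, Fin.sum_univ_two, p0, zero_mul,
        zero_add]
    have f0 := (e 0).symm.trans h0
    have f1 := (e 1).symm.trans h1
    rcases p1 with p1 | p1 <;> rw [p1] at f0 f1
    · exact ⟨(c, 1), Subtype.ext (Prod.ext (by simpa [rowMap] using f0)
        (by simpa [rowMap] using f1))⟩
    · exact ⟨(c, -1), Subtype.ext (Prod.ext (by simpa [rowMap] using f0)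
        (by simpa [rowMap] using f1))⟩

section Sums

variable [IsTotallyComplex K] [hdeg : Fact (Module.finrank ℚ K = 2)]

lemma one_le_norm_pair (p : Pairs K) : 1 ≤ ‖emb σ p.1.1‖ ^ 2 + ‖emb σ p.1.2‖ ^ 2 := by
  obtain ⟨⟨c, d⟩, hp⟩ := p
  by_cases hc : c = 0
  · have hd : d ≠ 0 := by rintro rfl; exact hp (by rw [hc]; rfl)
    have := one_le_norm_emb σ hd
    nlinarith [sq_nonneg ‖emb σ c‖]
  · have := one_le_norm_emb σ hc
    nlinarith [sq_nonneg ‖emb σ d‖]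

lemma summable_pairs {A : ℝ} (hA : 2 < A) :
    Summable fun p : Pairs K => (‖emb σ p.1.1‖ ^ 2 + ‖emb σ p.1.2‖ ^ 2) ^ (-A) := by
  have h1 := summable_one_add_rpow σ (B := A / 2) (by linarith)
  have h2 : Summable fun p : 𝓞 K × 𝓞 K =>
      (1 + ‖emb σ p.1‖ ^ 2) ^ (-(A / 2)) * (1 + ‖emb σ p.2‖ ^ 2) ^ (-(A / 2)) :=
    h1.mul_of_nonneg h1 (fun _ => by positivity) (fun _ => by positivity)
  have h3 := (h2.comp_injective (Subtype.val_injective (p := fun p : 𝓞 K × 𝓞 K => p ≠ 0))).mul_left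
    ((2 : ℝ) ^ A)
  refine Summable.of_nonneg_of_le (fun p => by positivity) (fun p => ?_) h3
  have hS := one_le_norm_pair σ p
  simp only [Function.comp_apply]
  set a := ‖emb σ p.1.1‖ ^ 2
  set b := ‖emb σ p.1.2‖ ^ 2
  have ha : 0 ≤ a := sq_nonneg _
  have hb : 0 ≤ b := sq_nonneg _
  rw [← Real.mul_rpow (by positivity) (by positivity)]
  -- `(1 + a) (1 + b) ≤ (2 (a + b))²`
  have h4 : (1 + a) * (1 + b) ≤ (2 * (a + b)) ^ 2 := by nlinarith
  calc (a + b) ^ (-A) = 2 ^ A * (2 * (a + b)) ^ (-A) := by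
        rw [Real.mul_rpow two_pos.le (by positivity), ← mul_assoc, ← Real.rpow_add two_pos]
        simp
    _ = 2 ^ A * ((2 * (a + b)) ^ 2) ^ (-(A / 2)) := by
        rw [← Real.rpow_natCast, ← Real.rpow_mul (by positivity)]
        congr 2; push_cast; ring
    _ ≤ _ := by
        gcongr 2 ^ A * ?_
        exact Real.rpow_le_rpow_of_nonpos (by positivity) h4 (by linarith)

/-- The form `|c z + d|² + |c|² r²` is positive definite, uniformly where `z` is bounded and `r` is
bounded below. -/
lemma exists_qf_lower (R : ℝ) {δ : ℝ} (hδ : 0 < δ) : ∃ C : ℝ, 0 < C ∧ ∀ P : H3, ‖P.z‖ ≤ R → δ ≤ P.r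
    → ∀ c d : 𝓞 K, ‖emb σ c‖ ^ 2 + ‖emb σ d‖ ^ 2 ≤ C * qf σ c d P := by
  refine ⟨2 + (2 * R ^ 2 + 1) / δ ^ 2, by positivity, fun P hz hr c d => ?_⟩
  have h1 : ‖emb σ d‖ ^ 2 ≤ 2 * normSq (emb σ c * P.z + emb σ d) + 2 * (‖emb σ c‖ ^ 2 * R ^ 2) := by
    have e : emb σ d = (emb σ c * P.z + emb σ d) - emb σ c * P.z := by ring
    have h2 : ‖emb σ d‖ ≤ ‖emb σ c * P.z + emb σ d‖ + ‖emb σ c‖ * R := by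
      conv_lhs => rw [e]
      refine (norm_sub_le _ _).trans ?_
      rw [norm_mul]
      gcongr
    have h3 := norm_nonneg (emb σ d)
    rw [← Complex.sq_norm]
    nlinarith [sq_nonneg (‖emb σ c * P.z + emb σ d‖ - ‖emb σ c‖ * R)]
  have h4 : ‖emb σ c‖ ^ 2 ≤ (normSq (emb σ c) * P.r ^ 2) / δ ^ 2 := by
    rw [Complex.sq_norm, le_div_iff₀ (by positivity)]
    have := normSq_nonneg (emb σ c)
    gcongr
  have h5 := normSq_nonneg (emb σ c * P.z + emb σ d)
  unfold qf
  have h6 : 0 ≤ normSq (emb σ c) * P.r ^ 2 := mul_nonneg (normSq_nonneg _) (sq_nonneg _)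
  have h8 : (normSq (emb σ c) * P.r ^ 2) / δ ^ 2 * (2 * R ^ 2 + 1)
      = (2 * R ^ 2 + 1) / δ ^ 2 * (normSq (emb σ c) * P.r ^ 2) := by ring
  have h9 : 0 ≤ (2 * R ^ 2 + 1) / δ ^ 2 * normSq (emb σ c * P.z + emb σ d) := by positivity
  nlinarith

lemma qf_pos (p : Pairs K) (P : H3) : 0 < qf σ p.1.1 p.1.2 P := by
  obtain ⟨C, hC, h⟩ := exists_qf_lower σ ‖P.z‖ P.r_pos
  have h1 := (one_le_norm_pair σ p).trans (h P le_rfl le_rfl p.1.1 p.1.2)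
  by_contra hcon
  push Not at hcon
  nlinarith

lemma qf_mul (g c d : 𝓞 K) (P : H3) : qf σ (g * c) (g * d) P = ‖emb σ g‖ ^ 2 * qf σ c d P := by
  unfold qf
  rw [map_mul, map_mul, mul_assoc, ← mul_add, normSq_mul, normSq_mul, Complex.sq_norm]
  ring

lemma exists_sum_qf_le {A : ℝ} (hA : 2 < A) (R : ℝ) {δ : ℝ} (hδ : 0 < δ) : ∃ C : ℝ, 0 < C ∧ ∀ P :
    H3, ‖P.z‖ ≤ R → δ ≤ P.r → Summable (fun p : Pairs K => qf σ p.1.1 p.1.2 P ^ (-A)) ∧ ∑' p : Pairs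
    K, qf σ p.1.1 p.1.2 P ^ (-A) ≤ C := by
  obtain ⟨C, hC, h⟩ := exists_qf_lower σ R hδ
  have hs := (summable_pairs σ hA).mul_left (C ^ A)
  refine ⟨∑' p : Pairs K, C ^ A * (‖emb σ p.1.1‖ ^ 2 + ‖emb σ p.1.2‖ ^ 2) ^ (-A) + 1, ?_,
    fun P hz hr => ?_⟩
  · positivity
  have hle : ∀ p : Pairs K, qf σ p.1.1 p.1.2 P ^ (-A)
      ≤ C ^ A * (‖emb σ p.1.1‖ ^ 2 + ‖emb σ p.1.2‖ ^ 2) ^ (-A) := by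
    intro p
    have h1 := h P hz hr p.1.1 p.1.2
    have h2 := one_le_norm_pair σ p
    have h3 := qf_pos σ p P
    calc qf σ p.1.1 p.1.2 P ^ (-A) = C ^ A * (C * qf σ p.1.1 p.1.2 P) ^ (-A) := by
          rw [Real.mul_rpow hC.le h3.le, ← mul_assoc, ← Real.rpow_add hC]; simp
      _ ≤ _ := by
          gcongr C ^ A * ?_
          exact Real.rpow_le_rpow_of_nonpos (by linarith) h1 (by linarith)
  have hsum := Summable.of_nonneg_of_le (fun p => Real.rpow_nonneg (qf_nonneg _ _ _ _) _) hle hs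
  exact ⟨hsum, (hsum.tsum_le_tsum hle hs).trans (by linarith)⟩

lemma summable_qf {A : ℝ} (hA : 2 < A) (P : H3) :
    Summable (fun p : Pairs K => qf σ p.1.1 p.1.2 P ^ (-A)) := by
  obtain ⟨C, -, h⟩ := exists_sum_qf_le σ hA ‖P.z‖ P.r_pos
  exact (h P le_rfl le_rfl).1

end Sums

section Gcd

variable [IsPrincipalIdealRing (𝓞 K)]

lemma exists_gcd (p : Pairs K) : ∃ (g : NZ K) (q : Cop K), p.1 = (g.1 * q.1.1, g.1 * q.1.2) := by
  obtain ⟨⟨x, y⟩, hp⟩ := p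
  set I := Ideal.span {x, y}
  obtain ⟨g, hg⟩ := (IsPrincipalIdealRing.principal I).principal
  have hx : x ∈ I := Ideal.subset_span (by simp)
  have hy : y ∈ I := Ideal.subset_span (by simp)
  rw [hg] at hx hy
  obtain ⟨a, ha⟩ := Ideal.mem_span_singleton'.1 hx
  obtain ⟨b, hb⟩ := Ideal.mem_span_singleton'.1 hy
  have hgI : g ∈ I := by rw [hg]; exact Ideal.mem_span_singleton_self g
  obtain ⟨u, v, huv⟩ := Ideal.mem_span_pair.1 hgI
  have hg0 : g ≠ 0 := by
    rintro rfl
    apply hp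
    rw [← ha, ← hb]; simp
  have hab : u * a + v * b = 1 := by
    apply mul_right_cancel₀ hg0
    linear_combination huv + u * ha + v * hb
  exact ⟨⟨g, hg0⟩, ⟨(a, b), ⟨u, v, hab⟩⟩,
    Prod.ext (ha.symm.trans (mul_comm a g)) (hb.symm.trans (mul_comm b g))⟩

/-- Every non-zero pair is a non-zero integer times a coprime pair, uniquely up to units. -/
def gcdMap (p : Pairs K × (𝓞 K)ˣ) : NZ K × Cop K :=
  (⟨(exists_gcd p.1).choose.1 * p.2, mul_ne_zero (exists_gcd p.1).choose.2 p.2.ne_zero⟩,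
    ⟨(((p.2⁻¹ : (𝓞 K)ˣ) : 𝓞 K) * (exists_gcd p.1).choose_spec.choose.1.1,
      ((p.2⁻¹ : (𝓞 K)ˣ) : 𝓞 K) * (exists_gcd p.1).choose_spec.choose.1.2), by
      have h := (exists_gcd p.1).choose_spec.choose.2
      exact (isCoprime_mul_unit_left (p.2⁻¹).isUnit _ _).2 h⟩)

lemma gcdMap_mul (p : Pairs K × (𝓞 K)ˣ) :
    p.1.1 = ((gcdMap p).1.1 * (gcdMap p).2.1.1, (gcdMap p).1.1 * (gcdMap p).2.1.2) := by
  have h := (exists_gcd p.1).choose_spec.choose_spec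
  rw [h]
  simp only [gcdMap]
  have hu : (p.2 : 𝓞 K) * ((p.2⁻¹ : (𝓞 K)ˣ) : 𝓞 K) = 1 := p.2.mul_inv
  ext1
  · dsimp only
    linear_combination (-(exists_gcd p.1).choose.1
      * (exists_gcd p.1).choose_spec.choose.1.1) * hu
  · dsimp only
    linear_combination (-(exists_gcd p.1).choose.1
      * (exists_gcd p.1).choose_spec.choose.1.2) * hu

lemma gcdMap_bijective : Function.Bijective (gcdMap (K := K)) := by
  constructor
  · intro p p' h
    have h1 : p.1 = p'.1 := Subtype.ext (by rw [gcdMap_mul p, gcdMap_mul p', h])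
    obtain ⟨a, u⟩ := p
    obtain ⟨a', u'⟩ := p'
    obtain rfl : a = a' := h1
    have h2 := congrArg (fun x => x.1.1) h
    simp only [gcdMap] at h2
    have h3 := mul_left_cancel₀ (exists_gcd a).choose.2 h2
    rw [Units.ext h3]
  · rintro ⟨⟨g, hg⟩, ⟨⟨x, y⟩, hxy⟩⟩
    have hp : ((g * x, g * y) : 𝓞 K × 𝓞 K) ≠ 0 := by
      intro h
      have hx : x = 0 := (mul_eq_zero.1 (congrArg Prod.fst h)).resolve_left hg
      have hy : y = 0 := (mul_eq_zero.1 (congrArg Prod.snd h)).resolve_left hg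
      rw [hx, hy] at hxy
      exact not_isCoprime_zero_zero hxy
    set p : Pairs K := ⟨(g * x, g * y), hp⟩ with hpdef
    have h := (exists_gcd p).choose_spec.choose_spec
    set g0 := (exists_gcd p).choose with hg0
    set q0 := (exists_gcd p).choose_spec.choose with hq0
    have hx : g * x = g0.1 * q0.1.1 := congrArg Prod.fst h
    have hy : g * y = g0.1 * q0.1.2 := congrArg Prod.snd h
    obtain ⟨a, b, hab⟩ := hxy
    obtain ⟨a', b', hab'⟩ := q0.2
    set u := a * q0.1.1 + b * q0.1.2 with hu
    set v := a' * x + b' * y with hv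
    have hgu : g = g0.1 * u := by
      rw [hu]; linear_combination (-g) * hab + a * hx + b * hy
    have hgv : g0.1 = g * v := by
      rw [hv]; linear_combination (-g0.1) * hab' - a' * hx - b' * hy
    have huv : u * v = 1 := by
      apply mul_left_cancel₀ g0.2
      linear_combination (-v) * hgu - hgv
    let U : (𝓞 K)ˣ := ⟨u, v, huv, by rw [mul_comm]; exact huv⟩
    refine ⟨(p, U), ?_⟩
    have e1 : (gcdMap (p, U)).1.1 = g := hgu.symm
    have e := gcdMap_mul (p, U)
    rw [e1] at e
    refine Prod.ext (Subtype.ext e1) (Subtype.ext (Prod.ext ?_ ?_))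
    · exact mul_left_cancel₀ hg (congrArg Prod.fst e).symm
    · exact mul_left_cancel₀ hg (congrArg Prod.snd e).symm

variable [IsTotallyComplex K] [hdeg : Fact (Module.finrank ℚ K = 2)]

lemma card_norm_eq (n : ℕ) (hn : n ≠ 0) :
    Nat.card {μ : NZ K // Ideal.absNorm (Ideal.span {μ.1}) = n}
      = Nat.card {I : Ideal (𝓞 K) // Ideal.absNorm I = n} * Nat.card (𝓞 K)ˣ := by
  rw [← Nat.card_prod]
  have hgen : ∀ I : Ideal (𝓞 K), ∃ g : 𝓞 K, I = Ideal.span {g} := fun I =>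
    (IsPrincipalIdealRing.principal I).principal
  choose g hg using hgen
  have hne : ∀ I : {I : Ideal (𝓞 K) // Ideal.absNorm I = n}, g I.1 ≠ 0 := by
    rintro ⟨I, hI⟩ h0
    apply hn
    rw [← hI, hg I, h0]
    simp
  symm
  refine Nat.card_congr (Equiv.ofBijective
    (fun p : {I : Ideal (𝓞 K) // Ideal.absNorm I = n} × (𝓞 K)ˣ =>
      (⟨⟨g p.1.1 * p.2, mul_ne_zero (hne p.1) p.2.ne_zero⟩, by
        rw [Ideal.span_singleton_mul_right_unit p.2.isUnit, ← hg, p.1.2]⟩ :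
        {μ : NZ K // Ideal.absNorm (Ideal.span {μ.1}) = n})) ⟨?_, ?_⟩)
  · rintro ⟨I, u⟩ ⟨J, v⟩ h
    have h1 : g I.1 * u = g J.1 * v := congrArg (fun x => x.1.1) h
    have hIJ : I = J := by
      apply Subtype.ext
      rw [hg I.1, hg J.1, ← Ideal.span_singleton_mul_right_unit u.isUnit, h1,
        Ideal.span_singleton_mul_right_unit v.isUnit]
    subst hIJ
    rw [Units.ext (mul_left_cancel₀ (hne I) h1)]
  · rintro ⟨⟨μ, hμ⟩, hn'⟩
    have h1 := hg (Ideal.span {μ})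
    rw [Ideal.span_singleton_eq_span_singleton] at h1
    obtain ⟨u, hu⟩ := h1.symm
    exact ⟨(⟨Ideal.span {μ}, hn'⟩, u), Subtype.ext (Subtype.ext hu)⟩

lemma summable_nz {s : ℂ} (hs : 1 < s.re) : Summable fun μ : NZ K => ((‖emb σ μ.1‖ ^ 2 : ℝ) : ℂ) ^
    (-s) := by
  have h := (summable_norm_rpow σ (A := 2 * s.re) (by linarith)).comp_injective
    (Subtype.val_injective (p := fun μ : 𝓞 K => μ ≠ 0))
  refine Summable.of_norm (h.congr fun μ => ?_)
  have hμ : 0 < ‖emb σ μ.1‖ := norm_emb_pos σ μ.2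
  rw [norm_cpow_eq_rpow_re_of_pos (by positivity), ← Real.rpow_natCast,
    ← Real.rpow_mul hμ.le, Function.comp_apply, neg_re]
  congr 1; push_cast; ring

/-- The Dedekind zeta function as a sum over integers. -/
lemma tsum_nz_eq_zeta {s : ℂ} (hs : 1 < s.re) : ∑' μ : NZ K, ((‖emb σ μ.1‖ ^ 2 : ℝ) : ℂ) ^ (-s) =
    unitCard K * dedekindZeta K s := by
  set N : NZ K → ℕ := fun μ => Ideal.absNorm (Ideal.span {μ.1}) with hN
  have hNe : ∀ μ : NZ K, ((‖emb σ μ.1‖ ^ 2 : ℝ) : ℂ) ^ (-s) = (N μ : ℂ) ^ (-s) := by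
    intro μ
    rw [norm_emb_sq, hN]; norm_cast
  have hsum := summable_nz σ hs
  have hsig := ((Equiv.sigmaFiberEquiv N).summable_iff.2 hsum).tsum_sigma
  simp only [Function.comp_def] at hsig
  rw [← (Equiv.sigmaFiberEquiv N).tsum_eq, hsig, dedekindZeta, LSeries, ← tsum_mul_left]
  refine tsum_congr fun n => ?_
  have h1 : ∀ μ : {μ : NZ K // N μ = n}, ((‖emb σ ((Equiv.sigmaFiberEquiv N) ⟨n, μ⟩).1‖ ^ 2 : ℝ) : ℂ)
      ^ (-s) = (n : ℂ) ^ (-s) := by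
    intro μ
    rw [hNe]
    congr 2
    exact μ.2
  rw [tsum_congr h1, tsum_const]
  by_cases hn : n = 0
  · subst hn
    have : (-s) ≠ 0 := by
      intro h; rw [neg_eq_zero] at h; rw [h, zero_re] at hs; linarith
    rw [LSeries.term_zero, mul_zero, Nat.cast_zero, zero_cpow this, smul_zero]
  · rw [LSeries.term_of_ne_zero hn, card_norm_eq n hn, nsmul_eq_mul, cpow_neg, unitCard]
    push_cast
    field_simp

/-- A sum over pairs of integers, split according to the greatest common divisor. -/
lemma unitCard_mul_tsum_pairs {h : 𝓞 K × 𝓞 K → ℂ} {f : 𝓞 K → ℂ}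
    (hs : Summable fun p : Pairs K => h p.1)
    (hmul : ∀ g c d : 𝓞 K, h (g * c, g * d) = f g * h (c, d)) :
    unitCard K * ∑' p : Pairs K, h p.1 = (∑' μ : NZ K, f μ.1) * ∑' q : Cop K, h q.1 := by
  have hpu : Summable fun p : Pairs K × (𝓞 K)ˣ => h p.1.1 := by
    have h2 : Summable fun _ : (𝓞 K)ˣ => (1 : ℝ) := Summable.of_finite
    have := (hs.norm).mul_of_nonneg h2 (fun _ => norm_nonneg _) (fun _ => zero_le_one)
    exact Summable.of_norm (this.congr fun p => by rw [mul_one])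
  have hmul' : ∀ p : Pairs K × (𝓞 K)ˣ, h p.1.1 = f (gcdMap p).1.1 * h (gcdMap p).2.1 := by
    intro p
    rw [gcdMap_mul p, hmul]
  have hgc : Summable fun q : NZ K × Cop K => f q.1.1 * h q.2.1 := by
    rw [← (Equiv.ofBijective _ (gcdMap_bijective (K := K))).summable_iff]
    exact hpu.congr hmul'
  have e1 : ∑' p : Pairs K × (𝓞 K)ˣ, h p.1.1 = unitCard K * ∑' p : Pairs K, h p.1 := by
    rw [hpu.tsum_prod, ← tsum_mul_left]
    refine tsum_congr fun p => ?_
    change ∑' _ : (𝓞 K)ˣ, h p.1 = _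
    rw [tsum_const, nsmul_eq_mul, unitCard]
  rw [← e1, tsum_congr hmul']
  have e2 := (Equiv.ofBijective _ (gcdMap_bijective (K := K))).tsum_eq
    (fun q : NZ K × Cop K => f q.1.1 * h q.2.1)
  simp only [Equiv.ofBijective_apply] at e2
  rw [e2, hgc.tsum_prod, ← tsum_mul_right]
  exact tsum_congr fun μ => by dsimp only; rw [tsum_mul_left]

lemma pairs_of_cop_injective : Function.Injective (fun q : Cop K => (⟨q.1, by
    intro h0
    have := q.2
    rw [h0] at this
    exact not_isCoprime_zero_zero this⟩ : Pairs K)) := fun _ _ hab =>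
  Subtype.ext (congrArg (fun x : Pairs K => x.1) hab)

/-- A sum over coprime pairs as a sum over cosets. -/
lemma tsum_cop {h : 𝓞 K × 𝓞 K → ℂ} (hs : Summable fun p : Pairs K => h p.1)
    (hneg : ∀ c d : 𝓞 K, h (-c, -d) = h (c, d)) :
    ∑' q : Cop K, h q.1 = 2 * ∑' c : Cosets K, h (c.out 1 0, c.out 1 1) := by
  have hcop : Summable fun q : Cop K => h q.1 := hs.comp_injective pairs_of_cop_injective
  have hval : ∀ p : Cosets K × ℤˣ, h (rowMap p).1 = h (p.1.out 1 0, p.1.out 1 1) := by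
    intro p
    rcases Int.units_eq_one_or p.2 with hp | hp
    · simp [rowMap, hp]
    · simpa [rowMap, hp] using hneg _ _
  have e := (Equiv.ofBijective _ (rowMap_bijective (K := K))).tsum_eq (fun q : Cop K => h q.1)
  have hs2 := (Equiv.ofBijective _ (rowMap_bijective (K := K))).summable_iff.2 hcop
  simp only [Equiv.ofBijective_apply, Function.comp_def, hval] at e hs2
  rw [← e, hs2.tsum_prod, ← tsum_mul_left]
  refine tsum_congr fun c => ?_
  change ∑' _ : ℤˣ, h (c.out 1 0, c.out 1 1) = _
  simp

/-- The Eisenstein series times the zeta function is an Epstein zeta function. -/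
lemma zeta_mul_eisSeries (P : H3) {s : ℂ} (hs : 1 < s.re) : dedekindZeta K (1 + s) * eisSeries σ P s
    = 1 / 2 * ∑' p : Pairs K, ((qf σ p.1.1 p.1.2 P / P.r : ℝ) : ℂ) ^ (-(1 + s)) := by
  have hre : 2 < (1 + s).re := by rw [add_re, one_re]; linarith
  have hr := P.r_pos
  have hsP : Summable fun p : Pairs K =>
      ((qf σ p.1.1 p.1.2 P / P.r : ℝ) : ℂ) ^ (-(1 + s)) := by
    refine Summable.of_norm (((summable_qf σ hre P).mul_left (P.r ^ (1 + s).re)).congr fun p => ?_)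
    have := qf_pos σ p P
    rw [norm_cpow_eq_rpow_re_of_pos (by positivity), neg_re, Real.div_rpow this.le hr.le,
      Real.rpow_neg hr.le, div_inv_eq_mul, mul_comm]
  have h1 := unitCard_mul_tsum_pairs
    (h := fun p => ((qf σ p.1 p.2 P / P.r : ℝ) : ℂ) ^ (-(1 + s)))
    (f := fun g => ((‖emb σ g‖ ^ 2 : ℝ) : ℂ) ^ (-(1 + s))) hsP (fun g c d => by
      rw [qf_mul, mul_div_assoc, ofReal_mul, mul_cpow_ofReal_nonneg (sq_nonneg _)
        (div_nonneg (qf_nonneg _ _ _ _) hr.le)])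
  have h2 := tsum_cop (h := fun p => ((qf σ p.1 p.2 P / P.r : ℝ) : ℂ) ^ (-(1 + s))) hsP
    (fun c d => by
      have h3 := qf_mul σ (-1) c d P
      rw [neg_one_mul, neg_one_mul] at h3
      rw [h3, map_neg, map_one, norm_neg, norm_one, one_pow, one_mul])
  have h3 : ∑' c : Cosets K, ((qf σ (c.out 1 0) (c.out 1 1) P / P.r : ℝ) : ℂ) ^ (-(1 + s))
      = eisSeries σ P s := by
    refine tsum_congr fun c => ?_
    rw [r_incl_smul, cpow_neg, ← inv_cpow, ← ofReal_inv, inv_div]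
    rw [arg_ofReal_of_nonneg (div_nonneg (qf_nonneg _ _ _ _) hr.le)]
    exact Real.pi_pos.ne
  rw [tsum_nz_eq_zeta σ (by rw [add_re, one_re]; linarith), h2, h3] at h1
  apply mul_left_cancel₀ (unitCard_ne_zero (K := K))
  linear_combination (-1 / 2 : ℂ) * h1

end Gcd

/-! ### Integrals in coordinates -/

lemma strip_eq (A : Set ℂ) (B : Set ℝ) :
    {P : H3 | P.z ∈ A ∧ P.r ∈ B} = Subtype.val ⁻¹' (A ×ˢ B) := rfl

lemma hypVol_eq_withDensity : hypVol = (Measure.comap Subtype.val (volume : Measure (ℂ × ℝ))).withDensity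
    (fun P : H3 => ((Real.toNNReal ((P.r ^ 3)⁻¹) : NNReal) : ENNReal)) := rfl

lemma measurable_r : Measurable H3.r := measurable_snd.comp measurable_subtype_coe

lemma measurable_z : Measurable H3.z := measurable_fst.comp measurable_subtype_coe

lemma measurable_density : Measurable fun P : H3 => Real.toNNReal ((P.r ^ 3)⁻¹) :=
  ((measurable_r.pow_const 3).inv).real_toNNReal

lemma coord_val (f : H3 → ℂ) (P : H3) : coord f P.1 = f P := by
  rw [coord, dif_pos P.2]

lemma density_smul (f : H3 → ℂ) (P : H3) : Real.toNNReal ((P.r ^ 3)⁻¹) • f P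
    = (((P.1.2 ^ 3)⁻¹ : ℝ) : ℂ) * coord f P.1 := by
  have h := P.r_pos
  rw [coord_val, NNReal.smul_def, Real.coe_toNNReal _ (by positivity), real_smul]
  rfl

lemma volume_restrict_upper {A : Set ℂ} {B : Set ℝ} (hB : B ⊆ Ioi 0) :
    ((volume : Measure (ℂ × ℝ)).restrict {p | 0 < p.2}).restrict (A ×ˢ B)
      = (volume : Measure (ℂ × ℝ)).restrict (A ×ˢ B) := by
  rw [Measure.restrict_restrict_of_subset]
  exact fun p hp => hB hp.2

/-- Integrability over a box in the hyperbolic volume, in coordinates. -/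
lemma integrableOn_strip {A : Set ℂ} (hA : MeasurableSet A) {B : Set ℝ} (hB : MeasurableSet B)
    (hB0 : B ⊆ Ioi 0) (f : H3 → ℂ) : IntegrableOn f {P : H3 | P.z ∈ A ∧ P.r ∈ B} hypVol ↔
      IntegrableOn (fun p : ℂ × ℝ => (((p.2 ^ 3)⁻¹ : ℝ) : ℂ) * coord f p) (A ×ˢ B) := by
  have hm : MeasurableSet {P : H3 | P.z ∈ A ∧ P.r ∈ B} :=
    (measurable_z hA).inter (measurable_r hB)
  rw [IntegrableOn, hypVol_eq_withDensity, restrict_withDensity hm,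
    integrable_withDensity_iff_integrable_smul measurable_density, IntegrableOn,
    ← volume_restrict_upper hB0, ← map_comap_subtype_coe measurableSet_upper]
  have h := (MeasurableEmbedding.subtype_coe measurableSet_upper).integrableOn_map_iff
    (μ := Measure.comap Subtype.val (volume : Measure (ℂ × ℝ))) (s := A ×ˢ B)
    (f := fun p : ℂ × ℝ => (((p.2 ^ 3)⁻¹ : ℝ) : ℂ) * coord f p)
  rw [IntegrableOn, IntegrableOn] at h
  rw [h, strip_eq]
  exact integrable_congr (.of_forall fun P => density_smul f P)

/-- Integrals over a box in the hyperbolic volume, in coordinates. -/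
lemma integral_strip {A : Set ℂ} (hA : MeasurableSet A) {B : Set ℝ} (hB : MeasurableSet B)
    (hB0 : B ⊆ Ioi 0) (f : H3 → ℂ) : ∫ P in {P : H3 | P.z ∈ A ∧ P.r ∈ B}, f P ∂hypVol
      = ∫ p in A ×ˢ B, (((p.2 ^ 3)⁻¹ : ℝ) : ℂ) * coord f p := by
  have hm : MeasurableSet {P : H3 | P.z ∈ A ∧ P.r ∈ B} :=
    (measurable_z hA).inter (measurable_r hB)
  rw [hypVol_eq_withDensity, restrict_withDensity hm,
    integral_withDensity_eq_integral_smul measurable_density,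
    ← volume_restrict_upper hB0, ← map_comap_subtype_coe measurableSet_upper,
    (MeasurableEmbedding.subtype_coe measurableSet_upper).setIntegral_map, strip_eq]
  exact integral_congr_ae (.of_forall fun P => density_smul f P)

/-! ### The theta function -/

section Theta

variable [IsTotallyComplex K] [hdeg : Fact (Module.finrank ℚ K = 2)]

/-- The theta series of the form `|c z + d|² + |c|² r²`, without its constant term. -/
def thetaP (P : H3) (x : ℝ) : ℝ :=
  ∑' p : Pairs K, Real.exp (-(condR K * x * (qf σ p.1.1 p.1.2 P / P.r)))

lemma exp_neg_le_cube {t : ℝ} (ht : 0 < t) : Real.exp (-t) ≤ 6 * t ^ (-(3 : ℝ)) := by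
  have h := Real.pow_div_factorial_le_exp t ht.le 3
  rw [Real.exp_neg, Real.rpow_neg ht.le, ← div_eq_mul_inv, inv_eq_one_div,
    div_le_div_iff₀ (Real.exp_pos _) (by positivity)]
  norm_num [Nat.factorial] at h ⊢
  linarith

lemma summable_thetaP (P : H3) {x : ℝ} (hx : 0 < x) :
    Summable fun p : Pairs K => Real.exp (-(condR K * x * (qf σ p.1.1 p.1.2 P / P.r))) := by
  have hk := condR_pos (K := K)
  have hr := P.r_pos
  have h := ((summable_qf σ (A := 3) (by norm_num) P).mul_left
    (6 * (condR K * x / P.r) ^ (-(3 : ℝ))))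
  refine Summable.of_nonneg_of_le (fun p => (Real.exp_pos _).le) (fun p => ?_) h
  have hq := qf_pos σ p P
  refine (exp_neg_le_cube (by positivity)).trans (le_of_eq ?_)
  rw [show condR K * x * (qf σ p.1.1 p.1.2 P / P.r) = condR K * x / P.r * qf σ p.1.1 p.1.2 P by
    ring, Real.mul_rpow (by positivity) hq.le, mul_assoc]

lemma thetaP_nonneg (P : H3) (x : ℝ) : 0 ≤ thetaP σ P x :=
  tsum_nonneg fun _ => (Real.exp_pos _).le

lemma hasSum_pairs {f : 𝓞 K × 𝓞 K → ℝ} (hf : Summable fun p : Pairs K => f p.1) :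
    HasSum f (f 0 + ∑' p : Pairs K, f p.1) := by
  classical
  have h1 := (hasSum_ite_eq (0 : 𝓞 K × 𝓞 K) (f 0)).add
    ((hasSum_subtype_iff_indicator (s := {p : 𝓞 K × 𝓞 K | p ≠ 0}) (f := f)).1 hf.hasSum)
  refine (congrArg (fun g => HasSum g _) ?_).mp h1
  funext p
  by_cases hp : p = 0
  · subst hp
    simp
  · rw [if_neg hp, zero_add, indicator_of_mem (show p ∈ {p : 𝓞 K × 𝓞 K | p ≠ 0} from hp)]

/-- The theta series with its constant term, as a sum over all pairs. -/
lemma hasSum_theta (P : H3) {x : ℝ} (hx : 0 < x) :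
    HasSum (fun p : 𝓞 K × 𝓞 K => Real.exp (-(condR K * x * (qf σ p.1 p.2 P / P.r))))
    (1 + thetaP σ P x) := by
  have h := hasSum_pairs (f := fun p => Real.exp (-(condR K * x * (qf σ p.1 p.2 P / P.r))))
    (summable_thetaP σ P hx)
  have h0 : qf σ (0 : 𝓞 K) 0 P = 0 := by simp [qf]
  unfold thetaP
  simpa only [Prod.fst_zero, Prod.snd_zero, h0, zero_div, mul_zero, neg_zero, Real.exp_zero]
    using h

/-- The dual series of the theta function. -/
def psi (P : H3) (x : ℝ) : ℂ :=
  ∑' p : 𝓞 K × 𝓞 K, (Real.exp (-(condR K * P.r * (‖emb σ p.1‖ ^ 2 * x + ‖emb σ p.2‖ ^ 2 / x))) : ℂ)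
    * chr (dualFreq σ (p.1 * p.2)) P.z

lemma summable_psi {r x : ℝ} (hr : 0 < r) (hx : 0 < x) : Summable fun p : 𝓞 K × 𝓞 K => Real.exp
    (-(condR K * r * (‖emb σ p.1‖ ^ 2 * x + ‖emb σ p.2‖ ^ 2 / x))) := by
  have hk := condR_pos (K := K)
  have h1 := summable_exp_norm σ (a := condR K * r * x) (by positivity) 0
  have h2 := summable_exp_norm σ (a := condR K * r / x) (by positivity) 0
  refine (h1.mul_of_nonneg h2 (fun _ => (Real.exp_pos _).le)
    (fun _ => (Real.exp_pos _).le)).congr fun p => ?_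
  rw [← Real.exp_add, zero_add, zero_add]
  congr 1; ring

/-- Poisson summation in the second variable of the theta series. -/
lemma theta_eq_psi (P : H3) {x : ℝ} (hx : 0 < x) : ((1 + thetaP σ P x : ℝ) : ℂ) = (P.r / x : ℝ) *
    psi σ P x := by
  have hr := P.r_pos
  have hs := (hasSum_ofReal.2 (hasSum_theta σ P hx))
  have hpsi : Summable fun p : 𝓞 K × 𝓞 K =>
      (Real.exp (-(condR K * P.r * (‖emb σ p.1‖ ^ 2 * x + ‖emb σ p.2‖ ^ 2 / x))) : ℂ)
        * chr (dualFreq σ (p.1 * p.2)) P.z := by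
    refine Summable.of_norm ((summable_psi σ hr hx).congr fun p => ?_)
    rw [norm_mul, norm_chr, mul_one, norm_real, Real.norm_of_nonneg (Real.exp_pos _).le]
  rw [← hs.tsum_eq, hs.summable.tsum_prod, psi, hpsi.tsum_prod, ← tsum_mul_left]
  refine tsum_congr fun c => ?_
  have hp := poisson σ (y := x / P.r) (by positivity) (emb σ c * P.z)
  have e1 : ∀ d : 𝓞 K, ((Real.exp (-(condR K * x * (qf σ c d P / P.r))) : ℝ) : ℂ)
      = (Real.exp (-(condR K * P.r * (‖emb σ c‖ ^ 2 * x))) : ℂ)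
        * (Real.exp (-(condR K * (x / P.r)) * ‖emb σ c * P.z + emb σ d‖ ^ 2) : ℂ) := by
    intro d
    rw [← ofReal_mul, ← Real.exp_add]
    congr 2
    rw [qf, ← Complex.sq_norm, ← Complex.sq_norm]
    field_simp
    ring
  have e2 : ∀ ν : 𝓞 K, (Real.exp (-(condR K * P.r * (‖emb σ c‖ ^ 2 * x + ‖emb σ ν‖ ^ 2 / x))) : ℂ)
        * chr (dualFreq σ (c * ν)) P.z = (Real.exp (-(condR K * P.r * (‖emb σ c‖ ^ 2 * x))) : ℂ)
        * ((Real.exp (-(condR K / (x / P.r)) * ‖emb σ ν‖ ^ 2) : ℂ)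
        * chr (dualFreq σ ν) (emb σ c * P.z)) := by
    intro ν
    rw [mul_comm c ν, chr_dualFreq_mul, ← mul_assoc, ← ofReal_mul, ← Real.exp_add]
    congr 3
    field_simp
    ring
  rw [tsum_congr e1, tsum_congr e2, tsum_mul_left, tsum_mul_left, hp]
  push_cast
  rw [inv_div]
  ring

/-- The functional equation of the theta function. -/
lemma theta_inv (P : H3) {x : ℝ} (hx : 0 < x) : 1 + thetaP σ P x⁻¹ = x ^ 2 * (1 + thetaP σ P x) :=
    by
  have h1 := theta_eq_psi σ P hx
  have h2 := theta_eq_psi σ P (inv_pos.2 hx)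
  have h3 : psi σ P x⁻¹ = psi σ P x := by
    unfold psi
    rw [← (Equiv.prodComm (𝓞 K) (𝓞 K)).tsum_eq]
    refine tsum_congr fun p => ?_
    simp only [Equiv.prodComm_apply, Prod.fst_swap, Prod.snd_swap, div_inv_eq_mul, mul_comm p.2]
    congr 4
    rw [div_eq_mul_inv, add_comm]
  have key : ((1 + thetaP σ P x⁻¹ : ℝ) : ℂ) = ((x ^ 2 * (1 + thetaP σ P x) : ℝ) : ℂ) := by
    rw [h2, h3, ofReal_mul, h1]
    push_cast
    field_simp
  exact_mod_cast key

lemma thetaP_antitone (P : H3) {x y : ℝ} (hx : 0 < x) (hxy : x ≤ y) : thetaP σ P y ≤ thetaP σ P x :=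
    by
  have hk := condR_pos (K := K)
  refine (summable_thetaP σ P (hx.trans_le hxy)).tsum_le_tsum (fun p => ?_) (summable_thetaP σ P hx)
  have h : 0 ≤ qf σ p.1.1 p.1.2 P / P.r := div_nonneg (qf_nonneg _ _ _ _) P.r_pos.le
  gcongr

/-- A non-zero pair with a small value of the form, relative to the height. If all values were
large then the theta series would be small at `1 / 2` compared with its value at `1 / 4`, which
contradicts the functional equation. -/
lemma exists_qf_le (P : H3) : ∃ p : Pairs K, condR K * (qf σ p.1.1 p.1.2 P / P.r) ≤ 16 := by
  by_contra hcon
  push Not at hcon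
  have h2 := theta_inv σ P (x := 2) two_pos
  have h4 := theta_inv σ P (x := 4) (by norm_num)
  have hle : thetaP σ P 2⁻¹ ≤ Real.exp (-4) * thetaP σ P 4⁻¹ := by
    unfold thetaP
    rw [← tsum_mul_left]
    refine (summable_thetaP σ P (by norm_num)).tsum_le_tsum (fun p => ?_)
      ((summable_thetaP σ P (by norm_num)).mul_left _)
    rw [← Real.exp_add]
    apply Real.exp_le_exp.2
    have := hcon p
    nlinarith
  have hanti := thetaP_antitone σ P (x := 2⁻¹) (y := 4) (by norm_num) (by norm_num)
  have hpos := thetaP_nonneg σ P 2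
  have he : Real.exp (-4) ≤ 1 / 32 := by
    rw [Real.exp_neg, one_div]
    apply inv_anti₀ (by norm_num)
    have h3 : Real.exp 4 = Real.exp 1 ^ 4 := by rw [← Real.exp_nat_mul]; norm_num
    have h5 := Real.exp_one_gt_d9
    rw [h3]
    calc (32 : ℝ) ≤ 2.7 ^ 4 := by norm_num
      _ ≤ _ := by gcongr; linarith
  have h0 := thetaP_nonneg σ P 4⁻¹
  nlinarith

end Theta

section Siegel

variable [IsPrincipalIdealRing (𝓞 K)] [IsTotallyComplex K]
  [hdeg : Fact (Module.finrank ℚ K = 2)]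

/-- A Siegel set meets every orbit. -/
lemma exists_siegel : ∃ δ : ℝ, 0 < δ ∧ ∀ P : H3, ∃ γ : Gam σ, (γ • P).z ∈ cell σ ∧ δ ≤ (γ • P).r :=
    by
  have hk := condR_pos (K := K)
  refine ⟨condR K / 16, by positivity, fun P => ?_⟩
  obtain ⟨p, hp⟩ := exists_qf_le σ P
  obtain ⟨g, q, hgq⟩ := exists_gcd p
  obtain ⟨M, h0, h1⟩ := q.2.exists_SL2_row 1
  have hq : qf σ q.1.1 q.1.2 P ≤ qf σ p.1.1 p.1.2 P := by
    rw [hgq, qf_mul]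
    have := one_le_norm_emb σ g.2
    exact le_mul_of_one_le_left (qf_nonneg σ q.1.1 q.1.2 P) (one_le_pow₀ this)
  obtain ⟨b, hb, -⟩ := existsUnique_add_mem_cell σ (incl σ M • P).z
  refine ⟨toGam σ (trl b * M), ?_, ?_⟩
  · rw [toGam_smul, map_mul, mul_smul, trl_smul]
    exact hb
  · rw [toGam_smul, map_mul, mul_smul, trl_smul, mk_r, r_incl_smul, h0, h1]
    have hr := P.r_pos
    have hqp : 0 < qf σ q.1.1 q.1.2 P := qf_pos σ ⟨q.1, by
      intro h; have := q.2; rw [h] at this; exact not_isCoprime_zero_zero this⟩ P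
    rw [le_div_iff₀ hqp]
    have h3 : condR K * (qf σ q.1.1 q.1.2 P / P.r) ≤ 16 :=
      le_trans (by gcongr) hp
    rw [mul_div_assoc', div_le_iff₀ hr] at h3
    linarith

/-- The height at the bottom of a Siegel set. -/
def siegelHt : ℝ := (exists_siegel σ).choose

lemma siegelHt_pos : 0 < siegelHt σ := (exists_siegel σ).choose_spec.1

lemma exists_smul_siegel (P : H3) : ∃ γ : Gam σ, (γ • P).z ∈ cell σ ∧ siegelHt σ ≤ (γ • P).r :=
    (exists_siegel σ).choose_spec.2 P

/-- The Siegel set. -/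
def siegel : Set H3 := {P : H3 | P.z ∈ cell σ ∧ P.r ∈ Ici (siegelHt σ)}

lemma measurableSet_siegel : MeasurableSet (siegel σ) :=
  (measurable_z (measurableSet_cell σ)).inter (measurable_r measurableSet_Ici)

/-- Integrals over a fundamental domain are dominated by integrals over the Siegel set. -/
lemma lintegral_le_siegel {D : Set H3} (hD : IsFundamentalDomain (Gam σ) D hypVol)
    {f : H3 → ENNReal} (hf : ∀ γ : Gam σ, ∀ P, f (γ • P) = f P) (hfm : Measurable f) :
    ∫⁻ P in D, f P ∂hypVol ≤ ∫⁻ P in siegel σ, f P ∂hypVol := by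
  have hm := measurableSet_siegel σ
  rw [← lintegral_indicator hm, hD.lintegral_eq_tsum'' ((siegel σ).indicator f),
    ← lintegral_tsum]
  · refine lintegral_mono fun P => ?_
    obtain ⟨γ, hz, hr⟩ := exists_smul_siegel σ P
    refine le_trans ?_ (ENNReal.le_tsum γ)
    rw [indicator_of_mem (show γ • P ∈ siegel σ from ⟨hz, hr⟩), hf]
  · fun_prop

lemma integrableOn_strip_rpow {B : Set ℝ} (hB : MeasurableSet B) (hB0 : B ⊆ Ioi 0) {A : ℝ}
    (hA : IntegrableOn (fun r : ℝ => r ^ (A - 3)) B) :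
    IntegrableOn (fun P : H3 => ((P.r ^ A : ℝ) : ℂ)) {P : H3 | P.z ∈ cell σ ∧ P.r ∈ B} hypVol := by
  rw [integrableOn_strip (measurableSet_cell σ) hB hB0, IntegrableOn,
    Measure.volume_eq_prod, ← Measure.prod_restrict]
  have h1 : Integrable (fun _ : ℂ => (1 : ℂ)) (volume.restrict (cell σ)) := by
    refine integrableOn_const (by rw [volume_cell]; exact ENNReal.ofReal_ne_top) (by simp)
  have h3 := h1.mul_prod hA.ofReal
  refine h3.congr ?_
  rw [Measure.prod_restrict]
  refine ae_restrict_of_forall_mem ((measurableSet_cell σ).prod hB) fun p hp => ?_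
  have hp2 : 0 < p.2 := hB0 hp.2
  beta_reduce
  rw [one_mul, coord, dif_pos hp2]
  have : H3.r ⟨p, hp2⟩ = p.2 := rfl
  rw [this, ← ofReal_mul, Real.rpow_sub hp2]
  norm_num
  rw [div_eq_mul_inv, mul_comm]

/-- The Siegel set has finite volume, even weighted by a power `r ^ A` with `A < 2`. -/
lemma integrableOn_siegel_rpow {A : ℝ} (hA : A < 2) :
    IntegrableOn (fun P : H3 => ((P.r ^ A : ℝ) : ℂ)) (siegel σ) hypVol := by
  have hδ := siegelHt_pos σ
  refine integrableOn_strip_rpow σ measurableSet_Ici (fun r hr => hδ.trans_le hr) ?_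
  rw [integrableOn_Ici_iff_integrableOn_Ioi]
  exact integrableOn_Ioi_rpow_of_lt (by linarith) hδ

/-- A measurable invariant function that is bounded on the Siegel set is integrable over a
fundamental domain. -/
lemma integrableOn_of_bounded {D : Set H3} (hD : IsFundamentalDomain (Gam σ) D hypVol) {f : H3 → ℂ}
    (hf : ∀ γ ∈ Gam σ, ∀ P, f (γ P) = f P) (hfm : Measurable f) {C : ℝ}
    (hC : ∀ P ∈ siegel σ, ‖f P‖ ≤ C) : IntegrableOn f D hypVol := by
  refine ⟨hfm.aestronglyMeasurable, ?_⟩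
  have h1 := lintegral_le_siegel σ hD (f := fun P => ‖f P‖ₑ)
    (fun γ P => by rw [gam_smul, hf γ.1 γ.2]) hfm.enorm
  refine h1.trans_lt ?_
  have h2 := (integrableOn_siegel_rpow σ (A := 0) two_pos).const_mul (C : ℂ)
  have h3 : IntegrableOn f (siegel σ) hypVol := by
    refine Integrable.mono h2 hfm.aestronglyMeasurable ?_
    refine ae_restrict_of_forall_mem (measurableSet_siegel σ) fun P hP => ?_
    rw [Real.rpow_zero, ofReal_one, mul_one, norm_real]
    exact (hC P hP).trans (le_abs_self C)
  exact h3.2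

end Siegel

/-! ### Mellin transforms of theta series -/

lemma rpow_mul_exp_neg_le {t σ : ℝ} (ht : 0 < t) (hσ : 0 < σ) :
    Real.exp (-t) ≤ σ ^ σ * t ^ (-σ) := by
  have h1 : t / σ ≤ Real.exp (t / σ) := by linarith [Real.add_one_le_exp (t / σ)]
  have h2 : (t / σ) ^ σ ≤ Real.exp t := by
    calc (t / σ) ^ σ ≤ Real.exp (t / σ) ^ σ := Real.rpow_le_rpow (by positivity) h1 hσ.le
      _ = Real.exp t := by rw [← Real.exp_mul]; congr 1; field_simp
  rw [Real.div_rpow ht.le hσ.le, div_le_iff₀ (by positivity)] at h2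
  rw [Real.exp_neg, Real.rpow_neg ht.le, ← div_eq_mul_inv, le_div_iff₀ (by positivity),
    inv_mul_le_iff₀ (Real.exp_pos _)]
  exact h2

lemma summable_exp_neg_of_rpow {ι : Type*} {p : ι → ℝ} (hp : ∀ i, 0 < p i) {σ : ℝ} (hσ : 0 < σ)
    (hsum : Summable fun i => p i ^ (-σ)) {x : ℝ} (hx : 0 < x) :
    Summable fun i => Real.exp (-x * p i) := by
  refine Summable.of_nonneg_of_le (fun i => (Real.exp_pos _).le) (fun i => ?_)
    (hsum.mul_left (σ ^ σ * x ^ (-σ)))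
  have := rpow_mul_exp_neg_le (mul_pos hx (hp i)) hσ
  rwa [Real.mul_rpow hx.le (hp i).le, ← mul_assoc, ← neg_mul] at this

/-- The Mellin transform of a sum of exponentials. -/
lemma mellin_sum_exp {ι : Type*} [Countable ι] {p : ι → ℝ} (hp : ∀ i, 0 < p i) {s : ℂ}
    (hs : 0 < s.re) (hsum : Summable fun i => p i ^ (-s.re)) :
    IntegrableOn (fun x : ℝ => (x : ℂ) ^ (s - 1) * ((∑' i, Real.exp (-x * p i) : ℝ) : ℂ)) (Ioi 0) ∧
    ∫ x in Ioi (0 : ℝ), (x : ℂ) ^ (s - 1) * ((∑' i, Real.exp (-x * p i) : ℝ) : ℂ)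
      = Gamma s * ∑' i, (p i : ℂ) ^ (-s) := by
  let _ : MeasurableSpace ι := ⊤
  have h := mellin_superposition (μ := (Measure.count : Measure ι)) (c := p) (g := fun _ => 1)
    (measurable_from_top) hp aestronglyMeasurable_const hs (by
      rw [integrable_count_iff]
      simpa [abs_of_pos (Real.rpow_pos_of_pos (hp _) _)] using hsum)
  have hc : ∀ {f : ι → ℂ}, Summable f → ∫ i, f i ∂Measure.count = ∑' i, f i := by
    intro f hf
    rw [integral_countable (integrable_count_iff.2 hf.norm)]
    simp
  have h1 : ∀ x ∈ Ioi (0 : ℝ), (x : ℂ) ^ (s - 1) * ∫ i, (Real.exp (-x * p i) : ℂ) * 1 ∂Measure.count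
      = (x : ℂ) ^ (s - 1) * ((∑' i, Real.exp (-x * p i) : ℝ) : ℂ) := by
    intro x hx
    have hsx := summable_exp_neg_of_rpow hp hs hsum hx
    simp only [mul_one]
    rw [hc (f := fun i => (Real.exp (-x * p i) : ℂ)) (by exact_mod_cast hsx), ofReal_tsum]
  refine ⟨h.1.congr_fun h1 measurableSet_Ioi, ?_⟩
  rw [← setIntegral_congr_fun measurableSet_Ioi h1, h.2]
  simp only [mul_one]
  rw [hc (f := fun i => (p i : ℂ) ^ (-s))]
  refine Summable.of_norm (hsum.congr fun i => ?_)
  rw [norm_cpow_eq_rpow_re_of_pos (hp i), neg_re]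

/-- The part of a Mellin transform over `x ≥ 1`. -/
def upperMellin (θ : ℝ → ℝ) (s : ℂ) : ℂ := ∫ x in Ioi (1 : ℝ), (x : ℂ) ^ (s - 1) * (θ x : ℂ)

lemma image_inv_Ioi_one : (fun x : ℝ => x⁻¹) '' Ioi 1 = Ioo 0 1 := by
  ext y
  constructor
  · rintro ⟨x, hx, rfl⟩
    have hx : 1 < x := hx
    exact ⟨inv_pos.2 (by linarith), inv_lt_one_of_one_lt₀ hx⟩
  · rintro ⟨h0, h1⟩
    exact ⟨y⁻¹, (one_lt_inv₀ h0).2 h1, inv_inv y⟩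

/-- Riemann's splitting of the Mellin transform of a function with
`1 + θ (1 / x) = x ^ k (1 + θ x)`. -/
lemma mellin_split {θ : ℝ → ℝ} {k : ℕ}
    (hint : ∀ s : ℂ, IntegrableOn (fun x : ℝ => (x : ℂ) ^ (s - 1) * (θ x : ℂ)) (Ioi 1))
    (hfe : ∀ x : ℝ, 0 < x → 1 + θ x⁻¹ = x ^ k * (1 + θ x)) {s : ℂ} (hs : k < s.re) :
    ∫ x in Ioi (0 : ℝ), (x : ℂ) ^ (s - 1) * (θ x : ℂ)
      = upperMellin θ s + upperMellin θ (k - s) - 1 / s - 1 / (k - s) := by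
  have hderiv : ∀ x ∈ Ioi (1 : ℝ), HasDerivWithinAt (fun x : ℝ => x⁻¹) (-(x ^ 2)⁻¹) (Ioi 1) x :=
    fun x hx => (hasDerivAt_inv (by have : (1 : ℝ) < x := hx; positivity)).hasDerivWithinAt
  have hinj : InjOn (fun x : ℝ => x⁻¹) (Ioi 1) := inv_injective.injOn
  have hcongr : ∀ x ∈ Ioi (1 : ℝ), |(-(x ^ 2)⁻¹)| • (((x⁻¹ : ℝ) : ℂ) ^ (s - 1) * (θ x⁻¹ : ℂ))
      = (x : ℂ) ^ ((k - s) - 1) * (θ x : ℂ)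
        + ((x : ℂ) ^ ((k - s) - 1) - (x : ℂ) ^ (-s - 1)) := by
    intro x hx
    have hx : (1 : ℝ) < x := hx
    have hx0 : (x : ℂ) ≠ 0 := by exact_mod_cast (by linarith : x ≠ 0)
    have h1 : (θ x⁻¹ : ℂ) = x ^ k * (1 + θ x) - 1 := by
      have := hfe x (by linarith)
      have h2 : θ x⁻¹ = x ^ k * (1 + θ x) - 1 := by linarith
      rw [h2]; push_cast; ring
    have e3 : ((x⁻¹ : ℝ) : ℂ) ^ (s - 1) = (x : ℂ) ^ (-(s - 1)) := by
      rw [ofReal_inv, inv_cpow _ _ (by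
        rw [arg_ofReal_of_nonneg (by linarith)]; exact Real.pi_pos.ne), ← cpow_neg]
    rw [h1, abs_neg, abs_of_pos (by positivity), real_smul, e3]
    have e1 : (x : ℂ) ^ ((k : ℂ) - s - 1) = (x : ℂ) ^ k * (x : ℂ) ^ (-s - 1) := by
      rw [show (k : ℂ) - s - 1 = k + (-s - 1) by ring, cpow_add _ _ hx0, cpow_natCast]
    have e2 : (((x ^ 2)⁻¹ : ℝ) : ℂ) * (x : ℂ) ^ (-(s - 1)) = (x : ℂ) ^ (-s - 1) := by
      rw [show -(s - 1) = (-s - 1) + (2 : ℕ) by push_cast; ring, cpow_add _ _ hx0, cpow_natCast]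
      push_cast
      field_simp
    rw [e1, ← mul_assoc, e2]
    ring
  have hpow : ∀ a : ℂ, a.re < 0 → IntegrableOn (fun x : ℝ => (x : ℂ) ^ (a - 1)) (Ioi 1) :=
    fun a ha => integrableOn_Ioi_cpow_of_lt (by rw [sub_re, one_re]; linarith) one_pos
  have hpowv : ∀ a : ℂ, a.re < 0 → ∫ x in Ioi (1 : ℝ), (x : ℂ) ^ (a - 1) = -1 / a := by
    intro a ha
    rw [integral_Ioi_cpow_of_lt (by rw [sub_re, one_re]; linarith) one_pos]
    simp
  have hk : ((k : ℂ) - s).re < 0 := by rw [sub_re, natCast_re]; linarith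
  have hs' : (-s).re < 0 := by rw [neg_re]; linarith [(Nat.cast_nonneg k : (0 : ℝ) ≤ k)]
  have hsub : IntegrableOn (fun x : ℝ => (x : ℂ) ^ ((k - s) - 1) - (x : ℂ) ^ (-s - 1)) (Ioi 1) :=
    (hpow _ hk).sub (hpow _ hs')
  have hR : IntegrableOn (fun x : ℝ => (x : ℂ) ^ ((k - s) - 1) * (θ x : ℂ)
        + ((x : ℂ) ^ ((k - s) - 1) - (x : ℂ) ^ (-s - 1))) (Ioi 1) :=
    (hint _).add hsub
  have hIoo : IntegrableOn (fun x : ℝ => (x : ℂ) ^ (s - 1) * (θ x : ℂ)) (Ioo 0 1) := by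
    rw [← image_inv_Ioi_one, integrableOn_image_iff_integrableOn_abs_deriv_smul measurableSet_Ioi
      hderiv hinj]
    exact hR.congr_fun (fun x hx => (hcongr x hx).symm) measurableSet_Ioi
  have hIooV : ∫ x in Ioo (0 : ℝ) 1, (x : ℂ) ^ (s - 1) * (θ x : ℂ)
      = upperMellin θ (k - s) - 1 / s - 1 / (k - s) := by
    rw [← image_inv_Ioi_one, integral_image_eq_integral_abs_deriv_smul measurableSet_Ioi
      hderiv hinj, setIntegral_congr_fun measurableSet_Ioi hcongr, integral_add (hint _) hsub, integral_sub (hpow _ hk) (hpow _ hs'), hpowv _ hk,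
      hpowv _ hs', upperMellin]
    ring
  have hunion : Ioi (0 : ℝ) = Ioc 0 1 ∪ Ioi 1 := (Ioc_union_Ioi_eq_Ioi zero_le_one).symm
  rw [hunion, setIntegral_union Ioc_disjoint_Ioi_same measurableSet_Ioi
    ((integrableOn_Ioc_iff_integrableOn_Ioo (by finiteness)).2 hIoo) (hint s), integral_Ioc_eq_integral_Ioo, hIooV,
    show ∫ x in Ioi (1 : ℝ), (x : ℂ) ^ (s - 1) * (θ x : ℂ) = upperMellin θ s from rfl]
  ring

lemma differentiable_upperMellin {θ : ℝ → ℝ}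
    (hint : ∀ s : ℂ, IntegrableOn (fun x : ℝ => (x : ℂ) ^ (s - 1) * (θ x : ℂ)) (Ioi 1)) :
    Differentiable ℂ (upperMellin θ) := by
  have hm : AEStronglyMeasurable (fun x : ℝ => (θ x : ℂ)) (volume.restrict (Ioi 1)) := by
    refine (hint 1).1.congr (.of_forall fun x => ?_)
    simp
  have h := differentiable_integral_cpow (μ := volume.restrict (Ioi (1 : ℝ))) (φ := fun x => x)
    measurable_id (ae_restrict_of_forall_mem measurableSet_Ioi fun x (hx : 1 < x) => hx.le) hm (fun A => by
      refine ((hint (A + 1)).norm).congr (ae_restrict_of_forall_mem measurableSet_Ioi fun x (hx : 1 < x) => ?_)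
      beta_reduce
      rw [norm_mul, norm_cpow_eq_rpow_re_of_pos (by linarith), mul_comm]
      simp)
  have e : upperMellin θ = fun s => (fun s : ℂ => ∫ x in Ioi (1 : ℝ), (θ x : ℂ) * (x : ℂ) ^ s) (s - 1) := by
    funext s
    unfold upperMellin
    simp only [mul_comm]
  rw [e]
  exact h.comp (differentiable_id.sub_const 1)

/-- Integrability over `(1, ∞)` against every power follows from integrability over `(0, ∞)`
against large powers. -/
lemma integrableOn_Ioi_one {θ : ℝ → ℝ} {σ₀ : ℝ}
    (h : ∀ σ : ℝ, σ₀ < σ → IntegrableOn (fun x : ℝ => (x : ℂ) ^ ((σ : ℂ) - 1) * (θ x : ℂ)) (Ioi 0))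
    (s : ℂ) : IntegrableOn (fun x : ℝ => (x : ℂ) ^ (s - 1) * (θ x : ℂ)) (Ioi 1) := by
  set σ := max (σ₀ + 1) s.re
  have h1 := (h σ (by have := le_max_left (σ₀ + 1) s.re; linarith)).mono_set
    (Ioi_subset_Ioi zero_le_one)
  have hm : AEStronglyMeasurable (fun x : ℝ => (θ x : ℂ)) (volume.restrict (Ioi 1)) := by
    have h2 : AEStronglyMeasurable (fun x : ℝ => (x : ℂ) ^ (-((σ : ℂ) - 1))
        * ((x : ℂ) ^ ((σ : ℂ) - 1) * (θ x : ℂ))) (volume.restrict (Ioi 1)) :=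
      (Measurable.aestronglyMeasurable (by fun_prop)).mul h1.1
    refine h2.congr (ae_restrict_of_forall_mem measurableSet_Ioi fun x (hx : 1 < x) => ?_)
    have hx0 : (x : ℂ) ≠ 0 := by exact_mod_cast (by linarith : x ≠ 0)
    beta_reduce
    rw [← mul_assoc, ← cpow_add _ _ hx0, neg_add_cancel, cpow_zero, one_mul]
  refine Integrable.mono h1 ((Measurable.aestronglyMeasurable (by fun_prop)).mul hm)
    (ae_restrict_of_forall_mem measurableSet_Ioi fun x (hx : 1 < x) => ?_)
  rw [norm_mul, norm_mul, norm_cpow_eq_rpow_re_of_pos (by linarith),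
    norm_cpow_eq_rpow_re_of_pos (by linarith)]
  refine mul_le_mul_of_nonneg_right (Real.rpow_le_rpow_of_exponent_le hx.le ?_) (norm_nonneg _)
  have : s.re ≤ σ := le_max_right _ _
  rw [sub_re, sub_re, ofReal_re]
  linarith

lemma ofReal_mul_cpow {a b : ℝ} (ha : 0 < a) (hb : 0 < b) (s : ℂ) :
    ((a * b : ℝ) : ℂ) ^ s = (a : ℂ) ^ s * (b : ℂ) ^ s := by
  rw [ofReal_mul, mul_cpow_ofReal_nonneg ha.le hb.le]

/-! ### The completed zeta function -/

section Zeta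

variable [IsTotallyComplex K] [hdeg : Fact (Module.finrank ℚ K = 2)]

/-- The theta series of the norm form, without its constant term. -/
def zetaTheta (x : ℝ) : ℝ := ∑' μ : NZ K, Real.exp (-x * (condR K * ‖emb σ μ.1‖ ^ 2))

lemma zeta_exponent_pos (μ : NZ K) : 0 < condR K * ‖emb σ μ.1‖ ^ 2 := by
  have h1 := condR_pos (K := K)
  have h2 := one_le_norm_emb σ μ.2
  positivity

lemma summable_zeta_exponent {A : ℝ} (hA : 1 < A) :
    Summable fun μ : NZ K => (condR K * ‖emb σ μ.1‖ ^ 2) ^ (-A) := by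
  have h := ((summable_norm_rpow σ (A := 2 * A) (by linarith)).comp_injective
    (Subtype.val_injective (p := fun μ : 𝓞 K => μ ≠ 0))).mul_left (condR K ^ (-A))
  refine h.congr fun μ => ?_
  rw [Real.mul_rpow (condR_pos K).le (sq_nonneg _), ← Real.rpow_natCast, ← Real.rpow_mul (norm_nonneg _),
    Function.comp_apply]
  congr 2; push_cast; ring

lemma summable_zetaTheta {x : ℝ} (hx : 0 < x) :
    Summable fun μ : NZ K => Real.exp (-x * (condR K * ‖emb σ μ.1‖ ^ 2)) :=
  summable_exp_neg_of_rpow (zeta_exponent_pos σ) two_pos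
    (summable_zeta_exponent σ one_lt_two) hx

lemma hasSum_zetaTheta {x : ℝ} (hx : 0 < x) :
    HasSum (fun μ : 𝓞 K => Real.exp (-x * (condR K * ‖emb σ μ‖ ^ 2))) (1 + zetaTheta σ x) := by
  classical
  have h1 := (hasSum_ite_eq (0 : 𝓞 K) (1 : ℝ)).add
    ((hasSum_subtype_iff_indicator (s := {μ : 𝓞 K | μ ≠ 0})
      (f := fun μ => Real.exp (-x * (condR K * ‖emb σ μ‖ ^ 2)))).1 (summable_zetaTheta σ hx).hasSum)
  refine (congrArg (fun g => HasSum g (1 + zetaTheta σ x)) ?_).mp h1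
  funext p
  by_cases hp : p = 0
  · subst hp
    simp
  · rw [if_neg hp, zero_add, indicator_of_mem (show p ∈ {p : 𝓞 K | p ≠ 0} from hp)]

lemma zetaTheta_inv {x : ℝ} (hx : 0 < x) : 1 + zetaTheta σ x⁻¹ = x ^ 1 * (1 + zetaTheta σ x) := by
  have hp := poisson σ (y := x⁻¹) (inv_pos.2 hx) 0
  have h1 := hasSum_ofReal.2 (hasSum_zetaTheta σ hx)
  have h2 := hasSum_ofReal.2 (hasSum_zetaTheta σ (inv_pos.2 hx))
  have key : ((1 + zetaTheta σ x⁻¹ : ℝ) : ℂ) = ((x ^ 1 * (1 + zetaTheta σ x) : ℝ) : ℂ) := by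
    rw [ofReal_mul, ← h1.tsum_eq, ← h2.tsum_eq, pow_one]
    simp only [zero_add, chr_zero, mul_one, ofReal_inv, inv_inv, div_inv_eq_mul] at hp
    convert hp using 4
    · ring_nf
    · ring_nf
  exact_mod_cast key

lemma integrableOn_zetaTheta (s : ℂ) :
    IntegrableOn (fun x : ℝ => (x : ℂ) ^ (s - 1) * (zetaTheta σ x : ℂ)) (Ioi 1) :=
  integrableOn_Ioi_one (σ₀ := 1) (fun A hA => (mellin_sum_exp (zeta_exponent_pos σ)
    (s := (A : ℂ)) (by rw [ofReal_re]; linarith) (summable_zeta_exponent σ (by simpa using hA))).1) s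

/-- The completed zeta function times the number of units and without its polar part. -/
def zetaEntire (s : ℂ) : ℂ :=
  upperMellin (zetaTheta σ) s + upperMellin (zetaTheta σ) (1 - s)

lemma differentiable_zetaEntire : Differentiable ℂ (zetaEntire σ) := by
  have h := differentiable_upperMellin (integrableOn_zetaTheta σ)
  exact h.add (h.comp (differentiable_id.const_sub 1))

/-- The completed zeta function. -/
def LamF (s : ℂ) : ℂ :=
  (unitCard K)⁻¹ * (zetaEntire σ s - 1 / s - 1 / (1 - s))

lemma LamF_one_sub (s : ℂ) : LamF σ (1 - s) = LamF σ s := by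
  unfold LamF zetaEntire
  ring_nf

/-- The Mellin transform of the theta series. -/
lemma mellin_zetaTheta {s : ℂ} (hs : 1 < s.re) :
    IntegrableOn (fun x : ℝ => (x : ℂ) ^ (s - 1) * (zetaTheta σ x : ℂ)) (Ioi 0)
    ∧ ∫ x in Ioi (0 : ℝ), (x : ℂ) ^ (s - 1) * (zetaTheta σ x : ℂ) = unitCard K * LamF σ s := by
  have h1 := mellin_sum_exp (zeta_exponent_pos σ) (s := s) (by linarith)
    (summable_zeta_exponent σ hs)
  have h2 := mellin_split (k := 1) (integrableOn_zetaTheta σ) (fun x hx => zetaTheta_inv σ hx)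
    (s := s) (by simpa using hs)
  refine ⟨h1.1, h2.trans ?_⟩
  rw [LamF, zetaEntire, mul_inv_cancel_left₀ (unitCard_ne_zero (K := K)), Nat.cast_one]

lemma analyticAt_LamF {s : ℂ} (h0 : s ≠ 0) (h1 : s ≠ 1) : AnalyticAt ℂ (LamF σ) s := by
  have h := (differentiable_zetaEntire σ).analyticAt s
  have e1 : AnalyticAt ℂ (fun s : ℂ => 1 / s) s := analyticAt_const.div analyticAt_id h0
  have e2 : AnalyticAt ℂ (fun s : ℂ => 1 / (1 - s)) s :=
    analyticAt_const.div (analyticAt_const.sub analyticAt_id) (sub_ne_zero.2 h1.symm)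
  exact analyticAt_const.mul ((h.sub e1).sub e2)

lemma meromorphicOn_LamF : MeromorphicOn (LamF σ) univ := by
  intro s _
  have h := ((differentiable_zetaEntire σ).analyticAt s).meromorphicAt
  have e1 : MeromorphicAt (fun s : ℂ => 1 / s) s :=
    (MeromorphicAt.const 1 s).div (MeromorphicAt.id s)
  have e2 : MeromorphicAt (fun s : ℂ => 1 / (1 - s)) s :=
    (MeromorphicAt.const 1 s).div ((MeromorphicAt.const 1 s).sub (MeromorphicAt.id s))
  exact (MeromorphicAt.const _ s).mul ((h.sub e1).sub e2)

variable [IsPrincipalIdealRing (𝓞 K)]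

lemma LamF_eq_zetaSeries {s : ℂ} (hs : 1 < s.re) : LamF σ s = zetaSeries K s := by
  have h1 := mellin_sum_exp (zeta_exponent_pos σ) (s := s) (by linarith)
    (summable_zeta_exponent σ hs)
  have h2 := (mellin_zetaTheta σ hs).2
  have h3 : ∑' μ : NZ K, ((condR K * ‖emb σ μ.1‖ ^ 2 : ℝ) : ℂ) ^ (-s)
      = cond K ^ (-s) * (unitCard K * dedekindZeta K s) := by
    rw [← tsum_nz_eq_zeta σ hs, ← tsum_mul_left]
    refine tsum_congr fun μ => ?_
    have := one_le_norm_emb σ μ.2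
    rw [ofReal_mul_cpow (condR_pos K) (by positivity)]
    rfl
  have h4 := h2.symm.trans (h1.2.trans (by rw [h3]))
  apply mul_left_cancel₀ (unitCard_ne_zero (K := K))
  rw [h4, zetaSeries]
  ring

lemma hasMeroCont_zeta : HasMeroCont (zetaSeries K) 1 ∧ ∀ s, s ≠ 0 → s ≠ 1 → LamK K s = LamF σ s :=
    by
  have h := hasMeroCont_and_eq (f := zetaSeries K) (σ₀ := 1) (meromorphicOn_LamF σ) (fun s hs =>
    analyticAt_LamF σ (by rintro rfl; simp at hs; linarith) (by rintro rfl; simp at hs))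
    (fun s hs => LamF_eq_zetaSeries σ hs)
  exact ⟨h.1, fun s h0 h1 => h.2 s (analyticAt_LamF σ h0 h1)⟩

end Zeta

/-! ### The theta series of a point and the group action -/

lemma qf_mul_den (p : Pairs K) (γ : SL(2, 𝓞 K)) (P : H3) :
    qf σ p.1.1 p.1.2 (incl σ γ • P) * qf σ (γ 1 0) (γ 1 1) P
    = qf σ (p.1.1 * γ 0 0 + p.1.2 * γ 1 0) (p.1.1 * γ 0 1 + p.1.2 * γ 1 1) P := by
  obtain ⟨⟨c, d⟩, hp⟩ := p
  -- complete the row `(c, d)` to an invertible matrix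
  obtain ⟨M, h0, h1⟩ : ∃ M : GL (Fin 2) ℂ, M.1 1 0 = emb σ c ∧ M.1 1 1 = emb σ d := by
    by_cases hc : c = 0
    · have hd : d ≠ 0 := by rintro rfl; exact hp (by rw [hc]; rfl)
      exact ⟨Matrix.GeneralLinearGroup.mkOfDetNeZero !![1, 0; emb σ c, emb σ d]
        (by simpa using emb_ne_zero σ hd), rfl, rfl⟩
    · exact ⟨Matrix.GeneralLinearGroup.mkOfDetNeZero !![0, 1; emb σ c, emb σ d]
        (by simpa using emb_ne_zero σ hc), rfl, rfl⟩
  have h := den_mul M (incl σ γ) P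
  have e1 : den (M * incl σ γ).1 P
      = qf σ (c * γ 0 0 + d * γ 1 0) (c * γ 0 1 + d * γ 1 1) P := by
    simp only [den, qf, Units.val_mul, Matrix.mul_apply, Fin.sum_univ_two, h0, h1, incl_apply,
      map_add, map_mul]
  have e2 : den M.1 (act (incl σ γ) P) = qf σ c d (incl σ γ • P) := by
    simp only [den, qf, h0, h1]
    rfl
  rw [e1, e2] at h
  exact h.symm

/-- Right multiplication of rows by a matrix. -/
def rowEquiv (γ : SL(2, 𝓞 K)) : Pairs K ≃ Pairs K :=
  have key : ∀ (γ δ : SL(2, 𝓞 K)), γ * δ = 1 → ∀ p : 𝓞 K × 𝓞 K,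
      ((p.1 * γ 0 0 + p.2 * γ 1 0) * δ 0 0 + (p.1 * γ 0 1 + p.2 * γ 1 1) * δ 1 0,
        (p.1 * γ 0 0 + p.2 * γ 1 0) * δ 0 1 + (p.1 * γ 0 1 + p.2 * γ 1 1) * δ 1 1) = p := by
    intro γ δ h p
    have e : ∀ i j, γ i 0 * δ 0 j + γ i 1 * δ 1 j = (1 : SL(2, 𝓞 K)) i j := by
      intro i j
      rw [← h, Matrix.SpecialLinearGroup.coe_mul, Matrix.mul_apply, Fin.sum_univ_two]
    have e00 := e 0 0
    have e01 := e 0 1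
    have e10 := e 1 0
    have e11 := e 1 1
    simp only [Matrix.SpecialLinearGroup.coe_one, Matrix.one_apply_eq, ne_eq, zero_ne_one,
      one_ne_zero, not_false_eq_true, Matrix.one_apply_ne] at e00 e01 e10 e11
    ext1
    · dsimp only; linear_combination p.1 * e00 + p.2 * e10
    · dsimp only; linear_combination p.1 * e01 + p.2 * e11
  have hne : ∀ (γ : SL(2, 𝓞 K)) (p : Pairs K),
      ((p.1.1 * γ 0 0 + p.1.2 * γ 1 0, p.1.1 * γ 0 1 + p.1.2 * γ 1 1) : 𝓞 K × 𝓞 K) ≠ 0 := by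
    intro γ p h0
    obtain ⟨h1, h2⟩ := Prod.ext_iff.1 h0
    have h := key γ γ⁻¹ (mul_inv_cancel γ) p.1
    dsimp only [Prod.fst_zero, Prod.snd_zero] at h1 h2
    rw [h1, h2] at h
    exact p.2 (by rw [← h]; simp)
  { toFun := fun p => ⟨_, hne γ p⟩
    invFun := fun p => ⟨_, hne γ⁻¹ p⟩
    left_inv := fun p => Subtype.ext (key γ γ⁻¹ (mul_inv_cancel γ) p.1)
    right_inv := fun p => Subtype.ext (key γ⁻¹ γ (inv_mul_cancel γ) p.1) }

section Est

variable [IsTotallyComplex K] [hdeg : Fact (Module.finrank ℚ K = 2)]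

lemma thetaP_smul (γ : SL(2, 𝓞 K)) (P : H3) (x : ℝ) : thetaP σ (incl σ γ • P) x = thetaP σ P x := by
  unfold thetaP
  rw [← (rowEquiv γ).tsum_eq (fun p : Pairs K =>
    Real.exp (-(condR K * x * (qf σ p.1.1 p.1.2 P / P.r))))]
  refine tsum_congr fun p => ?_
  have h := qf_mul_den σ p γ P
  have e : qf σ p.1.1 p.1.2 (incl σ γ • P) / H3.r (incl σ γ • P)
      = qf σ (rowEquiv γ p).1.1 (rowEquiv γ p).1.2 P / P.r := by
    rw [r_incl_smul, div_div_eq_mul_div, h]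
    rfl
  rw [e]

lemma thetaP_gam {γ : Equiv.Perm H3} (hγ : γ ∈ Gam σ) (P : H3) (x : ℝ) :
    thetaP σ (γ P) x = thetaP σ P x := by
  obtain ⟨M, rfl⟩ := hγ
  exact thetaP_smul σ M P x

lemma measurable_qf (c d : 𝓞 K) : Measurable (qf σ c d) := by
  have h1 := measurable_z
  have h2 := measurable_r
  have h3 : Measurable normSq := continuous_normSq.measurable
  exact (h3.comp ((h1.const_mul _).add_const _)).add ((h2.pow_const 2).const_mul _)

lemma measurable_thetaP : Measurable fun q : H3 × ℝ => thetaP σ q.1 q.2 := by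
  have e : (fun q : H3 × ℝ => thetaP σ q.1 q.2) = fun q : H3 × ℝ => (∑' p : Pairs K,
      ENNReal.ofReal (Real.exp (-(condR K * q.2 * (qf σ p.1.1 p.1.2 q.1 / q.1.r))))).toReal := by
    funext q
    rw [ENNReal.tsum_toReal_eq (fun _ => ENNReal.ofReal_ne_top), thetaP]
    exact tsum_congr fun p => (ENNReal.toReal_ofReal (Real.exp_pos _).le).symm
  rw [e]
  refine Measurable.ennreal_toReal (Measurable.tsum fun p => ?_)
  have h0 : Measurable (Prod.fst : H3 × ℝ → H3) := measurable_fst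
  have h4 : Measurable (Prod.snd : H3 × ℝ → ℝ) := measurable_snd
  have h3 := ((measurable_qf σ p.1.1 p.1.2).comp h0).div (measurable_r.comp h0)
  exact (Real.measurable_exp.comp ((h4.const_mul _).mul h3).neg).ennreal_ofReal

lemma theta_exponent_pos (P : H3) (p : Pairs K) : 0 < condR K * (qf σ p.1.1 p.1.2 P / P.r) := by
  have h1 := condR_pos (K := K)
  have h2 := qf_pos σ p P
  have h3 := P.r_pos
  positivity

lemma thetaP_eq (P : H3) (x : ℝ) :
    thetaP σ P x = ∑' p : Pairs K, Real.exp (-x * (condR K * (qf σ p.1.1 p.1.2 P / P.r))) := by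
  unfold thetaP
  refine tsum_congr fun p => ?_
  congr 1; ring

lemma theta_exponent_rpow (P : H3) (A : ℝ) (p : Pairs K) : (condR K * (qf σ p.1.1 p.1.2 P / P.r)) ^
    (-A) = condR K ^ (-A) * P.r ^ A * qf σ p.1.1 p.1.2 P ^ (-A) := by
  have h1 := condR_pos (K := K)
  have h2 := qf_pos σ p P
  have h3 := P.r_pos
  rw [Real.mul_rpow h1.le (by positivity), Real.div_rpow h2.le h3.le, Real.rpow_neg h3.le,
    div_inv_eq_mul]
  ring

lemma summable_theta_exponent (P : H3) {A : ℝ} (hA : 2 < A) :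
    Summable fun p : Pairs K => (condR K * (qf σ p.1.1 p.1.2 P / P.r)) ^ (-A) :=
  ((summable_qf σ hA P).mul_left _).congr fun p => (theta_exponent_rpow σ P A p).symm

/-- The Mellin transform of the theta series is an Epstein zeta function. -/
lemma mellin_thetaP (P : H3) {s : ℂ} (hs : 2 < s.re) :
    IntegrableOn (fun x : ℝ => (x : ℂ) ^ (s - 1) * (thetaP σ P x : ℂ)) (Ioi 0)
    ∧ ∫ x in Ioi (0 : ℝ), (x : ℂ) ^ (s - 1) * (thetaP σ P x : ℂ) = Gamma s * ∑' p : Pairs K,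
    ((condR K * (qf σ p.1.1 p.1.2 P / P.r) : ℝ) : ℂ) ^ (-s) := by
  simp only [thetaP_eq]
  exact mellin_sum_exp (theta_exponent_pos σ P) (by linarith) (summable_theta_exponent σ P hs)

lemma integrableOn_thetaP (P : H3) (s : ℂ) :
    IntegrableOn (fun x : ℝ => (x : ℂ) ^ (s - 1) * (thetaP σ P x : ℂ)) (Ioi 1) :=
  integrableOn_Ioi_one (σ₀ := 2) (fun A hA => (mellin_thetaP σ P (s := (A : ℂ))
    (by rwa [ofReal_re])).1) s

lemma integrableOn_rpow_mul_thetaP (P : H3) (A : ℝ) :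
    IntegrableOn (fun x : ℝ => x ^ A * thetaP σ P x) (Ioi 1) := by
  refine (integrableOn_thetaP σ P (A + 1)).norm.congr (ae_restrict_of_forall_mem measurableSet_Ioi fun x (hx : 1 < x) => ?_)
  have hx0 : 0 < x := by linarith
  beta_reduce
  rw [norm_mul, norm_cpow_eq_rpow_re_of_pos hx0, norm_real,
    Real.norm_of_nonneg (thetaP_nonneg σ P x)]
  simp

/-- Moments of the theta series grow at most polynomially at the cusp. -/
lemma exists_moment_thetaP_le (A R : ℝ) {δ : ℝ} (hδ : 0 < δ) : ∃ C B : ℝ, 0 < C ∧ ∀ P : H3, ‖P.z‖ ≤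
    R → δ ≤ P.r → ∫ x in Ioi (1 : ℝ), x ^ A * thetaP σ P x ≤ C * P.r ^ B := by
  set B := |A| + 3 with hB
  have hB2 : 2 < B := by have := abs_nonneg A; linarith
  obtain ⟨C, hC, h⟩ := exists_sum_qf_le σ hB2 R hδ
  have hk := condR_pos (K := K)
  refine ⟨Real.Gamma B * (condR K ^ (-B) * C), B, by positivity, fun P hz hr => ?_⟩
  have hr0 := P.r_pos
  obtain ⟨h1, h2⟩ := mellin_thetaP σ P (s := (B : ℂ)) (by rwa [ofReal_re])
  have e1 : ∀ x ∈ Ioi (0 : ℝ), (x : ℂ) ^ ((B : ℂ) - 1) * (thetaP σ P x : ℂ)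
      = ((x ^ (B - 1) * thetaP σ P x : ℝ) : ℂ) := by
    intro x (hx : 0 < x)
    rw [ofReal_mul, ofReal_cpow hx.le]; push_cast; rfl
  have e2 : ∀ p : Pairs K, ((condR K * (qf σ p.1.1 p.1.2 P / P.r) : ℝ) : ℂ) ^ (-(B : ℂ))
      = (((condR K * (qf σ p.1.1 p.1.2 P / P.r)) ^ (-B) : ℝ) : ℂ) := by
    intro p
    rw [ofReal_cpow (theta_exponent_pos σ P p).le]; push_cast; rfl
  have h3 : IntegrableOn (fun x : ℝ => x ^ (B - 1) * thetaP σ P x) (Ioi 0) := by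
    have := h1.congr_fun e1 measurableSet_Ioi
    exact this.re
  rw [setIntegral_congr_fun measurableSet_Ioi e1, integral_complex_ofReal, tsum_congr e2, ← ofReal_tsum,
    Gamma_ofReal, ← ofReal_mul] at h2
  have h4 := ofReal_injective h2
  calc ∫ x in Ioi (1 : ℝ), x ^ A * thetaP σ P x
      ≤ ∫ x in Ioi (1 : ℝ), x ^ (B - 1) * thetaP σ P x := by
        refine setIntegral_mono_on (integrableOn_rpow_mul_thetaP σ P A)
          (integrableOn_rpow_mul_thetaP σ P _) measurableSet_Ioi fun x (hx : 1 < x) => ?_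
        refine mul_le_mul_of_nonneg_right (Real.rpow_le_rpow_of_exponent_le hx.le ?_)
          (thetaP_nonneg σ P x)
        have := le_abs_self A
        linarith
    _ ≤ ∫ x in Ioi (0 : ℝ), x ^ (B - 1) * thetaP σ P x := by
        refine setIntegral_mono_set h3 (ae_restrict_of_forall_mem measurableSet_Ioi fun x (hx : 0 < x) => ?_)
          (.of_forall (Ioi_subset_Ioi zero_le_one))
        exact mul_nonneg (Real.rpow_nonneg hx.le _) (thetaP_nonneg σ P x)
    _ = Real.Gamma B * (condR K ^ (-B) * (∑' p : Pairs K, qf σ p.1.1 p.1.2 P ^ (-B)) * P.r ^ B) := by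
        rw [h4, tsum_congr (theta_exponent_rpow σ P B), tsum_mul_left]
        ring
    _ ≤ Real.Gamma B * (condR K ^ (-B) * C * P.r ^ B) := by
        have := (h P hz hr).2
        gcongr
    _ = _ := by ring

/-! ### The completed Eisenstein series -/

/-- The completed Eisenstein series `Λ(1 + s) E(P, s)`, defined for all `s ≠ ± 1` by Riemann's
splitting of the Mellin transform. -/
def Est (P : H3) (s : ℂ) : ℂ :=
  1 / 2 * (upperMellin (thetaP σ P) (1 + s) + upperMellin (thetaP σ P) (1 - s)
    - 1 / (1 + s) - 1 / (1 - s))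

lemma Est_neg (P : H3) (s : ℂ) : Est σ P (-s) = Est σ P s := by
  unfold Est
  ring_nf

lemma Est_gam {γ : Equiv.Perm H3} (hγ : γ ∈ Gam σ) (P : H3) (s : ℂ) : Est σ (γ P) s = Est σ P s :=
    by
  have h : thetaP σ (γ P) = thetaP σ P := funext fun x => thetaP_gam σ hγ P x
  rw [Est, h, Est]

/-- Near a given point the quadratic forms are bounded below by a multiple of the form of the
point `j`, which gives a common bound of the theta series. -/
lemma continuous_upperMellin_thetaP (s : ℂ) : Continuous fun P => upperMellin (thetaP σ P) s := by
  refine continuous_iff_continuousAt.2 fun P₀ => ?_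
  have hP₀ := P₀.r_pos
  obtain ⟨C, hC, h⟩ := exists_qf_lower σ (‖P₀.z‖ + 1) (half_pos hP₀)
  set m := (C * (2 * P₀.r))⁻¹ with hm
  have hm0 : 0 < m := by positivity
  have hk := condR_pos K
  have hr : Continuous H3.r := continuous_snd.comp continuous_subtype_val
  have hz : Continuous H3.z := continuous_fst.comp continuous_subtype_val
  set b : ℝ → Pairs K → ℝ := fun x p =>
    Real.exp (-(condR K * (m * x) * (qf σ p.1.1 p.1.2 (mk 0 1 one_pos) / (mk 0 1 one_pos).r))) with hb
  have hle : ∀ᶠ P in 𝓝 P₀, ∀ x, 0 < x → ∀ p : Pairs K,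
      Real.exp (-(condR K * x * (qf σ p.1.1 p.1.2 P / P.r))) ≤ b x p := by
    filter_upwards [hz.norm.continuousAt.eventually_lt_const (lt_add_one ‖P₀.z‖),
      hr.continuousAt.eventually_const_lt (half_lt_self hP₀),
      hr.continuousAt.eventually_lt_const (by linarith : P₀.r < 2 * P₀.r)] with P h1 h2 h3 x hx p
    have h4 := h P h1.le h2.le p.1.1 p.1.2
    have hP := P.r_pos
    have e : qf σ p.1.1 p.1.2 (mk 0 1 one_pos) / (mk 0 1 one_pos).r
        = ‖emb σ p.1.1‖ ^ 2 + ‖emb σ p.1.2‖ ^ 2 := by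
      simp [qf, mk, H3.z, H3.r, Complex.sq_norm, add_comm]
    have h5 : m * (‖emb σ p.1.1‖ ^ 2 + ‖emb σ p.1.2‖ ^ 2) ≤ qf σ p.1.1 p.1.2 P / P.r := by
      rw [le_div_iff₀ hP, hm, inv_mul_eq_div, div_mul_eq_mul_div, div_le_iff₀ (by positivity)]
      calc _ ≤ C * qf σ p.1.1 p.1.2 P * (2 * P₀.r) := by
            gcongr
            exact mul_nonneg hC.le (qf_nonneg _ _ _ _)
        _ = _ := by ring
    rw [hb]
    beta_reduce
    rw [e, mul_assoc (condR K), mul_assoc (condR K), mul_right_comm m x, mul_comm _ x]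
    gcongr
  have hsum : ∀ x, 0 < x → Summable (b x) := fun x hx =>
    summable_thetaP σ (mk 0 1 one_pos) (mul_pos hm0 hx)
  have hint : ∀ s : ℂ, IntegrableOn (fun x : ℝ => (x : ℂ) ^ (s - 1)
      * (thetaP σ (mk 0 1 one_pos) (m * x) : ℂ)) (Ioi 1) :=
    integrableOn_Ioi_one (σ₀ := 2) fun A hA => (MellinConvergent.comp_mul_left
      (f := fun x => (thetaP σ (mk 0 1 one_pos) x : ℂ)) hm0).2
      (mellin_thetaP σ (mk 0 1 one_pos) (s := (A : ℂ)) (by rwa [ofReal_re])).1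
  refine tendsto_integral_filter_of_dominated_convergence _
    (.of_forall fun P => (integrableOn_thetaP σ P s).aestronglyMeasurable) ?_ (hint s).norm ?_
  · filter_upwards [hle] with P hP
    refine ae_restrict_of_forall_mem measurableSet_Ioi fun x (hx : 1 < x) => ?_
    have hx0 : 0 < x := by linarith
    rw [norm_mul, norm_mul, norm_real, norm_real, Real.norm_of_nonneg (thetaP_nonneg σ P x),
      Real.norm_of_nonneg (thetaP_nonneg σ _ _)]
    gcongr
    exact (summable_thetaP σ P hx0).tsum_le_tsum (hP x hx0) (hsum x hx0)
  · refine ae_restrict_of_forall_mem measurableSet_Ioi fun x (hx : 1 < x) => ?_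
    have hx0 : 0 < x := by linarith
    refine ((continuous_ofReal.tendsto _).comp ?_).const_mul _
    refine tendsto_tsum_of_dominated_convergence (hsum x hx0) (fun p => ?_) ?_
    · have : ContinuousAt (fun P : H3 => qf σ p.1.1 p.1.2 P / P.r) P₀ := by
        unfold qf
        exact (((continuous_normSq.comp ((hz.const_mul _).add_const _)).add
          ((hr.pow 2).const_mul _)).continuousAt).div hr.continuousAt hP₀.ne'
      exact (Real.continuous_exp.continuousAt.comp (this.const_mul _).neg).tendsto
    · filter_upwards [hle] with P hP p
      rw [Real.norm_of_nonneg (Real.exp_pos _).le]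
      exact hP x hx0 p

lemma continuous_Est (s : ℂ) : Continuous fun P : H3 => Est σ P s :=
  ((((continuous_upperMellin_thetaP σ _).add (continuous_upperMellin_thetaP σ _)).sub
    continuous_const).sub continuous_const).const_mul _

lemma measurable_Est (s : ℂ) : Measurable fun P : H3 => Est σ P s :=
  (continuous_Est σ s).measurable

lemma norm_upperMellin_thetaP_le (P : H3) (s : ℂ) :
    ‖upperMellin (thetaP σ P) s‖ ≤ ∫ x in Ioi (1 : ℝ), x ^ (s.re - 1) * thetaP σ P x := by
  refine (norm_integral_le_integral_norm _).trans (le_of_eq ?_)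
  refine setIntegral_congr_fun measurableSet_Ioi fun x (hx : 1 < x) => ?_
  have hx0 : 0 < x := by linarith
  rw [norm_mul, norm_cpow_eq_rpow_re_of_pos hx0, norm_real,
    Real.norm_of_nonneg (thetaP_nonneg σ P x)]
  simp

/-- The completed Eisenstein series grows at most polynomially at the cusp. -/
lemma exists_norm_Est_le (s : ℂ) (R : ℝ) {δ : ℝ} (hδ : 0 < δ) : ∃ C B : ℝ, 0 ≤ C ∧ 0 ≤ B ∧ ∀ P : H3,
    ‖P.z‖ ≤ R → δ ≤ P.r → ‖Est σ P s‖ ≤ C * (1 + P.r) ^ B := by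
  obtain ⟨C₁, B₁, hC₁, h₁⟩ := exists_moment_thetaP_le σ ((1 + s).re - 1) R hδ
  obtain ⟨C₂, B₂, hC₂, h₂⟩ := exists_moment_thetaP_le σ ((1 - s).re - 1) R hδ
  have hpow : ∀ B : ℝ, ∃ c : ℝ, 0 < c ∧ ∀ r : ℝ, δ ≤ r → r ^ B ≤ c * (1 + r) ^ |B| := by
    intro B
    refine ⟨1 + δ ^ (-|B|), by positivity, fun r hr => ?_⟩
    have hr0 : 0 < r := hδ.trans_le hr
    have h3 : 1 ≤ (1 + r) ^ |B| := Real.one_le_rpow (by linarith) (abs_nonneg B)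
    rcases le_total 0 B with hB | hB
    · rw [abs_of_nonneg hB]
      rw [abs_of_nonneg hB] at h3
      have h4 : r ^ B ≤ (1 + r) ^ B := Real.rpow_le_rpow hr0.le (by linarith) hB
      have h5 := Real.rpow_pos_of_pos hδ (-B)
      nlinarith
    · have h4 : r ^ B ≤ δ ^ (-|B|) := by
        rw [abs_of_nonpos hB, neg_neg]
        exact Real.rpow_le_rpow_of_nonpos hδ hr hB
      have h5 := Real.rpow_pos_of_pos hδ (-|B|)
      nlinarith
  obtain ⟨c₁, hc₁, hp₁⟩ := hpow B₁
  obtain ⟨c₂, hc₂, hp₂⟩ := hpow B₂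
  refine ⟨C₁ * c₁ + C₂ * c₂ + ‖1 / (1 + s)‖ + ‖1 / (1 - s)‖, max |B₁| |B₂|, by positivity,
    (abs_nonneg _).trans (le_max_left _ _), fun P hz hr => ?_⟩
  set M := (1 + P.r) ^ max |B₁| |B₂| with hM
  have hM1 : 1 ≤ M := Real.one_le_rpow (by linarith) ((abs_nonneg _).trans (le_max_left _ _))
  have hb : ∀ {C c B : ℝ}, 0 < C → (∀ r : ℝ, δ ≤ r → r ^ B ≤ c * (1 + r) ^ |B|) → 0 < c →
      |B| ≤ max |B₁| |B₂| → C * P.r ^ B ≤ C * c * M := by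
    intro C c B hC hp hc hB
    rw [mul_assoc]
    refine mul_le_mul_of_nonneg_left ((hp _ hr).trans ?_) hC.le
    exact mul_le_mul_of_nonneg_left
      (Real.rpow_le_rpow_of_exponent_le (by linarith) hB) hc.le
  have e1 := ((norm_upperMellin_thetaP_le σ P (1 + s)).trans (h₁ P hz hr)).trans
    (hb hC₁ hp₁ hc₁ (le_max_left _ _))
  have e2 := ((norm_upperMellin_thetaP_le σ P (1 - s)).trans (h₂ P hz hr)).trans
    (hb hC₂ hp₂ hc₂ (le_max_right _ _))
  have e3 := le_mul_of_one_le_right (norm_nonneg (1 / (1 + s))) hM1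
  have e4 := le_mul_of_one_le_right (norm_nonneg (1 / (1 - s))) hM1
  rw [Est, norm_mul]
  have e5 : ‖(1 / 2 : ℂ)‖ ≤ 1 := by norm_num
  calc ‖(1 / 2 : ℂ)‖ * ‖_‖ ≤ 1 * (‖upperMellin (thetaP σ P) (1 + s)‖
      + ‖upperMellin (thetaP σ P) (1 - s)‖ + ‖1 / (1 + s)‖ + ‖1 / (1 - s)‖) := by
        gcongr
        exact (norm_sub_le _ _).trans (add_le_add ((norm_sub_le _ _).trans
          (add_le_add (norm_add_le _ _) le_rfl)) le_rfl)
    _ ≤ _ := by linarith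

lemma analyticAt_Est (P : H3) {s : ℂ} (h1 : s ≠ 1) (h2 : s ≠ -1) : AnalyticAt ℂ (Est σ P) s := by
  have h := differentiable_upperMellin (integrableOn_thetaP σ P)
  have a1 : AnalyticAt ℂ (fun s => upperMellin (thetaP σ P) (1 + s)) s :=
    (h.comp (differentiable_id.const_add 1)).analyticAt s
  have a2 : AnalyticAt ℂ (fun s => upperMellin (thetaP σ P) (1 - s)) s :=
    (h.comp (differentiable_id.const_sub 1)).analyticAt s
  have a3 : AnalyticAt ℂ (fun s : ℂ => 1 / (1 + s)) s :=
    analyticAt_const.div (analyticAt_const.add analyticAt_id)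
      (fun h => h2 (by linear_combination h))
  have a4 : AnalyticAt ℂ (fun s : ℂ => 1 / (1 - s)) s :=
    analyticAt_const.div (analyticAt_const.sub analyticAt_id) (sub_ne_zero.2 h1.symm)
  exact analyticAt_const.mul (((a1.add a2).sub a3).sub a4)

lemma meromorphicAt_Est (P : H3) (s : ℂ) : MeromorphicAt (Est σ P) s := by
  have h := differentiable_upperMellin (integrableOn_thetaP σ P)
  have a1 : AnalyticAt ℂ (fun s => upperMellin (thetaP σ P) (1 + s)) s :=
    (h.comp (differentiable_id.const_add 1)).analyticAt s
  have a2 : AnalyticAt ℂ (fun s => upperMellin (thetaP σ P) (1 - s)) s :=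
    (h.comp (differentiable_id.const_sub 1)).analyticAt s
  have a3 : MeromorphicAt (fun s : ℂ => 1 / (1 + s)) s :=
    (MeromorphicAt.const 1 s).div ((MeromorphicAt.const 1 s).add (MeromorphicAt.id s))
  have a4 : MeromorphicAt (fun s : ℂ => 1 / (1 - s)) s :=
    (MeromorphicAt.const 1 s).div ((MeromorphicAt.const 1 s).sub (MeromorphicAt.id s))
  exact (MeromorphicAt.const _ s).mul (((a1.meromorphicAt.add a2.meromorphicAt).sub a3).sub a4)

lemma conj_upperMellin (θ : ℝ → ℝ) (s : ℂ) :
    conj (upperMellin θ s) = upperMellin θ (conj s) := by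
  unfold upperMellin
  rw [← integral_conj]
  refine setIntegral_congr_fun measurableSet_Ioi fun x (hx : 1 < x) => ?_
  have e := cpow_conj (x : ℂ) (s - 1) (by
    rw [arg_ofReal_of_nonneg (by linarith)]; exact Real.pi_pos.ne)
  rw [conj_ofReal, map_sub, map_one] at e
  rw [e, map_mul, conj_ofReal]

lemma conj_Est (P : H3) (s : ℂ) : conj (Est σ P s) = Est σ P (conj s) := by
  simp only [Est, map_mul, map_sub, map_add, map_div₀, map_one, conj_upperMellin, map_ofNat]

lemma conj_LamF (s : ℂ) : conj (LamF σ s) = LamF σ (conj s) := by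
  simp only [LamF, zetaEntire, unitCard, map_mul, map_sub, map_add, map_div₀, map_one, map_inv₀,
    conj_upperMellin, map_natCast]

variable [IsPrincipalIdealRing (𝓞 K)]

lemma Est_eq (P : H3) {s : ℂ} (hs : 1 < s.re) : Est σ P s = LamF σ (1 + s) * eisSeries σ P s := by
  have hre : 2 < (1 + s).re := by rw [add_re, one_re]; linarith
  have h1 := (mellin_thetaP σ P hre).2
  have h2 := mellin_split (k := 2) (integrableOn_thetaP σ P) (fun x hx => theta_inv σ P hx)
    (s := 1 + s) (by simpa using hre)
  have h3 := zeta_mul_eisSeries σ P hs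
  have hk := condR_pos (K := K)
  have h4 : ∑' p : Pairs K, ((condR K * (qf σ p.1.1 p.1.2 P / P.r) : ℝ) : ℂ) ^ (-(1 + s))
      = cond K ^ (-(1 + s)) * (2 * (dedekindZeta K (1 + s) * eisSeries σ P s)) := by
    rw [h3, ← mul_assoc 2, mul_one_div_cancel two_ne_zero, one_mul, ← tsum_mul_left]
    refine tsum_congr fun p => ?_
    have := qf_pos σ p P
    have := P.r_pos
    rw [ofReal_mul_cpow hk (by positivity)]
    rfl
  rw [h1, h4] at h2
  rw [LamF_eq_zetaSeries σ (by linarith), zetaSeries]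
  have e1 : ((2 : ℕ) : ℂ) - (1 + s) = 1 - s := by push_cast; ring
  rw [e1] at h2
  unfold Est
  linear_combination (-1 / 2 : ℂ) * h2

end Est

/-! ### Continuation of the Eisenstein series -/

section Continuation

variable [IsTotallyComplex K] [hdeg : Fact (Module.finrank ℚ K = 2)]

lemma row_injective : Function.Injective fun c : Cosets K => (c.out 1 0, c.out 1 1) := by
  intro c c' h
  have h1 : rowMap (c, 1) = rowMap (c', 1) := by
    have h2 := Prod.ext_iff.1 h
    apply Subtype.ext
    simp only [rowMap, Units.val_one, one_smul]
    exact Prod.ext h2.1 h2.2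
  exact congrArg Prod.fst (rowMap_bijective.1 h1)

lemma summable_eisSeries (P : H3) {A : ℝ} (hA : 2 < A) :
    Summable fun c : Cosets K => H3.r (incl σ c.out • P) ^ A := by
  have hinj : Function.Injective fun c : Cosets K => (⟨(c.out 1 0, c.out 1 1), fun h0 => by
      have h := isCoprime_row c.out
      obtain ⟨h1, h2⟩ := Prod.ext_iff.1 h0
      dsimp only [Prod.fst_zero, Prod.snd_zero] at h1 h2
      rw [h1, h2] at h
      exact not_isCoprime_zero_zero h⟩ : Pairs K) :=
    fun c c' h => row_injective (congrArg Subtype.val h)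
  refine (((summable_qf σ hA P).comp_injective hinj).mul_left (P.r ^ A)).congr fun c => ?_
  have hr := P.r_pos
  have hq : 0 < qf σ (c.out 1 0) (c.out 1 1) P := den_pos (incl σ c.out) P
  rw [r_incl_smul, Real.div_rpow hr.le hq.le, Function.comp_apply, Real.rpow_neg hq.le]
  rfl

lemma analyticAt_eisSeries (P : H3) {s : ℂ} (hs : 1 < s.re) : AnalyticAt ℂ (eisSeries σ P) s := by
  set a := (1 + s.re) / 2 with ha
  set b := s.re + 1 with hb
  set U : Set ℂ := {z | a < z.re} ∩ {z | z.re < b} with hU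
  have hUo : IsOpen U := (isOpen_lt continuous_const continuous_re).inter
    (isOpen_lt continuous_re continuous_const)
  have hsum := (summable_eisSeries σ P (A := 1 + a) (by linarith)).add
    (summable_eisSeries σ P (A := 1 + b) (by linarith))
  have h := differentiableOn_tsum_of_summable_norm hsum
    (F := fun c : Cosets K => fun z : ℂ => (H3.r (incl σ c.out • P) : ℂ) ^ (1 + z)) (U := U)
    (fun c => by
      have hr : (H3.r (incl σ c.out • P) : ℂ) ≠ 0 := by exact_mod_cast (H3.r_pos _).ne'
      exact ((differentiable_id.const_add 1).const_cpow (Or.inl hr)).differentiableOn) hUo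
    (fun c z hz => by
      have hr := H3.r_pos (incl σ c.out • P)
      have h1 := Real.rpow_pos_of_pos hr (1 + a)
      have h2 := Real.rpow_pos_of_pos hr (1 + b)
      have hz1 : a < z.re := hz.1
      have hz2 : z.re < b := hz.2
      rw [norm_cpow_eq_rpow_re_of_pos hr, add_re, one_re]
      rcases le_total (H3.r (incl σ c.out • P)) 1 with h3 | h3
      · have := Real.rpow_le_rpow_of_exponent_ge hr h3 (by linarith : 1 + a ≤ 1 + z.re)
        linarith
      · have := Real.rpow_le_rpow_of_exponent_le h3 (by linarith : 1 + z.re ≤ 1 + b)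
        linarith)
  exact h.analyticAt (hUo.mem_nhds ⟨by change a < s.re; linarith, by change s.re < b; linarith⟩)

/-- The function `s Λ(1 + s)`, with the correct value at `s = 0`. -/
def LamReg (s : ℂ) : ℂ :=
  (unitCard K)⁻¹ * (s * zetaEntire σ (1 + s) - s / (1 + s) + 1)

lemma LamReg_eq {s : ℂ} (hs : s ≠ 0) : LamReg σ s = s * LamF σ (1 + s) := by
  unfold LamReg LamF
  rw [sub_add_cancel_left, div_neg, mul_left_comm s]
  congr 1
  field_simp
  ring

lemma LamReg_zero : LamReg σ 0 ≠ 0 := by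
  simpa [LamReg] using unitCard_ne_zero (K := K)

lemma meromorphicAt_LamReg (s : ℂ) : MeromorphicAt (LamReg σ) s := by
  have h : AnalyticAt ℂ (fun s => zetaEntire σ (1 + s)) s :=
    ((differentiable_zetaEntire σ).comp (differentiable_id.const_add 1)).analyticAt s
  exact (MeromorphicAt.const _ s).mul ((((MeromorphicAt.id s).mul h.meromorphicAt).sub
    ((MeromorphicAt.id s).div ((MeromorphicAt.const 1 s).add (MeromorphicAt.id s)))).add
    (MeromorphicAt.const 1 s))

lemma analyticAt_LamReg {s : ℂ} (hs : s ≠ -1) : AnalyticAt ℂ (LamReg σ) s := by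
  have h : AnalyticAt ℂ (fun s => zetaEntire σ (1 + s)) s :=
    ((differentiable_zetaEntire σ).comp (differentiable_id.const_add 1)).analyticAt s
  exact analyticAt_const.mul (((analyticAt_id.mul h).sub (analyticAt_id.div
    (analyticAt_const.add analyticAt_id) (fun h => hs (by
      have h : 1 + s = 0 := h
      linear_combination h)))).add
    analyticAt_const)

lemma eventually_LamReg_ne_zero {s : ℂ} (hs : -1 < s.re) : ∀ᶠ z in 𝓝[≠] s, LamReg σ z ≠ 0 := by
  have hA : AnalyticOnNhd ℂ (LamReg σ) {z : ℂ | -1 < z.re} := fun z hz =>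
    analyticAt_LamReg σ (by rintro rfl; simp at hz)
  rcases (hA s hs).eventually_eq_zero_or_eventually_ne_zero with h | h
  · exact absurd (hA.eqOn_zero_of_preconnected_of_eventuallyEq_zero
      (convex_halfSpace_re_gt (-1)).isPreconnected hs h
      (show (0 : ℂ) ∈ {z : ℂ | -1 < z.re} by simp)) (LamReg_zero σ)
  · exact h

variable [IsPrincipalIdealRing (𝓞 K)]

/-- The continuation of the Eisenstein series in terms of the completed series. -/
lemma eisenstein_eq (P : H3) : HasMeroCont (eisSeries σ P) 2 ∧ ∀ s : ℂ, s ≠ 1 → s ≠ -1 → LamReg σ s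
    ≠ 0 → eisenstein σ P s = s * Est σ P s / LamReg σ s := by
  have h := hasMeroCont_and_eq' (f := eisSeries σ P) (σ₀ := 2)
    (G := fun s => s * Est σ P s / LamReg σ s)
    (fun s _ => ((MeromorphicAt.id s).mul (meromorphicAt_Est σ P s)).div
      (meromorphicAt_LamReg σ s)) (fun s hs => ⟨analyticAt_eisSeries σ P (by linarith), by
      have hopen : {z : ℂ | 2 < z.re} ∈ 𝓝 s :=
        (isOpen_lt continuous_const continuous_re).mem_nhds hs
      filter_upwards [eventually_LamReg_ne_zero σ (s := s) (by linarith),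
        nhdsWithin_le_nhds hopen] with z hz (hz2 : 2 < z.re)
      have hz0 : z ≠ 0 := by rintro rfl; simp at hz2; linarith
      rw [Est_eq σ P (by linarith), ← mul_assoc, ← LamReg_eq σ hz0, mul_div_cancel_left₀ _ hz]⟩)
  exact ⟨h.1, fun s h1 h2 h3 => h.2 s ((analyticAt_id.mul (analyticAt_Est σ P h1 h2)).div
    (analyticAt_LamReg σ h2) h3)⟩

lemma I_mul_ne (t : ℝ) : I * t ≠ 1 ∧ I * t ≠ -1 := by
  constructor <;> intro h <;> simpa using congrArg re h

lemma Eis_zero (P : H3) : Eis σ 0 P = 0 := by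
  have h := (eisenstein_eq σ P).2 (I * (0 : ℝ)) (I_mul_ne 0).1 (I_mul_ne 0).2
    (by simpa using LamReg_zero σ)
  rw [Eis, h]
  simp

lemma Eis_eq {t : ℝ} (ht : t ≠ 0) (hL : LamF σ (1 + I * t) ≠ 0) (P : H3) :
    Eis σ t P = Est σ P (I * t) / LamF σ (1 + I * t) := by
  have h0 : I * (t : ℂ) ≠ 0 := mul_ne_zero I_ne_zero (by exact_mod_cast ht)
  have h := (eisenstein_eq σ P).2 (I * t) (I_mul_ne t).1 (I_mul_ne t).2
    (by rw [LamReg_eq σ h0]; exact mul_ne_zero h0 hL)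
  rw [Eis, h, LamReg_eq σ h0, mul_div_mul_left _ _ h0]

end Continuation

/-! ### Fourier coefficients of the theta series -/

section Coeff

variable [IsTotallyComplex K] [hdeg : Fact (Module.finrank ℚ K = 2)]

/-- The pairs of integers with product `μ`. -/
abbrev Fib (μ : 𝓞 K) : Type _ := {p : 𝓞 K × 𝓞 K // p.1 * p.2 = μ}

/-- The terms of the theta series after Poisson summation. -/
def gaussPair (r x : ℝ) (p : 𝓞 K × 𝓞 K) : ℝ :=
  Real.exp (-(condR K * r * (‖emb σ p.1‖ ^ 2 * x + ‖emb σ p.2‖ ^ 2 / x)))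

lemma gaussPair_pos (r x : ℝ) (p : 𝓞 K × 𝓞 K) : 0 < gaussPair σ r x p :=
  Real.exp_pos _

lemma gaussPair_inv (r x : ℝ) (p : 𝓞 K × 𝓞 K) : gaussPair σ r x⁻¹ p = gaussPair σ r x p.swap := by
  simp only [gaussPair, Prod.fst_swap, Prod.snd_swap, div_inv_eq_mul, ← div_eq_mul_inv]
  rw [add_comm]

/-- The sum of the Gaussian terms of frequency `μ`. -/
def cof (r : ℝ) (μ : 𝓞 K) (x : ℝ) : ℝ := ∑' p : Fib μ, gaussPair σ r x p.1

lemma cof_nonneg (r : ℝ) (μ : 𝓞 K) (x : ℝ) : 0 ≤ cof σ r μ x :=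
  tsum_nonneg fun _ => (Real.exp_pos _).le

lemma cof_inv (r : ℝ) (μ : 𝓞 K) (x : ℝ) : cof σ r μ x⁻¹ = cof σ r μ x := by
  let e : Fib μ ≃ Fib μ := (Equiv.prodComm (𝓞 K) (𝓞 K)).subtypeEquiv fun p => by
    rw [Equiv.prodComm_apply, Prod.fst_swap, Prod.snd_swap, mul_comm]
  unfold cof
  rw [← e.tsum_eq (fun p : Fib μ => gaussPair σ r x p.1)]
  exact tsum_congr fun p => gaussPair_inv σ r x p.1

lemma summable_gaussPair {r x : ℝ} (hr : 0 < r) (hx : 0 < x) : Summable (gaussPair σ r x) :=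
    summable_psi σ hr hx

lemma summable_cof {r x : ℝ} (hr : 0 < r) (hx : 0 < x) : Summable fun μ => cof σ r μ x :=
  ((Equiv.sigmaFiberEquiv fun p : 𝓞 K × 𝓞 K => p.1 * p.2).summable_iff.2
    (summable_gaussPair σ hr hx)).sigma

/-- The Fourier expansion of the theta series of a point. -/
lemma theta_eq_tsum_cof {r x : ℝ} (hr : 0 < r) (hx : 0 < x) (z : ℂ) :
    ((1 + thetaP σ (mk z r hr) x : ℝ) : ℂ) = ∑' μ, ((r / x * cof σ r μ x : ℝ) : ℂ)
    * chr (dualFreq σ μ) z := by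
  rw [theta_eq_psi σ _ hx, mk_r, psi, mk_z, mk_r]
  have hs : Summable fun p : 𝓞 K × 𝓞 K =>
      (gaussPair σ r x p : ℂ) * chr (dualFreq σ (p.1 * p.2)) z := by
    refine Summable.of_norm ((summable_gaussPair σ hr hx).congr fun p => ?_)
    rw [norm_mul, norm_chr, mul_one, norm_real, Real.norm_of_nonneg (gaussPair_pos σ r x p).le]
  have h1 := ((Equiv.sigmaFiberEquiv fun p : 𝓞 K × 𝓞 K =>
    p.1 * p.2).summable_iff.2 hs).tsum_sigma.symm.trans ((Equiv.sigmaFiberEquiv fun p :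
      𝓞 K × 𝓞 K => p.1 * p.2).tsum_eq fun p =>
    (gaussPair σ r x p : ℂ) * chr (dualFreq σ (p.1 * p.2)) z)
  refine (congrArg (fun w => ((r / x : ℝ) : ℂ) * w) h1.symm).trans ?_
  rw [← tsum_mul_left]
  refine tsum_congr fun μ => ?_
  rw [ofReal_mul, cof, ofReal_tsum, mul_assoc, ← tsum_mul_right]
  congr 1
  refine tsum_congr fun p => ?_
  obtain ⟨p, rfl⟩ := p
  rfl

lemma planeCoeff_const (c : ℂ) (μ : 𝓞 K) [Decidable (μ = 0)] : planeCoeff σ (fun _ => c) μ = if μ =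
    0 then c else 0 := by
  classical
  have h := planeCoeff_tsum (σ := σ) (a := fun ν => if ν = 0 then c else 0) (F := fun _ => c)
    (summable_of_ne_finset_zero (s := {0}) fun ν hν => if_neg (by simpa using hν)) (fun z => by
      rw [tsum_eq_single 0 (fun ν hν => by rw [if_neg hν, zero_mul]), if_pos rfl, dualFreq_zero,
        chr_zero_left, mul_one]) μ
  rw [h]
  congr

lemma continuous_theta {r x : ℝ} (hr : 0 < r) (hx : 0 < x) :
    Continuous fun z => (thetaP σ (mk z r hr) x : ℂ) := by
  have h : Continuous fun z => ∑' μ, ((r / x * cof σ r μ x : ℝ) : ℂ) * chr (dualFreq σ μ) z := by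
    refine continuous_tsum (fun μ => (continuous_const.mul (continuous_chr _)))
      ((summable_cof σ hr hx).mul_left (r / x)) fun μ z => ?_
    rw [norm_mul, norm_chr, mul_one, norm_real, Real.norm_of_nonneg
      (mul_nonneg (by positivity) (cof_nonneg σ r μ x))]
  refine (h.sub continuous_const).congr (g := fun z => (thetaP σ (mk z r hr) x : ℂ))
    (f := fun z => (∑' μ, ((r / x * cof σ r μ x : ℝ) : ℂ) * chr (dualFreq σ μ) z) - 1) fun z => ?_
  rw [← theta_eq_tsum_cof σ hr hx z]
  push_cast; ring

lemma integrableOn_box_of_continuous {F : ℂ → ℂ} (hF : Continuous F) (μ : 𝓞 K) :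
    IntegrableOn (fun x => F (par σ x) * chr (dualFreq σ μ) (-par σ x))
    (Set.Icc (0 : Idx K → ℝ) 1) := by
  refine ContinuousOn.integrableOn_compact isCompact_Icc (Continuous.continuousOn ?_)
  have h1 := (par σ).continuous
  exact (hF.comp h1).mul ((continuous_chr _).comp h1.neg)

/-- The Fourier coefficients of the theta series (without its constant term). -/
lemma planeCoeff_theta {r x : ℝ} (hr : 0 < r) (hx : 0 < x) (μ : 𝓞 K) [Decidable (μ = 0)] :
    planeCoeff σ (fun z => (thetaP σ (mk z r hr) x : ℂ)) μ = ((r / x * cof σ r μ x : ℝ) : ℂ) - if μ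
    = 0 then 1 else 0 := by
  have h1 := planeCoeff_tsum (σ := σ) (a := fun μ => ((r / x * cof σ r μ x : ℝ) : ℂ))
    (F := fun z => ((1 + thetaP σ (mk z r hr) x : ℝ) : ℂ))
    (by exact_mod_cast (summable_cof σ hr hx).mul_left (r / x)) (theta_eq_tsum_cof σ hr hx) μ
  have h2 := planeCoeff_const σ 1 μ
  rw [← h1, ← h2]
  unfold planeCoeff
  rw [← integral_sub]
  · refine setIntegral_congr_fun measurableSet_Icc fun z _ => ?_
    push_cast; ring
  · refine integrableOn_box_of_continuous σ
      (F := fun z => ((1 + thetaP σ (mk z r hr) x : ℝ) : ℂ)) ?_ μ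
    push_cast
    exact continuous_const.add (continuous_theta σ hr hx)
  · exact integrableOn_box_of_continuous σ (F := fun _ => (1 : ℂ)) continuous_const μ

/-! ### Fourier coefficients of the completed Eisenstein series -/

/-- The kernel of the completed Eisenstein series. -/
def kernS (s : ℂ) (x : ℝ) : ℂ := (x : ℂ) ^ s + (x : ℂ) ^ (-s)

lemma norm_kernS_le (s : ℂ) {x : ℝ} (hx : 1 < x) : ‖kernS s x‖ ≤ 2 * x ^ |s.re| := by
  have h0 : 0 < x := by linarith
  refine (norm_add_le _ _).trans ?_
  rw [norm_cpow_eq_rpow_re_of_pos h0, norm_cpow_eq_rpow_re_of_pos h0, neg_re]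
  have h1 := Real.rpow_le_rpow_of_exponent_le hx.le (le_abs_self s.re)
  have h2 := Real.rpow_le_rpow_of_exponent_le hx.le (neg_le_abs s.re)
  linarith

lemma Est_eq_integral (P : H3) (s : ℂ) :
    Est σ P s
    = 1 / 2
    * ((∫ x in Ioi (1 : ℝ), kernS s x * (thetaP σ P x : ℂ)) - (1 / (1 + s) + 1 / (1 - s))) := by
  have h : ∫ x in Ioi (1 : ℝ), kernS s x * (thetaP σ P x : ℂ)
      = upperMellin (thetaP σ P) (1 + s) + upperMellin (thetaP σ P) (1 - s) := by
    unfold upperMellin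
    rw [← integral_add (integrableOn_thetaP σ P _) (integrableOn_thetaP σ P _)]
    refine setIntegral_congr_fun measurableSet_Ioi fun x _ => ?_
    rw [kernS, add_mul, add_sub_cancel_left, show (1 - s - 1 : ℂ) = -s by ring]
  rw [h, Est]
  ring

lemma measurable_mk {r : ℝ} (hr : 0 < r) : Measurable fun z : ℂ => mk z r hr :=
  (measurable_id.prodMk measurable_const).subtype_mk

/-- Integrability on a period parallelogram times the half-line. -/
lemma integrable_kernS_box {r : ℝ} (hr : 0 < r) (s : ℂ) (μ : 𝓞 K) :
    Integrable (fun q : (Idx K → ℝ) × ℝ => kernS s q.2 * (thetaP σ (mk (par σ q.1) r hr) q.2 : ℂ)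
    * chr (dualFreq σ μ) (-par σ q.1))
    ((volume.restrict (Set.Icc 0 1)).prod (volume.restrict (Ioi 1))) := by
  have hm : Measurable (fun q : (Idx K → ℝ) × ℝ =>
      kernS s q.2 * (thetaP σ (mk (par σ q.1) r hr) q.2 : ℂ)
        * chr (dualFreq σ μ) (-par σ q.1)) := by
    have h0 : Measurable fun q : (Idx K → ℝ) × ℝ => par σ q.1 :=
      (par σ).continuous.measurable.comp measurable_fst
    have h1 : Measurable fun q : (Idx K → ℝ) × ℝ =>
        thetaP σ (mk (par σ q.1) r hr) q.2 :=
      (measurable_thetaP σ).comp (((measurable_mk hr).comp h0).prodMk measurable_snd)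
    have h2 := (continuous_chr (dualFreq σ μ)).measurable.comp h0.neg
    have h3 : Measurable (kernS s) := by unfold kernS; fun_prop
    exact ((h3.comp measurable_snd).mul (measurable_ofReal.comp h1)).mul h2
  obtain ⟨R, hR⟩ := (isCompact_Icc (a := (0 : Idx K → ℝ))
    (b := 1)).exists_bound_of_continuousOn (par σ).continuous.continuousOn
  obtain ⟨C, B, hC, hb⟩ := exists_moment_thetaP_le σ |s.re| R hr
  have hdom : ∀ y : Idx K → ℝ, ∀ x ∈ Ioi (1 : ℝ),
      ‖kernS s x * (thetaP σ (mk (par σ y) r hr) x : ℂ) * chr (dualFreq σ μ) (-par σ y)‖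
        ≤ 2 * (x ^ |s.re| * thetaP σ (mk (par σ y) r hr) x) := by
    intro y x hx
    rw [norm_mul, norm_chr, mul_one, norm_mul, norm_real, Real.norm_of_nonneg
      (thetaP_nonneg σ _ x), ← mul_assoc]
    exact mul_le_mul_of_nonneg_right (norm_kernS_le s hx) (thetaP_nonneg σ _ x)
  have hint : ∀ y : Idx K → ℝ, IntegrableOn (fun x : ℝ =>
      kernS s x * (thetaP σ (mk (par σ y) r hr) x : ℂ) * chr (dualFreq σ μ) (-par σ y)) (Ioi 1) :=
    fun y => Integrable.mono' ((integrableOn_rpow_mul_thetaP σ (mk (par σ y) r hr)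
      |s.re|).const_mul 2) (hm.comp measurable_prodMk_left).aestronglyMeasurable
      (ae_restrict_of_forall_mem measurableSet_Ioi (hdom y))
  rw [integrable_prod_iff hm.aestronglyMeasurable]
  refine ⟨.of_forall hint, ?_⟩
  refine Integrable.mono' (g := fun _ => 2 * (C * r ^ B))
    (integrableOn_const (by simp [Real.volume_Icc_pi]))
    (hm.aestronglyMeasurable.norm.integral_prod_right') ?_
  refine ae_restrict_of_forall_mem measurableSet_Icc fun y hy => ?_
  rw [Real.norm_of_nonneg (integral_nonneg fun _ => norm_nonneg _)]
  refine (setIntegral_mono_on (hint y).norm ((integrableOn_rpow_mul_thetaP σ (mk (par σ y) r hr)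
      |s.re|).const_mul 2) measurableSet_Ioi (hdom y)).trans ?_
  rw [integral_const_mul]
  exact mul_le_mul_of_nonneg_left (hb _ (hR y hy) le_rfl) two_pos.le

lemma planeCoeff_Est_eq_integral {r : ℝ} (hr : 0 < r) (s : ℂ) (μ : 𝓞 K) [Decidable (μ = 0)] :
    IntegrableOn
    (fun x : ℝ => kernS s x * (((r / x * cof σ r μ x : ℝ) : ℂ) - if μ = 0 then 1 else 0)) (Ioi 1)
    ∧ planeCoeff σ (fun z => Est σ (mk z r hr) s) μ
    = 1 / 2
    * ((∫ x in Ioi (1 : ℝ), kernS s x * (((r / x * cof σ r μ x : ℝ) : ℂ) - if μ = 0 then 1 else 0))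
    - if μ = 0 then 1 / (1 + s) + 1 / (1 - s) else 0) := by
  have h := integrable_kernS_box σ hr s μ
  have h1 : ∀ x ∈ Ioi (1 : ℝ), ∫ y in Set.Icc (0 : Idx K → ℝ) 1,
      kernS s x * (thetaP σ (mk (par σ y) r hr) x : ℂ) * chr (dualFreq σ μ) (-par σ y)
      = kernS s x * (((r / x * cof σ r μ x : ℝ) : ℂ) - if μ = 0 then 1 else 0) := by
    intro x (hx : 1 < x)
    rw [← planeCoeff_theta σ hr (by linarith) μ, planeCoeff, ← integral_const_mul]
    simp only [mul_assoc]
  refine ⟨h.integral_prod_right.congr (ae_restrict_of_forall_mem measurableSet_Ioi h1), ?_⟩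
  rw [← setIntegral_congr_fun measurableSet_Ioi h1, ← planeCoeff_const σ (1 / (1 + s) + 1 / (1 - s)) μ,
    ← integral_integral_swap h]
  unfold planeCoeff
  rw [← integral_sub h.integral_prod_left (integrableOn_box_of_continuous σ
    (F := fun _ => 1 / (1 + s) + 1 / (1 - s)) continuous_const μ), ← integral_const_mul]
  refine setIntegral_congr_fun measurableSet_Icc fun y _ => ?_
  dsimp only
  rw [Est_eq_integral, integral_mul_const]
  ring

lemma finite_norm_le (R : ℝ) : {c : 𝓞 K | ‖emb σ c‖ ≤ R}.Finite := by
  have h := (summable_exp_norm σ one_pos 0).tendsto_cofinite_zero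
  have h2 := h.eventually (gt_mem_nhds (Real.exp_pos (-R ^ 2)))
  refine (Filter.eventually_cofinite.1 h2).subset fun c (hc : ‖emb σ c‖ ≤ R) => ?_
  have h3 : ‖emb σ c‖ ^ 2 ≤ R ^ 2 := by gcongr
  simp only [zero_add, Set.mem_ofPred_eq, not_lt]
  exact Real.exp_le_exp.2 (by linarith)

lemma fib_ne_zero {μ : 𝓞 K} (hμ : μ ≠ 0) (p : Fib μ) : p.1.1 ≠ 0 ∧ p.1.2 ≠ 0 :=
  ⟨left_ne_zero_of_mul (p.2 ▸ hμ), right_ne_zero_of_mul (p.2 ▸ hμ)⟩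

lemma finite_fib (σ : K →+* ℂ) {μ : 𝓞 K} (hμ : μ ≠ 0) : Finite (Fib μ) := by
  have h := (finite_norm_le σ ‖emb σ μ‖).prod (finite_norm_le σ ‖emb σ μ‖)
  refine Set.Finite.to_subtype (s := {p : 𝓞 K × 𝓞 K | p.1 * p.2 = μ}) (h.subset ?_)
  intro p hp
  obtain ⟨h1, h2⟩ := fib_ne_zero hμ ⟨p, hp⟩
  have h3 := one_le_norm_emb σ h1
  have h4 := one_le_norm_emb σ h2
  have h5 : ‖emb σ p.1‖ * ‖emb σ p.2‖ = ‖emb σ μ‖ := by rw [← norm_mul, ← map_mul]; exact congrArg _ (congrArg _ hp)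
  constructor
  · change ‖emb σ p.1‖ ≤ _; nlinarith
  · change ‖emb σ p.2‖ ≤ _; nlinarith

/-- The divisor sum `∑ |ν / c| ^ s` over the factorizations `μ = c ν`. -/
def tau (s : ℂ) (μ : 𝓞 K) : ℂ :=
  ∑' p : Fib μ, ((‖emb σ p.1.2‖ / ‖emb σ p.1.1‖ : ℝ) : ℂ) ^ s

lemma mellin_cof {r : ℝ} (hr : 0 < r) (s : ℂ) {μ : 𝓞 K} (hμ : μ ≠ 0) :
    IntegrableOn (fun x : ℝ => (x : ℂ) ^ (s - 1) * (cof σ r μ x : ℂ)) (Ioi 0)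
    ∧ ∫ x in Ioi (0 : ℝ), (x : ℂ) ^ (s - 1) * (cof σ r μ x : ℂ)
    = 2 * (tau σ s μ * besselK s (2 * Real.pi * ‖dualFreq σ μ‖ * r)) := by
  have hfin := finite_fib σ hμ
  have := Fintype.ofFinite (Fib μ)
  have hk := condR_pos (K := K)
  have hterm : ∀ p : Fib μ, _ := fun p => integral_rpow_mul_exp_eq_besselK s
    (y := condR K * r) (by positivity) (norm_emb_pos σ (fib_ne_zero hμ p).1)
    (norm_emb_pos σ (fib_ne_zero hμ p).2)
  have hsum : ∀ x : ℝ, (x : ℂ) ^ (s - 1) * (cof σ r μ x : ℂ) = ∑ p : Fib μ, (x : ℂ) ^ (s - 1) *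
      (Real.exp (-(condR K * r) * (‖emb σ p.1.1‖ ^ 2 * x + ‖emb σ p.1.2‖ ^ 2 / x)) : ℂ) := by
    intro x
    rw [cof, tsum_fintype, ofReal_sum, Finset.mul_sum]
    simp only [gaussPair, neg_mul]
  simp only [hsum]
  refine ⟨integrable_finsetSum _ fun p _ => (hterm p).1, ?_⟩
  rw [integral_finsetSum _ fun p _ => (hterm p).1, tau, tsum_fintype, Finset.sum_mul,
    Finset.mul_sum]
  refine Finset.sum_congr rfl fun p _ => ?_
  rw [(hterm p).2, mul_assoc]
  congr 3
  have h5 : ‖emb σ p.1.1‖ * ‖emb σ p.1.2‖ = ‖emb σ μ‖ := by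
    rw [← norm_mul, ← map_mul, p.2]
  rw [norm_dualFreq, ← h5, condR]
  ring

lemma integral_Ioo_inv (g : ℝ → ℂ) :
    ∫ x in Ioo (0 : ℝ) 1, g x = ∫ x in Ioi (1 : ℝ), ((x ^ 2)⁻¹ : ℝ) * g x⁻¹ := by
  rw [← image_inv_Ioi_one, integral_image_eq_integral_abs_deriv_smul measurableSet_Ioi
    (fun x (hx : 1 < x) => (hasDerivAt_inv (by positivity)).hasDerivWithinAt) inv_injective.injOn]
  refine setIntegral_congr_fun measurableSet_Ioi fun x (hx : 1 < x) => ?_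
  rw [abs_neg, abs_of_pos (by positivity), real_smul]

lemma ofReal_inv_cpow {x : ℝ} (hx : 0 < x) (s : ℂ) : ((x⁻¹ : ℝ) : ℂ) ^ s = (x : ℂ) ^ (-s) := by
  rw [ofReal_inv, inv_cpow _ _ (by
    rw [arg_ofReal_of_nonneg hx.le]; exact Real.pi_pos.ne), ← cpow_neg]

/-- The non-constant Fourier coefficients of the completed Eisenstein series. -/
theorem planeCoeff_Est {r : ℝ} (hr : 0 < r) (s : ℂ) {μ : 𝓞 K} (hμ : μ ≠ 0) :
    planeCoeff σ (fun z => Est σ (mk z r hr) s) μ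
    = tau σ s μ * (r * besselK s (2 * Real.pi * ‖dualFreq σ μ‖ * r)) := by
  classical
  obtain ⟨-, h2⟩ := planeCoeff_Est_eq_integral σ hr s μ
  obtain ⟨m1, m2⟩ := mellin_cof σ hr s hμ
  obtain ⟨m3, -⟩ := mellin_cof σ hr (-s) hμ
  rw [h2]
  simp only [if_neg hμ, sub_zero]
  have e1 : ∀ x ∈ Ioi (1 : ℝ), kernS s x * ((r / x * cof σ r μ x : ℝ) : ℂ)
      = r * ((x : ℂ) ^ (s - 1) * (cof σ r μ x : ℂ) + (x : ℂ) ^ (-s - 1) * (cof σ r μ x : ℂ)) := by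
    intro x (hx : 1 < x)
    have hx0 : (x : ℂ) ≠ 0 := by exact_mod_cast (by linarith : x ≠ 0)
    rw [kernS, cpow_sub _ _ hx0, cpow_sub _ _ hx0, cpow_one]
    push_cast
    field_simp
  have e2 : ∫ x in Ioi (1 : ℝ), (x : ℂ) ^ (-s - 1) * (cof σ r μ x : ℂ)
      = ∫ x in Ioo (0 : ℝ) 1, (x : ℂ) ^ (s - 1) * (cof σ r μ x : ℂ) := by
    rw [integral_Ioo_inv]
    refine setIntegral_congr_fun measurableSet_Ioi fun x (hx : 1 < x) => ?_
    have hx0 : (x : ℂ) ≠ 0 := by exact_mod_cast (by linarith : x ≠ 0)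
    rw [cof_inv, ofReal_inv_cpow (by linarith), show -(s - 1) = (-s - 1) + (2 : ℕ) by push_cast; ring, cpow_add _ _ hx0, cpow_natCast]
    push_cast
    field_simp
  have hunion : Ioi (0 : ℝ) = Ioc 0 1 ∪ Ioi 1 := (Ioc_union_Ioi_eq_Ioi zero_le_one).symm
  have hs1 : Ioi (1 : ℝ) ⊆ Ioi 0 := Ioi_subset_Ioi zero_le_one
  have e3 := setIntegral_union (μ := volume)
    (f := fun x : ℝ => (x : ℂ) ^ (s - 1) * (cof σ r μ x : ℂ)) (Ioc_disjoint_Ioi_same (a := (0 : ℝ))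
      (b := 1)) measurableSet_Ioi (m1.mono_set Ioc_subset_Ioi_self) (m1.mono_set hs1)
  rw [← hunion, m2, integral_Ioc_eq_integral_Ioo, ← e2] at e3
  rw [setIntegral_congr_fun measurableSet_Ioi e1, integral_const_mul,
    integral_add (m1.mono_set hs1) (m3.mono_set hs1)]
  linear_combination (-(1 / 2 : ℂ) * r) * e3

end Coeff

/-! ### Integrals of rapidly decreasing functions against the Eisenstein series -/

section RS

variable [IsTotallyComplex K] [hdeg : Fact (Module.finrank ℚ K = 2)]
  [IsPrincipalIdealRing (𝓞 K)]

/-- Measurable `Γ`-invariant functions that decrease rapidly at the cusp. -/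
structure RapidInv (F : H3 → ℂ) : Prop where
  meas : Measurable F
  inv : ∀ γ ∈ Gam σ, ∀ P, F (γ P) = F P
  decay : ∀ B : ℝ, ∃ C : ℝ, ∀ P ∈ siegel σ, ‖F P‖ * (1 + P.r) ^ B ≤ C

lemma RapidInv.exists_bound {σ : K →+* ℂ} {F : H3 → ℂ} (hF : RapidInv σ F) :
    ∃ C : ℝ, ∀ P, ‖F P‖ ≤ C := by
  obtain ⟨C, hC⟩ := hF.decay 0
  refine ⟨C, fun P => ?_⟩
  obtain ⟨γ, h1, h2⟩ := exists_smul_siegel σ P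
  have h := hC (γ • P) ⟨h1, h2⟩
  rwa [Real.rpow_zero, mul_one, gam_smul, hF.inv γ.1 γ.2] at h

/-- The product with an invariant function of polynomial growth is again rapidly decreasing. -/
lemma RapidInv.mul {σ : K →+* ℂ} {F G : H3 → ℂ} (hF : RapidInv σ F) (hG : Measurable G)
    (hGi : ∀ γ ∈ Gam σ, ∀ P, G (γ P) = G P)
    (hGb : ∃ C B : ℝ, ∀ P ∈ siegel σ, ‖G P‖ ≤ C * (1 + P.r) ^ B) : RapidInv σ (G * F) where
  meas := hG.mul hF.meas
  inv γ hγ P := by rw [Pi.mul_apply, Pi.mul_apply, hF.inv γ hγ, hGi γ hγ]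
  decay B := by
    obtain ⟨C', B', h'⟩ := hGb
    obtain ⟨C, hC⟩ := hF.decay (B' + B)
    refine ⟨|C'| * C, fun P hP => ?_⟩
    have hr : 0 < 1 + P.r := by linarith [P.r_pos]
    have h1 := h' P hP
    have h2 := hC P hP
    rw [Real.rpow_add hr] at h2
    rw [Pi.mul_apply, norm_mul]
    calc ‖G P‖ * ‖F P‖ * (1 + P.r) ^ B
        ≤ (C' * (1 + P.r) ^ B') * ‖F P‖ * (1 + P.r) ^ B := by gcongr
      _ ≤ (|C'| * (1 + P.r) ^ B') * ‖F P‖ * (1 + P.r) ^ B := by gcongr; exact le_abs_self C'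
      _ = |C'| * (‖F P‖ * ((1 + P.r) ^ B' * (1 + P.r) ^ B)) := by ring
      _ ≤ |C'| * C := by gcongr

lemma RapidInv.integrableOn {σ : K →+* ℂ} {F : H3 → ℂ} (hF : RapidInv σ F) {D : Set H3}
    (hD : IsFundamentalDomain (Gam σ) D hypVol) : IntegrableOn F D hypVol := by
  obtain ⟨C, hC⟩ := hF.exists_bound
  exact integrableOn_of_bounded σ hD hF.inv hF.meas fun P _ => hC P

lemma exists_norm_Est_le_siegel (s : ℂ) : ∃ C B : ℝ, ∀ P ∈ siegel σ, ‖Est σ P s‖ ≤ C * (1 + P.r) ^ B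
    := by
  obtain ⟨R, -, hR⟩ := exists_norm_le_of_mem_cell σ
  obtain ⟨C, B, -, -, h⟩ := exists_norm_Est_le σ s R (siegelHt_pos σ)
  exact ⟨C, B, fun P hP => h P (hR _ hP.1) hP.2⟩

lemma RapidInv.mul_Est {σ : K →+* ℂ} {F : H3 → ℂ} (hF : RapidInv σ F) (s : ℂ) :
    RapidInv σ ((fun P => Est σ P s) * F) :=
  hF.mul (measurable_Est σ s) (fun _ hγ P => Est_gam σ hγ P s) (exists_norm_Est_le_siegel σ s)

lemma isFiniteMeasure_restrict {D : Set H3} (hD : IsFundamentalDomain (Gam σ) D hypVol) :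
    IsFiniteMeasure (hypVol.restrict D) := by
  have h := integrableOn_of_bounded σ hD (f := fun _ => (1 : ℂ)) (fun _ _ _ => rfl)
    measurable_const (C := 1) (fun P _ => by simp)
  rw [IntegrableOn, integrable_const_iff] at h
  exact h.resolve_left one_ne_zero

/-- The integral of a rapidly decreasing function against the completed Eisenstein series
depends analytically on `s`. -/
lemma RapidInv.analyticAt_integral {σ : K →+* ℂ} {F : H3 → ℂ} (hF : RapidInv σ F) {D : Set H3}
    (hD : IsFundamentalDomain (Gam σ) D hypVol) :
    ∃ W : ℂ → ℂ, Differentiable ℂ W ∧ ∀ s, ∫ P in D, F P * Est σ P s ∂hypVol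
      = W s - (∫ P in D, F P ∂hypVol) / 2 * (1 / (1 + s) + 1 / (1 - s)) := by
  have hfin := isFiniteMeasure_restrict σ hD
  set m := (hypVol.restrict D).prod (volume.restrict (Ioi (1 : ℝ))) with hm
  set h : H3 × ℝ → ℂ := fun q => F q.1 * (thetaP σ q.1 q.2 : ℂ) with hh
  have hF1 : Measurable fun q : H3 × ℝ => F q.1 := hF.meas.comp measurable_fst
  have hhm : Measurable h := hF1.mul (measurable_thetaP σ).complex_ofReal
  have hsnd : ∀ᵐ q ∂m, 1 ≤ q.2 := by
    have h1 : ∀ᵐ x ∂(volume.restrict (Ioi (1 : ℝ))), 1 ≤ x := (ae_restrict_of_forall_mem measurableSet_Ioi fun x (hx : 1 < x) => hx.le)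
    exact Measure.quasiMeasurePreserving_snd.ae h1
  have hint : ∀ A : ℝ, Integrable (fun q : H3 × ℝ => ‖h q‖ * q.2 ^ A) m := by
    intro A
    have hmA : Measurable fun q : H3 × ℝ => ‖h q‖ * q.2 ^ A :=
      hhm.norm.mul (measurable_snd.pow_const A)
    have e : ∀ P : H3, ∀ x : ℝ, ‖h (P, x)‖ * x ^ A = ‖F P‖ * (x ^ A * thetaP σ P x) := by
      intro P x
      rw [hh, norm_mul, norm_real, Real.norm_of_nonneg (thetaP_nonneg σ P x)]
      ring
    have hi : ∀ P : H3, IntegrableOn (fun x : ℝ => ‖h (P, x)‖ * x ^ A) (Ioi 1) := fun P => by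
      simp only [e]
      exact (integrableOn_rpow_mul_thetaP σ P A).const_mul _
    have hv : ∀ P : H3, ∫ x in Ioi (1 : ℝ), ‖‖h (P, x)‖ * x ^ A‖
        = ‖F P‖ * ∫ x in Ioi (1 : ℝ), x ^ A * thetaP σ P x := by
      intro P
      rw [← integral_const_mul]
      refine setIntegral_congr_fun measurableSet_Ioi fun x (hx : 1 < x) => ?_
      have h0 : 0 ≤ x ^ A := Real.rpow_nonneg (by linarith) A
      rw [Real.norm_of_nonneg (mul_nonneg (norm_nonneg _) h0), e]
    rw [integrable_prod_iff hmA.aestronglyMeasurable]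
    refine ⟨.of_forall hi, ?_⟩
    simp only [hv]
    obtain ⟨R, -, hR⟩ := exists_norm_le_of_mem_cell σ
    obtain ⟨C, B, hC, hb⟩ := exists_moment_thetaP_le σ A R (siegelHt_pos σ)
    obtain ⟨C₂, hC₂⟩ := hF.decay |B|
    obtain ⟨C₃, hC₃⟩ := hF.decay 0
    have hmH : Measurable fun P : H3 => ∫ x in Ioi (1 : ℝ), x ^ A * thetaP σ P x := by
      have h2 : Measurable fun q : H3 × ℝ => q.2 ^ A * thetaP σ q.1 q.2 :=
        (measurable_snd.pow_const A).mul (measurable_thetaP σ)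
      exact (h2.stronglyMeasurable.integral_prod_right').measurable
    have hδ := siegelHt_pos σ
    have key := integrableOn_of_bounded σ hD (f := fun P => ((‖F P‖ * ∫ x in Ioi (1 : ℝ),
        x ^ A * thetaP σ P x : ℝ) : ℂ)) (fun γ hγ P => by
          have h3 : thetaP σ (γ P) = thetaP σ P := funext fun x => thetaP_gam σ hγ P x
          rw [hF.inv γ hγ, h3]) (hF.meas.norm.mul hmH).complex_ofReal
        (C := C * (C₂ + C₃ * siegelHt σ ^ (-|B|))) (fun P hP => by
          have hr := P.r_pos
          have h4 := hb P (hR _ hP.1) hP.2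
          have h5 := hC₂ P hP
          have h6 := hC₃ P hP
          rw [Real.rpow_zero, mul_one] at h6
          have hH0 : 0 ≤ ∫ x in Ioi (1 : ℝ), x ^ A * thetaP σ P x :=
            setIntegral_nonneg measurableSet_Ioi fun x (hx : 1 < x) =>
              mul_nonneg (Real.rpow_nonneg (by linarith) _) (thetaP_nonneg σ P x)
          have hp : P.r ^ B ≤ (1 + P.r) ^ |B| + siegelHt σ ^ (-|B|) := by
            rcases le_total 0 B with hB | hB
            · rw [abs_of_nonneg hB]
              have := Real.rpow_le_rpow hr.le (by linarith : P.r ≤ 1 + P.r) hB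
              have := Real.rpow_pos_of_pos hδ (-B)
              linarith
            · have := Real.rpow_le_rpow_of_nonpos hδ hP.2 hB
              rw [abs_of_nonpos hB, neg_neg]
              have := Real.rpow_pos_of_pos (by linarith : 0 < 1 + P.r) (-B)
              linarith
          have hδB := Real.rpow_pos_of_pos hδ (-|B|)
          rw [norm_real, Real.norm_of_nonneg (mul_nonneg (norm_nonneg _) hH0)]
          calc ‖F P‖ * ∫ x in Ioi (1 : ℝ), x ^ A * thetaP σ P x
              ≤ ‖F P‖ * (C * ((1 + P.r) ^ |B| + siegelHt σ ^ (-|B|))) := by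
                refine mul_le_mul_of_nonneg_left (h4.trans ?_) (norm_nonneg _)
                exact mul_le_mul_of_nonneg_left hp hC.le
            _ = C * (‖F P‖ * (1 + P.r) ^ |B| + ‖F P‖ * siegelHt σ ^ (-|B|)) := by ring
            _ ≤ _ := by gcongr)
    exact key.re
  have hW := differentiable_integral_cpow (μ := m) measurable_snd hsnd hhm.aestronglyMeasurable hint
  set W₁ : ℂ → ℂ := fun s => ∫ q, h q * (q.2 : ℂ) ^ s ∂m with hW₁
  refine ⟨fun s => 1 / 2 * (W₁ s + W₁ (-s)),
    (hW.add (hW.comp differentiable_neg)).const_mul _, fun s => ?_⟩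
  have hWi : ∀ s : ℂ, Integrable (fun q : H3 × ℝ => h q * (q.2 : ℂ) ^ s) m := by
    intro s
    have hms : Measurable fun q : H3 × ℝ => h q * (q.2 : ℂ) ^ s :=
      hhm.mul (measurable_snd.complex_ofReal.pow_const s)
    refine (hint s.re).mono' hms.aestronglyMeasurable ?_
    filter_upwards [hsnd] with q hq
    rw [norm_mul, norm_cpow_eq_rpow_re_of_pos (by linarith)]
  have hsplit : W₁ s + W₁ (-s) = ∫ P in D, (F P * ∫ x in Ioi (1 : ℝ),
      kernS s x * (thetaP σ P x : ℂ)) ∂hypVol := by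
    rw [hW₁]
    beta_reduce
    rw [← integral_add (hWi s) (hWi (-s))]
    refine (integral_prod _ ((hWi s).add (hWi (-s)))).trans ?_
    refine integral_congr_ae (.of_forall fun P => ?_)
    beta_reduce
    rw [← integral_const_mul]
    refine setIntegral_congr_fun measurableSet_Ioi fun x _ => ?_
    simp only [hh, kernS, Pi.add_apply]
    ring
  have hI : IntegrableOn (fun P => F P * ∫ x in Ioi (1 : ℝ), kernS s x * (thetaP σ P x : ℂ)) D
      hypVol := by
    refine ((((hF.mul_Est s).integrableOn hD).const_mul 2).add ((hF.integrableOn hD).const_mul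
      (1 / (1 + s) + 1 / (1 - s)))).congr (.of_forall fun P => ?_)
    simp only [Pi.add_apply, Pi.mul_apply]
    rw [Est_eq_integral]
    ring
  have e : ∀ P, F P * Est σ P s = 1 / 2 * (F P * ∫ x in Ioi (1 : ℝ), kernS s x * (thetaP σ P x : ℂ))
      - (1 / (1 + s) + 1 / (1 - s)) / 2 * F P := by
    intro P
    rw [Est_eq_integral]
    ring
  rw [integral_congr_ae (.of_forall e)]
  rw [integral_sub (hI.const_mul _) ((hF.integrableOn hD).const_mul _), integral_const_mul,
    integral_const_mul, ← hsplit]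
  ring

/-- The Fourier coefficient of a function on `H3` at height `r`. -/
def coeffAt (F : H3 → ℂ) (μ : 𝓞 K) (r : ℝ) : ℂ :=
  planeCoeff σ (fun z => coord F (z, r)) μ

lemma coord_mk (F : H3 → ℂ) (z : ℂ) {r : ℝ} (hr : 0 < r) : coord F (z, r) = F (mk z r hr) := by
  rw [coord, dif_pos hr]; rfl

lemma coeffAt_eq (F : H3 → ℂ) (μ : 𝓞 K) {r : ℝ} (hr : 0 < r) :
    coeffAt σ F μ r = planeCoeff σ (fun z => F (mk z r hr)) μ := by
  simp only [coeffAt, coord_mk _ _ hr]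

lemma cell_eq_strip : {P : H3 | P.z ∈ cell σ} = {P : H3 | P.z ∈ cell σ ∧ P.r ∈ Ioi (0 : ℝ)} := by
  ext P
  exact ⟨fun h => ⟨h, P.r_pos⟩, fun h => h.1⟩

lemma RapidInv.integrableOn_cell {σ : K →+* ℂ} {F : H3 → ℂ} (hF : RapidInv σ F) {s : ℂ}
    (hs : 1 < s.re) :
    IntegrableOn (fun P => F P * (P.r : ℂ) ^ (1 + s)) {P : H3 | P.z ∈ cell σ} hypVol := by
  have hδ := siegelHt_pos σ
  have hunion : {P : H3 | P.z ∈ cell σ}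
      = {P : H3 | P.z ∈ cell σ ∧ P.r ∈ Ioo 0 (siegelHt σ)} ∪ siegel σ := by
    ext P
    constructor
    · intro h
      rcases lt_or_ge P.r (siegelHt σ) with h1 | h1
      · exact Or.inl ⟨h, P.r_pos, h1⟩
      · exact Or.inr ⟨h, h1⟩
    · rintro (h | h)
      · exact h.1
      · exact h.1
  have hm : Measurable fun P : H3 => F P * (P.r : ℂ) ^ (1 + s) :=
    hF.meas.mul (measurable_r.complex_ofReal.pow_const _)
  have hn : ∀ P : H3, ‖F P * (P.r : ℂ) ^ (1 + s)‖ = ‖F P‖ * P.r ^ (1 + s.re) := by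
    intro P
    rw [norm_mul, norm_cpow_eq_rpow_re_of_pos P.r_pos, add_re, one_re]
  rw [hunion]
  refine IntegrableOn.union ?_ ?_
  · obtain ⟨C, hC⟩ := hF.exists_bound
    have h1 := (integrableOn_strip_rpow σ (B := Ioo 0 (siegelHt σ)) measurableSet_Ioo
      (fun r hr => hr.1) (A := 1 + s.re) (by
        rw [← integrableOn_Ioc_iff_integrableOn_Ioo (by finiteness),
          ← intervalIntegrable_iff_integrableOn_Ioc_of_le hδ.le]
        exact intervalIntegral.intervalIntegrable_rpow' (by linarith))).const_mul (C : ℂ)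
    refine Integrable.mono h1 hm.aestronglyMeasurable (.of_forall fun P => ?_)
    have h2 := Real.rpow_nonneg P.r_pos.le (1 + s.re)
    rw [hn, norm_mul, norm_real, norm_real, Real.norm_of_nonneg h2]
    exact mul_le_mul_of_nonneg_right ((hC P).trans (Real.le_norm_self C)) h2
  · obtain ⟨C, hC⟩ := hF.decay (1 + s.re)
    have h1 := (integrableOn_siegel_rpow σ (A := 0) two_pos).const_mul (C : ℂ)
    refine Integrable.mono h1 hm.aestronglyMeasurable
      (ae_restrict_of_forall_mem (measurableSet_siegel σ) fun P hP => ?_)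
    have hr := P.r_pos
    rw [hn, Real.rpow_zero, ofReal_one, mul_one, norm_real]
    refine le_trans ?_ ((hC P hP).trans (Real.le_norm_self C))
    exact mul_le_mul_of_nonneg_left
      (Real.rpow_le_rpow hr.le (by linarith) (by linarith)) (norm_nonneg _)

/-- The Rankin-Selberg integral over a fundamental domain is a Mellin transform of the constant
term. -/
theorem RapidInv.integral_mul_Est {σ : K →+* ℂ} {F : H3 → ℂ} (hF : RapidInv σ F) {D : Set H3}
    (hD : IsFundamentalDomain (Gam σ) D hypVol) {s : ℂ} (hs : 1 < s.re) :
    ∫ P in D, F P * Est σ P s ∂hypVol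
    = LamF σ (1 + s)
    * ((sqrtDisc K / 2 : ℝ) * ∫ r in Ioi (0 : ℝ), (r : ℂ) ^ (s - 2) * coeffAt σ F 0 r) := by
  have hcell : MeasurableSet {P : H3 | P.z ∈ cell σ} := measurable_z (measurableSet_cell σ)
  have hint := hF.integrableOn_cell hs
  have h1 := unfolding σ hD (F := F) (φ := fun P => (P.r : ℂ) ^ (1 + s)) hF.inv
    (fun b P => by rw [trl_smul, mk_r]) (by
      rw [onCell, integrable_indicator_iff hcell]; exact hint)
  have h2 : ∫ P in D, F P * Est σ P s ∂hypVol = LamF σ (1 + s) *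
      ∫ P in D, F P * ∑' c : Cosets K, (H3.r (incl σ c.out • P) : ℂ) ^ (1 + s) ∂hypVol := by
    rw [← integral_const_mul]
    refine integral_congr_ae (.of_forall fun P => ?_)
    beta_reduce
    rw [Est_eq σ P hs, eisSeries]
    ring
  rw [h2, h1, onCell, integral_indicator hcell, cell_eq_strip]
  rw [cell_eq_strip, integrableOn_strip (measurableSet_cell σ) measurableSet_Ioi subset_rfl] at hint
  simp only [Pi.mul_def]
  rw [integral_strip (measurableSet_cell σ) measurableSet_Ioi subset_rfl]
  congr 1
  rw [Measure.volume_eq_prod] at hint ⊢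
  rw [IntegrableOn, ← Measure.prod_restrict] at hint
  rw [← Measure.prod_restrict, integral_prod_symm _ hint, ← integral_const_mul]
  refine setIntegral_congr_fun measurableSet_Ioi fun r (hr : 0 < r) => ?_
  have e : ∀ z : ℂ, (((r ^ 3)⁻¹ : ℝ) : ℂ) * coord (fun P => F P * (P.r : ℂ) ^ (1 + s)) (z, r)
      = (r : ℂ) ^ (s - 2) * coord F (z, r) := by
    intro z
    have hr0 : (r : ℂ) ≠ 0 := by exact_mod_cast hr.ne'
    rw [coord_mk _ _ hr, coord_mk _ _ hr, mk_r, show (1 + s : ℂ) = (s - 2) + (3 : ℕ) by push_cast; ring,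
      cpow_add _ _ hr0, cpow_natCast]
    push_cast
    field_simp
  simp only [e]
  rw [integral_const_mul, integral_cell, coeffAt, planeCoeff]
  simp only [dualFreq_zero, chr_zero_left, mul_one]
  ring

end RS

/-! ### The identity theorem -/

/-- The identity theorem on the complement of a countable set. -/
lemma eq_of_eq_halfPlane {S : Set ℂ} (hS : S.Countable) {f g : ℂ → ℂ} (hf : AnalyticOnNhd ℂ f Sᶜ)
    (hg : AnalyticOnNhd ℂ g Sᶜ) {A : ℝ} (hA : ∀ s ∈ S, s.re ≤ A)
    (h : ∀ s : ℂ, A < s.re → f s = g s) {s : ℂ} (hs : s ∉ S) : f s = g s := by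
  have hc := (hS.isPathConnected_compl_of_one_lt_rank
    (by rw [rank_real_complex]; norm_num)).isConnected.isPreconnected
  have hm : ((A + 1 : ℝ) : ℂ) ∈ Sᶜ := fun hmem => by
    have := hA _ hmem
    rw [ofReal_re] at this
    linarith
  refine hf.eqOn_of_preconnected_of_eventuallyEq hg hc hm ?_ hs
  exact Filter.eventually_of_mem ((isOpen_lt continuous_const continuous_re).mem_nhds
    (by simp : ((A + 1 : ℝ) : ℂ) ∈ {z : ℂ | A < z.re})) h

section Nonvanishing

variable [IsTotallyComplex K] [hdeg : Fact (Module.finrank ℚ K = 2)]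

/-! ### The constant term of the Eisenstein series -/

/-- The pairs of integers with product zero. -/
def fibZeroEquiv : 𝓞 K ⊕ NZ K → Fib (0 : 𝓞 K) :=
  Sum.elim (fun ν => ⟨(0, ν), zero_mul ν⟩) (fun c => ⟨(c.1, 0), mul_zero c.1⟩)

lemma fibZeroEquiv_bijective : Function.Bijective (fibZeroEquiv (K := K)) := by
  constructor
  · rintro (a | a) (b | b) h
    · have h1 := congrArg (fun p : Fib (0 : 𝓞 K) => p.1.2) h
      exact congrArg Sum.inl h1
    · have h1 := congrArg (fun p : Fib (0 : 𝓞 K) => p.1.1) h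
      exact absurd h1.symm b.2
    · have h1 := congrArg (fun p : Fib (0 : 𝓞 K) => p.1.1) h
      exact absurd h1 a.2
    · have h1 := congrArg (fun p : Fib (0 : 𝓞 K) => p.1.1) h
      exact congrArg Sum.inr (Subtype.ext h1)
  · rintro ⟨⟨c, ν⟩, hp⟩
    by_cases hc : c = 0
    · subst hc; exact ⟨Sum.inl ν, rfl⟩
    · obtain rfl : ν = 0 := (mul_eq_zero.1 hp).resolve_left hc
      exact ⟨Sum.inr ⟨c, hc⟩, rfl⟩

lemma cof_zero {r x : ℝ} (hr : 0 < r) (hx : 0 < x) : cof σ r 0 x = 1 + zetaTheta σ (r / x) +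
    zetaTheta σ (r * x) := by
  have h1 := hasSum_zetaTheta σ (x := r / x) (by positivity)
  have h2 := (summable_zetaTheta σ (x := r * x) (by positivity)).hasSum
  have h3 : HasSum ((fun p : Fib (0 : 𝓞 K) => gaussPair σ r x p.1) ∘ fibZeroEquiv)
      (1 + zetaTheta σ (r / x) + zetaTheta σ (r * x)) := by
    refine HasSum.sum (h1.congr_fun fun ν => ?_) (h2.congr_fun fun c => ?_)
    · simp only [Function.comp_apply, fibZeroEquiv, Sum.elim_inl, gaussPair, map_zero, norm_zero]
      congr 1; field_simp; ring
    · simp only [Function.comp_apply, fibZeroEquiv, Sum.elim_inr, gaussPair, map_zero, norm_zero]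
      congr 1; ring
  exact ((Equiv.ofBijective _ fibZeroEquiv_bijective).hasSum_iff.1 h3).tsum_eq

/-- The constant term of the theta series of a point at height `r`. -/
def thetaConst (r x : ℝ) : ℝ := zetaTheta σ (r⁻¹ * x) + r / x * zetaTheta σ (r * x)

lemma thetaConst_eq {r x : ℝ} (hr : 0 < r) (hx : 0 < x) : 1 + thetaConst σ r x = r / x * cof σ r 0 x
    := by
  have h := zetaTheta_inv σ (x := r⁻¹ * x) (by positivity)
  rw [mul_inv, inv_inv, ← div_eq_mul_inv, pow_one] at h
  rw [cof_zero σ hr hx, h, thetaConst]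
  field_simp
  ring

lemma thetaConst_inv {r x : ℝ} (hr : 0 < r) (hx : 0 < x) :
    1 + thetaConst σ r x⁻¹ = x ^ 2 * (1 + thetaConst σ r x) := by
  rw [thetaConst_eq σ hr hx, thetaConst_eq σ hr (inv_pos.2 hx), cof_inv]
  field_simp

/-- The Mellin transform of the constant term. -/
lemma mellin_thetaConst {r : ℝ} (hr : 0 < r) {s : ℂ} (hs : 2 < s.re) :
    IntegrableOn (fun x : ℝ => (x : ℂ) ^ (s - 1) * (thetaConst σ r x : ℂ)) (Ioi 0)
    ∧ ∫ x in Ioi (0 : ℝ), (x : ℂ) ^ (s - 1) * (thetaConst σ r x : ℂ)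
    = unitCard K * (LamF σ s * (r : ℂ) ^ s + LamF σ (s - 1) * (r : ℂ) ^ (2 - s)) := by
  have hr0 : (r : ℂ) ≠ 0 := by exact_mod_cast hr.ne'
  have key : ∀ {a : ℝ}, 0 < a → ∀ {w : ℂ}, 1 < w.re →
      IntegrableOn (fun x : ℝ => (x : ℂ) ^ (w - 1) * (zetaTheta σ (a * x) : ℂ)) (Ioi 0) ∧
      ∫ x in Ioi (0 : ℝ), (x : ℂ) ^ (w - 1) * (zetaTheta σ (a * x) : ℂ)
        = (a : ℂ) ^ (-w) * (unitCard K * LamF σ w) := by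
    intro a ha w hw
    obtain ⟨h1, h2⟩ := mellin_zetaTheta σ hw
    have h3 : MellinConvergent (fun x : ℝ => (zetaTheta σ x : ℂ)) w := h1
    have h4 := (MellinConvergent.comp_mul_left (a := a) ha).2 h3
    have h5 := mellin_comp_mul_left (fun x : ℝ => (zetaTheta σ x : ℂ)) w ha
    refine ⟨h4, h5.trans ?_⟩
    rw [← h2]
    rfl
  obtain ⟨a1, a2⟩ := key (inv_pos.2 hr) (w := s) (by linarith)
  obtain ⟨b1, b2⟩ := key hr (w := s - 1) (by rw [sub_re, one_re]; linarith)
  have e : ∀ x ∈ Ioi (0 : ℝ), (x : ℂ) ^ (s - 1) * (zetaTheta σ (r⁻¹ * x) : ℂ)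
      + r * ((x : ℂ) ^ (s - 1 - 1) * (zetaTheta σ (r * x) : ℂ))
      = (x : ℂ) ^ (s - 1) * (thetaConst σ r x : ℂ) := by
    intro x (hx : 0 < x)
    have hx0 : (x : ℂ) ≠ 0 := by exact_mod_cast hx.ne'
    rw [cpow_sub (s - 1) 1 hx0, cpow_one, thetaConst]
    push_cast
    field_simp
  refine ⟨(a1.add (b1.const_mul (r : ℂ))).congr_fun e measurableSet_Ioi, ?_⟩
  rw [← setIntegral_congr_fun measurableSet_Ioi e, integral_add a1 (b1.const_mul _),
    integral_const_mul, a2, b2, ofReal_inv_cpow hr, neg_neg,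
    show (2 - s : ℂ) = 1 + -(s - 1) by ring, cpow_add _ _ hr0, cpow_one]
  ring

lemma integrableOn_thetaConst {r : ℝ} (hr : 0 < r) (s : ℂ) :
    IntegrableOn (fun x : ℝ => (x : ℂ) ^ (s - 1) * (thetaConst σ r x : ℂ)) (Ioi 1) :=
  integrableOn_Ioi_one (σ₀ := 2) (fun A hA => (mellin_thetaConst σ hr (s := (A : ℂ))
    (by rwa [ofReal_re])).1) s

/-- The constant term of the completed Eisenstein series. -/
theorem planeCoeff_Est_zero {r : ℝ} (hr : 0 < r) {s : ℂ} (h0 : s ≠ 0) (h1 : s ≠ 1) (h2 : s ≠ -1) :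
    planeCoeff σ (fun z => Est σ (mk z r hr) s) 0
    = unitCard K / 2
    * (LamF σ (1 + s) * (r : ℂ) ^ (1 + s) + LamF σ (1 - s) * (r : ℂ) ^ (1 - s)) := by
  classical
  have hr0 : (r : ℂ) ≠ 0 := by exact_mod_cast hr.ne'
  have hform : ∀ s : ℂ, planeCoeff σ (fun z => Est σ (mk z r hr) s) 0
      = 1 / 2 * (upperMellin (thetaConst σ r) (1 + s) + upperMellin (thetaConst σ r) (1 - s)
        - 1 / (1 + s) - 1 / (1 - s)) := by
    intro s
    have h := (planeCoeff_Est_eq_integral σ hr s 0).2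
    simp only [↓reduceIte] at h
    rw [h]
    have e : ∫ x in Ioi (1 : ℝ), kernS s x * (((r / x * cof σ r 0 x : ℝ) : ℂ) - 1)
        = upperMellin (thetaConst σ r) (1 + s) + upperMellin (thetaConst σ r) (1 - s) := by
      unfold upperMellin
      rw [← integral_add (integrableOn_thetaConst σ hr _) (integrableOn_thetaConst σ hr _)]
      refine setIntegral_congr_fun measurableSet_Ioi fun x (hx : 1 < x) => ?_
      rw [← thetaConst_eq σ hr (by linarith), kernS, add_sub_cancel_left,
        show (1 - s - 1 : ℂ) = -s by ring]
      push_cast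
      ring
    rw [e]
    ring
  rw [hform]
  have hU := differentiable_upperMellin (integrableOn_thetaConst σ hr)
  have hS : ({0, 1, -1} : Set ℂ).Countable := by
    simp
  refine eq_of_eq_halfPlane (S := {0, 1, -1}) hS (f := fun s => 1 / 2 *
    (upperMellin (thetaConst σ r) (1 + s) + upperMellin (thetaConst σ r) (1 - s)
        - 1 / (1 + s) - 1 / (1 - s))) (g := fun s => unitCard K / 2 *
      (LamF σ (1 + s) * (r : ℂ) ^ (1 + s) + LamF σ (1 - s) * (r : ℂ) ^ (1 - s))) ?_ ?_ (A := 1)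
    ?_ ?_ (by simp [h0, h1, h2])
  · intro s hs
    simp only [mem_compl_iff, mem_insert_iff, mem_singleton_iff, not_or] at hs
    have a1 : AnalyticAt ℂ (fun s => upperMellin (thetaConst σ r) (1 + s)) s :=
      (hU.comp (differentiable_id.const_add 1)).analyticAt s
    have a2 : AnalyticAt ℂ (fun s => upperMellin (thetaConst σ r) (1 - s)) s :=
      (hU.comp (differentiable_id.const_sub 1)).analyticAt s
    have a3 : AnalyticAt ℂ (fun s : ℂ => 1 / (1 + s)) s :=
      analyticAt_const.div (analyticAt_const.add analyticAt_id) (fun h => hs.2.2 (by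
        have h : 1 + s = 0 := h
        linear_combination h))
    have a4 : AnalyticAt ℂ (fun s : ℂ => 1 / (1 - s)) s :=
      analyticAt_const.div (analyticAt_const.sub analyticAt_id) (sub_ne_zero.2 (Ne.symm hs.2.1))
    exact analyticAt_const.mul (((a1.add a2).sub a3).sub a4)
  · intro s hs
    simp only [mem_compl_iff, mem_insert_iff, mem_singleton_iff, not_or] at hs
    have n1 : (1 + s : ℂ) ≠ 0 := fun h => hs.2.2 (by linear_combination h)
    have l1 : AnalyticAt ℂ (fun s => LamF σ (1 + s)) s :=
      (analyticAt_LamF σ n1 (by simpa using hs.1)).comp (analyticAt_const.add analyticAt_id)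
    have l2 : AnalyticAt ℂ (fun s => LamF σ (1 - s)) s :=
      (analyticAt_LamF σ (sub_ne_zero.2 (Ne.symm hs.2.1)) (by simpa using hs.1)).comp
        (analyticAt_const.sub analyticAt_id)
    have p1 : AnalyticAt ℂ (fun s => (r : ℂ) ^ (1 + s)) s :=
      ((differentiable_id.const_add 1).const_cpow (Or.inl hr0)).analyticAt s
    have p2 : AnalyticAt ℂ (fun s => (r : ℂ) ^ (1 - s)) s :=
      ((differentiable_id.const_sub 1).const_cpow (Or.inl hr0)).analyticAt s
    exact analyticAt_const.mul ((l1.mul p1).add (l2.mul p2))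
  · rintro s (rfl | rfl | rfl) <;> simp
  · intro s hs
    have hre : 2 < (1 + s).re := by rw [add_re, one_re]; linarith
    have e1 := (mellin_thetaConst σ hr hre).2
    have e2 := mellin_split (k := 2) (integrableOn_thetaConst σ hr)
      (fun x hx => thetaConst_inv σ hr hx) (s := 1 + s) (by simpa using hre)
    have e3 : ((2 : ℕ) : ℂ) - (1 + s) = 1 - s := by push_cast; ring
    rw [e1, e3, add_sub_cancel_left, show (2 - (1 + s) : ℂ) = 1 - s by ring] at e2
    rw [LamF_one_sub σ s]
    linear_combination (-1 / 2 : ℂ) * e2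

end Nonvanishing

section Nonvanishing

variable [IsTotallyComplex K] [hdeg : Fact (Module.finrank ℚ K = 2)]

lemma LamF_one_sub_I (t : ℝ) : LamF σ (1 - I * t) = conj (LamF σ (1 + I * t)) := by
  rw [conj_LamF, map_add, map_mul, map_one, conj_I, conj_ofReal, neg_mul, ← sub_eq_add_neg]

lemma conj_Est_I (P : H3) (t : ℝ) : conj (Est σ P (I * t)) = Est σ P (I * t) := by
  rw [conj_Est, map_mul, conj_I, conj_ofReal, neg_mul, Est_neg]

lemma tau_one (s : ℂ) : tau σ s 1 = unitCard K := by
  have e : (𝓞 K)ˣ ≃ Fib (1 : 𝓞 K) :=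
    { toFun := fun u => ⟨(u, (u⁻¹ : (𝓞 K)ˣ)), u.mul_inv⟩
      invFun := fun p => ⟨p.1.1, p.1.2, p.2, (mul_comm _ _).trans p.2⟩
      left_inv := fun u => Units.ext rfl
      right_inv := fun p => by
        apply Subtype.ext
        rfl }
  have h1 : ∀ p : Fib (1 : 𝓞 K), ((‖emb σ p.1.2‖ / ‖emb σ p.1.1‖ : ℝ) : ℂ) ^ s = 1 := by
    intro p
    have h1 := one_le_norm_emb σ (fib_ne_zero one_ne_zero p).1
    have h2 := one_le_norm_emb σ (fib_ne_zero one_ne_zero p).2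
    have h3 : ‖emb σ p.1.1‖ * ‖emb σ p.1.2‖ = 1 := by
      rw [← norm_mul, ← map_mul, p.2, map_one, norm_one]
    have h4 : ‖emb σ p.1.1‖ = 1 := by nlinarith
    have h5 : ‖emb σ p.1.2‖ = 1 := by nlinarith
    rw [h4, h5]
    simp
  unfold tau
  simp only [h1]
  have := finite_fib σ (one_ne_zero (α := 𝓞 K))
  have := Fintype.ofFinite (Fib (1 : 𝓞 K))
  rw [tsum_fintype, Finset.sum_const, Finset.card_univ, nsmul_one, unitCard, Nat.card_congr e,
    Nat.card_eq_fintype_card]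

variable [IsPrincipalIdealRing (𝓞 K)]

/-! ### Cuspidal functions -/

lemma periodic_of_invariant {σ : K →+* ℂ} {f : H3 → ℂ} (hf : ∀ γ ∈ Gam σ, ∀ P, f (γ P) = f P)
    (r : ℝ) : Periodic σ (fun z => coord f (z, r)) := by
  intro z b
  by_cases hr : 0 < r
  · simp only [coord_mk _ _ hr]
    have h := hf _ (toGam σ (trl b)).2 (mk z r hr)
    rw [← h]
    exact congrArg f (trl_smul σ b (mk z r hr)).symm
  · simp only [coord, dif_neg hr]

lemma two_pi_norm_dualFreq (μ : 𝓞 K) : 2 * Real.pi * ‖dualFreq σ μ‖ = 2 * condR K * ‖emb σ μ‖ := by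
  rw [norm_dualFreq, condR]
  ring

lemma norm_coeffAt_le {σ : K →+* ℂ} {f : H3 → ℂ} {r M : ℝ} (hr : 0 < r)
    (h : ∀ z, ‖f (mk z r hr)‖ ≤ M) (μ : 𝓞 K) : ‖coeffAt σ f μ r‖ ≤ M := by
  rw [coeffAt, planeCoeff]
  refine (norm_setIntegral_le_of_norm_le_const (C := M) isCompact_Icc.measure_lt_top
    fun x _ => ?_).trans_eq (by rw [volume_box, mul_one])
  have : ‖chr (dualFreq σ μ) (-par σ x)‖ = 1 := by rw [chr_eq_exp, norm_exp_ofReal_mul_I]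
  rw [norm_mul, coord_mk _ _ hr, this, mul_one]
  exact h _

/-- Continuous `Γ`-invariant functions of polynomial growth with vanishing constant term and with
Fourier coefficients `a(μ) r K_ν(2 π |μ̃| r)`. -/
structure Cuspidal (F : H3 → ℂ) (ν : ℂ) (a : 𝓞 K → ℂ) : Prop where
  cont : Continuous F
  inv : ∀ γ ∈ Gam σ, ∀ P, F (γ P) = F P
  growth : ∃ C N : ℝ, ∀ P ∈ siegel σ, ‖F P‖ ≤ C * (1 + P.r) ^ N
  zero : ∀ r : ℝ, 0 < r → coeffAt σ F 0 r = 0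
  coeff : ∀ μ ≠ 0, ∀ r : ℝ, 0 < r →
    coeffAt σ F μ r = a μ * (r * besselK ν (2 * Real.pi * ‖dualFreq σ μ‖ * r))

/-- An element of `Γ` either preserves the height of a point or moves it to a height of at most
`1 / r`. -/
lemma r_smul_le (γ : Gam σ) (P : H3) : (γ • P).r ≤ P.r + P.r⁻¹ := by
  obtain ⟨_, M, rfl⟩ := γ
  have hP := P.r_pos
  change (incl σ M • P).r ≤ _
  have hq : 0 < qf σ (M 1 0) (M 1 1) P := den_pos (incl σ M) P
  rw [r_incl_smul, div_le_iff₀ hq]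
  by_cases hc : M 1 0 = 0
  · have hd : M 1 1 ≠ 0 := by
      intro h
      have h0 := M.det_coe
      rw [Matrix.det_fin_two, hc, h] at h0
      simp at h0
    have h1 := one_le_pow₀ (one_le_norm_emb σ hd) (n := 2)
    rw [qf, hc, map_zero, zero_mul, zero_add, map_zero, zero_mul, add_zero, ← Complex.sq_norm]
    nlinarith [inv_pos.2 hP]
  · have h1 := one_le_pow₀ (one_le_norm_emb σ hc) (n := 2)
    have h2 : P.r ^ 2 ≤ qf σ (M 1 0) (M 1 1) P := by
      rw [qf, ← Complex.sq_norm (emb σ (M 1 0))]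
      nlinarith [normSq_nonneg (emb σ (M 1 0) * P.z + emb σ (M 1 1)), sq_nonneg P.r]
    have h3 : P.r⁻¹ * P.r ^ 2 = P.r := by field_simp
    nlinarith [inv_pos.2 hP, mul_le_mul_of_nonneg_left h2 (inv_pos.2 hP).le]

namespace Cuspidal

variable {σ} {F : H3 → ℂ} {ν : ℂ} {a : 𝓞 K → ℂ}

/-- A bound of the function bounds the coefficients, by evaluating the coefficient of `μ` at the
height where the argument of the Bessel function is a fixed number. -/
lemma exists_norm_le (hF : Cuspidal σ F ν a) {C N : ℝ} (hN : 0 ≤ N)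
    (h : ∀ P, ‖F P‖ ≤ C * (1 + (P.r + P.r⁻¹)) ^ N) :
    ∃ C' : ℝ, 0 ≤ C' ∧ ∀ μ ≠ 0, ‖a μ‖ ≤ C' * ‖emb σ μ‖ ^ (N + 1) := by
  have hκ := condR_pos K
  obtain ⟨X, hX, hK⟩ := exists_besselK_ne_zero ν
  have hK := norm_pos_iff.2 hK
  have hC : 0 ≤ C := by
    have h0 := (Bianchi.mk 0 1 one_pos).r_pos
    exact nonneg_of_mul_nonneg_left ((norm_nonneg _).trans (h _)) (by positivity)
  set A := 1 + (X / (2 * condR K) + 2 * condR K / X) with hA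
  refine ⟨C * A ^ N * (2 * condR K) / (X * ‖besselK ν X‖), by positivity, fun μ hμ => ?_⟩
  have hn := one_le_norm_emb σ hμ
  have hn0 : 0 < ‖emb σ μ‖ := by linarith
  have hr : 0 < X / (2 * condR K * ‖emb σ μ‖) := by positivity
  set r := X / (2 * condR K * ‖emb σ μ‖) with hr'
  have h1 : 1 + (r + r⁻¹) ≤ A * ‖emb σ μ‖ := by
    have e1 : r ≤ X / (2 * condR K) * ‖emb σ μ‖ := by
      rw [hr', ← div_div]
      exact (div_le_self (by positivity) hn).trans (le_mul_of_one_le_right (by positivity) hn)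
    have e2 : r⁻¹ = 2 * condR K / X * ‖emb σ μ‖ := by rw [hr']; field_simp
    rw [hA, e2]
    linarith
  have h2 := norm_coeffAt_le (σ := σ) (M := C * (A ^ N * ‖emb σ μ‖ ^ N)) hr (fun z => (h _).trans (by
    rw [← Real.mul_rpow (by positivity) hn0.le]
    change C * (1 + (r + r⁻¹)) ^ N ≤ _
    gcongr)) μ
  have e3 : 2 * condR K * ‖emb σ μ‖ * r = X := by rw [hr']; field_simp
  rw [hF.coeff μ hμ r hr, norm_mul, norm_mul, norm_real, Real.norm_of_nonneg hr.le,
    two_pi_norm_dualFreq, e3, ← mul_assoc, ← le_div_iff₀ hK, ← le_div_iff₀ hr] at h2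
  refine h2.trans_eq ?_
  rw [Real.rpow_add_one hn0.ne', hr']
  field_simp

lemma exists_rpow_le (hF : Cuspidal σ F ν a) :
    ∃ C N : ℝ, 0 ≤ C ∧ ∀ μ ≠ 0, ‖a μ‖ ≤ C * ‖emb σ μ‖ ^ N := by
  obtain ⟨C, N, h⟩ := hF.growth
  obtain ⟨C', h'⟩ := hF.exists_norm_le (abs_nonneg N) (C := |C|) fun P => by
    obtain ⟨γ, h1, h2⟩ := exists_smul_siegel σ P
    have h3 := h (γ • P) ⟨h1, h2⟩
    rw [gam_smul, hF.inv γ.1 γ.2, ← gam_smul] at h3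
    have h4 := (γ • P).r_pos
    calc _ ≤ _ := h3
      _ ≤ |C| * (1 + (γ • P).r) ^ |N| := by
        gcongr ?_ * ?_
        · exact le_abs_self C
        · exact Real.rpow_le_rpow_of_exponent_le (by linarith) (le_abs_self N)
      _ ≤ _ := by
        gcongr
        exact r_smul_le σ γ P
  exact ⟨C', _, h'⟩

/-- The Fourier coefficients decrease rapidly in both variables. -/
lemma exists_coeffAt_le (hF : Cuspidal σ F ν a) {δ : ℝ} (hδ : 0 < δ) (M : ℝ) :
    ∃ A : ℝ, 0 ≤ A ∧ ∀ r, δ ≤ r → ∀ μ, ‖coeffAt σ F μ r‖ ≤ A * r ^ (-M) * ‖emb σ μ‖ ^ (-3 : ℝ) := by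
  have hκ := condR_pos K
  obtain ⟨C, N, hC, ha⟩ := hF.exists_rpow_le
  set x₀ := 2 * condR K * δ with hx₀
  have hx₀' : 0 < x₀ := by positivity
  set b := |N| + 4 + |M| with hb
  have hb0 : 0 < b := by positivity
  set B := besselBound |ν.re| x₀
  have hB := besselBound_nonneg |ν.re| x₀
  set D := C * (Real.exp x₀ * (b ^ b * (2 * condR K) ^ (-b)) * B) with hD
  refine ⟨D * δ ^ (1 - b + M), by positivity, fun r hr μ => ?_⟩
  have hr0 : 0 < r := hδ.trans_le hr
  by_cases hμ : μ = 0
  · rw [hμ, hF.zero r hr0, norm_zero]; positivity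
  have hn := one_le_norm_emb σ hμ
  have hn0 : 0 < ‖emb σ μ‖ := by linarith
  set x := 2 * condR K * ‖emb σ μ‖ * r with hx
  have hx0 : 0 < x := by positivity
  have hxx : x₀ ≤ x := by
    rw [hx, hx₀]
    exact mul_le_mul (le_mul_of_one_le_right (by positivity) hn) hr hδ.le (by positivity)
  have h1 : ‖besselK ν x‖ ≤ Real.exp x₀ * (b ^ b * x ^ (-b)) * B := by
    refine (norm_besselK_le _ hx0).trans ((besselBound_le hx₀' hxx).trans ?_)
    rw [neg_sub, sub_eq_add_neg, Real.exp_add]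
    gcongr
    exact rpow_mul_exp_neg_le hx0 hb0
  rw [hx, Real.mul_rpow (by positivity) hr0.le, Real.mul_rpow (by positivity) hn0.le, ← hx] at h1
  rw [hF.coeff μ hμ r hr0, norm_mul, norm_mul, norm_real, Real.norm_of_nonneg hr0.le,
    two_pi_norm_dualFreq, ← hx]
  have h2 : ‖emb σ μ‖ ^ N * ‖emb σ μ‖ ^ (-b) ≤ ‖emb σ μ‖ ^ (-3 : ℝ) := by
    rw [← Real.rpow_add hn0]
    refine Real.rpow_le_rpow_of_exponent_le hn ?_
    rw [hb]
    linarith [le_abs_self N, abs_nonneg M]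
  have h3 : r * r ^ (-b) ≤ δ ^ (1 - b + M) * r ^ (-M) := by
    have e : r * r ^ (-b) = r ^ (1 - b + M) * r ^ (-M) := by
      rw [← Real.rpow_add hr0, show 1 - b + M + -M = 1 + -b by ring, Real.rpow_add hr0,
        Real.rpow_one]
    rw [e]
    refine mul_le_mul_of_nonneg_right (Real.rpow_le_rpow_of_nonpos hδ hr ?_) (by positivity)
    rw [hb]
    linarith [le_abs_self M, abs_nonneg N]
  calc _ ≤ C * ‖emb σ μ‖ ^ N * (r * (Real.exp x₀ *
        (b ^ b * ((2 * condR K) ^ (-b) * ‖emb σ μ‖ ^ (-b) * r ^ (-b))) * B)) := by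
        gcongr
        exact ha μ hμ
    _ = D * ((r * r ^ (-b)) * (‖emb σ μ‖ ^ N * ‖emb σ μ‖ ^ (-b))) := by rw [hD]; ring
    _ ≤ D * (δ ^ (1 - b + M) * r ^ (-M) * ‖emb σ μ‖ ^ (-3 : ℝ)) := by gcongr
    _ = _ := by ring

/-- The Fourier expansion of a cuspidal function. -/
lemma hasSum (hF : Cuspidal σ F ν a) {r : ℝ} (hr : 0 < r) (z : ℂ) :
    HasSum (fun μ => coeffAt σ F μ r * chr (dualFreq σ μ) z) (F (Bianchi.mk z r hr)) := by
  obtain ⟨A, -, h⟩ := hF.exists_coeffAt_le hr 0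
  have hc : Continuous fun z => coord F (z, r) := by
    simp only [coord_mk F _ hr]
    exact hF.cont.comp (by unfold Bianchi.mk; fun_prop)
  rw [← coord_mk F _ hr]
  exact hasSum_planeCoeff (periodic_of_invariant hF.inv r) hc (.of_norm_bounded
    ((summable_norm_rpow σ (A := 3) (by norm_num)).mul_left _) (h r le_rfl)) z

lemma exists_le_rpow (hF : Cuspidal σ F ν a) {δ : ℝ} (hδ : 0 < δ) (M : ℝ) :
    ∃ A : ℝ, 0 ≤ A ∧ ∀ P : H3, δ ≤ P.r → ‖F P‖ ≤ A * P.r ^ (-M) := by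
  obtain ⟨A, hA, h⟩ := hF.exists_coeffAt_le hδ M
  refine ⟨A * ∑' μ : 𝓞 K, ‖emb σ μ‖ ^ (-3 : ℝ), by positivity, fun P hP => ?_⟩
  have h1 := hF.hasSum P.r_pos P.z
  rw [mul_right_comm, ← tsum_mul_left]
  change ‖F (Bianchi.mk P.z P.r P.r_pos)‖ ≤ _
  rw [← h1.tsum_eq]
  refine tsum_of_norm_bounded
    ((summable_norm_rpow σ (A := 3) (by norm_num)).mul_left _).hasSum fun μ => ?_
  rw [norm_mul, norm_chr, mul_one]
  exact h _ hP μ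

/-- Cuspidal functions decrease rapidly on the Siegel set. -/
lemma rapidInv (hF : Cuspidal σ F ν a) : RapidInv σ F where
  meas := hF.cont.measurable
  inv := hF.inv
  decay B := by
    have hδ := siegelHt_pos σ
    obtain ⟨A, hA, h⟩ := hF.exists_le_rpow hδ |B|
    refine ⟨A * (1 + (siegelHt σ)⁻¹) ^ |B|, fun P hP => ?_⟩
    have hr := P.r_pos
    have hr2 : siegelHt σ ≤ P.r := hP.2
    have h1 : (1 + P.r) ^ B ≤ (1 + (siegelHt σ)⁻¹) ^ |B| * P.r ^ |B| := by
      rw [← Real.mul_rpow (by positivity) hr.le]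
      refine (Real.rpow_le_rpow_of_exponent_le (by linarith) (le_abs_self B)).trans
        (Real.rpow_le_rpow (by linarith) ?_ (abs_nonneg B))
      have h3 : 1 ≤ (siegelHt σ)⁻¹ * P.r := by
        rw [inv_mul_eq_div, le_div_iff₀ hδ]; linarith
      linarith
    calc _ ≤ (A * P.r ^ (-|B|)) * ((1 + (siegelHt σ)⁻¹) ^ |B| * P.r ^ |B|) := by
          gcongr
          exact h P hr2
      _ = A * (1 + (siegelHt σ)⁻¹) ^ |B| * (P.r ^ (-|B|) * P.r ^ |B|) := by ring
      _ = _ := by rw [← Real.rpow_add hr, neg_add_cancel, Real.rpow_zero, mul_one]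

end Cuspidal

/-! ### Non-vanishing on the edge of the critical strip -/

/-- If `Λ` vanished at `1 + it`, the Eisenstein series there would be cuspidal. -/
lemma cuspidal_Est {t : ℝ} (ht : t ≠ 0) (hL : LamF σ (1 + I * t) = 0) :
    Cuspidal σ (fun P => Est σ P (I * t)) (I * t) (tau σ (I * t)) where
  cont := continuous_Est σ _
  inv γ hγ P := Est_gam σ hγ P _
  growth := exists_norm_Est_le_siegel σ _
  zero r hr := by
    have h := planeCoeff_Est_zero σ hr (mul_ne_zero I_ne_zero (ofReal_ne_zero.2 ht))
      (I_mul_ne t).1 (I_mul_ne t).2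
    rw [LamF_one_sub_I, hL, map_zero, zero_mul, zero_mul, add_zero, mul_zero] at h
    rw [coeffAt_eq _ _ _ hr, h]
  coeff μ hμ r hr := by rw [coeffAt_eq _ _ _ hr, planeCoeff_Est σ hr _ hμ]

/-- The Rankin-Selberg integral is meromorphic, with its only poles at `1` and `-1`. -/
lemma RapidInv.meromorphic_integral {σ : K →+* ℂ} {F : H3 → ℂ} (hF : RapidInv σ F) {D : Set H3}
    (hD : IsFundamentalDomain (Gam σ) D hypVol) :
    AnalyticOnNhd ℂ (fun s => ∫ P in D, F P * Est σ P s ∂hypVol) {1, -1}ᶜ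
      ∧ MeromorphicOn (fun s => ∫ P in D, F P * Est σ P s ∂hypVol) univ := by
  obtain ⟨W, hW, hWeq⟩ := hF.analyticAt_integral hD
  rw [funext hWeq]
  constructor
  · intro s hs
    simp only [mem_compl_iff, mem_insert_iff, mem_singleton_iff, not_or] at hs
    have a3 : AnalyticAt ℂ (fun s : ℂ => 1 / (1 + s)) s :=
      analyticAt_const.div (analyticAt_const.add analyticAt_id) (fun h => hs.2 (by
        have h : 1 + s = 0 := h
        linear_combination h))
    have a4 : AnalyticAt ℂ (fun s : ℂ => 1 / (1 - s)) s :=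
      analyticAt_const.div (analyticAt_const.sub analyticAt_id) (sub_ne_zero.2 (Ne.symm hs.1))
    exact (hW.analyticAt s).sub (analyticAt_const.mul (a3.add a4))
  · intro s _
    have h1 : MeromorphicAt (fun s : ℂ => 1 / (1 + s)) s := by fun_prop
    have h2 : MeromorphicAt (fun s : ℂ => 1 / (1 - s)) s := by fun_prop
    exact (hW.analyticAt s).meromorphicAt.sub ((MeromorphicAt.const _ s).mul (h1.add h2))

instance : Measure.IsOpenPosMeasure hypVol := by
  have h := Measure.IsOpenPosMeasure.comap (volume : Measure (ℂ × ℝ)) (f := (Subtype.val : H3 → ℂ × ℝ))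
    (isOpen_lt continuous_const continuous_snd).isOpenEmbedding_subtypeVal
  refine (withDensity_absolutelyContinuous' (f := fun P : H3 => ENNReal.ofReal ((P.r ^ 3)⁻¹))
    ?_ (.of_forall fun P => ?_)).isOpenPosMeasure
  · exact (((measurable_r.pow_const 3).inv).ennreal_ofReal).aemeasurable
  · have := P.r_pos
    simp only [ne_eq, ENNReal.ofReal_eq_zero, not_le]
    positivity

/-- **Non-vanishing of the completed zeta function at the edge of the critical strip.** -/
theorem LamF_ne_zero {D : Set H3} (hD : IsFundamentalDomain (Gam σ) D hypVol) {t : ℝ} (ht : t ≠ 0) :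
    LamF σ (1 + I * t) ≠ 0 := by
  intro hL
  set φ : H3 → ℂ := fun P => Est σ P (I * t) with hφ
  have hC := cuspidal_Est σ ht hL
  have hR := hC.rapidInv
  -- the Rankin-Selberg integral of `φ` vanishes identically
  have hzero : ∫ P in D, φ P * Est σ P (I * t) ∂hypVol = 0 := by
    have hS : ({1, -1} : Set ℂ).Countable := by simp
    refine eq_of_eq_halfPlane (S := {1, -1}) hS
      (f := fun s => ∫ P in D, φ P * Est σ P s ∂hypVol) (g := fun _ => 0) ?_
      (fun _ _ => analyticAt_const) (A := 1) ?_ ?_ (s := I * t) ?_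
    · exact (hR.meromorphic_integral hD).1
    · rintro s (rfl | rfl) <;> simp
    · intro s hs
      have h1 := hR.integral_mul_Est hD hs
      have h2 : ∫ r in Ioi (0 : ℝ), (r : ℂ) ^ (s - 2) * coeffAt σ φ 0 r = 0 := by
        rw [setIntegral_congr_fun (g := fun _ => (0 : ℂ)) measurableSet_Ioi
          (fun r hr => by rw [hC.zero r hr, mul_zero])]
        simp
      rw [h2, mul_zero, mul_zero] at h1
      exact h1
    · have := I_mul_ne t
      simp [this.1, this.2]
  -- hence `φ = 0` almost everywhere
  have hsq : ∫ P in D, ‖φ P‖ ^ 2 ∂hypVol = 0 := by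
    have h1 : ∫ P in D, ((‖φ P‖ ^ 2 : ℝ) : ℂ) ∂hypVol = 0 := by
      rw [← hzero]
      refine integral_congr_ae (.of_forall fun P => ?_)
      have h2 := conj_Est_I σ P t
      have h3 := mul_conj (φ P)
      rw [← Complex.sq_norm] at h3
      change ((‖φ P‖ ^ 2 : ℝ) : ℂ) = φ P * φ P
      rw [← h3]
      exact congrArg (φ P * ·) h2
    rw [integral_complex_ofReal] at h1
    exact_mod_cast h1
  have hint : IntegrableOn (fun P => ‖φ P‖ ^ 2) D hypVol := by
    have h1 := ((hR.mul_Est (I * t)).integrableOn hD).norm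
    refine h1.congr (.of_forall fun P => ?_)
    simp only [Pi.mul_apply, norm_mul, sq]
    rfl
  have hae := (setIntegral_eq_zero_iff_of_nonneg_ae (.of_forall fun P => by positivity)
    hint).1 hsq
  set T : Set H3 := {P | φ P ≠ 0} with hT
  have hTm : MeasurableSet T := hR.meas (measurableSet_singleton 0).compl
  have hT0 : hypVol T = 0 := by
    refine hD.measure_zero_of_invariant T (fun γ => ?_) ?_
    · ext P
      rw [Set.mem_smul_set_iff_inv_smul_mem, hT, Set.mem_ofPred_eq, Set.mem_ofPred_eq, gam_smul]
      exact Eq.to_iff (congrArg (· ≠ 0) (hR.inv _ (γ⁻¹).2 P))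
    · rw [← Measure.restrict_apply hTm]
      have h1 : ∀ᵐ P ∂(hypVol.restrict D), ¬ P ∈ T := by
        filter_upwards [hae] with P hP
        simpa [hT] using hP
      exact measure_eq_zero_iff_ae_notMem.2 h1
  have hφ0 : φ = fun _ => 0 :=
    (Continuous.ae_eq_iff_eq hypVol hC.cont continuous_const).1 (ae_iff.2 hT0)
  -- but the first coefficient does not vanish
  obtain ⟨X, hX, hK⟩ := exists_besselK_ne_zero (I * t)
  have ha : 0 < 2 * Real.pi * ‖dualFreq σ (1 : 𝓞 K)‖ := by
    have := condR_pos K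
    rw [two_pi_norm_dualFreq, map_one, norm_one]
    positivity
  set a := 2 * Real.pi * ‖dualFreq σ (1 : 𝓞 K)‖
  have hr : 0 < X / a := by positivity
  have h1 := hC.coeff 1 one_ne_zero _ hr
  rw [mul_div_cancel₀ _ ha.ne', tau_one, coeffAt_eq _ _ _ hr] at h1
  refine mul_ne_zero (unitCard_ne_zero (K := K)) (mul_ne_zero (ofReal_ne_zero.2 hr.ne') hK)
    (h1.symm.trans ?_)
  have h2 : ∀ P, Est σ P (I * t) = 0 := congrFun hφ0
  simp [planeCoeff, h2]

end Nonvanishing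

end

/-! ### The Bessel equation -/

/-- The solution `r K_ν(k r)` of the radial Laplace equation, and its first two derivatives. -/
lemma hasDerivAt_radial (ν : ℂ) {k r : ℝ} (hk : 0 < k) (hr : 0 < r) :
    HasDerivAt (fun r : ℝ => (r : ℂ) * besselK ν (k * r))
      (besselK ν (k * r) - k * r * besselDer 1 ν (k * r)) r ∧
    HasDerivAt (fun r : ℝ => besselK ν (k * r) - k * r * besselDer 1 ν (k * r))
      (-2 * k * besselDer 1 ν (k * r) + k ^ 2 * r * besselDer 2 ν (k * r)) r := by
  have hx : 0 < k * r := mul_pos hk hr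
  have hl : HasDerivAt (fun r : ℝ => k * r) k r := by
    simpa using (hasDerivAt_id r).const_mul k
  have h0 : HasDerivAt (fun r : ℝ => besselK ν (k * r)) (k * -besselDer 1 ν (k * r)) r := by
    have := (hasDerivAt_besselK ν hx).scomp r hl
    rwa [real_smul] at this
  have h1 : HasDerivAt (fun r : ℝ => besselDer 1 ν (k * r)) (k * -besselDer 2 ν (k * r)) r := by
    have := (hasDerivAt_besselDer 1 ν hx).scomp r hl
    rwa [real_smul] at this
  have hid : HasDerivAt (fun r : ℝ => (r : ℂ)) 1 r := (hasDerivAt_id r).ofReal_comp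
  refine ⟨(hid.mul h0).congr_deriv (by ring), ?_⟩
  have h2 := (hid.const_mul (k : ℂ)).mul h1
  exact (h0.sub h2).congr_deriv (by ring)

/-- Two solutions of the radial Laplace equation with the same initial values agree. -/
lemma radial_unique {lam : ℂ} {k : ℝ} {c c' : ℝ → ℂ} {r₀ : ℝ} (h0 : 0 < r₀)
    (hc : ∀ r, 0 < r → HasDerivAt c (c' r) r)
    (hc' : ∀ r, 0 < r → HasDerivAt c' (c' r / r + (k ^ 2 - lam / r ^ 2) * c r) r)
    (hi : c r₀ = 0) (hi' : c' r₀ = 0) {r : ℝ} (hr : 0 < r) : c r = 0 := by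
  set a := min r r₀ / 2 with ha
  set b := max r r₀ + 1 with hb
  have hm : 0 < min r r₀ := lt_min hr h0
  have ha0 : 0 < a := by positivity
  have hrm : r ∈ Ioo a b := ⟨by linarith [min_le_left r r₀], by linarith [le_max_left r r₀]⟩
  have hrm0 : r₀ ∈ Ioo a b := ⟨by linarith [min_le_right r r₀], by linarith [le_max_right r r₀]⟩
  set L : ℝ := 1 + a⁻¹ + (k ^ 2 + ‖lam‖ / a ^ 2) with hL
  have hL0 : 0 ≤ L := by positivity
  have hlip : ∀ t ∈ Ioo a b, LipschitzOnWith (Real.toNNReal L)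
      (fun p : ℂ × ℂ => (p.2, p.2 / (t : ℂ) + (k ^ 2 - lam / t ^ 2) * p.1)) univ := by
    intro t ht
    have ht0 : 0 < t := ha0.trans ht.1
    refine LipschitzOnWith.of_dist_le_mul fun p _ q _ => ?_
    rw [Real.coe_toNNReal _ hL0, Prod.dist_eq, Prod.dist_eq]
    set M := max (dist p.1 q.1) (dist p.2 q.2)
    have hM : 0 ≤ M := dist_nonneg.trans (le_max_left _ _)
    have h1 : dist p.1 q.1 ≤ M := le_max_left _ _
    have h2 : dist p.2 q.2 ≤ M := le_max_right _ _
    have hinv : t⁻¹ ≤ a⁻¹ := by gcongr; exact ht.1.le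
    refine max_le (h2.trans ?_) ?_
    · have : 0 ≤ a⁻¹ + (k ^ 2 + ‖lam‖ / a ^ 2) := by positivity
      nlinarith
    · rw [dist_eq_norm] at h1 h2 ⊢
      have e : p.2 / (t : ℂ) + (k ^ 2 - lam / t ^ 2) * p.1
          - (q.2 / (t : ℂ) + (k ^ 2 - lam / t ^ 2) * q.1)
          = (p.2 - q.2) * (t : ℂ)⁻¹ + (k ^ 2 - lam / t ^ 2) * (p.1 - q.1) := by ring
      have h3 : ‖(k : ℂ) ^ 2 - lam / t ^ 2‖ ≤ k ^ 2 + ‖lam‖ / a ^ 2 := by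
        refine (norm_sub_le _ _).trans (add_le_add ?_ ?_)
        · rw [norm_pow, norm_real, Real.norm_eq_abs, sq_abs]
        · rw [norm_div, norm_pow, norm_real, Real.norm_of_nonneg ht0.le]
          gcongr
          exact ht.1.le
      have h4 : ‖(t : ℂ)⁻¹‖ ≤ a⁻¹ := by
        rwa [norm_inv, norm_real, Real.norm_of_nonneg ht0.le]
      calc _ ≤ M * a⁻¹ + (k ^ 2 + ‖lam‖ / a ^ 2) * M := by
            rw [e]
            refine (norm_add_le _ _).trans (add_le_add ?_ ?_) <;> rw [norm_mul]
            · exact mul_le_mul h2 h4 (norm_nonneg _) hM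
            · exact mul_le_mul h3 h1 (norm_nonneg _) (by positivity)
        _ ≤ L * M := by rw [hL]; nlinarith
  have huniq := ODE_solution_unique_of_mem_Ioo (f := fun t => (c t, c' t)) (g := fun _ => (0, 0))
    (v := fun t p => (p.2, p.2 / (t : ℂ) + (k ^ 2 - lam / t ^ 2) * p.1)) (s := fun _ => univ)
    hlip hrm0 (fun t ht => ⟨(hc t (ha0.trans ht.1)).prodMk (hc' t (ha0.trans ht.1)), mem_univ _⟩)
    (fun t _ => ⟨(hasDerivAt_const t ((0, 0) : ℂ × ℂ)).congr_deriv (by simp; rfl), mem_univ _⟩) (by simp [hi, hi'])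
  exact congrArg Prod.fst (huniq hrm)

/-- Polynomials times `r ↦ K_ν⁽ʲ⁾(k r)` are bounded for `r ≥ 1`. -/
lemma exists_rpow_mul_besselDer_le (j : ℕ) (ν : ℂ) (N : ℕ) {k : ℝ} (hk : 0 < k) :
    ∃ C : ℝ, 0 ≤ C ∧ ∀ r : ℝ, 1 ≤ r → r ^ N * ‖besselDer j ν (k * r)‖ ≤ C := by
  set B := besselBound (j + |ν.re|) k with hB
  have hB0 : 0 ≤ B := besselBound_nonneg _ _
  refine ⟨N.factorial / k ^ N * (Real.exp k * B), by positivity, fun r hr => ?_⟩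
  have hr0 : 0 < r := by linarith
  have h1 := (norm_besselDer_le j ν (mul_pos hk hr0)).trans
    (besselBound_le (A := j + |ν.re|) hk (by nlinarith : k ≤ k * r))
  have h2 : (k * r) ^ N ≤ N.factorial * Real.exp (k * r) := by
    have := Real.pow_div_factorial_le_exp (k * r) (by positivity) N
    rwa [div_le_iff₀ (by positivity), mul_comm (Real.exp _)] at this
  have h3 : r ^ N ≤ N.factorial / k ^ N * Real.exp (k * r) := by
    rw [mul_pow] at h2
    rw [div_mul_eq_mul_div, le_div_iff₀ (by positivity)]
    linarith
  calc _ ≤ (N.factorial / k ^ N * Real.exp (k * r)) * (Real.exp (-(k * r - k)) * B) := by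
        gcongr
    _ = N.factorial / k ^ N * ((Real.exp (k * r) * Real.exp (-(k * r - k))) * B) := by ring
    _ = _ := by rw [← Real.exp_add]; congr 3; ring_nf

/-- A solution of the radial Laplace equation of polynomial growth is a multiple of
`r K_ν(k r)`. With `y` the latter, the Wronskian relation `c y' - c' y = w r` gives
`(c y + w r² / 2)' = 2 c y'`, where `c y` and `c y'` are bounded; hence `w = 0`. -/
lemma eq_besselK_of_radial (ν : ℂ) {k : ℝ} (hk : 0 < k) {c c' c'' : ℝ → ℂ}
    (hc : ∀ r, 0 < r → HasDerivAt c (c' r) r) (hc' : ∀ r, 0 < r → HasDerivAt c' (c'' r) r)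
    (hode : ∀ r : ℝ, 0 < r → (r : ℂ) ^ 2 * (c'' r - k ^ 2 * c r) - r * c' r + (1 - ν ^ 2) * c r = 0)
    {C : ℝ} {N : ℕ} (hgr : ∀ r, 1 ≤ r → ‖c r‖ ≤ C * r ^ N) :
    ∃ a : ℂ, ∀ r : ℝ, 0 < r → c r = a * (r * besselK ν (k * r)) := by
  have hC : 0 ≤ C := by simpa using (norm_nonneg _).trans (hgr 1 le_rfl)
  set y : ℝ → ℂ := fun r => (r : ℂ) * besselK ν (k * r) with hy
  set y' : ℝ → ℂ := fun r => besselK ν (k * r) - k * r * besselDer 1 ν (k * r) with hy'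
  have dy : ∀ r, 0 < r → HasDerivAt y (y' r) r := fun r hr => (hasDerivAt_radial ν hk hr).1
  have dc' : ∀ r, 0 < r → HasDerivAt c' (c' r / r + (k ^ 2 - (1 - ν ^ 2) / r ^ 2) * c r) r := by
    intro r hr
    have h0 : (r : ℂ) ≠ 0 := by exact_mod_cast hr.ne'
    refine (hc' r hr).congr_deriv ?_
    have h := hode r hr
    field_simp
    linear_combination h
  have dy' : ∀ r, 0 < r → HasDerivAt y' (y' r / r + (k ^ 2 - (1 - ν ^ 2) / r ^ 2) * y r) r := by
    intro r hr
    have h0 : (r : ℂ) ≠ 0 := by exact_mod_cast hr.ne'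
    refine (hasDerivAt_radial ν hk hr).2.congr_deriv ?_
    have h := bessel_equation ν (mul_pos hk hr)
    rw [← besselK_eq_besselDer] at h
    push_cast at h
    simp only [hy, hy']
    field_simp
    linear_combination h
  -- the Wronskian
  set W : ℝ → ℂ := fun r => (c r * y' r - c' r * y r) / r with hW
  have dW : ∀ r, 0 < r → HasDerivAt W 0 r := by
    intro r hr
    have h0 : (r : ℂ) ≠ 0 := by exact_mod_cast hr.ne'
    refine ((((hc r hr).mul (dy' r hr)).sub ((dc' r hr).mul (dy r hr))).div
      (hasDerivAt_id r).ofReal_comp h0).congr_deriv ?_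
    simp only [Pi.mul_apply, Pi.sub_apply, id, ofReal_one]
    field_simp
    ring
  set w := W 1 with hw
  have hWc : ∀ r : ℝ, 0 < r → c r * y' r - c' r * y r = w * r := by
    intro r hr
    have h0 : (r : ℂ) ≠ 0 := by exact_mod_cast hr.ne'
    have : W r = W 1 := (convex_Ioi (0 : ℝ)).is_const_of_fderivWithin_eq_zero (𝕜 := ℝ)
      (fun x hx => (dW x hx).differentiableAt.differentiableWithinAt)
      (fun x hx => by
        rw [fderivWithin_of_isOpen isOpen_Ioi hx]
        ext; simp [(dW x hx).deriv]) hr (mem_Ioi.2 one_pos)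
    rw [hw, ← this, hW]
    field_simp
  have hw0 : w = 0 := by
    obtain ⟨B₀, hB₀, b₀⟩ := exists_rpow_mul_besselDer_le 0 ν N hk
    obtain ⟨B₁, hB₁, b₁⟩ := exists_rpow_mul_besselDer_le 0 ν (N + 1) hk
    obtain ⟨B₂, hB₂, b₂⟩ := exists_rpow_mul_besselDer_le 1 ν (N + 1) hk
    simp only [← besselK_eq_besselDer] at b₀ b₁
    set Φ : ℝ → ℂ := fun r => c r * y r + w * (r : ℂ) ^ 2 / 2 with hΦ
    have dΦ : ∀ r, 0 < r → HasDerivAt Φ (2 * (c r * y' r)) r := by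
      intro r hr
      refine (((hc r hr).mul (dy r hr)).add ((((hasDerivAt_id r).ofReal_comp.pow 2).const_mul
        w).div_const 2)).congr_deriv ?_
      have := hWc r hr
      simp only [id, ofReal_one, Nat.cast_ofNat]
      linear_combination -this
    have bcy : ∀ r, 1 ≤ r → ‖c r * y r‖ ≤ C * B₁ := by
      intro r hr
      have hr0 : 0 < r := by linarith
      rw [hy, norm_mul, norm_mul, norm_real, Real.norm_of_nonneg hr0.le]
      calc _ ≤ (C * r ^ N) * (r * ‖besselK ν (k * r)‖) := by gcongr; exact hgr r hr
        _ = C * (r ^ (N + 1) * ‖besselK ν (k * r)‖) := by ring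
        _ ≤ _ := by gcongr; exact b₁ r hr
    have bcy' : ∀ r, 1 ≤ r → ‖2 * (c r * y' r)‖ ≤ 2 * (C * (B₀ + k * B₂)) := by
      intro r hr
      have hr0 : 0 < r := by linarith
      have h1 : ‖y' r‖ ≤ ‖besselK ν (k * r)‖ + k * r * ‖besselDer 1 ν (k * r)‖ := by
        refine (norm_sub_le _ _).trans_eq ?_
        rw [norm_mul, norm_mul, norm_real, norm_real, Real.norm_of_nonneg hr0.le,
          Real.norm_of_nonneg hk.le]
      rw [norm_mul, norm_mul, Complex.norm_ofNat]
      calc _ ≤ 2 * ((C * r ^ N) * (‖besselK ν (k * r)‖ + k * r * ‖besselDer 1 ν (k * r)‖)) := by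
            gcongr; exact hgr r hr
        _ = 2 * (C * (r ^ N * ‖besselK ν (k * r)‖ + k * (r ^ (N + 1) * ‖besselDer 1 ν (k * r)‖))) := by
            ring
        _ ≤ _ := by gcongr; exacts [b₀ r hr, b₂ r hr]
    set M := 2 * (C * (B₀ + k * B₂)) with hM
    have hM0 : 0 ≤ M := by positivity
    have hbound : ∀ r : ℝ, 1 ≤ r → ‖w‖ * r ^ 2 / 2 ≤ C * B₁ + ‖Φ 1‖ + M * r := by
      intro r hr
      have h1 := (convex_Ici (1 : ℝ)).norm_image_sub_le_of_norm_hasDerivWithin_le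
        (fun x (hx : 1 ≤ x) => (dΦ x (one_pos.trans_le hx)).hasDerivWithinAt) bcy'
        (mem_Ici.2 le_rfl) (mem_Ici.2 hr)
      rw [Real.norm_of_nonneg (by linarith : (0 : ℝ) ≤ r - 1)] at h1
      have h2 : ‖Φ r‖ ≤ ‖Φ 1‖ + M * r := by
        have := norm_sub_norm_le (Φ r) (Φ 1)
        nlinarith
      have h3 : ‖w * (r : ℂ) ^ 2 / 2‖ ≤ ‖Φ r‖ + ‖c r * y r‖ := by
        have : w * (r : ℂ) ^ 2 / 2 = Φ r - c r * y r := by rw [hΦ]; ring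
        rw [this]; exact norm_sub_le _ _
      rw [norm_div, norm_mul, norm_pow, norm_real, Complex.norm_ofNat, Real.norm_eq_abs,
        sq_abs] at h3
      have := bcy r hr
      linarith
    by_contra hne
    have hn : 0 < ‖w‖ := norm_pos_iff.2 hne
    set A := C * B₁ + ‖Φ 1‖ + M with hA
    have hA0 : 0 ≤ A := by positivity
    have h1 := hbound (1 + 2 * A / ‖w‖) (by linarith [show 0 ≤ 2 * A / ‖w‖ by positivity])
    set R := 1 + 2 * A / ‖w‖ with hR
    have hR1 : 1 ≤ R := by rw [hR]; linarith [show 0 ≤ 2 * A / ‖w‖ by positivity]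
    have h2 : ‖w‖ * R = ‖w‖ + 2 * A := by rw [hR]; field_simp
    have h3 : C * B₁ + ‖Φ 1‖ + M * R ≤ A * R := by
      have : 0 ≤ C * B₁ + ‖Φ 1‖ := by positivity
      nlinarith
    nlinarith
  obtain ⟨X, hX, hK⟩ := exists_besselK_ne_zero ν
  set r₀ := X / k with hr₀
  have hr₀' : 0 < r₀ := by positivity
  have hy0 : y r₀ ≠ 0 := by
    refine mul_ne_zero (by exact_mod_cast hr₀'.ne') ?_
    rwa [hr₀, mul_div_cancel₀ _ hk.ne']
  refine ⟨c r₀ / y r₀, fun r hr => sub_eq_zero.1 ?_⟩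
  refine radial_unique (c := fun r => c r - c r₀ / y r₀ * y r)
    (c' := fun r => c' r - c r₀ / y r₀ * y' r) (lam := 1 - ν ^ 2) (k := k) hr₀'
    (fun r hr => (hc r hr).sub ((dy r hr).const_mul _))
    (fun r hr => ((dc' r hr).sub ((dy' r hr).const_mul _)).congr_deriv (by ring)) ?_ ?_ hr
  · rw [div_mul_cancel₀ _ hy0, sub_self]
  · have h := hWc r₀ hr₀'
    rw [hw0, zero_mul] at h
    field_simp
    linear_combination -h

/-! ### Derivatives of invariant functions and the coefficients of cusp forms -/

section Directional

/-- The derivative of `G` in the direction `v`. -/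
def dirDer (v : ℂ × ℝ) (G : ℂ × ℝ → ℂ) (q : ℂ × ℝ) : ℂ := fderiv ℝ G q v

lemma isOpen_upper : IsOpen {p : ℂ × ℝ | 0 < p.2} := isOpen_lt continuous_const continuous_snd

lemma contDiffOn_dirDer (v : ℂ × ℝ) {G : ℂ × ℝ → ℂ} {n : ℕ}
    (hG : ContDiffOn ℝ (n + 1 : ℕ) G {p | 0 < p.2}) :
    ContDiffOn ℝ n (dirDer v G) {p | 0 < p.2} :=
  (hG.fderiv_of_isOpen isOpen_upper (by norm_cast)).clm_apply contDiffOn_const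

lemma hasDerivAt_line {G : ℂ × ℝ → ℂ} (hG : ContDiffOn ℝ (1 : ℕ) G {p | 0 < p.2}) (q v : ℂ × ℝ)
    {x : ℝ} (hx : 0 < (q + x • v).2) :
    HasDerivAt (fun x : ℝ => G (q + x • v)) (dirDer v G (q + x • v)) x := by
  have h1 : DifferentiableAt ℝ G (q + x • v) :=
    (hG.contDiffAt (isOpen_upper.mem_nhds hx)).differentiableAt (by norm_num)
  have h2 : HasDerivAt (fun x : ℝ => q + x • v) v x := by
    simpa using ((hasDerivAt_id x).smul_const v).const_add q
  exact h1.hasFDerivAt.comp_hasDerivAt x h2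

lemma iteratedDeriv_two_line {G : ℂ × ℝ → ℂ} (hG : ContDiffOn ℝ (2 : ℕ) G {p | 0 < p.2})
    (q v : ℂ × ℝ) {x : ℝ} (hx : 0 < (q + x • v).2) :
    deriv (fun x : ℝ => G (q + x • v)) x = dirDer v G (q + x • v) ∧
    iteratedDeriv 2 (fun x : ℝ => G (q + x • v)) x = dirDer v (dirDer v G) (q + x • v) := by
  have h1 : ContDiffOn ℝ (1 : ℕ) G {p | 0 < p.2} := hG.of_le (by norm_cast)
  have hev : ∀ᶠ y : ℝ in 𝓝 x, 0 < (q + y • v).2 :=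
    (isOpen_upper.preimage (f := fun y : ℝ => q + y • v) (by fun_prop)).mem_nhds hx
  refine ⟨(hasDerivAt_line h1 q v hx).deriv, ?_⟩
  rw [iteratedDeriv_succ, iteratedDeriv_one]
  have h2 : deriv (fun x : ℝ => G (q + x • v)) =ᶠ[𝓝 x] fun y => dirDer v G (q + y • v) := by
    filter_upwards [hev] with y hy
    exact (hasDerivAt_line h1 q v hy).deriv
  rw [h2.deriv_eq]
  exact (hasDerivAt_line (contDiffOn_dirDer v (n := 1) hG) q v hx).deriv

/-- Differentiation under an integral over the unit box. -/
lemma hasDerivAt_integral_line {ι : Type*} [Fintype ι] {G : ℂ × ℝ → ℂ}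
    (hG : ContDiffOn ℝ (1 : ℕ) G {p | 0 < p.2}) {q : (ι → ℝ) → ℂ × ℝ} (hq : Continuous q)
    (v : ℂ × ℝ) {χ : (ι → ℝ) → ℂ} (hχ : Continuous χ) {T : Set ℝ} (hT : IsOpen T)
    (hpos : ∀ τ ∈ T, ∀ x, 0 < (q x + τ • v).2) {τ : ℝ} (hτ : τ ∈ T) :
    HasDerivAt (fun τ : ℝ => ∫ x in Icc (0 : ι → ℝ) 1, G (q x + τ • v) * χ x)
      (∫ x in Icc (0 : ι → ℝ) 1, dirDer v G (q x + τ • v) * χ x) τ := by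
  have hcG := hG.continuousOn
  have hcD := (contDiffOn_dirDer v (n := 0) hG).continuousOn
  have hline : Continuous fun p : ℝ × (ι → ℝ) => q p.2 + p.1 • v := by fun_prop
  have hcont : ∀ {H : ℂ × ℝ → ℂ}, ContinuousOn H {p | 0 < p.2} → ∀ τ ∈ T,
      Continuous fun x => H (q x + τ • v) * χ x := fun hH τ hτ =>
    (hH.comp_continuous (by fun_prop) (hpos τ hτ)).mul hχ
  obtain ⟨ε, hε, hball⟩ := Metric.isOpen_iff.1 hT τ hτ
  have hcl : Metric.closedBall τ (ε / 2) ⊆ T :=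
    (Metric.closedBall_subset_ball (by linarith)).trans hball
  obtain ⟨M, hM⟩ := ((isCompact_closedBall τ (ε / 2)).prod
      (isCompact_Icc (a := (0 : ι → ℝ)) (b := 1))).exists_bound_of_continuousOn
    (f := fun p : ℝ × (ι → ℝ) => dirDer v G (q p.2 + p.1 • v) * χ p.2)
    ((hcD.comp hline.continuousOn fun p hp => hpos p.1 (hcl hp.1) p.2).mul
      (hχ.comp continuous_snd).continuousOn)
  refine (hasDerivAt_integral_of_dominated_loc_of_deriv_le (bound := fun _ => M)
    (F' := fun τ x => dirDer v G (q x + τ • v) * χ x)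
    (Metric.closedBall_mem_nhds τ (half_pos hε)) ?_ ?_ ?_ ?_ ?_ ?_).2
  · filter_upwards [hT.mem_nhds hτ] with t ht
    exact (hcont hcG t ht).aestronglyMeasurable
  · exact (hcont hcG τ hτ).integrableOn_Icc
  · exact (hcont hcD τ hτ).aestronglyMeasurable
  · exact ae_restrict_of_forall_mem measurableSet_Icc fun x hx t ht =>
      hM (t, x) ⟨ht, hx⟩
  · exact integrableOn_const isCompact_Icc.measure_lt_top.ne
  · exact .of_forall fun x t ht =>
      (hasDerivAt_line hG (q x) v (hpos t (hcl ht) x)).mul_const _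

lemma lap_eq {f : H3 → ℂ} (hf : ContDiffOn ℝ (2 : ℕ) (coord f) {p | 0 < p.2}) (P : H3) :
    lap f P
    = (P.r : ℂ) ^ 2
    * (dirDer (1, 0) (dirDer (1, 0) (coord f)) P.1 + dirDer (I, 0) (dirDer (I, 0) (coord f)) P.1
    + dirDer (0, 1) (dirDer (0, 1) (coord f)) P.1) - P.r * dirDer (0, 1) (coord f) P.1 := by
  have key : ∀ (q v : ℂ × ℝ) (x : ℝ) (φ : ℝ → ℂ × ℝ), (φ = fun x => q + x • v) → φ x = P.1 →
      deriv (fun x => coord f (φ x)) x = dirDer v (coord f) P.1 ∧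
      iteratedDeriv 2 (fun x => coord f (φ x)) x = dirDer v (dirDer v (coord f)) P.1 := by
    rintro q v x φ rfl h
    rw [← h]
    exact iteratedDeriv_two_line hf q v (by rw [show q + x • v = P.1 from h]; exact P.2)
  have ex := key ((⟨0, P.z.im⟩ : ℂ), P.r) (1, 0) P.z.re (fun x => (⟨x, P.z.im⟩, P.r))
    (funext fun x => Prod.ext (Complex.ext (by simp) (by simp)) (by simp)) rfl
  have ey := key ((⟨P.z.re, 0⟩ : ℂ), P.r) (I, 0) P.z.im (fun y => (⟨P.z.re, y⟩, P.r))
    (funext fun x => Prod.ext (Complex.ext (by simp) (by simp)) (by simp)) rfl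
  have er := key (P.z, 0) (0, 1) P.r (fun r => (P.z, r)) (by ext x <;> simp) rfl
  rw [lap, ex.2, ey.2, er.1, er.2]

lemma integral_combination {X : Type*} [MeasurableSpace X] {m : Measure X} {A B C D E : X → ℂ}
    (hA : Integrable A m) (hB : Integrable B m) (hC : Integrable C m) (hD : Integrable D m)
    (hE : Integrable E m) (a b c : ℂ) :
    ∫ x, (a * (A x + B x + C x) - b * D x + c * E x) ∂m
    = a * ((∫ x, A x ∂m) + (∫ x, B x ∂m) + ∫ x, C x ∂m) - b * (∫ x, D x ∂m) + c * ∫ x, E x ∂m := by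
  have h1 : Integrable (fun x => A x + B x) m := hA.add hB
  have h2 : Integrable (fun x => A x + B x + C x) m := h1.add hC
  rw [integral_add (f := fun x => a * (A x + B x + C x) - b * D x)
    ((h2.const_mul a).sub (hD.const_mul b)) (hE.const_mul c),
    integral_sub (h2.const_mul a) (hD.const_mul b), integral_const_mul, integral_const_mul,
    integral_const_mul, integral_add h1 hC, integral_add hA hB]

end Directional

section CuspForm

variable {K : Type*} [Field K] [NumberField K] [IsTotallyComplex K]
variable (σ : K →+* ℂ)
  [hdeg : Fact (Module.finrank ℚ K = 2)] [IsPrincipalIdealRing (𝓞 K)]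

lemma chr_smul (w v : ℂ) (τ : ℝ) :
    chr w (τ • v) = Complex.exp (2 * Real.pi * I * ((conj w * v).re : ℝ) * τ) := by
  rw [chr, mul_smul_comm, smul_re, smul_eq_mul]
  push_cast
  ring_nf

/-- Under a Fourier coefficient, a second derivative along the boundary plane is multiplication
by a constant. -/
lemma integral_dirDer_two {σ : K →+* ℂ} {f : H3 → ℂ} (hf : ∀ γ ∈ Gam σ, ∀ P, f (γ P) = f P)
    (hd : ContDiffOn ℝ (2 : ℕ) (coord f) {p | 0 < p.2}) (μ : 𝓞 K) {r : ℝ} (hr : 0 < r) (v : ℂ) :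
    ∫ x in Icc (0 : Idx K → ℝ) 1,
        dirDer (v, 0) (dirDer (v, 0) (coord f)) (par σ x, r) * chr (dualFreq σ μ) (-par σ x)
      = -(4 * Real.pi ^ 2 * ((conj (dualFreq σ μ) * v).re : ℂ) ^ 2) * coeffAt σ f μ r := by
  set χ : (Idx K → ℝ) → ℂ := fun x =>
    chr (dualFreq σ μ) (-par σ x) with hχ
  set a : ℂ := 2 * Real.pi * I * ((conj (dualFreq σ μ) * v).re : ℝ) with ha
  have hχc : Continuous χ := (continuous_chr _).comp (by fun_prop)
  have hq : Continuous fun x => (par σ x, r) := by fun_prop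
  have hpos : ∀ τ ∈ (univ : Set ℝ), ∀ x, 0 < ((par σ x, r) + τ • ((v, 0) : ℂ × ℝ)).2 := by
    intro τ _ x; simpa using hr
  have d1 := fun τ : ℝ => hasDerivAt_integral_line (hd.of_le (by norm_cast)) hq (v, 0) hχc
    isOpen_univ hpos (mem_univ τ)
  have d2 := hasDerivAt_integral_line (contDiffOn_dirDer (v, 0) (n := 1) hd) hq (v, 0) hχc
    isOpen_univ hpos (mem_univ 0)
  have hE : ∀ (τ : ℝ), HasDerivAt (fun τ : ℝ => Complex.exp (a * τ)) (a * Complex.exp (a * τ)) τ := by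
    intro τ
    have h := ((hasDerivAt_id τ).ofReal_comp.const_mul a).cexp
    exact h.congr_deriv (by simp [mul_comm])
  have e0 : (fun τ : ℝ => ∫ x in Icc (0 : Idx K → ℝ) 1,
      coord f ((par σ x, r) + τ • ((v, 0) : ℂ × ℝ)) * χ x)
      = fun τ : ℝ => Complex.exp (a * τ) * coeffAt σ f μ r := by
    funext τ
    have hper : Periodic σ (fun z => coord f (z, r) * chr (dualFreq σ μ) (-z)) := by
      intro z b
      have h1 := periodic_of_invariant hf r z b
      simp only at h1
      simp only [chr_neg, chr_dualFreq_add_emb, h1]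
    rw [coeffAt, planeCoeff, ← integral_box_translate hper (τ • v), ha, ← chr_smul,
      ← integral_const_mul]
    refine integral_congr_ae (.of_forall fun x => ?_)
    have h2 := chr_mul_chr_neg (dualFreq σ μ) (τ • v)
    simp only [hχ, neg_add, chr_add, Prod.smul_mk, Prod.mk_add_mk, smul_zero, add_zero]
    linear_combination (-coord f (par σ x + τ • v, r) * chr (dualFreq σ μ) (-par σ x)) * h2
  rw [e0] at d1
  have e1 : (fun τ : ℝ => ∫ x in Icc (0 : Idx K → ℝ) 1,
      dirDer (v, 0) (coord f) ((par σ x, r) + τ • ((v, 0) : ℂ × ℝ)) * χ x)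
      = fun τ : ℝ => a * Complex.exp (a * τ) * coeffAt σ f μ r :=
    funext fun τ => (d1 τ).unique ((hE τ).mul_const _)
  rw [e1] at d2
  have e2 := d2.unique (((hE 0).const_mul a).mul_const _)
  simp only [zero_smul, add_zero, ofReal_zero, mul_zero, Complex.exp_zero, mul_one] at e2
  rw [e2, ha]
  linear_combination (4 * Real.pi ^ 2 * ((conj (dualFreq σ μ) * v).re : ℂ) ^ 2
    * coeffAt σ f μ r) * I_sq

variable {σ} {f : H3 → ℂ} {t : ℂ} {lam : 𝓞 K → ℂ}

/-- The non-zero Fourier coefficients of a cusp form are multiples of `r K_{it}(2 π |μ̃| r)`. -/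
theorem IsHeckeMaassCuspForm.exists_coeffAt (hf : IsHeckeMaassCuspForm σ f t lam) {μ : 𝓞 K}
    (hμ : μ ≠ 0) : ∃ a : ℂ, ∀ r : ℝ, 0 < r →
      coeffAt σ f μ r = a * (r * besselK (I * t) (2 * Real.pi * ‖dualFreq σ μ‖ * r)) := by
  have hd : ContDiffOn ℝ (2 : ℕ) (coord f) {p | 0 < p.2} := hf.contDiffOn
  have hd1 : ContDiffOn ℝ (1 : ℕ) (coord f) {p | 0 < p.2} := hd.of_le (by norm_cast)
  have hr1 := contDiffOn_dirDer (0, 1) (n := 1) hd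
  set χ : (Idx K → ℝ) → ℂ := fun x =>
    chr (dualFreq σ μ) (-par σ x) with hχ
  have hχc : Continuous χ := (continuous_chr _).comp (by fun_prop)
  have hk : 0 < 2 * Real.pi * ‖dualFreq σ μ‖ := by
    have h1 := sqrtDisc_pos K
    have h2 := norm_emb_pos σ hμ
    rw [norm_dualFreq]
    positivity
  have hq : Continuous fun x => (par σ x, (0 : ℝ)) := by fun_prop
  have hpos : ∀ τ ∈ Ioi (0 : ℝ), ∀ x, 0 < ((par σ x, (0 : ℝ)) + τ • ((0, 1) : ℂ × ℝ)).2 := by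
    intro τ hτ x; simpa using hτ
  have hpt : ∀ (τ : ℝ) x, (par σ x, (0 : ℝ)) + τ • ((0, 1) : ℂ × ℝ) = (par σ x, τ) := by
    intro τ x; simp
  have d1 := fun (τ : ℝ) (hτ : 0 < τ) =>
    hasDerivAt_integral_line hd1 hq (0, 1) hχc isOpen_Ioi hpos (τ := τ) hτ
  have d2 := fun (τ : ℝ) (hτ : 0 < τ) =>
    hasDerivAt_integral_line hr1 hq (0, 1) hχc isOpen_Ioi hpos (τ := τ) hτ
  simp only [hpt] at d1 d2
  obtain ⟨C, N, hgr⟩ := hf.growth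
  refine eq_besselK_of_radial (I * t) hk (c := coeffAt σ f μ) d1 d2 (fun r hr => ?_) (C := C)
    (N := N) (fun r hr => ?_)
  · have hint : ∀ {H : ℂ × ℝ → ℂ}, ContinuousOn H {p | 0 < p.2} →
        IntegrableOn (fun x => H (par σ x, r) * χ x) (Icc 0 1) := fun hH =>
      ((hH.comp_continuous (f := fun x => (par σ x, r)) (by fun_prop) (fun x => hr)).mul
        hχc).integrableOn_Icc
    have c2 := fun v => hint (contDiffOn_dirDer v (n := 0) (contDiffOn_dirDer v (n := 1) hd)).continuousOn
    have c1 := hint hr1.continuousOn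
    have c0 := hint hd.continuousOn
    have hsum : ∫ x in Icc (0 : Idx K → ℝ) 1,
        ((r : ℂ) ^ 2 * (dirDer (1, 0) (dirDer (1, 0) (coord f)) (par σ x, r) * χ x
          + dirDer (I, 0) (dirDer (I, 0) (coord f)) (par σ x, r) * χ x
          + dirDer (0, 1) (dirDer (0, 1) (coord f)) (par σ x, r) * χ x)
        - r * (dirDer (0, 1) (coord f) (par σ x, r) * χ x)
        + (1 - (I * t) ^ 2) * (coord f (par σ x, r) * χ x)) = 0 := by
      refine integral_eq_zero_of_ae (.of_forall fun x => ?_)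
      have h1 := hf.eigen (Bianchi.mk (par σ x) r hr)
      rw [lap_eq hd, ← coord_mk f _ hr] at h1
      change -((r : ℂ) ^ 2 * (dirDer (1, 0) (dirDer (1, 0) (coord f)) (par σ x, r)
        + dirDer (I, 0) (dirDer (I, 0) (coord f)) (par σ x, r)
        + dirDer (0, 1) (dirDer (0, 1) (coord f)) (par σ x, r))
        - r * dirDer (0, 1) (coord f) (par σ x, r)) = _ at h1
      simp only [Pi.zero_apply]
      linear_combination -χ x * h1
    rw [integral_combination (c2 _) (c2 _) (c2 _) c1 c0, integral_dirDer_two hf.invariant hd μ hr,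
      integral_dirDer_two hf.invariant hd μ hr] at hsum
    have hc0 : coeffAt σ f μ r = ∫ x in Icc (0 : Idx K → ℝ) 1,
      coord f (par σ x, r) * χ x := rfl
    rw [← hc0] at hsum
    have hn : (‖dualFreq σ μ‖ : ℂ) ^ 2 = ((conj (dualFreq σ μ) * 1).re : ℂ) ^ 2
        + ((conj (dualFreq σ μ) * I).re : ℂ) ^ 2 := by
      rw [← ofReal_pow, Complex.sq_norm, normSq_apply]
      simp
      ring
    push_cast
    rw [mul_pow, mul_pow, hn]
    linear_combination hsum
  · exact norm_coeffAt_le (by linarith : 0 < r) (fun z => hgr (Bianchi.mk z r _) hr) μ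

lemma IsHeckeMaassCuspForm.coeffAt_eq (hf : IsHeckeMaassCuspForm σ f t lam) {μ : 𝓞 K}
    (hμ : μ ≠ 0) {r : ℝ} (hr : 0 < r) : coeffAt σ f μ r
      = rho σ f t μ * (r * besselK (I * t) (2 * Real.pi * ‖dualFreq σ μ‖ * r)) := by
  obtain ⟨a, ha⟩ := hf.exists_coeffAt hμ
  have h : ∃ a : ℂ, ∀ (r : ℝ) (hr : 0 < r), fourierCoeff σ f μ r hr
      = a * (r * besselK (I * t) (2 * Real.pi * ‖dualFreq σ μ‖ * r)) :=
    ⟨a, fun r hr => by rw [fourierCoeff_eq, ← Bianchi.coeffAt_eq, ha r hr]⟩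
  rw [rho, dif_pos h, Bianchi.coeffAt_eq _ _ _ hr, ← fourierCoeff_eq]
  exact h.choose_spec r hr

lemma IsHeckeMaassCuspForm.coeffAt_zero (hf : IsHeckeMaassCuspForm σ f t lam) {r : ℝ}
    (hr : 0 < r) : coeffAt σ f 0 r = 0 := by
  rw [Bianchi.coeffAt_eq _ _ _ hr, ← fourierCoeff_eq]
  exact hf.cuspidal r hr

end CuspForm

/-! ### Growth and decay of cusp forms -/

section CuspForm

variable {K : Type*} [Field K] [NumberField K] [IsTotallyComplex K]
variable (σ : K →+* ℂ)
  [hdeg : Fact (Module.finrank ℚ K = 2)] [IsPrincipalIdealRing (𝓞 K)]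

namespace IsHeckeMaassCuspForm

variable {σ} {f : H3 → ℂ} {t : ℂ} {lam : 𝓞 K → ℂ}

lemma continuous (hf : IsHeckeMaassCuspForm σ f t lam) : Continuous f := by
  have h1 := continuousOn_iff_continuous_domRestrict.1 hf.contDiffOn.continuousOn
  have h2 : f = {p : ℂ × ℝ | 0 < p.2}.domRestrict (coord f) := by
    funext P
    rw [domRestrict_apply, coord, dif_pos P.2]
  rw [h2]
  exact h1

lemma cuspForm (hf : IsHeckeMaassCuspForm σ f t lam) : Cuspidal σ f (I * t) (rho σ f t) where
  cont := hf.continuous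
  inv := hf.invariant
  zero _ := hf.coeffAt_zero
  coeff _ hμ _ := hf.coeffAt_eq hμ
  growth := by
    obtain ⟨C, N, hgr⟩ := hf.growth
    obtain ⟨Z, hZ, hcell⟩ := exists_norm_le_of_mem_cell σ
    have hδ := siegelHt_pos σ
    have hcpt := (isCompact_closedBall (0 : ℂ) Z).prod (isCompact_Icc (a := siegelHt σ) (b := 1))
    obtain ⟨M, hM⟩ := hcpt.exists_bound_of_continuousOn (f := coord f)
      (hf.contDiffOn.continuousOn.mono fun p hp => hδ.trans_le hp.2.1)
    refine ⟨|C| + |M|, N, fun P hP => ?_⟩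
    have hr := P.r_pos
    have h1 : 1 ≤ (1 + P.r) ^ N := one_le_pow₀ (by linarith)
    rw [Real.rpow_natCast]
    rcases le_total P.r 1 with h | h
    · have h2 := hM P.1 ⟨mem_closedBall_zero_iff.2 (hcell _ hP.1), hP.2, h⟩
      rw [coord_val] at h2
      nlinarith [le_abs_self M, abs_nonneg C, abs_nonneg M]
    · calc _ ≤ C * P.r ^ N := hgr P h
        _ ≤ |C| * (1 + P.r) ^ N := by
          gcongr
          · exact le_abs_self C
          · linarith
        _ ≤ _ := by nlinarith [abs_nonneg M]

lemma rapidInv (hf : IsHeckeMaassCuspForm σ f t lam) : RapidInv σ f := hf.cuspForm.rapidInv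

lemma exists_rho_le (hf : IsHeckeMaassCuspForm σ f t lam) :
    ∃ C : ℝ, 0 ≤ C ∧ ∀ μ : 𝓞 K, μ ≠ 0 → ‖rho σ f t μ‖ ≤ C * ‖emb σ μ‖ := by
  obtain ⟨M, hM⟩ := hf.rapidInv.exists_bound
  simpa using hf.cuspForm.exists_norm_le le_rfl (C := M) fun P => by simpa using hM P

lemma hasSum_coeffAt (hf : IsHeckeMaassCuspForm σ f t lam) {r : ℝ} (hr : 0 < r) (z : ℂ) :
    HasSum (fun μ => coeffAt σ f μ r * chr (dualFreq σ μ) z) (f (Bianchi.mk z r hr)) :=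
  hf.cuspForm.hasSum hr z

lemma summable_coeffAt (hf : IsHeckeMaassCuspForm σ f t lam) {r : ℝ} (hr : 0 < r) :
    Summable fun μ => ‖coeffAt σ f μ r‖ := by
  obtain ⟨A, -, h⟩ := hf.cuspForm.exists_coeffAt_le hr 0
  exact .of_nonneg_of_le (fun _ => norm_nonneg _) (h r le_rfl)
    ((summable_norm_rpow σ (A := 3) (by norm_num)).mul_left _)

lemma exists_rho_ne_zero (hf : IsHeckeMaassCuspForm σ f t lam) :
    ∃ μ : 𝓞 K, μ ≠ 0 ∧ rho σ f t μ ≠ 0 := by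
  by_contra! h
  refine hf.ne_zero (funext fun P => ?_)
  have h1 := hf.hasSum_coeffAt P.r_pos P.z
  have h2 : ∀ μ, coeffAt σ f μ P.r * chr (dualFreq σ μ) P.z = 0 := by
    intro μ
    by_cases hμ : μ = 0
    · rw [hμ, hf.coeffAt_zero P.r_pos, zero_mul]
    · rw [hf.coeffAt_eq hμ P.r_pos, h μ hμ, zero_mul, zero_mul]
  simp only [h2] at h1
  exact h1.unique hasSum_zero

lemma abs_re_le_one (hf : IsHeckeMaassCuspForm σ f t lam) : |(I * t).re| ≤ 1 := by
  obtain ⟨M, hM⟩ := hf.rapidInv.exists_bound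
  obtain ⟨μ, hμ, hρ⟩ := hf.exists_rho_ne_zero
  have hκ := condR_pos K
  have hn : 0 < ‖emb σ μ‖ := norm_emb_pos σ hμ
  have hρ0 : 0 < ‖rho σ f t μ‖ := norm_pos_iff.2 hρ
  set k := 2 * condR K * ‖emb σ μ‖ with hk
  have hk0 : 0 < k := by positivity
  refine abs_re_le_one_of_besselK (C := M * k / ‖rho σ f t μ‖) fun x hx => ?_
  have hr : 0 < x / k := by positivity
  have h2 := norm_coeffAt_le (σ := σ) (f := f) hr (fun z => hM _) μ
  rw [hf.coeffAt_eq hμ hr, norm_mul, norm_mul, norm_real, Real.norm_of_nonneg hr.le,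
    two_pi_norm_dualFreq, ← hk, mul_div_cancel₀ _ hk0.ne', div_mul_eq_mul_div, ← mul_div_assoc,
    div_le_iff₀ hk0] at h2
  rw [div_div, le_div_iff₀ (by positivity)]
  linarith

end IsHeckeMaassCuspForm

end CuspForm

/-! ### Representatives of the Hecke operators -/

section Hecke

variable {K : Type*} [Field K] [NumberField K] [IsTotallyComplex K]
variable (σ : K →+* ℂ)
  [hdeg : Fact (Module.finrank ℚ K = 2)] [IsPrincipalIdealRing (𝓞 K)]

/-- A choice of normalized associates in `𝓞 K`. -/
instance : NormalizationMonoid (𝓞 K) :=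
  (UniqueFactorizationMonoid.strongNormalizationMonoid).toNormalizationMonoid

variable (K) in
/-- The normalized non-zero integers: one generator for each non-zero ideal. -/
abbrev Gen : Type _ := {a : NZ K // normalize a.1 = a.1}

lemma Gen.eq_of_associated {a b : Gen K} (h : Associated a.1.1 b.1.1) : a = b :=
  Subtype.ext (Subtype.ext (by rw [← a.2, ← b.2, normalize_eq_normalize_iff_associated.2 h]))

instance : One (Gen K) := ⟨⟨⟨1, one_ne_zero⟩, normalize_one⟩⟩

lemma Gen.eq_one {a : Gen K} (h : IsUnit a.1.1) : a = 1 :=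
  Gen.eq_of_associated (associated_one_iff_isUnit.2 h)

/-- The product `a d` of a chosen generator and a non-zero integer. -/
def genMul (p : Gen K × NZ K) : NZ K := ⟨p.1.1.1 * p.2.1, mul_ne_zero p.1.1.2 p.2.2⟩

/-- The factorizations `n = a d`, up to units. -/
abbrev Factors (n : NZ K) : Type _ := genMul ⁻¹' ({n} : Set (NZ K))

lemma Factors.mul_eq {n : NZ K} (p : Factors n) : p.1.1.1.1 * p.1.2.1 = n.1 :=
  congrArg Subtype.val p.2

instance finite_factors (n : NZ K) : Finite (Factors n) := by
  obtain ⟨σ⟩ : Nonempty (K →+* ℂ) := inferInstance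
  have := finite_fib σ n.2
  refine Finite.of_injective (fun p : Factors n => (⟨(p.1.1.1.1, p.1.2.1), p.mul_eq⟩ : Fib n.1))
    fun p q h => ?_
  have h1 := congrArg Subtype.val h
  simp only [Prod.mk.injEq] at h1
  exact Subtype.ext (Prod.ext (Subtype.ext (Subtype.ext h1.1)) (Subtype.ext h1.2))

lemma finite_quotient (d : NZ K) : Finite (𝓞 K ⧸ Ideal.span {d.1}) :=
  Ring.HasFiniteQuotients.finiteQuotient (by simpa using d.2)

/-- The integral matrix `(a, b; 0, d)` attached to a factorization `n = a d` and a class `b`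
modulo `d`. -/
def heckeMat {n : NZ K} (x : Σ p : Factors n, 𝓞 K ⧸ Ideal.span {p.1.2.1}) : MatDet n.1 :=
  ⟨!![x.1.1.1.1.1, Quotient.out x.2; 0, x.1.1.2.1], by
    rw [Matrix.det_fin_two_of, mul_zero, sub_zero]; exact x.1.mul_eq⟩

/-- The matrices `(a, b; 0, d)` represent the classes of integral matrices of determinant `n`. -/
lemma heckeMat_bijective (n : NZ K) :
    Function.Bijective
    (fun x : Σ p : Factors n,
    𝓞 K ⧸ Ideal.span {p.1.2.1} => (Quotient.mk (matSetoid n.1) (heckeMat x))) := by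
  constructor
  · rintro ⟨⟨⟨a, d⟩, h⟩, c⟩ ⟨⟨⟨a', d'⟩, h'⟩, c'⟩ hx
    obtain ⟨γ, hγ⟩ := Quotient.exact hx
    have hdet := γ.det_coe
    rw [Matrix.det_fin_two] at hdet
    have e00 := congrFun (congrFun hγ 0) 0
    have e01 := congrFun (congrFun hγ 0) 1
    have e10 := congrFun (congrFun hγ 1) 0
    have e11 := congrFun (congrFun hγ 1) 1
    simp only [heckeMat, Matrix.mul_apply, Fin.sum_univ_two, Matrix.of_apply, Matrix.cons_val',
      Matrix.cons_val_zero, Matrix.cons_val_one, Matrix.cons_val_fin_one, mul_zero, add_zero]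
      at e00 e01 e10 e11
    have h10 : γ.1 1 0 = 0 := (mul_eq_zero.1 e10.symm).resolve_right a.1.2
    rw [h10, mul_zero, sub_zero] at hdet
    have haa : a = a' := Gen.eq_of_associated
      ⟨⟨γ.1 0 0, γ.1 1 1, hdet, by rw [mul_comm]; exact hdet⟩, by rw [e00, mul_comm]⟩
    subst haa
    have h00 : γ.1 0 0 = 1 := mul_right_cancel₀ a.1.2 (by rw [← e00, one_mul])
    rw [h00, one_mul] at hdet
    rw [h10, hdet, zero_mul, zero_add, one_mul] at e11
    have hdd : d = d' := Subtype.ext e11.symm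
    subst hdd
    have hcc : c = c' := by
      rw [← Quotient.out_eq c, ← Quotient.out_eq c']
      refine (Ideal.Quotient.eq (I := Ideal.span {d.1})).2 (Ideal.mem_span_singleton.2 ⟨-γ.1 0 1, ?_⟩)
      rw [h00, one_mul] at e01
      linear_combination -e01
    rw [hcc]
  · intro q
    induction q using Quotient.inductionOn with
    | _ M =>
    have hM := M.2
    rw [Matrix.det_fin_two] at hM
    obtain ⟨g, ⟨q, u, v, huv⟩, hg⟩ := exists_gcd (⟨(M.1 0 0, M.1 1 0), fun h => n.2 (by
      simp only [Prod.mk_eq_zero] at h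
      rw [← hM, h.1, h.2, zero_mul, mul_zero, sub_zero])⟩ : Pairs K)
    obtain ⟨h0, h1⟩ : M.1 0 0 = g.1 * q.1 ∧ M.1 1 0 = g.1 * q.2 := Prod.mk.injEq _ _ _ _ ▸ hg
    obtain ⟨w, hw⟩ := associated_normalize g.1
    have hww : (w : 𝓞 K) * (w⁻¹ : (𝓞 K)ˣ) = 1 := Units.mul_inv w
    have ha0 : normalize g.1 ≠ 0 := by rw [← hw]; exact mul_ne_zero g.2 w.ne_zero
    set D := -((w⁻¹ : (𝓞 K)ˣ) : 𝓞 K) * q.2 * M.1 0 1 + (w⁻¹ : (𝓞 K)ˣ) * q.1 * M.1 1 1 with hD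
    have hn : normalize g.1 * D = n.1 := by
      rw [← hw, ← hM, h0, h1, hD]
      linear_combination (-(g.1 * q.2 * M.1 0 1) + g.1 * q.1 * M.1 1 1) * hww
    set p : Factors n := ⟨(⟨⟨_, ha0⟩, normalize_idem g.1⟩,
      ⟨D, fun h => n.2 (by rw [← hn, h, mul_zero])⟩), Subtype.ext hn⟩ with hp
    set B := w * u * M.1 0 1 + w * v * M.1 1 1 with hB
    set c : 𝓞 K ⧸ Ideal.span {D} := Ideal.Quotient.mk _ B with hc
    obtain ⟨x, hx⟩ : D ∣ Quotient.out c - B := by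
      rw [← Ideal.mem_span_singleton, ← Ideal.Quotient.eq, ← hc]
      exact Quotient.out_eq c
    refine ⟨⟨p, c⟩, (Quotient.sound (s := matSetoid n.1) (a := M) (b := heckeMat ⟨p, c⟩) ⟨⟨!![w * u - x * (w⁻¹ : (𝓞 K)ˣ) * q.2,
      w * v + x * (w⁻¹ : (𝓞 K)ˣ) * q.1; -(w⁻¹ : (𝓞 K)ˣ) * q.2, (w⁻¹ : (𝓞 K)ˣ) * q.1], ?_⟩, ?_⟩).symm⟩
    · rw [Matrix.det_fin_two_of]
      linear_combination huv + (u * q.1 + v * q.2) * hww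
    · rw [Matrix.eta_fin_two M.1]
      simp only [heckeMat, hp, Matrix.mul_fin_two]
      rw [← hw]
      refine Matrix.ext fun i j => ?_
      fin_cases i <;> fin_cases j <;> simp only [Fin.zero_eta, Fin.mk_one, Matrix.cons_val_zero,
        Matrix.cons_val_one, Matrix.cons_val', Matrix.cons_val_fin_one, Matrix.of_apply]
      · linear_combination (-(w * u) + x * (w⁻¹ : (𝓞 K)ˣ) * q.2) * h0
          - (w * v + x * (w⁻¹ : (𝓞 K)ˣ) * q.1) * h1 - w * g.1 * huv
      · linear_combination hx + x * hD - hB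
      · linear_combination ((w⁻¹ : (𝓞 K)ˣ) * q.2) * h0 - ((w⁻¹ : (𝓞 K)ˣ) * q.1) * h1
      · linear_combination hD

lemma hecke_class_eq {σ : K →+* ℂ} {f : H3 → ℂ} (hf : ∀ γ ∈ Gam σ, ∀ P, f (γ P) = f P) {n : 𝓞 K}
    (hn : n ≠ 0) (M : MatDet n) (P : H3) :
    f (toGL σ (Quotient.mk (matSetoid n) M).out.1 • P) = f (toGL σ M.1 • P) := by
  obtain ⟨γ, hγ⟩ := Quotient.mk_out (s := matSetoid n) M
  have hdet : ∀ N : MatDet n, (N.1.map (emb σ)).det ≠ 0 := by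
    intro N
    have : (N.1.map (emb σ)).det = emb σ N.1.det := (RingHom.map_det _ _).symm
    rw [this, N.2]
    exact emb_ne_zero σ hn
  have h1 : toGL σ M.1 = incl σ γ * toGL σ (Quotient.mk (matSetoid n) M).out.1 := by
    rw [toGL, dif_pos (hdet _), toGL, dif_pos (hdet _)]
    refine Units.ext ?_
    change M.1.map (emb σ) = γ.1.map (emb σ) * (Quotient.mk (matSetoid n) M).out.1.map (emb σ)
    rw [hγ, Matrix.map_mul]
  rw [h1, mul_smul]
  exact (hf _ (toGam σ γ).2 _).symm

lemma smul_upper (g : GL (Fin 2) ℂ) {a b d : ℂ} (hg : g.1 = !![a, b; 0, d]) (hd : d ≠ 0) (z : ℂ)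
    {r : ℝ} (hr : 0 < r) (hr' : 0 < ‖a‖ / ‖d‖ * r) :
    g • mk z r hr = mk ((a * z + b) / d) (‖a‖ / ‖d‖ * r) hr' := by
  change act _ _ = _
  have hcd : conj d ≠ 0 := (map_ne_zero _).2 hd
  have hnd : ‖d‖ ≠ 0 := norm_ne_zero_iff.2 hd
  refine H3.ext' ?_ ?_
  · simp only [act, mk_z, mk_r, den, hg]
    simp [normSq_eq_conj_mul_self]
    field_simp
  · simp only [act, mk_z, mk_r, den, hg]
    simp [normSq_eq_norm_sq, Matrix.det_fin_two]
    field_simp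

lemma toGL_heckeMat_smul {n : NZ K} (x : Σ p : Factors n, 𝓞 K ⧸ Ideal.span {p.1.2.1}) (z : ℂ)
    {r : ℝ} (hr : 0 < r) :
    toGL σ (heckeMat x).1 • mk z r hr
    = mk ((emb σ x.1.1.1.1.1 * z + emb σ (Quotient.out x.2)) / emb σ x.1.1.2.1)
    (‖emb σ x.1.1.1.1.1‖ / ‖emb σ x.1.1.2.1‖ * r)
    (mul_pos (div_pos (norm_emb_pos σ x.1.1.1.1.2) (norm_pos_iff.2 (emb_ne_zero σ x.1.1.2.2)))
    hr) := by
  have hd := emb_ne_zero σ x.1.1.2.2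
  have hM : (heckeMat x).1.map (emb σ)
      = !![emb σ x.1.1.1.1.1, emb σ (Quotient.out x.2); 0, emb σ x.1.1.2.1] := by
    ext i j
    fin_cases i <;> fin_cases j <;> simp [heckeMat]
  have hdet : ((heckeMat x).1.map (emb σ)).det ≠ 0 := by
    rw [hM, Matrix.det_fin_two_of, mul_zero, sub_zero]
    exact mul_ne_zero (emb_ne_zero σ x.1.1.1.1.2) hd
  rw [toGL, dif_pos hdet]
  exact smul_upper _ hM hd z hr _

end Hecke

/-! ### Hecke relations -/

section Hecke

variable {K : Type*} [Field K] [NumberField K] [IsTotallyComplex K]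
variable (σ : K →+* ℂ)
  [hdeg : Fact (Module.finrank ℚ K = 2)] [IsPrincipalIdealRing (𝓞 K)]

/-- A character `z ↦ e(⟨ν̃, z / d⟩)` that is trivial on `𝓞 K` has `d ∣ ν`. -/
lemma dvd_of_chr_eq_one {d ν : 𝓞 K} (hd : d ≠ 0)
    (h : ∀ b : 𝓞 K, chr (dualFreq σ ν) (emb σ b / emb σ d) = 1) : d ∣ ν := by
  have hd0 := emb_ne_zero σ hd
  set F : ℂ → ℂ := fun z => chr (dualFreq σ ν) (z / emb σ d) with hF
  have hper : Periodic σ F := by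
    intro z b
    simp only [hF, add_div, chr_add, h, mul_one]
  have hc : Continuous F := (continuous_chr _).comp (by fun_prop)
  -- some Fourier coefficient of `F` does not vanish
  obtain ⟨κ, hκ⟩ : ∃ κ, planeCoeff σ F κ ≠ 0 := by
    by_contra! h0
    have h1 := hasSum_planeCoeff hper hc (by simpa only [funext h0] using summable_zero) 0
    simp only [h0, zero_mul] at h1
    have h2 : F 0 = 0 := h1.unique hasSum_zero
    simp [hF, chr] at h2
  have hper2 : Periodic σ (fun z => F z * chr (dualFreq σ κ) (-z)) := by
    intro z b
    simp only [chr_neg, chr_dualFreq_add_emb, hper z b]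
  have key : ∀ z, F z * chr (dualFreq σ κ) (-z) = 1 := by
    intro w
    have h1 := integral_box_translate hper2 w
    have h2 : ∀ x, F (par σ x + w) * chr (dualFreq σ κ) (-(par σ x + w))
        = (F w * chr (dualFreq σ κ) (-w)) * (F (par σ x) * chr (dualFreq σ κ) (-par σ x)) := by
      intro x
      simp only [hF, add_div, chr_add, neg_add]
      ring
    simp only [h2] at h1
    rw [integral_const_mul] at h1
    exact mul_right_cancel₀ hκ (h1.trans (one_mul _).symm)
  refine ⟨κ, ?_⟩
  classical
  have h3 := integral_box_chr σ (ν - d * κ)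
  have h4 : ∀ x, chr (dualFreq σ (ν - d * κ)) (par σ x) = 1 := by
    intro x
    have h5 := key (emb σ d * par σ x)
    simp only [hF] at h5
    rw [mul_div_cancel_left₀ _ hd0, chr_neg, ← chr_dualFreq_mul, ← chr_neg_left, ← dualFreq_neg,
      ← chr_add_left, ← dualFreq_add, mul_comm κ d, ← sub_eq_add_neg] at h5
    exact h5
  simp only [h4] at h3
  by_contra hne
  rw [if_neg (sub_ne_zero.2 hne)] at h3
  have h6 := volume_box (ι := Idx K)
  simp [h6] at h3

/-- Orthogonality: the sum of `e(⟨ν̃, c / d⟩)` over the classes `c` modulo `d`. -/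
lemma sum_chr_quotient (d : NZ K) [Fintype (𝓞 K ⧸ Ideal.span {d.1}) ] (ν : 𝓞 K) :
    (d.1 ∣ ν → ∑ c : 𝓞 K ⧸ Ideal.span {d.1}, chr (dualFreq σ ν) (emb σ (Quotient.out c) / emb σ d.1)
    = (‖emb σ d.1‖ : ℂ) ^ 2)
    ∧ (¬ d.1 ∣ ν → ∑ c : 𝓞 K ⧸ Ideal.span {d.1},
    chr (dualFreq σ ν) (emb σ (Quotient.out c) / emb σ d.1) = 0) := by
  have hd0 := emb_ne_zero σ d.2
  constructor
  · rintro ⟨κ, rfl⟩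
    have h1 : ∀ b : 𝓞 K, chr (dualFreq σ (d.1 * κ)) (emb σ b / emb σ d.1) = 1 := by
      intro b
      rw [mul_comm, chr_dualFreq_mul, mul_div_cancel₀ _ hd0, chr_dualFreq_emb]
    simp only [h1, Finset.sum_const, Finset.card_univ, nsmul_eq_mul, mul_one]
    rw [← ofReal_pow, norm_emb_sq, Ideal.absNorm_apply, Submodule.cardQuot_apply,
      ← Nat.card_eq_fintype_card, ofReal_natCast]
  · intro hdν
    obtain ⟨b, hb⟩ : ∃ b : 𝓞 K, chr (dualFreq σ ν) (emb σ b / emb σ d.1) ≠ 1 := by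
      by_contra! h
      exact hdν (dvd_of_chr_eq_one σ d.2 h)
    have hwd : ∀ x : 𝓞 K, chr (dualFreq σ ν) (emb σ (Quotient.out
        (Ideal.Quotient.mk (Ideal.span {d.1}) x)) / emb σ d.1)
        = chr (dualFreq σ ν) (emb σ x / emb σ d.1) := by
      intro x
      obtain ⟨y, hy⟩ : d.1 ∣ Quotient.out (Ideal.Quotient.mk (Ideal.span {d.1}) x) - x := by
        rw [← Ideal.mem_span_singleton, ← Ideal.Quotient.eq]
        exact Quotient.out_eq _
      rw [sub_eq_iff_eq_add'.1 hy, map_add, map_mul, add_div, mul_div_cancel_left₀ _ hd0,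
        chr_dualFreq_add_emb]
    set S := ∑ c : 𝓞 K ⧸ Ideal.span {d.1}, chr (dualFreq σ ν) (emb σ (Quotient.out c) / emb σ d.1)
      with hS
    have h1 : S = chr (dualFreq σ ν) (emb σ b / emb σ d.1) * S := by
      rw [hS, Finset.mul_sum]
      refine Fintype.sum_equiv (Equiv.subRight (Ideal.Quotient.mk _ b)) _ _ fun c => ?_
      obtain ⟨x, rfl⟩ := Ideal.Quotient.mk_surjective c
      rw [Equiv.subRight_apply, ← map_sub, hwd, hwd, ← chr_add, ← add_div, ← map_add,
        add_sub_cancel]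
    have h2 : (1 - chr (dualFreq σ ν) (emb σ b / emb σ d.1)) * S = 0 := by linear_combination h1
    exact (mul_eq_zero.1 h2).resolve_left (sub_ne_zero.2 hb.symm)

lemma mul_injective_of_ne_zero (a : NZ K) : Function.Injective (fun ν : 𝓞 K => a.1 * ν) :=
  mul_right_injective₀ a.2

namespace IsHeckeMaassCuspForm

variable {σ} {f : H3 → ℂ} {t : ℂ} {lam : 𝓞 K → ℂ}

/-- The Fourier expansion of the part of `T_n f` belonging to a factorization `n = a d`. -/
lemma hasSum_heckeMat (hf : IsHeckeMaassCuspForm σ f t lam) {n : NZ K} (p : Factors n)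
    [Fintype (𝓞 K ⧸ Ideal.span {p.1.2.1})] {r : ℝ} (hr : 0 < r) (z : ℂ) :
    HasSum
    (fun μ => Function.extend (fun ν => p.1.1.1.1 * ν)
    (fun ν => (‖emb σ p.1.2.1‖ : ℂ) ^ 2
    * coeffAt σ f (p.1.2.1 * ν) (‖emb σ p.1.1.1.1‖ / ‖emb σ p.1.2.1‖ * r)) 0 μ
    * chr (dualFreq σ μ) z)
    (∑ c : 𝓞 K ⧸ Ideal.span {p.1.2.1}, f (toGL σ (heckeMat ⟨p, c⟩).1 • Bianchi.mk z r hr)) := by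
  have hd0 := emb_ne_zero σ p.1.2.2
  set r' := ‖emb σ p.1.1.1.1‖ / ‖emb σ p.1.2.1‖ * r with hr'
  have h1 := hasSum_sum (s := Finset.univ) fun (c : 𝓞 K ⧸ Ideal.span {p.1.2.1}) _ =>
    hf.hasSum_coeffAt (mul_pos (div_pos (norm_emb_pos σ p.1.1.1.2)
      (norm_pos_iff.2 hd0)) hr) ((emb σ p.1.1.1.1 * z + emb σ (Quotient.out c)) / emb σ p.1.2.1)
  simp only [← toGL_heckeMat_smul σ ⟨p, _⟩ z hr] at h1
  have h2 : ∀ ν, ∑ c : 𝓞 K ⧸ Ideal.span {p.1.2.1}, coeffAt σ f ν r' * chr (dualFreq σ ν)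
      ((emb σ p.1.1.1.1 * z + emb σ (Quotient.out c)) / emb σ p.1.2.1)
      = coeffAt σ f ν r' * chr (dualFreq σ ν) (emb σ p.1.1.1.1 * z / emb σ p.1.2.1)
        * ∑ c : 𝓞 K ⧸ Ideal.span {p.1.2.1},
          chr (dualFreq σ ν) (emb σ (Quotient.out c) / emb σ p.1.2.1) := by
    intro ν
    rw [Finset.mul_sum]
    refine Finset.sum_congr rfl fun c _ => ?_
    rw [add_div, chr_add, mul_assoc]
  simp only [← hr', h2] at h1
  rw [← (mul_injective_of_ne_zero p.1.2).hasSum_iff fun ν hν => by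
    rw [(sum_chr_quotient σ p.1.2 ν).2 fun ⟨κ, hκ⟩ => hν ⟨κ, hκ.symm⟩, mul_zero]] at h1
  rw [← (mul_injective_of_ne_zero p.1.1.1).hasSum_iff fun μ hμ => by
    rw [Function.extend_apply' _ _ _ (by simpa using hμ), Pi.zero_apply, zero_mul]]
  refine h1.congr_fun fun ν => ?_
  simp only [Function.comp_apply]
  rw [(mul_injective_of_ne_zero p.1.1.1).extend_apply,
    (sum_chr_quotient σ p.1.2 _).1 (Dvd.intro ν rfl), mul_comm p.1.1.1.1 ν, chr_dualFreq_mul σ ν,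
    mul_comm p.1.2.1 ν, chr_dualFreq_mul σ ν p.1.2.1, mul_div_cancel₀ _ hd0]
  ring

/-- The Hecke relations `λ(n) ρ(μ) = ∑ ρ(n μ / a²)`, the sum over the common divisors `(a)`. -/
theorem hecke_rho (hf : IsHeckeMaassCuspForm σ f t lam) (n : NZ K) {μ : 𝓞 K} (hμ : μ ≠ 0) :
    lam n.1 * rho σ f t μ = ∑' p : Factors n,
      Function.extend (fun ν => p.1.1.1.1 * ν) (fun ν => rho σ f t (p.1.2.1 * ν)) 0 μ := by
  have := Fintype.ofFinite (Factors n)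
  have hfin : ∀ p : Factors n, Fintype (𝓞 K ⧸ Ideal.span {p.1.2.1}) := fun p =>
    haveI := finite_quotient p.1.2
    Fintype.ofFinite _
  have hκ := condR_pos K
  obtain ⟨X, hX, hK⟩ := exists_besselK_ne_zero (I * t)
  have hμ0 : 0 < ‖emb σ μ‖ := norm_emb_pos σ hμ
  have hk : 0 < 2 * condR K * ‖emb σ μ‖ := by positivity
  set r := X / (2 * condR K * ‖emb σ μ‖) with hr
  have hr0 : 0 < r := by positivity
  have hKr : besselK (I * t) (2 * condR K * ‖emb σ μ‖ * r) ≠ 0 := by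
    rw [hr, mul_div_cancel₀ _ hk.ne']; exact hK
  have hn0 : (‖emb σ n.1‖ : ℂ) ≠ 0 := by
    exact_mod_cast norm_ne_zero_iff.2 (emb_ne_zero σ n.2)
  have hexp : ∀ z, HasSum (fun μ => (∑ p : Factors n, Function.extend (fun ν => p.1.1.1.1 * ν)
      (fun ν => (‖emb σ p.1.2.1‖ : ℂ) ^ 2
        * coeffAt σ f (p.1.2.1 * ν) (‖emb σ p.1.1.1.1‖ / ‖emb σ p.1.2.1‖ * r)) 0 μ)
        * chr (dualFreq σ μ) z) (‖emb σ n.1‖ * (lam n.1 * f (Bianchi.mk z r hr0))) := by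
    intro z
    have h1 := hf.hecke_eigen n.1 n.2 (Bianchi.mk z r hr0)
    rw [hecke, ← finsum_comp_equiv (Equiv.ofBijective _ (heckeMat_bijective n)),
      finsum_eq_sum_of_fintype, Fintype.sum_sigma] at h1
    simp only [Equiv.ofBijective_apply, hecke_class_eq hf.invariant n.2] at h1
    rw [← h1, mul_inv_cancel_left₀ hn0]
    simp only [Finset.sum_mul]
    exact hasSum_sum fun p _ => hf.hasSum_heckeMat p hr0 z
  have hsum : Summable fun μ => ∑ p : Factors n, Function.extend (fun ν => p.1.1.1.1 * ν)
      (fun ν => (‖emb σ p.1.2.1‖ : ℂ) ^ 2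
        * coeffAt σ f (p.1.2.1 * ν) (‖emb σ p.1.1.1.1‖ / ‖emb σ p.1.2.1‖ * r)) 0 μ := by
    refine (hexp 0).summable.congr fun μ => ?_
    simp [chr]
  have h1 := planeCoeff_tsum hsum (fun z => (hexp z).tsum_eq.symm) μ
  have h2 : planeCoeff σ (fun z => ‖emb σ n.1‖ * (lam n.1 * f (Bianchi.mk z r hr0))) μ
      = ‖emb σ n.1‖ * (lam n.1 * coeffAt σ f μ r) := by
    rw [Bianchi.coeffAt_eq _ _ _ hr0, planeCoeff, planeCoeff, ← integral_const_mul,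
      ← integral_const_mul]
    exact integral_congr_ae (.of_forall fun x => by ring)
  rw [h2, hf.coeffAt_eq hμ hr0, two_pi_norm_dualFreq] at h1
  refine mul_left_cancel₀ (mul_ne_zero hn0 (mul_ne_zero (ofReal_ne_zero.2 hr0.ne') hKr)) ?_
  rw [tsum_fintype, Finset.mul_sum]
  refine Eq.trans (by ring) (h1.trans (Finset.sum_congr rfl fun p _ => ?_))
  by_cases hp : ∃ ν, p.1.1.1.1 * ν = μ
  · obtain ⟨ν, rfl⟩ := hp
    have hν : ν ≠ 0 := right_ne_zero_of_mul hμ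
    have ha := norm_emb_pos σ p.1.1.1.2
    have hd := norm_emb_pos σ p.1.2.2
    rw [(mul_injective_of_ne_zero p.1.1.1).extend_apply,
      (mul_injective_of_ne_zero p.1.1.1).extend_apply,
      hf.coeffAt_eq (mul_ne_zero p.1.2.2 hν) (by positivity), two_pi_norm_dualFreq, ← p.mul_eq]
    have e : 2 * condR K * ‖emb σ (p.1.2.1 * ν)‖ * (‖emb σ p.1.1.1.1‖ / ‖emb σ p.1.2.1‖ * r)
        = 2 * condR K * ‖emb σ (p.1.1.1.1 * ν)‖ * r := by
      rw [map_mul, map_mul, norm_mul, norm_mul]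
      field_simp
    have hd' : (‖emb σ p.1.2.1‖ : ℂ) ≠ 0 := by exact_mod_cast hd.ne'
    rw [e]
    simp only [map_mul, norm_mul]
    push_cast
    field_simp
  · rw [Function.extend_apply' _ _ _ hp, Function.extend_apply' _ _ _ hp, Pi.zero_apply,
      mul_zero]

lemma rho_eq (hf : IsHeckeMaassCuspForm σ f t lam) {n : 𝓞 K} (hn : n ≠ 0) :
    rho σ f t n = lam n * rho σ f t 1 := by
  rw [hf.hecke_rho ⟨n, hn⟩ one_ne_zero, tsum_eq_single (⟨(1, ⟨n, hn⟩), Subtype.ext (one_mul n)⟩)]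
  · have := (mul_injective_of_ne_zero (1 : Gen K).1).extend_apply (fun ν => rho σ f t (n * ν)) 0 1
    rw [mul_one] at this
    exact (mul_one n ▸ this).symm
  · intro p hp
    refine Function.extend_apply' _ _ _ fun ⟨ν, hν⟩ => hp ?_
    have h1 : p.1.1 = 1 := Gen.eq_one (IsUnit.of_mul_eq_one ν hν)
    refine Subtype.ext (Prod.ext h1 (Subtype.ext ?_))
    have := p.mul_eq
    rw [h1] at this
    exact (one_mul _).symm.trans this

lemma rho_one_ne_zero (hf : IsHeckeMaassCuspForm σ f t lam) : rho σ f t 1 ≠ 0 := by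
  obtain ⟨μ, hμ, h⟩ := hf.exists_rho_ne_zero
  intro h0
  exact h (by rw [hf.rho_eq hμ, h0, mul_zero])

lemma hecke_lam (hf : IsHeckeMaassCuspForm σ f t lam) (n μ : NZ K) :
    lam n.1 * lam μ.1 = ∑' p : Factors n,
      Function.extend (fun ν => p.1.1.1.1 * ν) (fun ν => lam (p.1.2.1 * ν)) 0 μ.1 := by
  refine mul_right_cancel₀ hf.rho_one_ne_zero ?_
  rw [mul_assoc, ← hf.rho_eq μ.2, hf.hecke_rho n μ.2, ← tsum_mul_right]
  refine tsum_congr fun p => ?_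
  by_cases hp : ∃ ν, p.1.1.1.1 * ν = μ.1
  · obtain ⟨ν, hν⟩ := hp
    have hν0 : ν ≠ 0 := right_ne_zero_of_mul (hν ▸ μ.2)
    rw [← hν, (mul_injective_of_ne_zero p.1.1.1).extend_apply,
      (mul_injective_of_ne_zero p.1.1.1).extend_apply, hf.rho_eq (mul_ne_zero p.1.2.2 hν0)]
  · rw [Function.extend_apply' _ _ _ hp, Function.extend_apply' _ _ _ hp, Pi.zero_apply, zero_mul]

lemma lam_neg (hf : IsHeckeMaassCuspForm σ f t lam) (μ : NZ K) :
    lam (-μ.1) = lam (-1) * lam μ.1 := by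
  have hn : (-1 : 𝓞 K) ≠ 0 := neg_ne_zero.2 one_ne_zero
  rw [hf.hecke_lam ⟨-1, hn⟩ μ, tsum_eq_single (⟨(1, ⟨-1, hn⟩), Subtype.ext (one_mul _)⟩)]
  · have := (mul_injective_of_ne_zero (1 : Gen K).1).extend_apply (fun ν => lam (-1 * ν)) 0 μ.1
    rw [neg_one_mul] at this
    exact ((congrArg _ (one_mul μ.1).symm).trans this).symm
  · intro p hp
    have h1 : p.1.1 = 1 := Gen.eq_one (IsUnit.of_mul_eq_one (-p.1.2.1) (by
      rw [mul_neg, p.mul_eq, neg_neg]))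
    refine absurd (Subtype.ext (Prod.ext h1 (Subtype.ext ?_))) hp
    have := p.mul_eq
    rw [h1] at this
    exact (one_mul _).symm.trans this

lemma exists_lam_le (hf : IsHeckeMaassCuspForm σ f t lam) :
    ∃ C : ℝ, 0 ≤ C ∧ ∀ μ : NZ K, ‖lam μ.1‖ ≤ C * ‖emb σ μ.1‖ := by
  obtain ⟨C, hC, h⟩ := hf.exists_rho_le
  have h1 := norm_pos_iff.2 hf.rho_one_ne_zero
  refine ⟨C / ‖rho σ f t 1‖, by positivity, fun μ => ?_⟩
  have h2 := h μ.1 μ.2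
  rw [hf.rho_eq μ.2, norm_mul, ← le_div_iff₀ h1] at h2
  exact h2.trans_eq (by ring)

end IsHeckeMaassCuspForm

end Hecke

/-! ### Dirichlet series -/

section Dirichlet

variable {K : Type*} [Field K] [NumberField K] [IsTotallyComplex K]
variable (σ : K →+* ℂ)
  [hdeg : Fact (Module.finrank ℚ K = 2)] [IsPrincipalIdealRing (𝓞 K)]

/-- The term `N(μ)^(-s)` of a Dirichlet series. -/
def npow (s : ℂ) (μ : 𝓞 K) : ℂ := ((‖emb σ μ‖ ^ 2 : ℝ) : ℂ) ^ (-s)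

lemma npow_eq (s : ℂ) (μ : NZ K) : npow σ s μ.1 = (‖emb σ μ.1‖ : ℂ) ^ (-(2 * s)) := by
  have h := norm_emb_pos σ μ.2
  rw [npow, sq, ofReal_mul_cpow h h, ← cpow_add _ _ (ofReal_ne_zero.2 h.ne')]
  ring_nf

lemma npow_mul (s : ℂ) (μ ν : NZ K) : npow σ s (μ.1 * ν.1) = npow σ s μ.1 * npow σ s ν.1 := by
  have h1 := norm_emb_pos σ μ.2
  have h2 := norm_emb_pos σ ν.2
  rw [npow, npow, npow, ← ofReal_mul_cpow (by positivity) (by positivity), map_mul, norm_mul,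
    mul_pow]

lemma npow_add (s s' : ℂ) (μ : NZ K) : npow σ (s + s') μ.1 = npow σ s μ.1 * npow σ s' μ.1 := by
  have h := norm_emb_pos σ μ.2
  rw [npow, npow, npow, neg_add, cpow_add _ _ (ofReal_ne_zero.2 (by positivity))]

lemma norm_npow (s : ℂ) (μ : NZ K) : ‖npow σ s μ.1‖ = ‖emb σ μ.1‖ ^ (-(2 * s.re)) := by
  rw [npow_eq, norm_cpow_eq_rpow_re_of_pos (norm_emb_pos σ μ.2)]
  simp

lemma summable_nz_rpow {A : ℝ} (hA : 2 < A) : Summable fun μ : NZ K => ‖emb σ μ.1‖ ^ (-A) :=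
  (summable_norm_rpow σ hA).comp_injective Subtype.val_injective

lemma norm_mul_npow_le {σ : K →+* ℂ} {a : 𝓞 K → ℂ} {C k : ℝ} (μ : NZ K)
    (ha : ‖a μ.1‖ ≤ C * ‖emb σ μ.1‖ ^ k) (s : ℂ) :
    ‖a μ.1 * npow σ s μ.1‖ ≤ C * ‖emb σ μ.1‖ ^ (-(2 * s.re - k)) := by
  have h := norm_emb_pos σ μ.2
  rw [norm_mul, norm_npow, neg_sub, sub_eq_add_neg, Real.rpow_add h, ← mul_assoc]
  exact mul_le_mul_of_nonneg_right ha (by positivity)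

/-- Each non-zero integer is uniquely a unit times a normalized one. -/
lemma unit_mul_gen_bijective : Function.Bijective fun p : Gen K × (𝓞 K)ˣ =>
    (⟨p.1.1.1 * p.2, mul_ne_zero p.1.1.2 p.2.ne_zero⟩ : NZ K) := by
  constructor
  · rintro ⟨a, u⟩ ⟨b, v⟩ h
    have h1 : a.1.1 * u = b.1.1 * v := congrArg Subtype.val h
    have hab : a = b := Gen.eq_of_associated ⟨u * v⁻¹, by
      rw [Units.val_mul, ← mul_assoc, h1, mul_assoc, Units.mul_inv, mul_one]⟩
    subst hab
    rw [Units.ext (mul_left_cancel₀ a.1.2 h1)]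
  · intro μ
    obtain ⟨u, hu⟩ := normalize_associated μ.1
    exact ⟨(⟨⟨normalize μ.1, fun h => μ.2 (normalize_eq_zero.1 h)⟩, normalize_idem _⟩, u),
      Subtype.ext hu⟩

lemma hasSum_gen {s : ℂ} (hs : 1 < s.re) : Summable (fun a : Gen K => ‖npow σ s a.1.1‖) ∧ ∑' a : Gen
    K, npow σ s a.1.1 = dedekindZeta K s := by
  have h0 : Summable fun μ : NZ K => npow σ s μ.1 := summable_nz σ hs
  have h1 := (Equiv.ofBijective _ (unit_mul_gen_bijective (K := K))).summable_iff.2 h0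
  have h2 : ∀ p : Gen K × (𝓞 K)ˣ, npow σ s (p.1.1.1 * p.2) = npow σ s p.1.1.1 := by
    intro p
    rw [npow, npow, map_mul, norm_mul, norm_emb_unit, mul_one]
  refine ⟨(h0.comp_injective Subtype.val_injective).norm, ?_⟩
  refine mul_left_cancel₀ (unitCard_ne_zero (K := K)) ?_
  refine Eq.trans ?_ (tsum_nz_eq_zeta σ hs)
  change _ = ∑' μ : NZ K, npow σ s μ.1
  rw [← (Equiv.ofBijective _ (unit_mul_gen_bijective (K := K))).tsum_eq (fun μ : NZ K => npow σ s μ.1),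
    Summable.tsum_prod (f := fun p => npow σ s
      ((Equiv.ofBijective _ (unit_mul_gen_bijective (K := K))) p).1) h1,
    ← tsum_mul_left]
  refine tsum_congr fun a => ?_
  change _ = ∑' u : (𝓞 K)ˣ, npow σ s (a.1.1 * u)
  rw [tsum_congr fun u => h2 (a, u)]
  change _ = ∑' _ : (𝓞 K)ˣ, npow σ s a.1.1
  rw [tsum_const, nsmul_eq_mul, unitCard]

variable {σ} {f : H3 → ℂ} {t : ℂ} {lam : 𝓞 K → ℂ}

lemma IsHeckeMaassCuspForm.summable_pair (hf : IsHeckeMaassCuspForm σ f t lam) {s₁ s₂ : ℂ}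
    (h1 : 3 / 2 < s₁.re) (h2 : 3 / 2 < s₂.re) : Summable fun p : NZ K × NZ K =>
      lam (p.1.1 * p.2.1) * (npow σ s₁ p.1.1 * npow σ s₂ p.2.1) := by
  obtain ⟨C, hC, hb⟩ := hf.exists_lam_le
  have h3 := ((summable_nz_rpow σ (A := 2 * s₁.re - 1) (by linarith)).mul_of_nonneg
    (summable_nz_rpow σ (A := 2 * s₂.re - 1) (by linarith)) (fun _ => by positivity)
    (fun _ => by positivity)).mul_left C
  refine Summable.of_norm_bounded h3 fun p => ?_
  have h4 := hb ⟨p.1.1 * p.2.1, mul_ne_zero p.1.2 p.2.2⟩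
  have e1 := norm_emb_pos σ p.1.2
  have e2 := norm_emb_pos σ p.2.2
  rw [norm_mul, norm_mul, norm_npow, norm_npow, neg_sub, neg_sub, sub_eq_add_neg, sub_eq_add_neg,
    Real.rpow_add e1, Real.rpow_add e2, Real.rpow_one, Real.rpow_one]
  simp only [map_mul, norm_mul] at h4
  calc _ ≤ (C * (‖emb σ p.1.1‖ * ‖emb σ p.2.1‖))
        * (‖emb σ p.1.1‖ ^ (-(2 * s₁.re)) * ‖emb σ p.2.1‖ ^ (-(2 * s₂.re))) := by gcongr
    _ = _ := by ring

lemma IsHeckeMaassCuspForm.summable_lam (hf : IsHeckeMaassCuspForm σ f t lam) {s : ℂ}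
    (hs : 3 / 2 < s.re) : Summable fun μ : NZ K => lam μ.1 * npow σ s μ.1 := by
  obtain ⟨C, hC, hb⟩ := hf.exists_lam_le
  exact Summable.of_norm_bounded ((summable_nz_rpow σ (A := 2 * s.re - 1) (by linarith)).mul_left C)
    fun μ => norm_mul_npow_le μ (by rw [Real.rpow_one]; exact hb μ) s

/-- The product of two values of the L-series of a Hecke eigenform, by the Hecke relations. -/
theorem IsHeckeMaassCuspForm.tsum_mul_tsum (hf : IsHeckeMaassCuspForm σ f t lam) {s₁ s₂ : ℂ}
    (h1 : 3 / 2 < s₁.re) (h2 : 3 / 2 < s₂.re) :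
    (∑' n : NZ K, lam n.1 * npow σ s₁ n.1) * ∑' μ : NZ K, lam μ.1 * npow σ s₂ μ.1
      = dedekindZeta K (s₁ + s₂) * ∑' p : NZ K × NZ K,
        lam (p.1.1 * p.2.1) * (npow σ s₁ p.1.1 * npow σ s₂ p.2.1) := by
  have hp := hf.summable_pair h1 h2
  set H : NZ K → ℂ := fun d => ∑' ν : NZ K, lam (d.1 * ν.1) * npow σ s₂ ν.1 with hH
  have hH1 : ∀ d : NZ K, Summable fun ν : NZ K => lam (d.1 * ν.1) * npow σ s₂ ν.1 := by
    intro d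
    have h3 := hp.prod_factor d
    refine (h3.mul_left (npow σ s₁ d.1)⁻¹).congr fun ν => ?_
    have : npow σ s₁ d.1 ≠ 0 := by
      rw [← norm_ne_zero_iff, norm_npow]
      exact (Real.rpow_pos_of_pos (norm_emb_pos σ d.2) _).ne'
    field_simp
  have hHs : ∀ d : NZ K, npow σ s₁ d.1 * H d
      = ∑' ν : NZ K, lam (d.1 * ν.1) * (npow σ s₁ d.1 * npow σ s₂ ν.1) := by
    intro d
    rw [hH, ← tsum_mul_left]
    exact tsum_congr fun ν => by ring
  have hdH : Summable fun d : NZ K => ‖npow σ s₁ d.1 * H d‖ := by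
    refine (hp.norm.prod).of_nonneg_of_le (fun _ => norm_nonneg _) fun d => ?_
    rw [hHs]
    exact norm_tsum_le_tsum_norm (hp.norm.prod_factor d)
  have key : ∀ n : NZ K, lam n.1 * npow σ s₁ n.1 * ∑' μ : NZ K, lam μ.1 * npow σ s₂ μ.1
      = ∑' p : Factors n, npow σ (s₁ + s₂) p.1.1.1.1 * (npow σ s₁ p.1.2.1 * H p.1.2) := by
    intro n
    have := Fintype.ofFinite (Factors n)
    have hinj : ∀ a : NZ K, Function.Injective fun ν : NZ K =>
        (⟨a.1 * ν.1, mul_ne_zero a.2 ν.2⟩ : NZ K) := fun a ν ν' h =>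
      Subtype.ext (mul_left_cancel₀ a.2 (congrArg Subtype.val h))
    have hterm : ∀ p : Factors n, HasSum (fun μ : NZ K => Function.extend
        (fun ν => p.1.1.1.1 * ν) (fun ν => lam (p.1.2.1 * ν)) 0 μ.1 * npow σ s₂ μ.1)
        (npow σ s₂ p.1.1.1.1 * H p.1.2) := by
      intro p
      rw [← (hinj p.1.1.1).hasSum_iff fun μ hμ => by
        rw [Function.extend_apply', Pi.zero_apply, zero_mul]
        rintro ⟨ν, hν⟩
        exact hμ ⟨⟨ν, right_ne_zero_of_mul (hν ▸ μ.2)⟩, Subtype.ext hν⟩]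
      refine ((hH1 p.1.2).hasSum.mul_left (npow σ s₂ p.1.1.1.1)).congr_fun fun ν => ?_
      simp only [Function.comp_apply]
      rw [(mul_injective_of_ne_zero p.1.1.1).extend_apply, npow_mul]
      ring
    have hs : ∑' μ : NZ K, lam n.1 * lam μ.1 * npow σ s₂ μ.1
        = ∑ p : Factors n, npow σ s₂ p.1.1.1.1 * H p.1.2 := by
      rw [← (hasSum_sum (s := Finset.univ) fun p _ => hterm p).tsum_eq]
      refine tsum_congr fun μ => ?_
      rw [hf.hecke_lam n μ, tsum_fintype, Finset.sum_mul]
    have e : ∀ μ : NZ K, lam n.1 * npow σ s₁ n.1 * (lam μ.1 * npow σ s₂ μ.1)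
        = npow σ s₁ n.1 * (lam n.1 * lam μ.1 * npow σ s₂ μ.1) := fun μ => by ring
    rw [← tsum_mul_left, tsum_congr e, tsum_mul_left, hs, tsum_fintype, Finset.mul_sum]
    refine Finset.sum_congr rfl fun p _ => ?_
    rw [← p.mul_eq, npow_mul, npow_add]
    ring
  rw [← tsum_mul_right, tsum_congr key]
  have hg := hasSum_gen σ (s := s₁ + s₂) (by rw [add_re]; linarith)
  have hprod := summable_mul_of_summable_norm hg.1 hdH
  rw [(hprod.hasSum.tsum_fiberwise genMul).tsum_eq,
    ← tsum_mul_tsum_of_summable_norm hg.1 hdH, hg.2, hp.tsum_prod, tsum_congr hHs]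

/-- The product of two non-zero integers. -/
def nzMul (p : NZ K × NZ K) : NZ K := ⟨p.1.1 * p.2.1, mul_ne_zero p.1.2 p.2.2⟩

/-- The factorizations of a non-zero integer. -/
def fibEquiv (μ : NZ K) : nzMul ⁻¹' ({μ} : Set (NZ K)) ≃ Fib μ.1 where
  toFun p := ⟨(p.1.1.1, p.1.2.1), congrArg Subtype.val p.2⟩
  invFun p := ⟨(⟨p.1.1, (fib_ne_zero μ.2 p).1⟩, ⟨p.1.2, (fib_ne_zero μ.2 p).2⟩), Subtype.ext p.2⟩
  left_inv _ := rfl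
  right_inv _ := rfl

lemma tau_eq (σ : K →+* ℂ) (s : ℂ) (μ : NZ K) : tau σ s μ.1
    = ∑' p : nzMul ⁻¹' ({μ} : Set (NZ K)), npow σ (s / 2) p.1.1.1 * npow σ (-(s / 2)) p.1.2.1 := by
  rw [tau, ← (fibEquiv μ).tsum_eq]
  refine tsum_congr fun p => ?_
  have e1 := norm_emb_pos σ p.1.1.2
  have e2 := norm_emb_pos σ p.1.2.2
  rw [npow_eq, npow_eq, div_eq_inv_mul]
  change ((‖emb σ p.1.1.1‖⁻¹ * ‖emb σ p.1.2.1‖ : ℝ) : ℂ) ^ s = _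
  rw [ofReal_mul_cpow (inv_pos.2 e1) e2, ofReal_inv_cpow e1]
  congr 2 <;> ring

/-- The Dirichlet series of `τ_s(μ) λ(μ)`. -/
lemma IsHeckeMaassCuspForm.tsum_tau_mul (hf : IsHeckeMaassCuspForm σ f t lam) {s s' : ℂ}
    (h1 : 3 / 2 < (s' + s / 2).re) (h2 : 3 / 2 < (s' - s / 2).re) :
    ∑' μ : NZ K, tau σ s μ.1 * lam μ.1 * npow σ s' μ.1 = ∑' p : NZ K × NZ K,
      lam (p.1.1 * p.2.1) * (npow σ (s' + s / 2) p.1.1 * npow σ (s' - s / 2) p.2.1) := by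
  rw [← ((hf.summable_pair h1 h2).hasSum.tsum_fiberwise nzMul).tsum_eq]
  refine tsum_congr fun μ => ?_
  rw [tau_eq, mul_assoc, ← tsum_mul_right]
  refine tsum_congr fun p => ?_
  have : μ.1 = p.1.1.1 * p.1.2.1 := (congrArg Subtype.val p.2).symm
  rw [this, npow_mul, npow_add, sub_eq_add_neg, npow_add]
  ring

lemma summable_tau (σ : K →+* ℂ) (t : ℝ) {A : ℝ} (hA : 2 < A) :
    Summable fun μ : NZ K => ‖tau σ (I * t) μ.1‖ * ‖emb σ μ.1‖ ^ (-A) := by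
  have h := summable_nz_rpow σ hA
  have h1 := ((h.mul_of_nonneg h (fun _ => by positivity)
    (fun _ => by positivity)).hasSum.tsum_fiberwise nzMul).summable
  refine h1.of_nonneg_of_le (fun _ => by positivity) fun μ => ?_
  have := finite_fib σ μ.2
  have : Finite (nzMul ⁻¹' ({μ} : Set (NZ K))) := Finite.of_equiv _ (fibEquiv μ).symm
  have h2 : ‖tau σ (I * t) μ.1‖ ≤ ∑' _ : nzMul ⁻¹' ({μ} : Set (NZ K)), (1 : ℝ) := by
    rw [tau_eq]
    refine (norm_tsum_le_tsum_norm Summable.of_finite).trans_eq (tsum_congr fun p => ?_)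
    rw [norm_mul, norm_npow, norm_npow]
    simp
  refine (mul_le_mul_of_nonneg_right h2 (by positivity)).trans_eq ?_
  rw [← tsum_mul_right]
  refine tsum_congr fun p => ?_
  have : μ.1 = p.1.1.1 * p.1.2.1 := (congrArg Subtype.val p.2).symm
  rw [this, map_mul, norm_mul, Real.mul_rpow (norm_nonneg _) (norm_nonneg _), one_mul]

end Dirichlet

/-! ### Mellin transforms of the unfolded integrals -/

section Unfold

/-- Termwise integration of a series of dilates. -/
lemma hasSum_integral_dilate {ι : Type*} [Countable ι] {φ : ℝ → ℂ} (hφ : IntegrableOn φ (Ioi 0))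
    {k : ι → ℝ} (hk : ∀ i, 0 < k i) {A : ι → ℂ} (hA : Summable fun i => ‖A i‖ * (k i)⁻¹) :
    HasSum (fun i => A i * ((k i : ℂ)⁻¹ * ∫ x in Ioi (0 : ℝ), φ x))
      (∫ r in Ioi (0 : ℝ), ∑' i, A i * φ (k i * r)) := by
  have h1 : ∀ i, IntegrableOn (fun r => φ (k i * r)) (Ioi 0) := fun i =>
    (integrableOn_Ioi_comp_mul_left_iff φ 0 (hk i)).2 (by rwa [mul_zero])
  have h2 : ∀ i, ∫ r in Ioi (0 : ℝ), A i * φ (k i * r)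
      = A i * ((k i : ℂ)⁻¹ * ∫ x in Ioi (0 : ℝ), φ x) := by
    intro i
    rw [integral_const_mul, integral_comp_mul_left_Ioi φ 0 (hk i), mul_zero, real_smul, ofReal_inv]
  have h3 : ∀ i, ∫ r in Ioi (0 : ℝ), ‖A i * φ (k i * r)‖
      = ‖A i‖ * (k i)⁻¹ * ∫ x in Ioi (0 : ℝ), ‖φ x‖ := by
    intro i
    simp only [norm_mul]
    rw [integral_const_mul, integral_comp_mul_left_Ioi (fun x => ‖φ x‖) 0 (hk i), mul_zero,
      smul_eq_mul, mul_assoc]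
  rw [← funext h2]
  refine hasSum_integral_of_summable_integral_norm (fun i => (h1 i).const_mul (A i)) ?_
  rw [funext h3]
  exact hA.mul_right _

variable {K : Type*} [Field K] [NumberField K] [IsTotallyComplex K]
variable (σ : K →+* ℂ)
  [hdeg : Fact (Module.finrank ℚ K = 2)] [IsPrincipalIdealRing (𝓞 K)]
variable {σ} {f : H3 → ℂ} {t : ℂ} {lam : 𝓞 K → ℂ}

lemma summable_condR_mul {A : NZ K → ℂ} {s : ℂ}
    (h : Summable fun μ : NZ K => ‖A μ‖ * ‖emb σ μ.1‖ ^ (-(s.re + 1))) :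
    Summable fun μ : NZ K => ‖A μ * ((2 * condR K * ‖emb σ μ.1‖ : ℝ) : ℂ) ^ (-s)‖
      * (2 * condR K * ‖emb σ μ.1‖)⁻¹ := by
  have hκ := condR_pos K
  refine (h.mul_right ((2 * condR K) ^ (-(s.re + 1)))).congr fun μ => ?_
  have h0 := norm_emb_pos σ μ.2
  have hk : 0 < 2 * condR K * ‖emb σ μ.1‖ := by positivity
  rw [norm_mul, norm_cpow_eq_rpow_re_of_pos hk, mul_assoc, mul_assoc, neg_re,
    ← div_eq_mul_inv, ← Real.rpow_sub_one hk.ne', show -s.re - 1 = -(s.re + 1) by ring,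
    Real.mul_rpow (by positivity) h0.le, mul_comm (‖emb σ μ.1‖ ^ _)]

lemma condR_mul_cpow (μ : NZ K) (s : ℂ) :
    ((2 * condR K * ‖emb σ μ.1‖ : ℝ) : ℂ) ^ (-s) * ((2 * condR K * ‖emb σ μ.1‖ : ℝ) : ℂ)⁻¹
      = 2 ^ (-(s + 1)) * cond K ^ (-(s + 1)) * npow σ ((s + 1) / 2) μ.1 := by
  have hκ := condR_pos K
  have h0 := norm_emb_pos σ μ.2
  have hk : 0 < 2 * condR K * ‖emb σ μ.1‖ := by positivity
  rw [← cpow_neg_one, ← cpow_add _ _ (ofReal_ne_zero.2 hk.ne'), npow_eq,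
    ofReal_mul_cpow (by positivity) h0, ofReal_mul_cpow two_pos hκ, neg_add, ofReal_ofNat]
  congr 2
  ring

/-- Pairing a function on a horizontal plane with the Fourier expansion of a cusp form. -/
lemma IsHeckeMaassCuspForm.coeffAt_mul (hf : IsHeckeMaassCuspForm σ f t lam) {h : H3 → ℂ}
    (hm : Measurable h) {r : ℝ} (hr : 0 < r) {M : ℝ}
    (hM : ∀ x ∈ Icc 0 1, ‖h (Bianchi.mk (par σ x) r hr)‖ ≤ M) :
    coeffAt σ (h * f) 0 r = ∑' μ : NZ K, coeffAt σ h (-μ.1) r * coeffAt σ f μ.1 r := by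
  set ψ : (Idx K → ℝ) → ℂ := fun x =>
    h (Bianchi.mk (par σ x) r hr) with hψ
  have hψm : Measurable ψ := hm.comp ((measurable_mk hr).comp (par σ).continuous.measurable)
  have hψb : ∀ᵐ x ∂volume.restrict (Icc 0 1), ‖ψ x‖ ≤ M :=
    (ae_restrict_of_forall_mem measurableSet_Icc hM)
  have hFm : ∀ μ : 𝓞 K, Measurable fun x => ψ x * (coeffAt σ f μ r * chr (dualFreq σ μ) (par σ x)) :=
    fun μ => hψm.mul (((continuous_chr _).comp (par σ).continuous).measurable.const_mul _)
  have hFb : ∀ μ : 𝓞 K, ∀ᵐ x ∂volume.restrict (Icc 0 1),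
      ‖ψ x * (coeffAt σ f μ r * chr (dualFreq σ μ) (par σ x))‖ ≤ M * ‖coeffAt σ f μ r‖ := by
    intro μ
    filter_upwards [hψb] with x hx
    rw [norm_mul, norm_mul, chr_eq_exp, norm_exp_ofReal_mul_I, mul_one]
    gcongr
  have hbox := volume_box (ι := Idx K)
  have hfin : volume (Icc (0 : Idx K → ℝ) 1) ≠ ⊤ :=
    isCompact_Icc.measure_lt_top.ne
  have hI := hasSum_integral_of_summable_integral_norm
    (μ := volume.restrict (Icc (0 : Idx K → ℝ) 1))
    (F := fun (μ : 𝓞 K) x => ψ x * (coeffAt σ f μ r * chr (dualFreq σ μ) (par σ x)))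
    (fun μ => Integrable.mono' (integrableOn_const hfin) (hFm μ).aestronglyMeasurable (hFb μ))
    (((hf.summable_coeffAt hr).mul_left M).of_nonneg_of_le
      (fun μ => integral_nonneg fun x => norm_nonneg _) fun μ => by
        refine (integral_mono_of_nonneg (.of_forall fun x => norm_nonneg _)
          (integrableOn_const hfin) (hFb μ)).trans_eq ?_
        rw [setIntegral_const, hbox, one_smul])
  have e1 : ∀ x, ∑' μ : 𝓞 K, ψ x * (coeffAt σ f μ r * chr (dualFreq σ μ) (par σ x))
      = (h * f) (Bianchi.mk (par σ x) r hr) := by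
    intro x
    rw [tsum_mul_left, (hf.hasSum_coeffAt hr (par σ x)).tsum_eq]
    rfl
  have e2 : ∀ μ : 𝓞 K, ∫ x in Icc (0 : Idx K → ℝ) 1,
      ψ x * (coeffAt σ f μ r * chr (dualFreq σ μ) (par σ x))
      = coeffAt σ h (-μ) r * coeffAt σ f μ r := by
    intro μ
    rw [Bianchi.coeffAt_eq σ h _ hr, planeCoeff, ← integral_mul_const]
    refine integral_congr_ae (.of_forall fun x => ?_)
    simp only [hψ]
    rw [chr_neg, dualFreq_neg, chr_neg_left, conj_conj]
    ring
  rw [funext e2] at hI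
  rw [Bianchi.coeffAt_eq _ _ _ hr, planeCoeff]
  simp only [dualFreq_zero, chr_zero_left, mul_one, ← e1]
  rw [← hI.tsum_eq]
  refine (Subtype.val_injective.tsum_eq fun μ hμ => ?_).symm
  refine ⟨⟨μ, fun h0 => hμ ?_⟩, rfl⟩
  simp only [h0, hf.coeffAt_zero hr, mul_zero]

/-- **Rankin-Selberg unfolding.** Here `h` is an automorphic function with coefficients `a(μ)`. -/
theorem IsHeckeMaassCuspForm.integral_mul_Est (hf : IsHeckeMaassCuspForm σ f t lam) {D : Set H3}
    (hD : IsFundamentalDomain (Gam σ) D hypVol) {h : H3 → ℂ} (hm : Measurable h)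
    (hM : ∀ (r : ℝ) (hr : 0 < r), ∃ M, ∀ x ∈ Icc 0 1, ‖h (Bianchi.mk (par σ x) r hr)‖ ≤ M)
    (hR : RapidInv σ (h * f)) {a : 𝓞 K → ℂ} {α : ℂ}
    (ha : ∀ μ : 𝓞 K, μ ≠ 0 → ∀ r : ℝ, 0 < r → coeffAt σ h μ r
    = a μ * (r * besselK α (2 * Real.pi * ‖dualFreq σ μ‖ * r))) {s : ℂ} (hs : 1 < s.re)
    (h1 : |(α + I * t).re| < s.re + 1) (h2 : |(α - I * t).re| < s.re + 1)
    (hsum : Summable fun μ : NZ K => ‖a (-μ.1) * rho σ f t μ.1‖ * ‖emb σ μ.1‖ ^ (-(s.re + 1))) :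
    ∫ P in D, (h * f) P * Est σ P s ∂hypVol
    = (sqrtDisc K / 16 : ℂ)
    * (cond K ^ (-(2 * (1 + s)))
    * (Gamma (((1 + s) + (α + I * t)) / 2) * Gamma (((1 + s) - (α + I * t)) / 2)
    * (Gamma (((1 + s) + (α - I * t)) / 2) * Gamma (((1 + s) - (α - I * t)) / 2)))
    * (dedekindZeta K (1 + s) * ∑' μ : NZ K, a (-μ.1) * rho σ f t μ.1
    * npow σ ((1 + s) / 2) μ.1)) := by
  have hκ := condR_pos K
  have hk : ∀ μ : NZ K, 0 < 2 * condR K * ‖emb σ μ.1‖ := fun μ => by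
    have := norm_emb_pos σ μ.2
    positivity
  obtain ⟨hI, hV⟩ := mellin_besselK_mul (a := α) (b := I * t) (s := 1 + s)
    (by rwa [add_re 1 s, one_re, add_comm 1]) (by rwa [add_re 1 s, one_re, add_comm 1])
  simp only [add_sub_cancel_left] at hI hV
  have hS := hasSum_integral_dilate hI hk (summable_condR_mul hsum)
  have hint : ∫ r in Ioi (0 : ℝ), (r : ℂ) ^ (s - 2) * coeffAt σ (h * f) 0 r
      = ∫ r in Ioi (0 : ℝ), ∑' μ : NZ K, a (-μ.1) * rho σ f t μ.1
        * ((2 * condR K * ‖emb σ μ.1‖ : ℝ) : ℂ) ^ (-s)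
        * (((2 * condR K * ‖emb σ μ.1‖ * r : ℝ) : ℂ) ^ s
          * (besselK α (2 * condR K * ‖emb σ μ.1‖ * r)
            * besselK (I * t) (2 * condR K * ‖emb σ μ.1‖ * r))) := by
    refine setIntegral_congr_fun measurableSet_Ioi fun r (hr : 0 < r) => ?_
    obtain ⟨M, hM⟩ := hM r hr
    rw [hf.coeffAt_mul hm hr hM, ← tsum_mul_left]
    refine tsum_congr fun μ => ?_
    have h3 : (r : ℂ) ≠ 0 := ofReal_ne_zero.2 hr.ne'
    have h4 : ((2 * condR K * ‖emb σ μ.1‖ : ℝ) : ℂ) ^ (-s)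
        * ((2 * condR K * ‖emb σ μ.1‖ : ℝ) : ℂ) ^ s = 1 := by
      rw [← cpow_add _ _ (ofReal_ne_zero.2 (hk μ).ne'), neg_add_cancel, cpow_zero]
    have h5 : (r : ℂ) ^ (s - 2) * ((r : ℂ) * r) = (r : ℂ) ^ s := by
      rw [cpow_sub _ _ h3, cpow_ofNat]
      field_simp
    rw [ha _ (neg_ne_zero.2 μ.2) r hr, hf.coeffAt_eq μ.2 hr, two_pi_norm_dualFreq,
      two_pi_norm_dualFreq, map_neg, norm_neg, ofReal_mul_cpow (hk μ) hr, ← h5]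
    linear_combination (-(a (-μ.1) * rho σ f t μ.1 * (r : ℂ) ^ (s - 2) * r * r
      * besselK α (2 * condR K * ‖emb σ μ.1‖ * r)
      * besselK (I * t) (2 * condR K * ‖emb σ μ.1‖ * r))) * h4
  have hG : Gamma (1 + s) ≠ 0 := Gamma_ne_zero_of_re_pos (by rw [add_re, one_re]; linarith)
  have h2p : (2 : ℂ) ^ (-(s + 1)) * 2 ^ (1 + s - 3) = 1 / 8 := by
    rw [← cpow_add _ _ two_ne_zero, show -(s + 1) + (1 + s - 3) = ((-3 : ℤ) : ℂ) by push_cast; ring,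
      cpow_intCast]
    norm_num
  have hc : cond K ^ (-(2 * (1 + s))) = cond K ^ (-(1 + s)) * cond K ^ (-(s + 1)) := by
    rw [← cpow_add (x := cond K) _ _ (ofReal_ne_zero.2 hκ.ne')]
    ring_nf
  rw [hR.integral_mul_Est hD hs, hint, ← hS.tsum_eq, hV, LamF_eq_zetaSeries σ
    (by rw [add_re, one_re]; linarith), zetaSeries, hc]
  have e : ∀ (X : ℂ) (μ : NZ K), a (-μ.1) * rho σ f t μ.1
      * ((2 * condR K * ‖emb σ μ.1‖ : ℝ) : ℂ) ^ (-s)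
      * (((2 * condR K * ‖emb σ μ.1‖ : ℝ) : ℂ)⁻¹ * (2 ^ (1 + s - 3) * X / Gamma (1 + s)))
      = a (-μ.1) * rho σ f t μ.1 * npow σ ((1 + s) / 2) μ.1
        * (1 / 8 * cond K ^ (-(s + 1)) * X / Gamma (1 + s)) := by
    intro X μ
    have := condR_mul_cpow (σ := σ) μ s
    rw [← h2p, add_comm 1 s]
    linear_combination (a (-μ.1) * rho σ f t μ.1 * (2 ^ (s + 1 - 3) * X / Gamma (s + 1))) * this
  rw [tsum_congr (e _), tsum_mul_right, ofReal_div, ofReal_ofNat]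
  generalize Gamma ((1 + s + (α + I * t)) / 2) * Gamma ((1 + s - (α + I * t)) / 2)
    * (Gamma ((1 + s + (α - I * t)) / 2) * Gamma ((1 + s - (α - I * t)) / 2)) = X
  generalize Gamma (1 + s) = G at hG
  generalize (∑' μ : NZ K, a (-μ.1) * rho σ f t μ.1 * npow σ ((1 + s) / 2) μ.1) = Y
  field_simp
  ring

end Unfold

/-! ### Values of the integrals -/

section FinalFormulas

variable {K : Type*} [Field K] [NumberField K] [IsTotallyComplex K]
variable (σ : K →+* ℂ)
  [hdeg : Fact (Module.finrank ℚ K = 2)] [IsPrincipalIdealRing (𝓞 K)]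
variable {σ} {f : H3 → ℂ} {t : ℂ} {lam : 𝓞 K → ℂ}

lemma coord_inv (hf : ∀ γ ∈ Gam σ, ∀ P, f (γ P) = f P) {r : ℝ} (hr : 0 < r) :
    coord f (0, r⁻¹) = coord f (0, r) := by
  set S : SL(2, 𝓞 K) := ⟨!![0, -1; 1, 0], by simp [Matrix.det_fin_two]⟩ with hS
  have hden : den (incl σ S).1 (mk 0 r hr) = r ^ 2 := by
    have h1 : (incl σ S).1 1 0 = 1 := map_one (emb σ)
    have h2 : (incl σ S).1 1 1 = 0 := map_zero (emb σ)
    simp [den, h1, h2, mk_z, mk_r]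
  have h : incl σ S • mk 0 r hr = mk 0 r⁻¹ (inv_pos.2 hr) := by
    have h0 : (incl σ S).1 0 0 = 0 := map_zero (emb σ)
    have h1 : (incl σ S).1 1 1 = 0 := map_zero (emb σ)
    have hd : (incl σ S).1.det = 1 := by
      rw [Matrix.det_fin_two, h0, zero_mul, zero_sub, show (incl σ S).1 1 0 = 1 from map_one (emb σ),
        show (incl σ S).1 0 1 = -1 from (map_neg (emb σ) 1).trans (by rw [map_one]), neg_one_mul,
        neg_neg]
    apply H3.ext'
    · change ((_ : ℂ) / (den (incl σ S).1 (mk 0 r hr) : ℂ)) = _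
      rw [h0, h1, mk_z, mk_z]
      simp
    · change ‖(incl σ S).1.det‖ * (mk 0 r hr).r / den (incl σ S).1 (mk 0 r hr) = _
      rw [hden, hd, mk_r, mk_r]
      simp only [norm_one]
      field_simp
  rw [coord_mk _ _ hr, coord_mk _ _ (inv_pos.2 hr), ← h]
  exact hf _ ⟨S, rfl⟩ _

lemma dirichletSeries_eq (a : 𝓞 K → ℂ) (s : ℂ) : dirichletSeries σ a s
    = (unitCard K)⁻¹ * ∑' μ : NZ K, a μ.1 * npow σ s μ.1 := rfl

namespace IsHeckeMaassCuspForm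

/-- The Mellin transform of a cusp form along the geodesic from `0` to `∞`. -/
lemma integral_coord (hf : IsHeckeMaassCuspForm σ f t lam) {s : ℂ} (hs : 2 < s.re) :
    ∫ r in Ioi (0 : ℝ), (r : ℂ) ^ (2 * s - 2) * coord f (0, r)
      = unitCard K / 4 * rho σ f t 1 * stdSeries σ t lam s := by
  have hk : ∀ μ : NZ K, 0 < 2 * condR K * ‖emb σ μ.1‖ := fun μ => by
    have := norm_emb_pos σ μ.2
    have := condR_pos K
    positivity
  have ht := hf.abs_re_le_one
  obtain ⟨hI, hV⟩ := mellin_besselK (ν := I * t) (s := 2 * s)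
    (by simp only [mul_re, re_ofNat, im_ofNat, zero_mul, sub_zero] at ht ⊢; linarith)
  have hsum : Summable fun μ : NZ K => ‖rho σ f t μ.1‖ * ‖emb σ μ.1‖ ^ (-((2 * s - 1).re + 1)) := by
    refine ((hf.summable_lam (s := s) (by linarith)).norm.mul_left ‖rho σ f t 1‖).congr fun μ => ?_
    rw [hf.rho_eq μ.2, norm_mul, norm_mul, norm_npow,
      show -((2 * s - 1).re + 1) = -(2 * s.re) by simp]
    ring
  have hS := hasSum_integral_dilate hI hk (summable_condR_mul hsum)
  have e : ∀ μ : NZ K, rho σ f t μ.1 * ((2 * condR K * ‖emb σ μ.1‖ : ℝ) : ℂ) ^ (-(2 * s - 1))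
      * (((2 * condR K * ‖emb σ μ.1‖ : ℝ) : ℂ)⁻¹ * ∫ x in Ioi (0 : ℝ),
        (x : ℂ) ^ (2 * s - 1) * besselK (I * t) x)
      = rho σ f t 1 / 4 * (cond K ^ (-2 * s)
        * (Gamma (s + I * t / 2) * Gamma (s - I * t / 2))) * (lam μ.1 * npow σ s μ.1) := by
    intro μ
    have h1 := condR_mul_cpow (σ := σ) μ (2 * s - 1)
    have h2 : (2 : ℂ) ^ (-(2 * s)) * 2 ^ (2 * s - 2) = 1 / 4 := by
      rw [← cpow_add _ _ two_ne_zero, show -(2 * s) + (2 * s - 2) = ((-2 : ℤ) : ℂ) by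
        push_cast; ring, cpow_intCast]
      norm_num
    rw [sub_add_cancel, mul_div_cancel_left₀ _ (two_ne_zero' ℂ)] at h1
    rw [hV, hf.rho_eq μ.2, show (2 * s + I * t) / 2 = s + I * t / 2 by ring,
      show (2 * s - I * t) / 2 = s - I * t / 2 by ring, neg_mul]
    generalize Gamma (s + I * t / 2) * Gamma (s - I * t / 2) = X
    linear_combination (lam μ.1 * rho σ f t 1 * 2 ^ (2 * s - 2) * X) * h1
      + (lam μ.1 * rho σ f t 1 * cond K ^ (-(2 * s)) * npow σ s μ.1 * X) * h2
  have hint : ∫ r in Ioi (0 : ℝ), (r : ℂ) ^ (2 * s - 2) * coord f (0, r)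
      = ∫ r in Ioi (0 : ℝ), ∑' μ : NZ K, rho σ f t μ.1
        * ((2 * condR K * ‖emb σ μ.1‖ : ℝ) : ℂ) ^ (-(2 * s - 1))
        * (((2 * condR K * ‖emb σ μ.1‖ * r : ℝ) : ℂ) ^ (2 * s - 1)
          * besselK (I * t) (2 * condR K * ‖emb σ μ.1‖ * r)) := by
    refine setIntegral_congr_fun measurableSet_Ioi fun r (hr : 0 < r) => ?_
    have h1 := hf.hasSum_coeffAt hr 0
    simp only [chr_zero, mul_one] at h1
    have h2 : ∑' μ : NZ K, coeffAt σ f μ.1 r = coord f (0, r) := by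
      rw [coord_mk _ _ hr, ← h1.tsum_eq]
      refine Subtype.val_injective.tsum_eq fun μ hμ => ⟨⟨μ, fun h0 => hμ ?_⟩, rfl⟩
      exact h0 ▸ hf.coeffAt_zero hr
    rw [← h2, ← tsum_mul_left]
    refine tsum_congr fun μ => ?_
    have h3 : (r : ℂ) ≠ 0 := ofReal_ne_zero.2 hr.ne'
    have h4 : ((2 * condR K * ‖emb σ μ.1‖ : ℝ) : ℂ) ^ (-(2 * s - 1))
        * ((2 * condR K * ‖emb σ μ.1‖ : ℝ) : ℂ) ^ (2 * s - 1) = 1 := by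
      rw [← cpow_add _ _ (ofReal_ne_zero.2 (hk μ).ne'), neg_add_cancel, cpow_zero]
    have h5 : (r : ℂ) ^ (2 * s - 2) * r = (r : ℂ) ^ (2 * s - 1) := by
      rw [show 2 * s - 1 = (2 * s - 2) + 1 by ring, cpow_add _ _ h3, cpow_one]
    rw [hf.coeffAt_eq μ.2 hr, two_pi_norm_dualFreq, ofReal_mul_cpow (hk μ) hr, ← h5]
    linear_combination (-(rho σ f t μ.1 * (r : ℂ) ^ (2 * s - 2) * r
      * besselK (I * t) (2 * condR K * ‖emb σ μ.1‖ * r))) * h4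
  rw [hint, ← hS.tsum_eq, tsum_congr e, tsum_mul_left, stdSeries,
    dirichletSeries_eq]
  have := unitCard_ne_zero (K := K)
  field_simp

/-- The Mellin transform of `f(rj)` is entire, by rapid decay at `∞` and `f(r⁻¹j) = f(rj)`. -/
lemma lamStd (hf : IsHeckeMaassCuspForm σ f t lam) : HasMeroCont (stdSeries σ t lam) 2
    ∧ Differentiable ℂ (LamStd σ t lam)
    ∧ ∀ s : ℂ, 2 < s.re → LamStd σ t lam s = stdSeries σ t lam s := by
  set F : ℝ → ℂ := fun r => (r : ℂ)⁻¹ * coord f (0, r) with hF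
  have hint : LocallyIntegrableOn F (Ioi 0) := by
    refine ContinuousOn.locallyIntegrableOn ?_ measurableSet_Ioi
    refine ContinuousOn.mul (fun r (hr : 0 < r) => ?_) (hf.contDiffOn.continuousOn.comp
      (Continuous.continuousOn (by fun_prop)) fun r (hr : 0 < r) => hr)
    exact (continuous_ofReal.continuousAt.inv₀ (ofReal_ne_zero.2 hr.ne')).continuousWithinAt
  have htop : ∀ a : ℝ, (fun r => F r - 0) =O[atTop] (fun r : ℝ => r ^ a) := by
    intro a
    obtain ⟨A, -, h⟩ := hf.cuspForm.exists_le_rpow one_pos (-a)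
    refine .of_bound A ?_
    filter_upwards [eventually_ge_atTop 1] with r hr
    have hr0 : 0 < r := by linarith
    have := h (Bianchi.mk 0 r hr0) hr
    rw [mk_r, neg_neg] at this
    rw [sub_zero, hF]
    beta_reduce
    rw [coord_mk _ _ hr0, norm_mul, norm_inv, norm_real, Real.norm_of_nonneg hr0.le,
      Real.norm_of_nonneg (by positivity)]
    exact (mul_le_of_le_one_left (norm_nonneg _) (inv_le_one_of_one_le₀ hr)).trans this
  have hfe : ∀ r ∈ Ioi (0 : ℝ), F (1 / r) = (1 * ((r ^ (2 : ℝ) : ℝ) : ℂ)) • F r := by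
    intro r (hr : 0 < r)
    have := ofReal_ne_zero.2 hr.ne'
    simp only [hF, one_div, coord_inv hf.invariant hr, smul_eq_mul, Real.rpow_two]
    push_cast
    field_simp
  let W : WeakFEPair ℂ := ⟨F, F, 2, 1, 0, 0, hint, hint, two_pos, one_ne_zero, hfe, htop, htop⟩
  have hW : IsStrongFEPair W := ⟨rfl, rfl⟩
  have hd := hW.differentiable_Λ
  have hw := unitCard_ne_zero (K := K)
  have h1 := hf.rho_one_ne_zero
  have hG : Differentiable ℂ fun s => 4 / (unitCard K * rho σ f t 1) * W.Λ (2 * s) := by fun_prop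
  have hval : ∀ s : ℂ, 2 < s.re →
      4 / (unitCard K * rho σ f t 1) * W.Λ (2 * s) = stdSeries σ t lam s := by
    intro s hs
    have : W.Λ (2 * s) = ∫ r in Ioi (0 : ℝ), (r : ℂ) ^ (2 * s - 2) * coord f (0, r) := by
      rw [hW.Λ_eq, mellin]
      refine setIntegral_congr_fun measurableSet_Ioi fun r (hr : 0 < r) => ?_
      have h3 : (r : ℂ) ≠ 0 := ofReal_ne_zero.2 hr.ne'
      change (r : ℂ) ^ (2 * s - 1) • ((r : ℂ)⁻¹ * coord f (0, r)) = _
      rw [smul_eq_mul, ← mul_assoc, ← cpow_neg_one, ← cpow_add _ _ h3]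
      ring_nf
    rw [this, hf.integral_coord hs]
    field_simp
  have h := hasMeroCont_and_eq (f := stdSeries σ t lam) (σ₀ := 2)
    (fun s _ => (hG.analyticAt s).meromorphicAt) (fun s _ => hG.analyticAt s) hval
  have e : LamStd σ t lam = fun s => 4 / (unitCard K * rho σ f t 1) * W.Λ (2 * s) :=
    funext fun s => h.2 s (hG.analyticAt s)
  exact ⟨h.1, e ▸ hG, fun s hs => (congrFun e s).trans (hval s hs)⟩

end IsHeckeMaassCuspForm

variable {u g : H3 → ℂ} {tu tg : ℂ} {lamu lamg : 𝓞 K → ℂ} {D : Set H3}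

lemma rapidInv_mul (hu : IsHeckeMaassCuspForm σ u tu lamu)
    (hg : IsHeckeMaassCuspForm σ g tg lamg) : RapidInv σ (g * u) := by
  obtain ⟨C, hC⟩ := hg.rapidInv.exists_bound
  exact hu.rapidInv.mul hg.rapidInv.meas hg.invariant
    ⟨C, 0, fun P _ => by rw [Real.rpow_zero, mul_one]; exact hC P⟩

/-- The Rankin-Selberg integral of two cusp forms, in the domain of absolute convergence. -/
lemma integral_cusp_mul_cusp_mul_Est (hu : IsHeckeMaassCuspForm σ u tu lamu)
    (hg : IsHeckeMaassCuspForm σ g tg lamg) (hD : IsFundamentalDomain (Gam σ) D hypVol) {s : ℂ}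
    (hs : 3 < s.re) : ∫ P in D, (g * u) P * Est σ P s ∂hypVol
      = cK K * lamg (-1) * (rho σ u tu 1 * rho σ g tg 1)
        * rsSeries σ tg tu lamg lamu ((1 + s) / 2) := by
  obtain ⟨M, hM⟩ := hg.rapidInv.exists_bound
  have h1 := abs_le.1 hu.abs_re_le_one
  have h2 := abs_le.1 hg.abs_re_le_one
  obtain ⟨C, hC, hb⟩ := hu.exists_rho_le
  obtain ⟨C', hC', hb'⟩ := hg.exists_rho_le
  have hsum : Summable fun μ : NZ K =>
      ‖rho σ g tg (-μ.1) * rho σ u tu μ.1‖ * ‖emb σ μ.1‖ ^ (-(s.re + 1)) := by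
    refine ((summable_nz_rpow σ (A := s.re - 1) (by linarith)).mul_left (C' * C)).of_nonneg_of_le
      (fun μ => by positivity) fun μ => ?_
    have h0 := norm_emb_pos σ μ.2
    have h3 := hb' _ (neg_ne_zero.2 μ.2)
    rw [map_neg, norm_neg] at h3
    rw [show -(s.re - 1) = 2 + -(s.re + 1) by ring, Real.rpow_add h0, Real.rpow_two, norm_mul,
      ← mul_assoc]
    refine mul_le_mul_of_nonneg_right ?_ (by positivity)
    calc _ ≤ (C' * ‖emb σ μ.1‖) * (C * ‖emb σ μ.1‖) := by
          gcongr
          exact hb _ μ.2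
      _ = _ := by ring
  rw [hu.integral_mul_Est hD hg.rapidInv.meas (fun r hr => ⟨M, fun x _ => hM _⟩)
    (rapidInv_mul hu hg) (fun μ hμ r hr => hg.coeffAt_eq hμ hr) (by linarith)
    (by rw [add_re, abs_lt]; constructor <;> linarith)
    (by rw [sub_re, abs_lt]; constructor <;> linarith) hsum]
  have e : ∀ μ : NZ K, rho σ g tg (-μ.1) * rho σ u tu μ.1 * npow σ ((1 + s) / 2) μ.1
      = lamg (-1) * (rho σ u tu 1 * rho σ g tg 1)
        * (lamg μ.1 * lamu μ.1 * npow σ ((1 + s) / 2) μ.1) := by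
    intro μ
    rw [hg.rho_eq (neg_ne_zero.2 μ.2), hg.lam_neg, hu.rho_eq μ.2]
    ring
  rw [tsum_congr e, tsum_mul_left, cK, rsSeries, dirichletSeries_eq]
  rw [show -4 * ((1 + s) / 2) = -(2 * (1 + s)) by ring,
    show 2 * ((1 + s) / 2) = 1 + s by ring,
    show (1 + s + (I * tg + I * tu)) / 2 = (1 + s) / 2 + I * tg / 2 + I * tu / 2 by ring,
    show (1 + s + (I * tg - I * tu)) / 2 = (1 + s) / 2 + I * tg / 2 - I * tu / 2 by ring,
    show (1 + s - (I * tg - I * tu)) / 2 = (1 + s) / 2 - I * tg / 2 + I * tu / 2 by ring,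
    show (1 + s - (I * tg + I * tu)) / 2 = (1 + s) / 2 - I * tg / 2 - I * tu / 2 by ring]
  generalize (∑' μ : NZ K, lamg μ.1 * lamu μ.1 * npow σ ((1 + s) / 2) μ.1) = S
  generalize Gamma _ = G₁, Gamma _ = G₂, Gamma _ = G₃, Gamma _ = G₄
  generalize dedekindZeta K _ = Z, cond K ^ (_ : ℂ) = c, rho σ u tu 1 = a, rho σ g tg 1 = b
  have hw := mul_inv_cancel₀ (unitCard_ne_zero (K := K))
  linear_combination (-(sqrtDisc K / 16 * (c * (G₄ * G₃ * (G₂ * G₁))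
    * (Z * (lamg (-1) * (a * b) * S))))) * hw

/-- The completed Rankin-Selberg L-function is, up to a non-zero constant, the integral of the two
cusp forms against the completed Eisenstein series. -/
lemma lamRS (hu : IsHeckeMaassCuspForm σ u tu lamu) (hg : IsHeckeMaassCuspForm σ g tg lamg)
    (hD : IsFundamentalDomain (Gam σ) D hypVol) : HasMeroCont (rsSeries σ tg tu lamg lamu) 2
    ∧ ∀ s : ℂ, s ≠ 1 → s ≠ -1 → ∫ P in D, (g * u) P * Est σ P s ∂hypVol
      = cK K * lamg (-1) * (rho σ u tu 1 * rho σ g tg 1)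
        * LamRS σ tg tu lamg lamu ((1 + s) / 2) := by
  obtain ⟨hZ, hZm⟩ := (rapidInv_mul hu hg).meromorphic_integral hD
  set Z : ℂ → ℂ := fun s => ∫ P in D, (g * u) P * Est σ P s ∂hypVol with hZdef
  set c := cK K * lamg (-1) * (rho σ u tu 1 * rho σ g tg 1) with hc
  have hc0 : c ≠ 0 := by
    have h1 := hg.rho_one_ne_zero
    have h2 : lamg (-1) ≠ 0 := fun h => by
      have h3 := hg.lam_neg ⟨-1, neg_ne_zero.2 one_ne_zero⟩
      rw [neg_neg, h, zero_mul] at h3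
      have h4 := hg.rho_eq one_ne_zero
      rw [h3, zero_mul] at h4
      exact h1 h4
    have h3 : cK K ≠ 0 := by
      rw [cK]
      exact div_ne_zero (mul_ne_zero unitCard_ne_zero
        (ofReal_ne_zero.2 (sqrtDisc_pos K).ne')) (by norm_num)
    exact mul_ne_zero (mul_ne_zero h3 h2) (mul_ne_zero hu.rho_one_ne_zero h1)
  have hlin : ∀ s : ℂ, AnalyticAt ℂ (fun s : ℂ => 2 * s - 1) s := fun s => by fun_prop
  have hA : ∀ s : ℂ, s ≠ 1 → s ≠ 0 → AnalyticAt ℂ (fun s => c⁻¹ * Z (2 * s - 1)) s := by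
    intro s h1 h0
    refine analyticAt_const.mul ((hZ _ ?_).comp (hlin s))
    simp only [mem_compl_iff, mem_insert_iff, mem_singleton_iff, not_or]
    exact ⟨fun h => h1 (by linear_combination h / 2), fun h => h0 (by linear_combination h / 2)⟩
  have h := hasMeroCont_and_eq (f := rsSeries σ tg tu lamg lamu) (σ₀ := 2)
    (G := fun s => c⁻¹ * Z (2 * s - 1))
    (fun s _ => (MeromorphicAt.const _ s).mul ((hZm _ (mem_univ _)).comp_analyticAt (hlin s)))
    (fun s hs => hA s (by rintro rfl; norm_num at hs) (by rintro rfl; norm_num at hs))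
    (fun s hs => by
      have h2 : 3 < (2 * s - 1).re := by simp; linarith
      simp only [hZdef]
      rw [integral_cusp_mul_cusp_mul_Est hu hg hD h2, ← hc, inv_mul_cancel_left₀ hc0]
      ring_nf)
  refine ⟨h.1, fun s h1 h2 => ?_⟩
  have h3 := h.2 ((1 + s) / 2) (hA _ (fun h => h1 (by linear_combination 2 * h))
    (fun h => h2 (by linear_combination 2 * h)))
  rw [LamRS, h3, mul_inv_cancel_left₀ hc0, show 2 * ((1 + s) / 2) - 1 = s by ring]

lemma tau_neg (s : ℂ) (μ : 𝓞 K) : tau σ s (-μ) = tau σ s μ := by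
  let e : Fib μ ≃ Fib (-μ) :=
    { toFun := fun p => ⟨(p.1.1, -p.1.2), by rw [mul_neg, p.2]⟩
      invFun := fun p => ⟨(p.1.1, -p.1.2), by rw [mul_neg, p.2, neg_neg]⟩
      left_inv := fun p => Subtype.ext (Prod.ext rfl (neg_neg _))
      right_inv := fun p => Subtype.ext (Prod.ext rfl (neg_neg _)) }
  rw [tau, tau, ← e.tsum_eq]
  refine tsum_congr fun p => ?_
  change ((‖emb σ (-p.1.2)‖ / ‖emb σ p.1.1‖ : ℝ) : ℂ) ^ s = _
  rw [map_neg, norm_neg]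

/-- A cusp form against two completed Eisenstein series. -/
lemma integral_Est_mul_cusp_mul_Est (hg : IsHeckeMaassCuspForm σ g tg lamg)
    (hD : IsFundamentalDomain (Gam σ) D hypVol) (t : ℝ) {s : ℂ} (h1 : s ≠ 1) (h2 : s ≠ -1) :
    ∫ P in D, ((fun P => Est σ P (I * t)) * g) P * Est σ P s ∂hypVol
    = cK K
    * (unitCard K * rho σ g tg 1
    * (LamStd σ tg lamg ((1 + s + I * t) / 2) * LamStd σ tg lamg ((1 + s - I * t) / 2))) := by
  have hR := hg.rapidInv.mul_Est (I * t)
  obtain ⟨-, hd, hL⟩ := hg.lamStd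
  have hd' : Differentiable ℂ fun s => cK K * (unitCard K * rho σ g tg 1 *
      (LamStd σ tg lamg ((1 + s + I * t) / 2) * LamStd σ tg lamg ((1 + s - I * t) / 2))) := by
    fun_prop
  refine eq_of_eq_halfPlane (S := {1, -1}) (to_countable _) (A := 3)
    (hR.meromorphic_integral hD).1 (fun s _ => hd'.analyticAt s)
    (by rintro _ (rfl | rfl) <;> norm_num) (fun s hs => ?_) (by simp [h1, h2])
  have hre : (I * (t : ℂ)).re = 0 := by simp
  have h3 := abs_le.1 hg.abs_re_le_one
  obtain ⟨C, hC, hb⟩ := hg.exists_rho_le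
  have hsum : Summable fun μ : NZ K =>
      ‖tau σ (I * t) (-μ.1) * rho σ g tg μ.1‖ * ‖emb σ μ.1‖ ^ (-(s.re + 1)) := by
    refine ((summable_tau σ t (A := s.re) (by linarith)).mul_left C).of_nonneg_of_le
      (fun μ => by positivity) fun μ => ?_
    have h0 := norm_emb_pos σ μ.2
    rw [tau_neg, norm_mul, show -s.re = 1 + -(s.re + 1) by ring, Real.rpow_add h0, Real.rpow_one]
    calc _ ≤ ‖tau σ (I * t) μ.1‖ * (C * ‖emb σ μ.1‖) * ‖emb σ μ.1‖ ^ (-(s.re + 1)) := by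
          gcongr
          exact hb _ μ.2
      _ = _ := by ring
  have hM : ∀ (r : ℝ) (hr : 0 < r), ∃ M, ∀ x ∈ Icc (0 : Idx K → ℝ) 1,
      ‖Est σ (mk (par σ x) r hr) (I * t)‖ ≤ M := by
    intro r hr
    obtain ⟨R, hR⟩ := (isCompact_Icc (a := (0 : Idx K → ℝ))
      (b := 1)).exists_bound_of_continuousOn (f := par σ) (par σ).continuous.continuousOn
    obtain ⟨C, B, -, -, h⟩ := exists_norm_Est_le σ (I * t) R hr
    exact ⟨C * (1 + r) ^ B, fun x hx => h (mk (par σ x) r hr) (hR x hx) le_rfl⟩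
  rw [hg.integral_mul_Est hD (measurable_Est σ _) hM hR (α := I * t) (a := tau σ (I * t))
    (fun μ hμ r hr => by rw [coeffAt_eq _ _ _ hr, planeCoeff_Est σ hr _ hμ]) (by linarith)
    (by rw [add_re, hre, abs_lt]; constructor <;> linarith)
    (by rw [sub_re, hre, abs_lt]; constructor <;> linarith) hsum]
  have e : ∀ μ : NZ K, tau σ (I * t) (-μ.1) * rho σ g tg μ.1 * npow σ ((1 + s) / 2) μ.1
      = rho σ g tg 1 * (tau σ (I * t) μ.1 * lamg μ.1 * npow σ ((1 + s) / 2) μ.1) := by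
    intro μ
    rw [tau_neg, hg.rho_eq μ.2]
    ring
  have r1 : 2 < ((1 + s + I * t) / 2).re := by
    rw [div_ofNat_re, add_re, add_re, hre, one_re]; linarith
  have r2 : 2 < ((1 + s - I * t) / 2).re := by
    rw [div_ofNat_re, sub_re, add_re, hre, one_re]; linarith
  have e1 : (1 + s) / 2 + I * t / 2 = (1 + s + I * t) / 2 := by ring
  have e2 : (1 + s) / 2 - I * t / 2 = (1 + s - I * t) / 2 := by ring
  have hT := hg.tsum_tau_mul (s := I * t) (s' := (1 + s) / 2) (by rw [e1]; linarith)
    (by rw [e2]; linarith)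
  have hP := hg.tsum_mul_tsum (s₁ := (1 + s + I * t) / 2) (s₂ := (1 + s - I * t) / 2)
    (by linarith) (by linarith)
  rw [e1, e2] at hT
  rw [← hT, show (1 + s + I * t) / 2 + (1 + s - I * t) / 2 = 1 + s by ring] at hP
  have hw := mul_inv_cancel₀ (unitCard_ne_zero (K := K))
  rw [tsum_congr e, tsum_mul_left, hL _ r1, hL _ r2, cK, mul_left_comm (dedekindZeta K _), ← hP,
    stdSeries, stdSeries, dirichletSeries_eq, dirichletSeries_eq]
  have hc : cond K ^ (-(2 * (1 + s))) = cond K ^ (-2 * ((1 + s + I * t) / 2))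
      * cond K ^ (-2 * ((1 + s - I * t) / 2)) := by
    rw [← cpow_add (x := cond K) _ _ (ofReal_ne_zero.2 (condR_pos K).ne')]
    ring_nf
  rw [hc, show (1 + s + (I * t + I * tg)) / 2 = (1 + s + I * t) / 2 + I * tg / 2 by ring,
    show (1 + s + (I * t - I * tg)) / 2 = (1 + s + I * t) / 2 - I * tg / 2 by ring,
    show (1 + s - (I * t - I * tg)) / 2 = (1 + s - I * t) / 2 + I * tg / 2 by ring,
    show (1 + s - (I * t + I * tg)) / 2 = (1 + s - I * t) / 2 - I * tg / 2 by ring]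
  generalize (∑' μ : NZ K, lamg μ.1 * npow σ ((1 + s + I * t) / 2) μ.1) = S
  generalize (∑' μ : NZ K, lamg μ.1 * npow σ ((1 + s - I * t) / 2) μ.1) = S'
  generalize Gamma _ = G₁, Gamma _ = G₂, Gamma _ = G₃, Gamma _ = G₄
  generalize cond K ^ (_ : ℂ) = c₁, cond K ^ (_ : ℂ) = c₂, rho σ g tg 1 = b
  linear_combination (-(sqrtDisc K / 16 * (c₁ * c₂ * (G₄ * G₃ * (G₂ * G₁)) * (b * (S * S'))))
    * (unitCard K * (unitCard K)⁻¹ + 1)) * hw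

lemma rho_eq_of_coeffAt {μ : 𝓞 K} (hμ : μ ≠ 0) {a : ℂ}
    (h : ∀ r : ℝ, 0 < r → coeffAt σ f μ r
    = a * (r * besselK (I * t) (2 * Real.pi * ‖dualFreq σ μ‖ * r))) : rho σ f t μ = a := by
  have hf : ∀ (r : ℝ) (hr : 0 < r), fourierCoeff σ f μ r hr
      = a * (r * besselK (I * t) (2 * Real.pi * ‖dualFreq σ μ‖ * r)) := fun r hr => by
    rw [fourierCoeff_eq, ← coeffAt_eq, h r hr]
  have hex : ∃ a : ℂ, ∀ (r : ℝ) (hr : 0 < r), fourierCoeff σ f μ r hr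
      = a * (r * besselK (I * t) (2 * Real.pi * ‖dualFreq σ μ‖ * r)) := ⟨a, hf⟩
  rw [rho, dif_pos hex]
  have hk : 0 < 2 * Real.pi * ‖dualFreq σ μ‖ := by
    have := norm_emb_pos σ hμ
    have := condR_pos K
    rw [two_pi_norm_dualFreq]
    positivity
  obtain ⟨X, hX, hne⟩ := exists_besselK_ne_zero (I * t)
  have hr : 0 < X / (2 * Real.pi * ‖dualFreq σ μ‖) := by positivity
  have h1 := (hex.choose_spec _ hr).symm.trans (hf _ hr)
  refine mul_right_cancel₀ (mul_ne_zero (ofReal_ne_zero.2 hr.ne') ?_) h1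
  rwa [mul_div_cancel₀ _ hk.ne']

lemma rho_Eis_zero : rho σ (Eis σ 0) t 1 = 0 :=
  rho_eq_of_coeffAt one_ne_zero fun r hr => by
    rw [coeffAt_eq _ _ _ hr, planeCoeff]
    simp [Eis_zero]

lemma rho_Eis {t : ℝ} (ht : t ≠ 0) (hL : LamF σ (1 + I * t) ≠ 0) :
    rho σ (Eis σ t) t 1 = unitCard K / LamF σ (1 + I * t) :=
  rho_eq_of_coeffAt one_ne_zero fun r hr => by
    have h := planeCoeff_Est σ hr (I * t) (one_ne_zero (α := 𝓞 K))
    rw [tau_one] at h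
    rw [coeffAt_eq _ _ _ hr, div_mul_eq_mul_div, ← h, planeCoeff, planeCoeff, ← integral_div]
    refine integral_congr_ae (.of_forall fun x => ?_)
    beta_reduce
    rw [Eis_eq σ ht hL]
    ring

lemma hasInner_Eis_zero (F : H3 → ℂ) : HasInner D F (Eis σ 0) 0 := by
  simp [HasInner, HasPairing, Eis_zero]

/-- A rapidly decreasing function against `E_t`, `t ≠ 0`, and against its complex conjugate. -/
lemma RapidInv.hasPairing_Eis {F : H3 → ℂ} (hF : RapidInv σ F)
    (hD : IsFundamentalDomain (Gam σ) D hypVol) {t : ℝ} (ht : t ≠ 0) :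
    HasPairing D F (Eis σ t) ((∫ P in D, F P * Est σ P (I * t) ∂hypVol) / LamK K (1 + I * t))
    ∧ HasInner D F (Eis σ t)
      ((∫ P in D, F P * Est σ P (I * t) ∂hypVol) / LamK K (1 - I * t)) := by
  have h0 : I * (t : ℂ) ≠ 0 := mul_ne_zero I_ne_zero (ofReal_ne_zero.2 ht)
  have hre : (I * (t : ℂ)).re = 0 := by simp
  have hL := LamF_ne_zero σ hD ht
  have hint : IntegrableOn (fun P => F P * Est σ P (I * t)) D hypVol := by
    have := (hF.mul_Est (I * t)).integrableOn hD
    rwa [mul_comm] at this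
  have e1 : ∀ P, F P * Eis σ t P = F P * Est σ P (I * t) / LamF σ (1 + I * t) := fun P => by
    rw [Eis_eq σ ht hL, mul_div_assoc]
  have e2 : ∀ P, F P * conj (Eis σ t P) = F P * Est σ P (I * t) / LamF σ (1 - I * t) := fun P => by
    rw [Eis_eq σ ht hL, map_div₀, conj_Est_I, LamF_one_sub_I, mul_div_assoc]
  rw [(hasMeroCont_zeta σ).2 _ (fun h => by simpa [hre] using congrArg re h)
    (fun h => h0 (by linear_combination h)), (hasMeroCont_zeta σ).2 _
    (fun h => by simpa [hre] using congrArg re h) (fun h => h0 (by linear_combination -h))]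
  refine ⟨⟨?_, ?_⟩, ⟨?_, ?_⟩⟩
  · rw [funext e1]; exact hint.div_const _
  · rw [funext e1, integral_div]
  · beta_reduce; rw [funext e2]; exact hint.div_const _
  · beta_reduce; rw [funext e2, integral_div]

end FinalFormulas

end

end Bianchi

open Bianchi in
theorem lemma2p3 {K : Type*} [Field K] [NumberField K] [IsTotallyComplex K]
    (hdeg : Module.finrank ℚ K = 2) (hcl : classNumber K = 1) (σ : K →+* ℂ)
    (u g : Bianchi.H3 → ℂ) (tu tg : ℂ) (lamu lamg : 𝓞 K → ℂ)
    (hu : Bianchi.IsHeckeMaassCuspForm σ u tu lamu)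
    (hg : Bianchi.IsHeckeMaassCuspForm σ g tg lamg)
    (D : Set Bianchi.H3) (hD : IsFundamentalDomain (Bianchi.Gam σ) D Bianchi.hypVol) :
    -- the continuations exist, and one may divide by `Λ(1 + it)` for real `t ≠ 0`
    ((∀ P, Bianchi.HasMeroCont (Bianchi.eisSeries σ P) 2)
      ∧ Bianchi.HasMeroCont (Bianchi.zetaSeries K) 1
      ∧ Bianchi.HasMeroCont (Bianchi.stdSeries σ tg lamg) 2
      ∧ Bianchi.HasMeroCont (Bianchi.rsSeries σ tg tu lamg lamu) 2
      ∧ ∀ t : ℝ, t ≠ 0 → Bianchi.LamK K (1 + I * t) ≠ 0)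
    -- a cusp form against one Eisenstein series, `t ≠ 0`
    ∧ (∀ t : ℝ, t ≠ 0 →
        Bianchi.HasPairing D (u * g) (Bianchi.Eis σ t)
          (Bianchi.cK K * lamg (-1) * (Bianchi.rho σ u tu 1 * Bianchi.rho σ g tg 1
            * Bianchi.LamRS σ tg tu lamg lamu ((1 + I * t) / 2)) / Bianchi.LamK K (1 + I * t))
        ∧ Bianchi.HasInner D (u * g) (Bianchi.Eis σ t)
          (Bianchi.cK K * lamg (-1) * (Bianchi.rho σ u tu 1 * Bianchi.rho σ g tg 1
            * Bianchi.LamRS σ tg tu lamg lamu ((1 + I * t) / 2)) / Bianchi.LamK K (1 - I * t)))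
    -- a cusp form against two Eisenstein series, `s ≠ 0`
    ∧ (∀ t s : ℝ, s ≠ 0 →
        Bianchi.HasPairing D (Bianchi.Eis σ t * g) (Bianchi.Eis σ s)
          (Bianchi.cK K * (Bianchi.rho σ (Bianchi.Eis σ t) t 1 * Bianchi.rho σ g tg 1
            * (Bianchi.LamStd σ tg lamg ((1 + I * s + I * t) / 2)
              * Bianchi.LamStd σ tg lamg ((1 + I * s - I * t) / 2))) / Bianchi.LamK K (1 + I * s))
        ∧ Bianchi.HasInner D (Bianchi.Eis σ t * g) (Bianchi.Eis σ s)
          (Bianchi.cK K * (Bianchi.rho σ (Bianchi.Eis σ t) t 1 * Bianchi.rho σ g tg 1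
            * (Bianchi.LamStd σ tg lamg ((1 + I * s + I * t) / 2)
              * Bianchi.LamStd σ tg lamg ((1 + I * s - I * t) / 2))) / Bianchi.LamK K (1 - I * s)))
    -- at parameter `0`, where `Λ` has a pole and `1 / Λ` vanishes, the inner products are `0`
    ∧ (Bianchi.HasInner D (u * g) (Bianchi.Eis σ 0) 0
        ∧ ∀ t : ℝ, Bianchi.HasInner D (Bianchi.Eis σ t * g) (Bianchi.Eis σ 0) 0) := by
  have : Fact (Module.finrank ℚ K = 2) := ⟨hdeg⟩
  have : IsPrincipalIdealRing (𝓞 K) := classNumber_eq_one_iff.1 hcl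
  have hR := rapidInv_mul hg hu
  have hne : ∀ t : ℝ, I * (t : ℂ) ≠ 1 ∧ I * (t : ℂ) ≠ -1 := I_mul_ne
  refine ⟨⟨fun P => (eisenstein_eq σ P).1, (hasMeroCont_zeta σ).1, hg.lamStd.1,
    (lamRS hu hg hD).1, fun t ht => ?_⟩, fun t ht => ?_, fun t s hs => ?_,
    hasInner_Eis_zero _, fun t => hasInner_Eis_zero _⟩
  · have h0 : I * (t : ℂ) ≠ 0 := mul_ne_zero I_ne_zero (ofReal_ne_zero.2 ht)
    rw [(hasMeroCont_zeta σ).2 _ (fun h => (hne t).2 (by linear_combination h))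
      (fun h => h0 (by linear_combination h))]
    exact LamF_ne_zero σ hD ht
  · have h := hR.hasPairing_Eis hD ht
    rw [mul_comm u g, (lamRS hu hg hD).2 _ (hne t).1 (hne t).2, mul_assoc _ _ (LamRS _ _ _ _ _ _)]
      at h
    rw [mul_comm u g]
    exact h
  · rcases eq_or_ne t 0 with rfl | ht
    · have h0 : Eis σ 0 * g = 0 := funext fun P => by simp [Eis_zero]
      rw [h0, rho_Eis_zero]
      simp [HasInner, HasPairing]
    · have hL := LamF_ne_zero σ hD ht
      have h0 : Eis σ t * g = (fun _ => (LamF σ (1 + I * t))⁻¹)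
          * ((fun P => Est σ P (I * t)) * g) := funext fun P => by
        simp only [Pi.mul_apply]
        rw [Eis_eq σ ht hL]
        ring
      have h := ((hg.rapidInv.mul_Est (I * t)).mul (G := fun _ => (LamF σ (1 + I * t))⁻¹)
        measurable_const (fun _ _ _ => rfl) ⟨‖(LamF σ (1 + I * t))⁻¹‖, 0, fun P _ => by
          rw [Real.rpow_zero, mul_one]⟩).hasPairing_Eis hD hs
      have e : ∫ P in D, ((fun _ => (LamF σ (1 + I * t))⁻¹ : Bianchi.H3 → ℂ)
          * ((fun P => Est σ P (I * t)) * g)) P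
          * Est σ P (I * s) ∂hypVol = cK K * (rho σ (Eis σ t) t 1 * rho σ g tg 1
            * (LamStd σ tg lamg ((1 + I * s + I * t) / 2)
              * LamStd σ tg lamg ((1 + I * s - I * t) / 2))) := by
        have := integral_Est_mul_cusp_mul_Est hg hD t (hne s).1 (hne s).2
        rw [rho_Eis ht hL, div_eq_inv_mul]
        simp only [mul_assoc, mul_left_comm (cK K)] at this ⊢
        rw [← this, ← integral_const_mul]
        refine integral_congr_ae (.of_forall fun P => ?_)
        simp only [Pi.mul_apply, mul_assoc]
      rw [e] at h
      rwa [h0]
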